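/- All von Neumann algebras have separable predual and all locally compact groups are Hausdorff and second countable. For every $n\in\mathbb N$ let $G_n$ be a locally compact group with left Haar measure $\mu_n$ and a compact open subgroup $K_n$ with $\mu_n(K_n)=1$; let $\varphi_n$ be a normal semifinite faithful weight on a von Neumann algebra $M_n$, with $M_n$ acting on $H_n$ through a GNS construction $(H_n,\iota,\Lambda_n)$ of $\varphi_n$ (so $\Lambda_n$ is defined on $\{x\in M_n:\varphi_n(x^*x)<\infty\}$); let $q_n$ be a projection in the centralizer $M_n^{\varphi_n}$ (the fixed-point algebra of the modular automorphism group $\sigma^{\varphi_n}$) with $\varphi_n(q_n)=1$; and let $\alpha^n:G_n\to\mathrm{Aut}(M_n)$ be a pointwise $\sigma$-weakly continuous action such that for all $g\in G_n$ there is $c_n(g)>0$ with $\varphi_n\circ\alpha^n_g=c_n(g)\varphi_n$, and $c_n(g)=1$, $\alpha^n_g(q_n)=q_n$ for $g\in K_n$. For a sequence of von Neumann algebras $N_n$ with weights $\psi_n$ and projections $p_n\in N_n$ with $\psi_n(p_n)=1$, let $\bigotimes(N_n,\psi_n,p_n)$ be the von Neumann algebra generated by the operators $x_0\otimes\dots\otimes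 x_k\otimes1\otimes\cdots$ ($x_i\in N_i$) on the infinite tensor product of the GNS spaces of the $\psi_n$ relative to the unit vectors $\Lambda_{\psi_n}(p_n)$. Put $M=\bigotimes(M_n,\varphi_n,q_n)$ and let $G=\prod'(G_n,K_n)$ be the restricted direct product. For an action $\alpha$ of a locally compact group $\Gamma$ with left Haar measure on a von Neumann algebra $N\subset B(H)$, the crossed product $\Gamma\ltimes N$ is the von Neumann algebra on $L^2(\Gamma,H)$ generated by the operators $(\pi(x)\xi)(g)=\alpha_{g^{-1}}(x)\xi(g)$, $x\in N$, and $((\lambda_h\otimes1)\xi)(g)=\xi(h^{-1}g)$, $h\in\Gamma$. Let $\pi_n$ be the map $\pi$ of $G_n\ltimes M_n$, and let $\tilde\varphi_n$ be the dual weight of $\varphi_n$ on $G_n\ltimes M_n$, that is, the weight of the left Hilbert algebra on $L^2(G_n,H_n)$ in which the vector $k\otimes\Lambda_n(a)$ corresponds to the operator $(\lambda(k)\otimes1)\pi_n(a)$, for $k\in C_c(G_n)$ and $a\in M_n$ with $\varphi_n(a^*a)<\infty$, where $\lambda(k)=\int k(t)\lambda_t\,d\mu_n(t)$. Then: 1.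 For every $n$, $e_n:=\pi_n(q_n)\bigl(\lambda(1_{K_n})\otimes1\bigr)$ is a projection in $G_n\ltimes M_n$, $\tilde\varphi_n(e_n)=1$, and $e_n$ lies in the centralizer $(G_n\ltimes M_n)^{\tilde\varphi_n}$. Moreover $\tilde\varphi_n$ has a GNS construction on $L^2(G_n,H_n)$ with $G_n\ltimes M_n$ acting identically. 2. There is a unique action $\alpha$ of $G$ on $M$ with $\alpha_g(x_0\otimes\dots\otimes x_k\otimes1\otimes\cdots)=\alpha^0_{g_0}(x_0)\otimes\dots\otimes\alpha^k_{g_k}(x_k)\otimes1\otimes\cdots$ for all $g=(g_n)\in G$ and $x_i\in M_i$, and for this action $$G\ltimes M\;\simeq\;\bigotimes\bigl(G_n\ltimes M_n,\tilde\varphi_n,e_n\bigr).$$ -/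

import Mathlib

open MeasureTheory Filter Topology
open scoped ENNReal InnerProductSpace ComplexOrder RestrictedProduct

universe u v w

noncomputable section

set_option linter.unusedSectionVars false

namespace InfTensor

variable {H : ℕ → Type u} [∀ n, NormedAddCommGroup (H n)] [∀ n, InnerProductSpace ℂ (H n)]

/-- Families of vectors `v n ∈ H n` with `v n = ξ n` for all but finitely many `n`. -/
structure Fam (ξ : ∀ n, Metric.sphere (0 : H n) 1) : Type u where
  /-- The vectors of the family. -/
  val : ∀ n, H n
  eventually_eq : ∀ᶠ n in cofinite, val n = ξ n

/-- `∏ n, ⟪v n, w n⟫`, a product with finitely many factors different from `1`. -/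
def kernel (ξ : ∀ n, Metric.sphere (0 : H n) 1) : Matrix (Fam ξ) (Fam ξ) ℂ :=
  fun v w => ∏ᶠ n, ⟪v.val n, w.val n⟫_ℂ

/-- Finite formal linear combinations of elementary tensors. -/
abbrev Pre (ξ : ∀ n, Metric.sphere (0 : H n) 1) : Type u := Fam ξ →₀ ℂ

variable {ξ : ∀ n, Metric.sphere (0 : H n) 1}

theorem inner_base (n : ℕ) : ⟪(ξ n : H n), (ξ n : H n)⟫_ℂ = 1 := by
  rw [inner_self_eq_norm_sq_to_K]; simp

theorem kernel_eq_prod (v w : Fam ξ) (F : Finset ℕ) (hv : ∀ n ∉ F, v.val n = ξ n)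
    (hw : ∀ n ∉ F, w.val n = ξ n) : kernel ξ v w = ∏ n ∈ F, ⟪v.val n, w.val n⟫_ℂ := by
  refine finprod_eq_prod_of_mulSupport_subset _ fun n hn => ?_
  by_contra h
  exact hn (by simp only [hv n h, hw n h, inner_base])

theorem exists_common (s : Finset (Fam ξ)) :
    ∃ F : Finset ℕ, ∀ v ∈ s, ∀ n ∉ F, v.val n = ξ n := by
  classical
  refine ⟨s.biUnion fun v => (mem_cofinite.1 v.eventually_eq).toFinset, fun v hv n hn => ?_⟩
  by_contra h
  exact hn (Finset.mem_biUnion.2 ⟨v, hv, (Set.Finite.mem_toFinset _).2 h⟩)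

theorem posSemidef_gram {E ι : Type*} [NormedAddCommGroup E] [InnerProductSpace ℂ E]
    (v : ι → E) : (Matrix.gram ℂ v).PosSemidef := by
  refine ⟨Matrix.isHermitian_gram ℂ v, fun c => ?_⟩
  have : (c.sum fun i xi => c.sum fun j xj => star xi * Matrix.gram ℂ v i j * xj)
      = ⟪c.sum fun i xi => xi • v i, c.sum fun i xi => xi • v i⟫_ℂ := by
    simp only [Finsupp.sum, sum_inner, inner_sum, inner_smul_left, inner_smul_right,
      Matrix.gram_apply, Finset.mul_sum]
    rw [Finset.sum_comm]
    refine Finset.sum_congr rfl fun i _ => Finset.sum_congr rfl fun j _ => ?_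
    simp only [RCLike.star_def]
    ring
  rw [this, inner_self_eq_norm_sq_to_K]
  positivity

/-- Schur products of dominated Gram kernels are dominated. -/
theorem posSemidef_prod (T : ∀ n, H n →L[ℂ] H n) (F : Finset ℕ) :
    (Matrix.of fun v w : Fam ξ => ∏ n ∈ F, ⟪T n (v.val n), T n (w.val n)⟫_ℂ).PosSemidef ∧
    (Matrix.of fun v w : Fam ξ => (∏ n ∈ F, (‖T n‖ ^ 2 : ℝ) • ⟪v.val n, w.val n⟫_ℂ) -
      ∏ n ∈ F, ⟪T n (v.val n), T n (w.val n)⟫_ℂ).PosSemidef := by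
  classical
  have h1 : ∀ n, (Matrix.gram ℂ fun v : Fam ξ => T n (v.val n)).PosSemidef :=
    fun n => posSemidef_gram _
  have h2 : ∀ n, (‖T n‖ ^ 2 • (Matrix.gram ℂ fun v : Fam ξ => v.val n) -
      Matrix.gram ℂ fun v : Fam ξ => T n (v.val n)).PosSemidef :=
    fun n => Matrix.posSemidef_opNorm_smul_gram_sub_gram _ (T n)
  induction F using Finset.induction_on with
  | empty =>
    constructor
    · convert posSemidef_gram (fun _ : Fam ξ => (1 : ℂ)) using 1
      ext v w
      simp
    · convert Matrix.PosSemidef.zero using 1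
      ext v w
      simp
  | insert a s ha ih =>
    constructor
    · refine (congrArg Matrix.PosSemidef ?_).mpr ((h1 a).hadamard ih.1)
      ext v w
      simp [Finset.prod_insert ha]
    · refine (congrArg Matrix.PosSemidef ?_).mpr
        (((h2 a).hadamard (ih.1.add ih.2)).add ((h1 a).hadamard ih.2))
      ext v w
      simp only [Finset.prod_insert ha, Matrix.of_apply, Matrix.add_apply, Matrix.hadamard_apply,
        Matrix.sub_apply, Matrix.smul_apply, Matrix.gram_apply]
      ring

theorem conj_kernel (v w : Fam ξ) : (starRingEnd ℂ) (kernel ξ w v) = kernel ξ v w := by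
  classical
  obtain ⟨F, hF⟩ := exists_common ({v, w} : Finset (Fam ξ))
  rw [kernel_eq_prod v w F (hF v (by simp)) (hF w (by simp)),
    kernel_eq_prod w v F (hF w (by simp)) (hF v (by simp)), map_prod]
  exact Finset.prod_congr rfl fun n _ => inner_conj_symm _ _

theorem kernel_posSemidef : (kernel ξ).PosSemidef := by
  refine ⟨Matrix.ext fun v w => conj_kernel v w, fun c => ?_⟩
  obtain ⟨F, hF⟩ := exists_common c.support
  have := (posSemidef_prod (ξ := ξ) (fun n => ContinuousLinearMap.id ℂ (H n)) F).1.2 c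
  refine this.trans_eq (Finset.sum_congr rfl fun v hv => Finset.sum_congr rfl fun w hw => ?_)
  dsimp only
  rw [kernel_eq_prod v w F (hF v hv) (hF w hw)]
  rfl

instance : PreInnerProductSpace.Core ℂ (Pre ξ) where
  inner f g := Finsupp.sum f fun v a => Finsupp.sum g fun w b => star a * kernel ξ v w * b
  conj_inner_symm f g := by
    rw [Finsupp.sum_comm]
    simp only [map_finsuppSum]
    refine Finset.sum_congr rfl fun v _ => Finset.sum_congr rfl fun w _ => ?_
    simp only [map_mul, conj_kernel, RCLike.star_def, Complex.conj_conj]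
    ring
  re_inner_nonneg f := (Complex.le_def.1 (kernel_posSemidef.2 f)).1
  add_left f g h := by
    refine Finsupp.sum_add_index' (by simp) fun v a b => ?_
    simp [add_mul, Finsupp.sum_add]
  smul_left f g r := by
    refine (Finsupp.sum_smul_index (by simp)).trans ?_
    rw [Finsupp.mul_sum]
    refine Finset.sum_congr rfl fun v _ => ?_
    simp [Finsupp.mul_sum, mul_assoc]

instance : SeminormedAddCommGroup (Pre ξ) :=
  InnerProductSpace.Core.toSeminormedAddCommGroup (𝕜 := ℂ)

instance : InnerProductSpace ℂ (Pre ξ) := .ofCore _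

theorem inner_pre (f g : Pre ξ) : ⟪f, g⟫_ℂ =
    Finsupp.sum f fun v a => Finsupp.sum g fun w b => star a * kernel ξ v w * b := rfl

end InfTensor

/-- The infinite tensor product of the Hilbert spaces `H n` relative to the unit vectors `ξ n`:
the Hilbert space spanned by elementary tensors `⨂ v n` (`v n = ξ n` for almost all `n`) with
`⟪⨂ v n, ⨂ w n⟫ = ∏ ⟪v n, w n⟫`. -/
abbrev InfTensor {H : ℕ → Type u} [∀ n, NormedAddCommGroup (H n)] [∀ n, InnerProductSpace ℂ (H n)]
    (ξ : ∀ n, Metric.sphere (0 : H n) 1) : Type u :=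
  UniformSpace.Completion (InfTensor.Pre ξ)

namespace InfTensor

variable {H : ℕ → Type u} [∀ n, NormedAddCommGroup (H n)] [∀ n, InnerProductSpace ℂ (H n)]
  {ξ : ∀ n, Metric.sphere (0 : H n) 1}

/-- The elementary tensor `⨂ v n`. -/
def tmul (v : Fam ξ) : InfTensor ξ :=
  ((Finsupp.single v 1 : Pre ξ) : UniformSpace.Completion (Pre ξ))

theorem inner_tmul (v w : Fam ξ) : ⟪tmul v, tmul w⟫_ℂ = ∏ᶠ n, ⟪v.val n, w.val n⟫_ℂ := by
  refine (UniformSpace.Completion.inner_coe (𝕜 := ℂ) (E := Pre ξ) _ _).trans ?_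
  rw [inner_pre]
  simp [kernel]

/-- `⨂ v n ↦ ⨂ T n (v n)` on families. -/
def famMap (T : ∀ n, H n →L[ℂ] H n) (hT : ∀ᶠ n in cofinite, T n = 1) (v : Fam ξ) : Fam ξ :=
  ⟨fun n => T n (v.val n), by
    filter_upwards [hT, v.eventually_eq] with n h1 h2
    simp [h1, h2]⟩

theorem norm_sq_pre (f : Pre ξ) : ‖f‖ ^ 2 =
    (Finsupp.sum f fun v a => Finsupp.sum f fun w b => star a * kernel ξ v w * b).re := by
  rw [← inner_pre, ← inner_self_eq_norm_sq (𝕜 := ℂ)]; rfl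

/-- The operator induced by `⨂ v n ↦ ⨂ T n (v n)` on formal linear combinations. -/
def preMap (T : ∀ n, H n →L[ℂ] H n) (hT : ∀ᶠ n in cofinite, T n = 1) : Pre ξ →ₗ[ℂ] Pre ξ :=
  (Finsupp.lmapDomain ℂ ℂ (famMap T hT) : (Fam ξ →₀ ℂ) →ₗ[ℂ] (Fam ξ →₀ ℂ))

theorem norm_preMap_le (T : ∀ n, H n →L[ℂ] H n) (hT : ∀ᶠ n in cofinite, T n = 1) (f : Pre ξ) :
    ‖preMap T hT f‖ ≤ (∏ n ∈ (mem_cofinite.1 hT).toFinset, ‖T n‖) * ‖f‖ := by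
  classical
  set F₀ := (mem_cofinite.1 hT).toFinset with hF₀
  have hTF : ∀ n ∉ F₀, T n = 1 := fun n hn => by
    by_contra h
    exact hn ((Set.Finite.mem_toFinset _).2 h)
  have hn1 : ∀ n ∉ F₀, ‖T n‖ = 1 := fun n hn => by
    have : Nontrivial (H n) := ⟨⟨ξ n, 0, fun h => by
      have h1 : ‖(ξ n : H n)‖ = 1 := by simp
      rw [h] at h1; simp at h1⟩⟩
    rw [hTF n hn]; exact norm_one
  obtain ⟨F₁, hF₁⟩ := exists_common f.support
  set F := F₀ ∪ F₁
  have hF : ∀ v ∈ f.support, ∀ n ∉ F, v.val n = ξ n := fun v hv n hn =>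
    hF₁ v hv n fun h => hn (Finset.mem_union_right _ h)
  have hF' : ∀ v ∈ f.support, ∀ n ∉ F, (famMap T hT v).1 n = ξ n := fun v hv n hn => by
    simp only [famMap, hTF n fun h => hn (Finset.mem_union_left _ h), hF v hv n hn]
    rfl
  have hprod : ∏ n ∈ F₀, ‖T n‖ = ∏ n ∈ F, ‖T n‖ :=
    Finset.prod_subset Finset.subset_union_left fun n _ hn => hn1 n hn
  refine abs_le_of_sq_le_sq' ?_ (by positivity) |>.2
  rw [mul_pow, hprod, norm_sq_pre, norm_sq_pre, ← Finset.prod_pow]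
  have key := (posSemidef_prod (ξ := ξ) T F).2.2 f
  have e1 : (Finsupp.sum (preMap T hT f) fun v a => Finsupp.sum (preMap T hT f) fun w b =>
      star a * kernel ξ v w * b) = Finsupp.sum f fun v a => Finsupp.sum f fun w b =>
      star a * (∏ n ∈ F, ⟪T n (v.val n), T n (w.val n)⟫_ℂ) * b := by
    refine (Finsupp.sum_mapDomain_index (by simp) fun v a b => by
      simp [add_mul, Finsupp.sum_add]).trans ?_
    refine Finset.sum_congr rfl fun v hv => ?_
    refine (Finsupp.sum_mapDomain_index (by simp) fun v a b => by simp [mul_add]).trans ?_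
    refine Finset.sum_congr rfl fun w hw => ?_
    dsimp only
    rw [kernel_eq_prod _ _ F (hF' v hv) (hF' w hw)]
    rfl
  have e2 : (Finsupp.sum f fun v a => Finsupp.sum f fun w b =>
      star a * (∏ n ∈ F, (‖T n‖ ^ 2 : ℝ) • ⟪v.val n, w.val n⟫_ℂ) * b) =
      ((∏ n ∈ F, ‖T n‖ ^ 2 : ℝ) : ℂ) * Finsupp.sum f fun v a => Finsupp.sum f fun w b =>
        star a * kernel ξ v w * b := by
    simp only [Finsupp.mul_sum]
    refine Finset.sum_congr rfl fun v hv => Finset.sum_congr rfl fun w hw => ?_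
    dsimp only
    rw [kernel_eq_prod _ _ F (hF v hv) (hF w hw)]
    simp only [Complex.real_smul, Finset.prod_mul_distrib, Complex.ofReal_prod]
    ring
  rw [e1, ← Complex.re_ofReal_mul, ← e2, ← sub_nonneg, ← Complex.sub_re]
  refine (Complex.le_def.1 (key.trans_eq ?_)).1
  simp only [Finsupp.sum, ← Finset.sum_sub_distrib, Matrix.of_apply, mul_sub, sub_mul]

/-- The operator `⨂ T n` on the infinite tensor product, where `T n = 1` for almost all `n`. -/
def op (T : ∀ n, H n →L[ℂ] H n) (hT : ∀ᶠ n in cofinite, T n = 1) :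
    InfTensor ξ →L[ℂ] InfTensor ξ :=
  ((preMap T hT).mkContinuous _ (norm_preMap_le T hT)).completion

theorem op_tmul (T : ∀ n, H n →L[ℂ] H n) (hT : ∀ᶠ n in cofinite, T n = 1) (v : Fam ξ) :
    op T hT (tmul v) = tmul (famMap T hT v) := by
  refine (ContinuousLinearMap.completion_apply_coe _ _).trans ?_
  refine congrArg (fun f : Pre ξ => (f : UniformSpace.Completion (Pre ξ))) ?_
  exact Finsupp.mapDomain_single

theorem dense_span_tmul : Dense (Submodule.span ℂ (Set.range (tmul (ξ := ξ))) : Set (InfTensor ξ)) := by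
  refine UniformSpace.Completion.denseRange_coe.mono ?_
  rintro _ ⟨f, rfl⟩
  refine Finsupp.induction_linear f ?_ (fun f g hf hg => ?_) fun v a => ?_
  · exact Submodule.zero_mem _
  · rw [UniformSpace.Completion.coe_add]
    exact Submodule.add_mem _ hf hg
  · have : (Finsupp.single v a : Pre ξ) = a • (Finsupp.single v 1 : Pre ξ) := by simp
    rw [this, UniformSpace.Completion.coe_smul]
    exact Submodule.smul_mem _ _ (Submodule.subset_span ⟨v, rfl⟩)

/-- The family equal to `w` on `F` and to `ξ` off `F`. -/
def trunc (ξ : ∀ n, Metric.sphere (0 : H n) 1) (F : Finset ℕ) (w : ∀ n, H n) : Fam ξ :=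
  ⟨fun n => if n ∈ F then w n else ξ n, by
    refine mem_cofinite.2 (F.finite_toSet.subset fun n hn => ?_)
    by_contra h
    exact hn (if_neg h)⟩

theorem continuous_tmul_trunc (F : Finset ℕ) : Continuous fun w => tmul (trunc ξ F w) := by
  have hin : ∀ v w, ⟪tmul (trunc ξ F v), tmul (trunc ξ F w)⟫_ℂ = ∏ n ∈ F, ⟪v n, w n⟫_ℂ := by
    intro v w
    refine (inner_tmul _ _).trans ((kernel_eq_prod (trunc ξ F v) (trunc ξ F w) F
      (fun n hn => if_neg hn) (fun n hn => if_neg hn)).trans ?_)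
    exact Finset.prod_congr rfl fun n hn => by simp [trunc, hn]
  refine continuous_iff_continuousAt.2 fun w₀ => ?_
  refine tendsto_iff_norm_sub_tendsto_zero.2 ?_
  have h : ∀ w, ‖tmul (trunc ξ F w) - tmul (trunc ξ F w₀)‖ = √(RCLike.re (∏ n ∈ F, ⟪w n, w n⟫_ℂ)
      - 2 * RCLike.re (∏ n ∈ F, ⟪w n, w₀ n⟫_ℂ) + RCLike.re (∏ n ∈ F, ⟪w₀ n, w₀ n⟫_ℂ)) := by
    intro w
    rw [← hin, ← hin, ← hin, inner_self_eq_norm_sq, inner_self_eq_norm_sq,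
      ← norm_sub_sq (𝕜 := ℂ), Real.sqrt_sq (norm_nonneg _)]
  simp only [h]
  have hc : Continuous fun w : ∀ n, H n => √(RCLike.re (∏ n ∈ F, ⟪w n, w n⟫_ℂ)
      - 2 * RCLike.re (∏ n ∈ F, ⟪w n, w₀ n⟫_ℂ) + RCLike.re (∏ n ∈ F, ⟪w₀ n, w₀ n⟫_ℂ)) := by
    fun_prop
  have := hc.tendsto w₀
  rwa [← h, sub_self, norm_zero] at this

instance [∀ n, SecondCountableTopology (H n)] : SecondCountableTopology (InfTensor ξ) := by
  classical
  have hsep : TopologicalSpace.IsSeparable (Set.range (tmul (ξ := ξ))) := by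
    have hF : ∀ F : Finset ℕ,
        TopologicalSpace.IsSeparable (Set.range fun w => tmul (trunc ξ F w)) := fun F =>
      TopologicalSpace.isSeparable_range (continuous_tmul_trunc F)
    refine (TopologicalSpace.IsSeparable.iUnion hF).mono ?_
    rintro _ ⟨v, rfl⟩
    obtain ⟨F, hF⟩ := exists_common ({v} : Finset (Fam ξ))
    refine Set.mem_iUnion.2 ⟨F, v.val, congrArg tmul ?_⟩
    obtain ⟨v, hv⟩ := v
    simp only [trunc, Fam.mk.injEq]
    funext n
    split_ifs with h
    · rfl
    · exact (hF _ (Finset.mem_singleton_self _) n h).symm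
  have h2 : TopologicalSpace.IsSeparable (Set.univ : Set (InfTensor ξ)) := by
    have := (hsep.span (R := ℂ)).closure
    rwa [dense_span_tmul.closure_eq] at this
  have : TopologicalSpace.SeparableSpace (InfTensor ξ) :=
    TopologicalSpace.isSeparable_univ_iff.1 h2
  exact UniformSpace.secondCountable_of_separable _

end InfTensor

/-! ### Von Neumann algebras -/

section VN

variable {H : Type u} [NormedAddCommGroup H] [InnerProductSpace ℂ H] [CompleteSpace H]

namespace VonNeumannAlgebra

/-- The type of elements of a von Neumann algebra. -/
abbrev Elt (M : VonNeumannAlgebra H) : Type u := M.toStarSubalgebra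

/-- The von Neumann algebra generated by a set of operators: the bicommutant of `S ∪ S⋆`. -/
def generated (S : Set (H →L[ℂ] H)) : VonNeumannAlgebra H where
  toStarSubalgebra := StarSubalgebra.centralizer ℂ (StarSubalgebra.centralizer ℂ S : Set (H →L[ℂ] H))
  centralizer_centralizer' := by
    change Set.centralizer (Set.centralizer ((StarSubalgebra.centralizer ℂ
      (StarSubalgebra.centralizer ℂ S : Set (H →L[ℂ] H)) : StarSubalgebra ℂ (H →L[ℂ] H)) :
        Set (H →L[ℂ] H))) = ((StarSubalgebra.centralizer ℂ
      (StarSubalgebra.centralizer ℂ S : Set (H →L[ℂ] H)) : StarSubalgebra ℂ (H →L[ℂ] H)) :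
        Set (H →L[ℂ] H))
    rw [StarSubalgebra.coe_centralizer, Set.centralizer_centralizer_centralizer]

theorem subset_generated (S : Set (H →L[ℂ] H)) {x : H →L[ℂ] H} (hx : x ∈ S) :
    x ∈ (generated S).toStarSubalgebra :=
  StarAlgebra.adjoin_le_centralizer_centralizer ℂ S
    (StarAlgebra.subset_adjoin ℂ S hx)

/-- Elements of the predual `M_*`: the `σ`-weakly continuous functionals
`x ↦ ∑ i, ⟪ξ i, x (η i)⟫` with `∑ ‖ξ i‖ ^ 2 < ∞` and `∑ ‖η i‖ ^ 2 < ∞`. -/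
def IsNormalFunctional (M : VonNeumannAlgebra H) (ω : M.Elt → ℂ) : Prop :=
  ∃ ξ η : ℕ → H, (Summable fun i => ‖ξ i‖ ^ 2) ∧ (Summable fun i => ‖η i‖ ^ 2) ∧
    ∀ x : M.Elt, ω x = ∑' i, ⟪ξ i, (x : H →L[ℂ] H) (η i)⟫_ℂ

/-- `σ`-weak continuity of a linear map between von Neumann algebras. -/
def IsNormalMap {K : Type v} [NormedAddCommGroup K] [InnerProductSpace ℂ K] [CompleteSpace K]
    (M : VonNeumannAlgebra H) (N : VonNeumannAlgebra K) (Φ : M.Elt → N.Elt) : Prop :=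
  ∀ ω : N.Elt → ℂ, N.IsNormalFunctional ω → M.IsNormalFunctional (ω ∘ Φ)

/-- Isomorphism of von Neumann algebras. -/
def IsIsomorphic {K : Type v} [NormedAddCommGroup K] [InnerProductSpace ℂ K] [CompleteSpace K]
    (M : VonNeumannAlgebra H) (N : VonNeumannAlgebra K) : Prop :=
  ∃ Φ : M.Elt ≃⋆ₐ[ℂ] N.Elt, IsNormalMap M N Φ ∧ IsNormalMap N M Φ.symm

/-- Positivity of elements. -/
def IsPos (M : VonNeumannAlgebra H) (x : M.Elt) : Prop := (x : H →L[ℂ] H).IsPositive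

end VonNeumannAlgebra

open VonNeumannAlgebra

/-- An action of a topological group on a von Neumann algebra: a homomorphism into the group of
(normal) automorphisms that is pointwise `σ`-weakly continuous. -/
structure VNAction (G : Type v) [Group G] [TopologicalSpace G] (M : VonNeumannAlgebra H) where
  /-- The automorphism attached to a group element. -/
  aut : G → (M.Elt ≃⋆ₐ[ℂ] M.Elt)
  aut_one : ∀ x, aut 1 x = x
  aut_mul : ∀ g h x, aut (g * h) x = aut g (aut h x)
  normal : ∀ g, IsNormalMap M M (aut g)
  continuous : ∀ (x : M.Elt) (ω : M.Elt → ℂ), M.IsNormalFunctional ω →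
    Continuous fun g => ω (aut g x)

/-! ### Weights

A weight on `M` is a map `M⁺ → [0, ∞]`. It is represented by a function on `M`, of which only the
values at positive elements are used. -/

/-- `φ` is a normal semifinite faithful weight. Normality: `φ` is a sum of positive normal
functionals (equivalently, of vector functionals). Semifiniteness: the positive elements of finite
weight generate `M`. -/
structure IsNSFWeight (M : VonNeumannAlgebra H) (φ : M.Elt → ℝ≥0∞) : Prop where
  add : ∀ x y, M.IsPos x → M.IsPos y → φ (x + y) = φ x + φ y
  smul : ∀ (r : ℝ) x, 0 ≤ r → M.IsPos x → φ ((r : ℂ) • x) = ENNReal.ofReal r * φ x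
  normal : ∃ (ι : Type) (ζ : ι → H), ∀ x, M.IsPos x →
    φ x = ∑' i, ENNReal.ofReal (⟪ζ i, (x : H →L[ℂ] H) (ζ i)⟫_ℂ).re
  semifinite : generated {x : H →L[ℂ] H | ∃ y : M.Elt, M.IsPos y ∧ φ y < ⊤ ∧ (y : H →L[ℂ] H) = x} = M
  faithful : ∀ x, M.IsPos x → φ x = 0 → x = 0

variable {M : VonNeumannAlgebra H}

/-- The left ideal of all `a` with `φ (a⋆ a) < ∞`. -/
def weightIdeal (φ : M.Elt → ℝ≥0∞) : Set M.Elt := {a | φ (star a * a) < ⊤}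

/-- The value `φ (a⋆ b)` of the linear extension of `φ`, for `a` and `b` in the left ideal of `φ`,
by polarization. -/
def weightForm (φ : M.Elt → ℝ≥0∞) (a b : M.Elt) : ℂ :=
  4⁻¹ * ∑ k ∈ Finset.range 4, (-Complex.I) ^ k *
    ((φ (star (a + Complex.I ^ k • b) * (a + Complex.I ^ k • b))).toReal : ℂ)

/-- `σ` is the modular automorphism group of `φ`: it leaves `φ` invariant and satisfies the
modular (KMS) condition. -/
def IsModularGroup (φ : M.Elt → ℝ≥0∞) (σ : VNAction (Multiplicative ℝ) M) : Prop :=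
  (∀ t x, M.IsPos x → φ (σ.aut t x) = φ x) ∧
  ∀ x y : M.Elt, x ∈ weightIdeal φ → star x ∈ weightIdeal φ → y ∈ weightIdeal φ →
    star y ∈ weightIdeal φ →
    ∃ F : ℂ → ℂ, DiffContOnCl ℂ F {z | 0 < z.im ∧ z.im < 1} ∧
      (∃ C : ℝ, ∀ z : ℂ, 0 ≤ z.im → z.im ≤ 1 → ‖F z‖ ≤ C) ∧
      ∀ t : ℝ, F t = weightForm φ (star (σ.aut (Multiplicative.ofAdd t) x)) y ∧
        F (t + Complex.I) = weightForm φ (star y) (σ.aut (Multiplicative.ofAdd t) x)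

/-- The centralizer of `φ`: the fixed points of the modular automorphism group of `φ` (which exists
and is unique if `φ` is normal, semifinite and faithful). -/
def weightCentralizer (φ : M.Elt → ℝ≥0∞) : Set M.Elt :=
  {x | ∃ σ : VNAction (Multiplicative ℝ) M, IsModularGroup φ σ ∧ ∀ t, σ.aut t x = x}

/-- `(K, ρ, Λ)` is a GNS construction for `φ`. The map `Λ` is defined on the left ideal of `φ`; its
values elsewhere are irrelevant. -/
structure IsGNS (φ : M.Elt → ℝ≥0∞) {K : Type v} [NormedAddCommGroup K] [InnerProductSpace ℂ K]
    [CompleteSpace K] (ρ : M.Elt →⋆ₐ[ℂ] (K →L[ℂ] K)) (Λ : M.Elt → K) : Prop where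
  map_add : ∀ a b, a ∈ weightIdeal φ → b ∈ weightIdeal φ → Λ (a + b) = Λ a + Λ b
  map_smul : ∀ (r : ℂ) a, a ∈ weightIdeal φ → Λ (r • a) = r • Λ a
  norm_sq : ∀ a, a ∈ weightIdeal φ → φ (star a * a) = ENNReal.ofReal (‖Λ a‖ ^ 2)
  dense : Dense (Λ '' weightIdeal φ)
  map_mul : ∀ x a, a ∈ weightIdeal φ → Λ (x * a) = ρ x (Λ a)

theorem IsGNS.mem_sphere {φ : M.Elt → ℝ≥0∞} {K : Type v} [NormedAddCommGroup K]
    [InnerProductSpace ℂ K] [CompleteSpace K] {ρ : M.Elt →⋆ₐ[ℂ] (K →L[ℂ] K)} {Λ : M.Elt → K}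
    (h : IsGNS φ ρ Λ) {q : M.Elt} (hq : IsStarProjection q) (h1 : φ q = 1) :
    Λ q ∈ Metric.sphere (0 : K) 1 := by
  have e : star q * q = q := by rw [hq.isSelfAdjoint.star_eq, hq.isIdempotentElem.eq]
  have := h.norm_sq q (by simp [weightIdeal, e, h1])
  rw [e, h1, eq_comm, ENNReal.ofReal_eq_one] at this
  rw [mem_sphere_zero_iff_norm]
  nlinarith [norm_nonneg (Λ q)]

end VN

/-! ### Infinite tensor products of von Neumann algebras -/

section TensorVN

open VonNeumannAlgebra

variable {H : ℕ → Type u} [∀ n, NormedAddCommGroup (H n)] [∀ n, InnerProductSpace ℂ (H n)]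
  [∀ n, CompleteSpace (H n)] {M : ∀ n, VonNeumannAlgebra (H n)}
  {φ : ∀ n, (M n).Elt → ℝ≥0∞}
  {K : ℕ → Type v} [∀ n, NormedAddCommGroup (K n)] [∀ n, InnerProductSpace ℂ (K n)]
  [∀ n, CompleteSpace (K n)] {ρ : ∀ n, (M n).Elt →⋆ₐ[ℂ] (K n →L[ℂ] K n)}
  {Λ : ∀ n, (M n).Elt → K n} {q : ∀ n, (M n).Elt}

/-- The unit vectors `Λ n (q n)`. -/
def gnsVec (hΛ : ∀ n, IsGNS (φ n) (ρ n) (Λ n)) (hq : ∀ n, IsStarProjection (q n))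
    (h1 : ∀ n, φ n (q n) = 1) (n : ℕ) : Metric.sphere (0 : K n) 1 :=
  ⟨Λ n (q n), (hΛ n).mem_sphere (hq n) (h1 n)⟩

/-- The operator `x 0 ⊗ x 1 ⊗ ⋯`, with `x n = 1` for almost all `n`. -/
def tensorOp (hΛ : ∀ n, IsGNS (φ n) (ρ n) (Λ n)) (hq : ∀ n, IsStarProjection (q n))
    (h1 : ∀ n, φ n (q n) = 1) (x : ∀ n, (M n).Elt) (hx : ∀ᶠ n in cofinite, x n = 1) :
    InfTensor (gnsVec hΛ hq h1) →L[ℂ] InfTensor (gnsVec hΛ hq h1) :=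
  InfTensor.op (fun n => ρ n (x n)) (hx.mono fun n h => by rw [h, map_one])

/-- The infinite tensor product `⨂ (M n, φ n, q n)`, acting on the infinite tensor product of the
GNS spaces relative to the unit vectors `Λ n (q n)`. -/
def weightTensor (hΛ : ∀ n, IsGNS (φ n) (ρ n) (Λ n)) (hq : ∀ n, IsStarProjection (q n))
    (h1 : ∀ n, φ n (q n) = 1) : VonNeumannAlgebra (InfTensor (gnsVec hΛ hq h1)) :=
  generated {T | ∃ (x : ∀ n, (M n).Elt) (hx : ∀ᶠ n in cofinite, x n = 1),
    T = tensorOp hΛ hq h1 x hx}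

/-- The element `x 0 ⊗ x 1 ⊗ ⋯` of `⨂ (M n, φ n, q n)`, with `x n = 1` for almost all `n`. -/
def tensorElt (hΛ : ∀ n, IsGNS (φ n) (ρ n) (Λ n)) (hq : ∀ n, IsStarProjection (q n))
    (h1 : ∀ n, φ n (q n) = 1) (x : ∀ n, (M n).Elt) (hx : ∀ᶠ n in cofinite, x n = 1) :
    (weightTensor hΛ hq h1).Elt :=
  ⟨tensorOp hΛ hq h1 x hx, subset_generated _ ⟨x, hx, rfl⟩⟩

/-- `α` is the restricted direct product of the actions `β n`: on elementary tensors it is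
`⨂ x n ↦ ⨂ β n (g n) (x n)`. -/
def IsRestrictedProductAction {G : ℕ → Type w} [∀ n, Group (G n)] [∀ n, TopologicalSpace (G n)]
    {U : ∀ n, Subgroup (G n)} (β : ∀ n, VNAction (G n) (M n))
    (hΛ : ∀ n, IsGNS (φ n) (ρ n) (Λ n)) (hq : ∀ n, IsStarProjection (q n))
    (h1 : ∀ n, φ n (q n) = 1)
    (α : VNAction (Πʳ n, [G n, U n]) (weightTensor hΛ hq h1)) : Prop :=
  ∀ (g : Πʳ n, [G n, U n]) (x : ∀ n, (M n).Elt) (hx : ∀ᶠ n in cofinite, x n = 1),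
    α.aut g (tensorElt hΛ hq h1 x hx) =
      tensorElt hΛ hq h1 (fun n => (β n).aut (g n) (x n)) (hx.mono fun n h => by rw [h, map_one])

end TensorVN

/-! ### Crossed products -/

section Crossed

open VonNeumannAlgebra

variable {H : Type u} [NormedAddCommGroup H] [InnerProductSpace ℂ H] [CompleteSpace H]
  {M : VonNeumannAlgebra H} {G : Type v} [Group G] [TopologicalSpace G]

theorem VonNeumannAlgebra.isNormalFunctional_inner (ζ η : H) :
    M.IsNormalFunctional fun x => ⟪ζ, (x : H →L[ℂ] H) η⟫_ℂ := by
  refine ⟨fun i => if i = 0 then ζ else 0, fun i => if i = 0 then η else 0, ?_, ?_, fun x => ?_⟩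
  · exact summable_of_ne_finset_zero (s := {0}) fun i hi => by simp_all
  · exact summable_of_ne_finset_zero (s := {0}) fun i hi => by simp_all
  · rw [tsum_eq_single 0 fun i hi => by simp [hi]]
    simp

namespace VNAction

variable (α : VNAction G M)

theorem norm_aut_le (g : G) (x : M.Elt) : ‖(α.aut g x : H →L[ℂ] H)‖ ≤ ‖(x : H →L[ℂ] H)‖ := by
  have hcl : IsClosed (M.toStarSubalgebra : Set (H →L[ℂ] H)) := by
    have : (M.toStarSubalgebra : Set (H →L[ℂ] H)) = _ := M.centralizer_centralizer'.symm
    rw [this]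
    exact Set.isClosed_centralizer _
  exact NonUnitalStarAlgHom.norm_apply_le (α.aut g) x

theorem continuous_aut_apply (x : M.Elt) (ζ : H) :
    Continuous fun g => (α.aut g x : H →L[ℂ] H) ζ := by
  refine continuous_iff_continuousAt.2 fun g₀ => tendsto_iff_norm_sub_tendsto_zero.2 ?_
  set ζ₀ := (α.aut g₀ x : H →L[ℂ] H) ζ
  have h : ∀ g, ‖(α.aut g x : H →L[ℂ] H) ζ - ζ₀‖ =
      √(RCLike.re ⟪ζ, (α.aut g (star x * x) : H →L[ℂ] H) ζ⟫_ℂ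
        - 2 * RCLike.re ⟪ζ₀, (α.aut g x : H →L[ℂ] H) ζ⟫_ℂ + ‖ζ₀‖ ^ 2) := by
    intro g
    have e : ⟪ζ, (α.aut g (star x * x) : H →L[ℂ] H) ζ⟫_ℂ =
        ⟪(α.aut g x : H →L[ℂ] H) ζ, (α.aut g x : H →L[ℂ] H) ζ⟫_ℂ := by
      have e' : (α.aut g (star x * x) : H →L[ℂ] H) =
          ContinuousLinearMap.adjoint (α.aut g x : H →L[ℂ] H) * (α.aut g x : H →L[ℂ] H) :=
        congrArg Subtype.val ((map_mul (α.aut g) (star x) x).trans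
          (congrArg (· * α.aut g x) (map_star (α.aut g) x)))
      rw [e', mul_apply_eq_comp, ContinuousLinearMap.adjoint_inner_right]
    rw [e, inner_self_eq_norm_sq, inner_re_symm, ← norm_sub_sq (𝕜 := ℂ),
      Real.sqrt_sq (norm_nonneg _)]
  have h1 := α.continuous (star x * x) _ (isNormalFunctional_inner ζ ζ)
  have h2 := α.continuous x _ (isNormalFunctional_inner ζ₀ ζ)
  have hc : Continuous fun g => ‖(α.aut g x : H →L[ℂ] H) ζ - ζ₀‖ := by
    simp only [h]
    fun_prop
  have := hc.tendsto g₀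
  rwa [sub_self, norm_zero] at this

variable [IsTopologicalGroup G] [MeasurableSpace G] [BorelSpace G] (μ : Measure G)
  [SecondCountableTopology H]

theorem memLp_pi (x : M.Elt) (f : Lp H 2 μ) :
    MemLp (fun g => (α.aut g⁻¹ x : H →L[ℂ] H) (f g)) 2 μ := by
  borelize H
  refine (Lp.memLp f).of_le_mul (c := ‖(x : H →L[ℂ] H)‖) ?_ (ae_of_all _ fun g => ?_)
  · have hu : StronglyMeasurable (Function.uncurry
        fun (ζ : H) (g : G) => (α.aut g⁻¹ x : H →L[ℂ] H) ζ) :=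
      stronglyMeasurable_uncurry_of_continuous_of_stronglyMeasurable
        (fun g => (α.aut g⁻¹ x : H →L[ℂ] H).continuous)
        fun ζ => ((α.continuous_aut_apply x ζ).comp continuous_inv).stronglyMeasurable
    exact (hu.comp_measurable
      ((Lp.stronglyMeasurable f).measurable.prodMk measurable_id)).aestronglyMeasurable
  · refine ((α.aut g⁻¹ x : H →L[ℂ] H).le_opNorm _).trans ?_
    gcongr
    exact α.norm_aut_le _ _

/-- The operator `π(x)` on `L²(G, H)`: `(π(x) f)(g) = α_{g⁻¹}(x) f(g)`. -/
def piOp (x : M.Elt) : Lp H 2 μ →L[ℂ] Lp H 2 μ :=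
  LinearMap.mkContinuous
    { toFun := fun f => (α.memLp_pi μ x f).toLp _
      map_add' := fun f₁ f₂ => by
        rw [← MemLp.toLp_add, MemLp.toLp_eq_toLp_iff]
        filter_upwards [Lp.coeFn_add f₁ f₂] with g hg
        rw [hg]
        simp
      map_smul' := fun r f => by
        rw [RingHom.id_apply, ← MemLp.toLp_const_smul, MemLp.toLp_eq_toLp_iff]
        filter_upwards [Lp.coeFn_smul r f] with g hg
        simp [hg] }
    ‖(x : H →L[ℂ] H)‖ fun f => by
      refine Lp.norm_le_mul_norm_of_ae_le_mul ?_
      filter_upwards [(α.memLp_pi μ x f).coeFn_toLp] with g hg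
      simp only [LinearMap.coe_mk, AddHom.coe_mk, hg]
      refine ((α.aut g⁻¹ x : H →L[ℂ] H).le_opNorm _).trans ?_
      gcongr
      exact α.norm_aut_le _ _

end VNAction

variable [IsTopologicalGroup G] [MeasurableSpace G] [BorelSpace G] (μ : Measure G)
  [μ.IsHaarMeasure]

/-- Left translation on `L²(G, H)`: `(λ_g f)(h) = f(g⁻¹ h)`. -/
def lamOp (H : Type u) [NormedAddCommGroup H] [InnerProductSpace ℂ H] (g : G) :
    Lp H 2 μ →L[ℂ] Lp H 2 μ :=
  (Lp.compMeasurePreservingₗᵢ ℂ (g⁻¹ * ·) (measurePreserving_mul_left μ g⁻¹)).toContinuousLinearMap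

/-- The crossed product `G ⋉ M`: the von Neumann algebra on `L²(G, H)` generated by `π(M)` and the
left translations. -/
def crossedProduct [SecondCountableTopology H] (α : VNAction G M) :
    VonNeumannAlgebra (Lp H 2 μ) :=
  generated (Set.range (α.piOp μ) ∪ Set.range (lamOp μ H))

section Conv

variable [LocallyCompactSpace G] [T2Space G] [SecondCountableTopology G]

theorem continuous_lamOp (f : Lp H 2 μ) : Continuous fun g => lamOp μ H g f := by
  have : Continuous fun g : G => (DomMulAct.mk g⁻¹) • f := by
    have hc : Continuous fun g : G => DomMulAct.mk g⁻¹ :=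
      DomMulAct.continuous_mk.comp continuous_inv
    have : Fact ((2 : ℝ≥0∞) ≠ ∞) := ⟨by simp⟩
    exact hc.smul continuous_const
  exact this

theorem integrable_conv {k : G → ℂ} (hk : Integrable k μ) (f : Lp H 2 μ) :
    Integrable (fun t => k t • lamOp μ H t f) μ := by
  refine Integrable.mono' (hk.norm.mul_const ‖f‖)
    (hk.aestronglyMeasurable.smul (continuous_lamOp μ f).aestronglyMeasurable)
    (ae_of_all _ fun t => ?_)
  rw [norm_smul]
  gcongr
  exact (LinearIsometry.norm_map _ f).le

/-- The convolution operator `λ(k) ⊗ 1` on `L²(G, H)` by an integrable function: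
`λ(k) f = ∫ k(t) λ_t f dμ(t)`. -/
def convOp (H : Type u) [NormedAddCommGroup H] [InnerProductSpace ℂ H] [CompleteSpace H]
    {k : G → ℂ} (hk : Integrable k μ) : Lp H 2 μ →L[ℂ] Lp H 2 μ :=
  LinearMap.mkContinuous
    { toFun := fun f => ∫ t, k t • lamOp μ H t f ∂μ
      map_add' := fun f₁ f₂ => by
        rw [← integral_add (integrable_conv μ hk f₁) (integrable_conv μ hk f₂)]
        simp only [map_add, smul_add]
      map_smul' := fun r f => by
        rw [RingHom.id_apply, ← integral_smul]
        simp only [map_smul, smul_comm r] }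
    (∫ t, ‖k t‖ ∂μ) fun f => by
      refine (norm_integral_le_integral_norm _).trans_eq ?_
      rw [← integral_mul_const]
      refine integral_congr_ae (ae_of_all _ fun t => ?_)
      simp only [norm_smul]
      congr 1
      exact LinearIsometry.norm_map _ f

open scoped CompactlySupported

/-- The vector `k ⊗ ζ` of `L²(G, H)`, that is `g ↦ k(g) ζ`. -/
def elemL2 (k : C_c(G, ℂ)) (ζ : H) : Lp H 2 μ :=
  ((k.continuous.smul continuous_const).memLp_of_hasCompactSupport
    (k.hasCompactSupport.smul_right (f' := fun _ => ζ)) : MemLp (fun g => k g • ζ) 2 μ).toLp _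

variable [SecondCountableTopology H]

/-- `f` is right bounded with right multiplication operator `R`, with respect to the vectors
`k ⊗ Λ(a)` corresponding to the operators `(λ(k) ⊗ 1) π(a)`. -/
def IsRightBounded (α : VNAction G M) (φ : M.Elt → ℝ≥0∞) (Λ : M.Elt → H) (f : Lp H 2 μ)
    (R : Lp H 2 μ →L[ℂ] Lp H 2 μ) : Prop :=
  ∀ (k : C_c(G, ℂ)) (a : M.Elt), a ∈ weightIdeal φ →
    R (elemL2 μ k (Λ a)) =
      convOp μ H (k.continuous.integrable_of_hasCompactSupport k.hasCompactSupport)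
        (α.piOp μ a f)

/-- `y` is the left multiplication operator of the left bounded vector `ζ`. -/
def IsLeftMul (α : VNAction G M) (φ : M.Elt → ℝ≥0∞) (Λ : M.Elt → H)
    (y : (crossedProduct μ α).Elt) (ζ : Lp H 2 μ) : Prop :=
  ∀ f R, IsRightBounded μ α φ Λ f R → (y : Lp H 2 μ →L[ℂ] Lp H 2 μ) f = R ζ

/-- The dual weight of `φ` on `G ⋉ M`, where `M` acts on the GNS space `H` of `φ` with GNS map `Λ`:
the weight of the left Hilbert algebra on `L²(G, H)` in which `k ⊗ Λ(a)` has left multiplication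
operator `(λ(k) ⊗ 1) π(a)`. Its value at `y⋆ y` is `‖ζ‖ ^ 2` if `y` is the left multiplication
operator of a left bounded vector `ζ`, and `∞` if there is no such vector. -/
def dualWeight (α : VNAction G M) (φ : M.Elt → ℝ≥0∞) (Λ : M.Elt → H)
    (z : (crossedProduct μ α).Elt) : ℝ≥0∞ :=
  ⨅ (y : (crossedProduct μ α).Elt) (ζ : Lp H 2 μ)
    (_ : star y * y = z ∧ IsLeftMul μ α φ Λ y ζ), ENNReal.ofReal (‖ζ‖ ^ 2)

/-- The operator `π(q) (λ(1_U) ⊗ 1)` for a compact open subgroup `U`. -/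
def crossedProj (α : VNAction G M) {U : Subgroup G} (hU : IsOpen (U : Set G))
    (hc : IsCompact (U : Set G)) (q : M.Elt) : Lp H 2 μ →L[ℂ] Lp H 2 μ :=
  α.piOp μ q * convOp μ H (k := (U : Set G).indicator 1)
    ((integrable_indicator_iff hU.measurableSet).2
      (integrableOn_const hc.measure_lt_top.ne))

end Conv

end Crossed

end

/-! The isomorphism is spatial. Write `κ` for the Haar measure of `∏ K n` in the restricted product
`G`. The unitary sends the elementary tensor of the vectors `k n ⊗ ζ n`, almost all equal to `1_{K
n} ⊗ Λ n (q n)`, to `κ^(-1/2) (∏ k n) ⊗ (⨂ ζ n)` in `L²(G, ⨂ H n)`. It preserves inner products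
because the Haar integral of a product function is `κ` times the product of the integrals
(`CcFam.integral_prod`), and it is onto because product functions are total in `L²`
(`CcFam.totalSet_elemL2_prod`, by Stone-Weierstrass on translates of `∏ K n`). By the same
computation it carries `⨂ π n (x n)` to `π(⨂ x n)`, and it carries `⨂ λ_{g n}` to `λ_g` if almost
all `g n` are `1`. The two von Neumann algebras are then compared through their commutants: by
`commute_of_amplification` generators suffice in each factor, and by `commute_lamOp_of_finite`
finitely supported translations suffice in `G`, since `K n` fixes its own indicator function.

The action of `G` exists because each `α^n` is implemented by the unitaries `U_g Λ(a) = c(g)^(-1/2)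
Λ(α_g(a))`, which fix the base vector `Λ n (q n)` for `g ∈ K n` and hence can be tensored. It is
unique because normal maps are determined by elementary tensors (`weightTensor_normalMap_ext`).

For the dual weight everything rests on an explicit supply of right bounded vectors, namely `l ⊗ η`
with `η` right bounded for `φ` (`isRightBounded_rightOp`). Their right multiplication operators lie
in the commutant of the crossed product and have no common kernel (`eq_zero_of_isRightBounded`).
Therefore a left multiplication operator determines its vector, the dual weight of `y⋆ y` is the
squared norm of that vector, and the vectors give a GNS construction on `L²(G, H)`. The vector of
`e` is `1_K ⊗ Λ(q)`, which has norm `1`.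

That `e` lies in the centralizer requires the modular group of the dual weight. The candidate is
conjugation by the flow `f(s) ↦ (c Δ)(s)^(it) V_t f(s)`, where `V` implements the modular group of
`φ`. Instead of unbounded operators, the KMS condition is handled through Gaussian averages of the
flow: they are entire in their centre, and the condition becomes an identity between bounded
operators. For the vectors of `λ(k) π(a)` this identity holds fibre by fibre (`kms_fieldPairs`). The
duality `UnitaryFlow.KMS₂.dual`, which plays the role of passing from an involution to its adjoint,
transports it to right bounded vectors and from there back to all elements `y` such that both `y`
and `y⋆` are left bounded (`stripKMS_leftPairs`). Then `e` is fixed, because `c` and `Δ` are `1` on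
`K` and `q` is fixed by the modular group of `φ`. The uniqueness of KMS flows
(`UnitaryFlow.StripKMS.unique`) enters because `V` has to commute with the implementation of the
action. -/

noncomputable section

set_option linter.unusedSectionVars false

/-! ### Total sets in Hilbert spaces -/

section Total

variable {H : Type*} [NormedAddCommGroup H] [InnerProductSpace ℂ H]
  {K : Type*} [NormedAddCommGroup K] [InnerProductSpace ℂ K]

/-- A set of vectors is total if only the zero vector is orthogonal to it. -/
def TotalSet (s : Set H) : Prop := ∀ v, (∀ w ∈ s, ⟪w, v⟫_ℂ = 0) → v = 0

theorem TotalSet.mono {s t : Set H} (hs : TotalSet s) (h : s ⊆ t) : TotalSet t :=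
  fun v hv => hs v fun w hw => hv w (h hw)

theorem Dense.totalSet {s : Set H} (hs : Dense s) : TotalSet s := fun v hv => by
  have h : ∀ w, ⟪w, v⟫_ℂ = 0 := fun w => hs.induction (P := fun w => ⟪w, v⟫_ℂ = 0) hv
    (isClosed_eq (by fun_prop) continuous_const) w
  exact inner_self_eq_zero.1 (h v)

theorem TotalSet.of_span {s : Set H} (hs : TotalSet (Submodule.span ℂ s : Set H)) : TotalSet s := by
  refine fun v hv => hs v fun w hw => ?_
  induction hw using Submodule.span_induction with
  | mem x hx => exact hv x hx
  | zero => simp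
  | add x y _ _ hx hy => rw [inner_add_left, hx, hy, add_zero]
  | smul a x _ hx => rw [inner_smul_left, hx, mul_zero]

theorem TotalSet.dense_of_submodule [CompleteSpace H] {S : Submodule ℂ H} (hs : TotalSet (S : Set H)) :
    Dense (S : Set H) := by
  rw [Submodule.dense_iff_topologicalClosure_eq_top, Submodule.topologicalClosure_eq_top_iff,
    Submodule.eq_bot_iff]
  exact fun v hv => hs v fun w hw => hv w hw

theorem TotalSet.dense_span [CompleteSpace H] {s : Set H} (hs : TotalSet s) :
    Dense (Submodule.span ℂ s : Set H) :=
  (hs.mono Submodule.subset_span).dense_of_submodule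

theorem TotalSet.clm_ext [CompleteSpace H] [CompleteSpace K] {s : Set H} (hs : TotalSet s)
    {S T : H →L[ℂ] K} (h : ∀ w ∈ s, S w = T w) : S = T := by
  refine ContinuousLinearMap.ext_on hs.dense_span h

theorem TotalSet.image [CompleteSpace H] [CompleteSpace K] {s : Set H} (hs : TotalSet s)
    (W : H ≃ₗᵢ[ℂ] K) : TotalSet (W '' s) := fun v hv => by
  have := hs (W.symm v) fun w hw => by
    rw [← W.inner_map_map, W.apply_symm_apply]; exact hv _ ⟨w, hw, rfl⟩
  simpa using this

end Total

/-! ### Conjugation by unitaries -/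

section Conj

variable {H : Type*} [NormedAddCommGroup H] [InnerProductSpace ℂ H] [CompleteSpace H]
  {K : Type*} [NormedAddCommGroup K] [InnerProductSpace ℂ K] [CompleteSpace K]

/-- `x ↦ W x W⁻¹`. -/
def conjCLM (W : H ≃ₗᵢ[ℂ] K) (x : H →L[ℂ] H) : K →L[ℂ] K :=
  (W : H →L[ℂ] K) ∘L x ∘L (W.symm : K →L[ℂ] H)

@[simp] theorem conjCLM_apply (W : H ≃ₗᵢ[ℂ] K) (x : H →L[ℂ] H) (v : K) :
    conjCLM W x v = W (x (W.symm v)) := rfl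

theorem conjCLM_mul (W : H ≃ₗᵢ[ℂ] K) (x y : H →L[ℂ] H) :
    conjCLM W (x * y) = conjCLM W x * conjCLM W y := by
  ext v; simp

theorem conjCLM_star (W : H ≃ₗᵢ[ℂ] K) (x : H →L[ℂ] H) :
    conjCLM W (star x) = star (conjCLM W x) := by
  refine ContinuousLinearMap.ext fun v => ext_inner_left ℂ fun w => ?_
  rw [ContinuousLinearMap.star_eq_adjoint, ContinuousLinearMap.star_eq_adjoint,
    ContinuousLinearMap.adjoint_inner_right, conjCLM_apply, conjCLM_apply]
  rw [← W.symm.inner_map_map, W.symm_apply_apply, ContinuousLinearMap.adjoint_inner_right,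
    ← W.inner_map_map, W.apply_symm_apply]

@[simp] theorem conjCLM_symm_conjCLM (W : H ≃ₗᵢ[ℂ] K) (x : H →L[ℂ] H) :
    conjCLM W.symm (conjCLM W x) = x := by
  ext v; simp

@[simp] theorem conjCLM_conjCLM_symm (W : H ≃ₗᵢ[ℂ] K) (x : K →L[ℂ] K) :
    conjCLM W (conjCLM W.symm x) = x := by
  ext v; simp

theorem inner_conjCLM (W : H ≃ₗᵢ[ℂ] K) (x : H →L[ℂ] H) (v w : K) :
    ⟪v, conjCLM W x w⟫_ℂ = ⟪W.symm v, x (W.symm w)⟫_ℂ := by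
  rw [conjCLM_apply, ← W.symm.inner_map_map, W.symm_apply_apply]

end Conj

/-! ### Commutants, generated algebras, normal maps and spatial isomorphisms -/

namespace VonNeumannAlgebra

variable {H : Type u} [NormedAddCommGroup H] [InnerProductSpace ℂ H] [CompleteSpace H]
  {K : Type v} [NormedAddCommGroup K] [InnerProductSpace ℂ K] [CompleteSpace K]

theorem mem_iff_commute {M : VonNeumannAlgebra H} {x : H →L[ℂ] H} :
    x ∈ M.toStarSubalgebra ↔
      ∀ T : H →L[ℂ] H, (∀ y ∈ M.toStarSubalgebra, y * T = T * y) → T * x = x * T := by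
  have h : (M.toStarSubalgebra : Set (H →L[ℂ] H)) =
    Set.centralizer (Set.centralizer (M.toStarSubalgebra : Set (H →L[ℂ] H))) :=
    M.centralizer_centralizer'.symm
  rw [← SetLike.mem_coe, h]
  rfl

theorem mem_generated_iff {S : Set (H →L[ℂ] H)} {x : H →L[ℂ] H} :
    x ∈ (generated S).toStarSubalgebra ↔
      ∀ T : H →L[ℂ] H, (∀ s ∈ S, s * T = T * s ∧ star s * T = T * star s) → T * x = x * T := by
  change x ∈ StarSubalgebra.centralizer ℂ (StarSubalgebra.centralizer ℂ S : Set (H →L[ℂ] H)) ↔ _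
  rw [StarSubalgebra.mem_centralizer_iff]
  constructor
  · intro h T hT
    exact (h T ((StarSubalgebra.mem_centralizer_iff ℂ).2 hT)).1
  · intro h T hT
    refine ⟨h T ((StarSubalgebra.mem_centralizer_iff ℂ).1 hT), h _ ?_⟩
    exact (StarSubalgebra.mem_centralizer_iff ℂ).1 (star_mem hT)

/-- If `T` commutes with the amplifications of a set `S` of operators, then it commutes with the
amplifications of the operators in the von Neumann algebra generated by `S`. -/
theorem commute_of_amplification {ι : Type*} {j : ι → H →L[ℂ] K}
    (hj : TotalSet {v | ∃ i w, v = j i w}) {S : Set (H →L[ℂ] H)} {T : K →L[ℂ] K}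
    (hT : ∀ s ∈ S, ∃ Y : K →L[ℂ] K, (∀ i w, Y (j i w) = j i (s w)) ∧
      (∀ i w, star Y (j i w) = j i (star s w)) ∧ Y * T = T * Y ∧ star Y * T = T * star Y)
    {x : H →L[ℂ] H} (hx : x ∈ (generated S).toStarSubalgebra) {X : K →L[ℂ] K}
    (hX : ∀ i w, X (j i w) = j i (x w)) (hX' : ∀ i w, star X (j i w) = j i (star x w)) :
    T * X = X * T := by
  -- The compressions of `T` to the copies of `H` commute with `S` and its adjoints, so they lie in
  -- the commutant of the generated algebra and commute with `x`. These compressions are the matrix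
  -- entries of `T` with respect to the total ranges of the `j i`.
  have key : ∀ i k, ContinuousLinearMap.adjoint (j i) ∘L T ∘L j k * x =
      x * (ContinuousLinearMap.adjoint (j i) ∘L T ∘L j k) := by
    intro i k
    refine mem_generated_iff.1 hx _ fun s hs => ?_
    obtain ⟨Y, h1, h2, h3, h4⟩ := hT s hs
    have main : ∀ (s : H →L[ℂ] H) (Y : K →L[ℂ] K), (∀ i w, Y (j i w) = j i (s w)) →
        (∀ i w, star Y (j i w) = j i (star s w)) → Y * T = T * Y →
        s * (ContinuousLinearMap.adjoint (j i) ∘L T ∘L j k) =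
          (ContinuousLinearMap.adjoint (j i) ∘L T ∘L j k) * s := by
      intro s Y h1 h2 h3
      refine ContinuousLinearMap.ext fun v => ext_inner_left ℂ fun w => ?_
      simp only [mul_apply_eq_comp, ContinuousLinearMap.comp_apply]
      rw [← ContinuousLinearMap.adjoint_inner_left, ← ContinuousLinearMap.star_eq_adjoint,
        ContinuousLinearMap.adjoint_inner_right, ContinuousLinearMap.adjoint_inner_right, ← h2,
        ← h1, ContinuousLinearMap.star_eq_adjoint, ContinuousLinearMap.adjoint_inner_left,
        ← mul_apply_eq_comp, h3, mul_apply_eq_comp]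
    exact ⟨main s Y h1 h2 h3, main _ _ h2 (by simpa using h1) h4⟩
  refine hj.clm_ext ?_
  rintro _ ⟨k, w, rfl⟩
  refine sub_eq_zero.1 (hj _ ?_)
  rintro _ ⟨i, v, rfl⟩
  have := congrArg (fun Z : H →L[ℂ] H => ⟪v, Z w⟫_ℂ) (key i k)
  simp only [mul_apply_eq_comp, ContinuousLinearMap.comp_apply] at this
  rw [ContinuousLinearMap.adjoint_inner_right, ← ContinuousLinearMap.adjoint_inner_left x,
    ← ContinuousLinearMap.star_eq_adjoint, ContinuousLinearMap.adjoint_inner_right, ← hX, ← hX',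
    ContinuousLinearMap.star_eq_adjoint, ContinuousLinearMap.adjoint_inner_left] at this
  rw [inner_sub_right, mul_apply_eq_comp, mul_apply_eq_comp, this, sub_self]

/-- The orthogonal projection onto a closed subspace invariant under `Y` and `Y⋆` commutes
with `Y`. -/
theorem commute_starProjection {W : Submodule ℂ H} [W.HasOrthogonalProjection] {Y : H →L[ℂ] H}
    (h1 : ∀ w ∈ W, Y w ∈ W) (h2 : ∀ w ∈ W, star Y w ∈ W) :
    Y * W.starProjection = W.starProjection * Y := by
  ext v
  rw [mul_apply_eq_comp, mul_apply_eq_comp]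
  refine (Submodule.eq_starProjection_of_mem_orthogonal (h1 _ (W.starProjection_apply_mem v))
    fun w hw => ?_).symm
  rw [← map_sub, ← ContinuousLinearMap.adjoint_inner_left, ← ContinuousLinearMap.star_eq_adjoint]
  exact W.sub_starProjection_mem_orthogonal v _ (h2 w hw)

/-- The commutant is selfadjoint, so a subspace invariant under it reduces it, and the projection
lies in the bicommutant. -/
theorem starProjection_mem {M : VonNeumannAlgebra H} {W : Submodule ℂ H}
    [W.HasOrthogonalProjection]
    (h : ∀ T : H →L[ℂ] H, (∀ y ∈ M.toStarSubalgebra, y * T = T * y) → ∀ w ∈ W, T w ∈ W) :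
    W.starProjection ∈ M.toStarSubalgebra := by
  refine mem_iff_commute.2 fun T hT => commute_starProjection (h T hT) (h _ fun y hy => ?_)
  have := congrArg star (hT _ (star_mem hy))
  simpa using this.symm

/-- The diagonal amplification of an operator to `ℓ²(ℕ, H)`. -/
def ampl (x : H →L[ℂ] H) : lp (fun _ : ℕ => H) 2 →L[ℂ] lp (fun _ : ℕ => H) 2 :=
  lp.mapCLM 2 (fun _ => x) (norm_nonneg x) fun _ => le_rfl

theorem ampl_apply (x : H →L[ℂ] H) (f : lp (fun _ : ℕ => H) 2) (i : ℕ) :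
    ampl x f i = x (f i) := rfl

theorem star_ampl (x : H →L[ℂ] H) : star (ampl x) = ampl (star x) := by
  refine ContinuousLinearMap.ext fun v => ext_inner_left ℂ fun w => ?_
  rw [ContinuousLinearMap.star_eq_adjoint, ContinuousLinearMap.adjoint_inner_right,
    lp.inner_eq_tsum, lp.inner_eq_tsum]
  refine tsum_congr fun i => ?_
  rw [ampl_apply, ampl_apply, ContinuousLinearMap.star_eq_adjoint,
    ContinuousLinearMap.adjoint_inner_right]

/-- A normal functional that vanishes on a unital selfadjoint semigroup of generators vanishes. -/
theorem IsNormalFunctional.eq_zero {S : Set (H →L[ℂ] H)} (h1 : 1 ∈ S)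
    (hmul : ∀ s ∈ S, ∀ t ∈ S, s * t ∈ S) (hstar : ∀ s ∈ S, star s ∈ S)
    {ω : (generated S).Elt → ℂ} (hω : (generated S).IsNormalFunctional ω)
    (h0 : ∀ s (hs : s ∈ S), ω ⟨s, subset_generated S hs⟩ = 0) (x : (generated S).Elt) :
    ω x = 0 := by
  classical
  obtain ⟨ξ, η, hξ, hη, h⟩ := hω
  have mem : ∀ f : ℕ → H, (Summable fun i => ‖f i‖ ^ 2) → Memℓp f 2 := fun f hf => by
    refine memℓp_gen ?_
    simpa using hf
  set ξ' : lp (fun _ : ℕ => H) 2 := ⟨ξ, mem ξ hξ⟩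
  set η' : lp (fun _ : ℕ => H) 2 := ⟨η, mem η hη⟩
  have hω' : ∀ x, ω x = ⟪ξ', ampl (x : H →L[ℂ] H) η'⟫_ℂ := fun x => by
    rw [h, lp.inner_eq_tsum]; rfl
  -- The functional becomes a single vector functional of the amplification to `ℓ²(ℕ, H)`. `W` is
  -- the cyclic subspace of `η'` under the semigroup `S`; the functional vanishes on `S`, which
  -- means that `ξ'` is orthogonal to `W`.
  set W := (Submodule.span ℂ ((fun s => ampl s η') '' S)).topologicalClosure with hW
  have hWc : IsClosed (W : Set (lp (fun _ : ℕ => H) 2)) := Submodule.isClosed_topologicalClosure _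
  have : CompleteSpace W := hWc.completeSpace_coe
  have hinv : ∀ s ∈ S, ∀ w ∈ W, ampl s w ∈ W := by
    intro s hs w hw
    have hle : W ≤ W.comap (ampl s : lp (fun _ : ℕ => H) 2 →ₗ[ℂ] lp (fun _ : ℕ => H) 2) := by
      refine Submodule.topologicalClosure_minimal _ (Submodule.span_le.2 ?_)
        (hWc.preimage (ampl s).continuous)
      rintro _ ⟨t, ht, rfl⟩
      exact Submodule.le_topologicalClosure _ (Submodule.subset_span ⟨s * t, hmul s hs t ht, rfl⟩)
    exact hle hw
  -- Since `W` reduces the amplified generators, its projection commutes with them, hence with the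
  -- amplification of `x`. So `x` cannot move `η'` out of `W`.
  have hcomm : W.starProjection * ampl (x : H →L[ℂ] H) = ampl (x : H →L[ℂ] H) * W.starProjection := by
    refine commute_of_amplification (S := S)
      (j := fun i => (lp.singleContinuousLinearMap ℂ (fun _ : ℕ => H) 2 i)) ?_ ?_ x.2 ?_ ?_
    · intro v hv
      ext i
      have := hv (lp.single 2 i (v i)) ⟨i, v i, rfl⟩
      rw [lp.inner_single_left] at this
      simpa using this
    · intro s hs
      refine ⟨ampl s, fun i w => ?_, fun i w => ?_, ?_, ?_⟩
      · ext k; simp [ampl_apply, lp.single_apply, Pi.single_apply]; split_ifs <;> simp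
      · rw [star_ampl]; ext k; simp [ampl_apply, lp.single_apply, Pi.single_apply]; split_ifs <;> simp
      · exact commute_starProjection (hinv s hs) (by rw [star_ampl]; exact hinv _ (hstar s hs))
      · exact commute_starProjection (by rw [star_ampl]; exact hinv _ (hstar s hs))
          (by rw [star_star]; exact hinv s hs)
    · intro i w; ext k; simp [ampl_apply, lp.single_apply, Pi.single_apply]; split_ifs <;> simp
    · intro i w
      rw [star_ampl]; ext k; simp [ampl_apply, lp.single_apply, Pi.single_apply]; split_ifs <;> simp
  have hη' : η' ∈ W := Submodule.le_topologicalClosure _ (Submodule.subset_span ⟨1, h1, by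
    ext i; rfl⟩)
  have hx : ampl (x : H →L[ℂ] H) η' ∈ W := by
    rw [← Submodule.starProjection_eq_self_iff] at hη' ⊢
    rw [← mul_apply_eq_comp, hcomm, mul_apply_eq_comp, hη']
  have hle : W ≤ (ℂ ∙ ξ')ᗮ := by
    refine Submodule.topologicalClosure_minimal _ (Submodule.span_le.2 ?_)
      (Submodule.isClosed_orthogonal _)
    rintro _ ⟨s, hs, rfl⟩
    rw [SetLike.mem_coe, Submodule.mem_orthogonal_singleton_iff_inner_right]
    exact (hω' ⟨s, subset_generated S hs⟩).symm.trans (h0 s hs)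
  rw [hω', ← Submodule.mem_orthogonal_singleton_iff_inner_right]
  exact hle hx

/-- Both sequences of vectors are interleaved along a bijection of `ℕ ⊕ ℕ` with `ℕ`, and the sign is
absorbed into the second one. -/
theorem IsNormalFunctional.sub {M : VonNeumannAlgebra H} {ω ω' : M.Elt → ℂ}
    (h : M.IsNormalFunctional ω) (h' : M.IsNormalFunctional ω') :
    M.IsNormalFunctional fun x => ω x - ω' x := by
  obtain ⟨ξ, η, hξ, hη, hω⟩ := h
  obtain ⟨ξ', η', hξ', hη', hω'⟩ := h'
  have hs : ∀ {a b : ℕ → H}, (Summable fun i => ‖a i‖ ^ 2) → (Summable fun i => ‖b i‖ ^ 2) →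
      ∀ x : H →L[ℂ] H, Summable fun i => ⟪a i, x (b i)⟫_ℂ := by
    intro a b ha hb x
    refine Summable.of_norm_bounded (g := fun i => ‖x‖ * (‖a i‖ ^ 2 + ‖b i‖ ^ 2))
      ((ha.add hb).mul_left _) fun i => ?_
    refine (norm_inner_le_norm _ _).trans ?_
    have := x.le_opNorm (b i)
    nlinarith [norm_nonneg (a i), norm_nonneg (b i), norm_nonneg x, sq_nonneg (‖a i‖ - ‖b i‖),
      mul_le_mul_of_nonneg_left this (norm_nonneg (a i)),
      mul_nonneg (norm_nonneg x) (sq_nonneg (‖a i‖ - ‖b i‖)),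
      mul_nonneg (norm_nonneg x) (sq_nonneg (‖a i‖)),
      mul_nonneg (norm_nonneg x) (sq_nonneg (‖b i‖))]
  set e := Equiv.natSumNatEquivNat
  have key : ∀ f g : ℕ → H, (Summable fun i => ‖f i‖ ^ 2) → (Summable fun i => ‖g i‖ ^ 2) →
      Summable fun i => ‖Sum.elim f g (e.symm i)‖ ^ 2 := by
    intro f g hf hg
    refine (Equiv.summable_iff e).1 ?_
    refine Summable.sum _ ?_ ?_
    · simpa [Function.comp_def] using hf
    · simpa [Function.comp_def] using hg
  refine ⟨fun i => Sum.elim ξ ξ' (e.symm i), fun i => Sum.elim η (fun k => - η' k) (e.symm i),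
    key _ _ hξ hξ', key _ _ hη (by simpa using hη'), fun x => ?_⟩
  change ω x - ω' x = _
  rw [hω, hω', ← e.tsum_eq (fun i => ⟪Sum.elim ξ ξ' (e.symm i),
    (x : H →L[ℂ] H) (Sum.elim η (fun k => - η' k) (e.symm i))⟫_ℂ)]
  simp only [Equiv.symm_apply_apply]
  have h1 := hs hξ hη (x : H →L[ℂ] H)
  have h2 := hs hξ' hη' (x : H →L[ℂ] H)
  rw [Summable.tsum_sum (f := fun i => ⟪Sum.elim ξ ξ' i,
    (x : H →L[ℂ] H) (Sum.elim η (fun k => - η' k) i)⟫_ℂ) h1 (by simpa [Function.comp_def] using h2.neg)]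
  simp [tsum_neg, sub_eq_add_neg]

theorem eq_of_inner_eq {M : VonNeumannAlgebra H} {x y : M.Elt}
    (h : ∀ v w, ⟪v, (x : H →L[ℂ] H) w⟫_ℂ = ⟪v, (y : H →L[ℂ] H) w⟫_ℂ) : x = y :=
  Subtype.ext (ContinuousLinearMap.ext fun w => ext_inner_left ℂ fun v => h v w)

/-- Each matrix coefficient of the difference of the two maps is a normal functional that vanishes
on the generating semigroup. -/
theorem normalMap_ext {S : Set (H →L[ℂ] H)} (h1 : 1 ∈ S)
    (hmul : ∀ s ∈ S, ∀ t ∈ S, s * t ∈ S) (hstar : ∀ s ∈ S, star s ∈ S)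
    {N : VonNeumannAlgebra K} {Φ Ψ : (generated S).Elt → N.Elt}
    (hΦ : IsNormalMap _ N Φ) (hΨ : IsNormalMap _ N Ψ)
    (h : ∀ s (hs : s ∈ S), Φ ⟨s, subset_generated S hs⟩ = Ψ ⟨s, subset_generated S hs⟩)
    (x : (generated S).Elt) : Φ x = Ψ x := by
  refine eq_of_inner_eq fun v w => sub_eq_zero.1 ?_
  have := IsNormalFunctional.eq_zero h1 hmul hstar
    ((hΦ _ (isNormalFunctional_inner v w)).sub (hΨ _ (isNormalFunctional_inner v w)))
    (fun s hs => by simp [h s hs]) x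
  exact this

/-- Conjugation by a unitary that maps `M` onto `N`. -/
def conjEquiv {M : VonNeumannAlgebra H} {N : VonNeumannAlgebra K} (W : H ≃ₗᵢ[ℂ] K)
    (h : ∀ x ∈ M.toStarSubalgebra, conjCLM W x ∈ N.toStarSubalgebra)
    (h' : ∀ y ∈ N.toStarSubalgebra, conjCLM W.symm y ∈ M.toStarSubalgebra) :
    M.Elt ≃⋆ₐ[ℂ] N.Elt where
  toFun x := ⟨conjCLM W x, h x x.2⟩
  invFun y := ⟨conjCLM W.symm y, h' y y.2⟩
  left_inv x := by ext; simp
  right_inv y := by ext; simp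
  map_mul' x y := Subtype.ext (conjCLM_mul W _ _)
  map_add' x y := by ext; simp
  map_star' x := Subtype.ext (conjCLM_star W _)
  map_smul' r x := by ext; simp

@[simp] theorem coe_conjEquiv {M : VonNeumannAlgebra H} {N : VonNeumannAlgebra K} (W : H ≃ₗᵢ[ℂ] K)
    (h : ∀ x ∈ M.toStarSubalgebra, conjCLM W x ∈ N.toStarSubalgebra)
    (h' : ∀ y ∈ N.toStarSubalgebra, conjCLM W.symm y ∈ M.toStarSubalgebra) (x : M.Elt) :
    (conjEquiv W h h' x : K →L[ℂ] K) = conjCLM W x := rfl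

theorem isNormalMap_of_conj {M : VonNeumannAlgebra H} {N : VonNeumannAlgebra K} (W : H ≃ₗᵢ[ℂ] K)
    {Φ : M.Elt → N.Elt} (h : ∀ x, (Φ x : K →L[ℂ] K) = conjCLM W x) : IsNormalMap M N Φ := by
  rintro ω ⟨ξ, η, hξ, hη, hω⟩
  refine ⟨fun i => W.symm (ξ i), fun i => W.symm (η i), by simpa using hξ, by simpa using hη,
    fun x => ?_⟩
  rw [Function.comp_apply, hω]
  exact tsum_congr fun i => by rw [h, inner_conjCLM]

theorem isIsomorphic_of_conj {M : VonNeumannAlgebra H} {N : VonNeumannAlgebra K} (W : H ≃ₗᵢ[ℂ] K)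
    (h : ∀ x ∈ M.toStarSubalgebra, conjCLM W x ∈ N.toStarSubalgebra)
    (h' : ∀ y ∈ N.toStarSubalgebra, conjCLM W.symm y ∈ M.toStarSubalgebra) :
    M.IsIsomorphic N :=
  ⟨conjEquiv W h h', isNormalMap_of_conj W fun _ => rfl, isNormalMap_of_conj W.symm fun _ => rfl⟩

theorem conjCLM_mem_of_generated {S : Set (H →L[ℂ] H)} {N : VonNeumannAlgebra K} (W : H ≃ₗᵢ[ℂ] K)
    (h : ∀ s ∈ S, conjCLM W s ∈ N.toStarSubalgebra) {x : H →L[ℂ] H}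
    (hx : x ∈ (generated S).toStarSubalgebra) : conjCLM W x ∈ N.toStarSubalgebra := by
  refine mem_iff_commute.2 fun T hT => ?_
  have := mem_generated_iff.1 hx (conjCLM W.symm T) fun s hs => by
    constructor
    · rw [← conjCLM_symm_conjCLM W s, ← conjCLM_mul, ← conjCLM_mul, hT _ (h s hs)]
    · rw [← conjCLM_symm_conjCLM W s, ← conjCLM_star, ← conjCLM_mul, ← conjCLM_mul,
        hT _ (star_mem (h s hs))]
  have := congrArg (conjCLM W) this
  rwa [conjCLM_mul, conjCLM_mul, conjCLM_conjCLM_symm] at this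

/-- If `y⋆ y = z⋆ z` in a von Neumann algebra, then `y = w z` for a contraction `w` in it. -/
theorem exists_contraction {N : VonNeumannAlgebra H} {y z : N.Elt} (h : star y * y = star z * z) :
    ∃ w : N.Elt, (∀ v, ‖(w : H →L[ℂ] H) v‖ ≤ ‖v‖) ∧ w * z = y := by
  set Y : H →L[ℂ] H := y.1 with hYdef
  set Z : H →L[ℂ] H := z.1 with hZdef
  have hYZ : star Y * Y = star Z * Z := congrArg Subtype.val h
  have hn : ∀ v, ‖Y v‖ = ‖Z v‖ := by
    intro v
    have := congrArg (fun T : H →L[ℂ] H => RCLike.re ⟪v, T v⟫_ℂ) hYZ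
    simp only [mul_apply_eq_comp, ContinuousLinearMap.star_eq_adjoint,
      ContinuousLinearMap.adjoint_inner_right, inner_self_eq_norm_sq] at this
    exact (sq_eq_sq₀ (norm_nonneg _) (norm_nonneg _)).1 this
  set R := (LinearMap.range (Z : H →ₗ[ℂ] H)).topologicalClosure with hR
  have hRc : IsClosed (R : Set H) := Submodule.isClosed_topologicalClosure _
  have : CompleteSpace R := hRc.completeSpace_coe
  have hZR : ∀ v, Z v ∈ R := fun v => Submodule.le_topologicalClosure _ ⟨v, rfl⟩
  set e : H →ₗ[ℂ] R := (Z : H →ₗ[ℂ] H).codRestrict R hZR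
  have he : DenseRange e := by
    intro r
    rw [Metric.mem_closure_iff]
    intro ε hε
    obtain ⟨_, ⟨v, rfl⟩, hv⟩ := Metric.mem_closure_iff.1 (show (r : H) ∈ closure _ from r.2) ε hε
    exact ⟨e v, ⟨v, rfl⟩, hv⟩
  -- Since `‖Y v‖ = ‖Z v‖`, the assignment `Z v ↦ Y v` is well defined and isometric. It is extended
  -- by continuity to the closure `R` of the range of `Z`, and below by `0` to the orthogonal
  -- complement.
  set w₀ : R →L[ℂ] H := (Y : H →ₗ[ℂ] H).extendOfNorm e
  have hw₀ : ∀ v, w₀ (e v) = Y v :=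
    LinearMap.extendOfNorm_eq he ⟨1, fun v => by rw [one_mul]; exact (hn v).le⟩
  have hw₀n : ∀ r, ‖w₀ r‖ ≤ 1 * ‖r‖ :=
    LinearMap.norm_extendOfNorm_apply_le he 1 fun v => by rw [one_mul]; exact (hn v).le
  set w : H →L[ℂ] H := w₀ ∘L R.orthogonalProjectionOnto
  have hwZ : ∀ v, w (Z v) = Y v := fun v => by
    rw [← hw₀ v]
    exact congrArg w₀ (Submodule.orthogonalProjectionOnto_mem_subspace_eq_self (e v))
  have hw0 : ∀ v ∈ Rᗮ, w v = 0 := fun v hv => by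
    simp only [w, ContinuousLinearMap.comp_apply]
    rw [(Submodule.orthogonalProjectionOnto_eq_zero_iff).2 hv, map_zero]
  have hwM : w ∈ N.toStarSubalgebra := by
    refine mem_iff_commute.2 fun T hT => ?_
    have hTZ : ∀ v, T (Z v) = Z (T v) := fun v =>
      (DFunLike.congr_fun (hT Z z.2) v).symm
    have hTY : ∀ v, T (Y v) = Y (T v) := fun v =>
      (DFunLike.congr_fun (hT Y y.2) v).symm
    have hT' : ∀ v, star T (Z v) = Z (star T v) := fun v => by
      have := congrArg star (hT _ (star_mem z.2))
      rw [star_mul, star_mul, star_star] at this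
      exact DFunLike.congr_fun this v
    ext v
    rw [mul_apply_eq_comp, mul_apply_eq_comp]
    have hv : v = R.starProjection v + (v - R.starProjection v) := by abel
    have hort := R.sub_starProjection_mem_orthogonal v
    -- An operator `T` in the commutant preserves `Rᗮ`, because `T⋆` commutes with `Z`. On `R` it
    -- commutes with `w`, because it commutes with both `Y` and `Z`. Together these put `w` into the
    -- bicommutant.
    have hTo : ∀ u ∈ Rᗮ, T u ∈ Rᗮ := by
      intro u hu
      have hle : R ≤ (ℂ ∙ T u)ᗮ := by
        refine Submodule.topologicalClosure_minimal _ ?_ (Submodule.isClosed_orthogonal _)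
        rintro _ ⟨a, rfl⟩
        rw [Submodule.mem_orthogonal_singleton_iff_inner_left]
        change ⟪Z a, T u⟫_ℂ = 0
        rw [← ContinuousLinearMap.adjoint_inner_left, ← ContinuousLinearMap.star_eq_adjoint, hT']
        exact hu _ (hZR _)
      intro r hr
      exact Submodule.mem_orthogonal_singleton_iff_inner_left.1 (hle hr)
    have hR' : ∀ r ∈ R, T (w r) = w (T r) := by
      have hcl : IsClosed {r : H | T (w r) = w (T r)} :=
        isClosed_eq (by fun_prop) (by fun_prop)
      intro r hr
      refine closure_minimal (s := (LinearMap.range (Z : H →ₗ[ℂ] H) : Set H)) ?_ hcl hr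
      rintro _ ⟨a, rfl⟩
      change T (w (Z a)) = w (T (Z a))
      rw [hwZ, hTZ, hwZ, hTY]
    rw [hv, map_add, map_add, map_add, map_add, hw0 _ hort, hw0 _ (hTo _ hort),
      hR' _ (R.starProjection_apply_mem v), map_zero]
  refine ⟨⟨w, hwM⟩, fun v => ?_, Subtype.ext (ContinuousLinearMap.ext hwZ)⟩
  refine (hw₀n _).trans ?_
  rw [one_mul]
  exact R.norm_orthogonalProjectionOnto_apply_le v

end VonNeumannAlgebra

/-! ### Actions implemented by unitary representations -/

section UnitaryAction

open VonNeumannAlgebra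

variable {H : Type u} [NormedAddCommGroup H] [InnerProductSpace ℂ H] [CompleteSpace H]
  {G : Type v} [Group G] [TopologicalSpace G] [IsTopologicalGroup G]

/-- The action `g ↦ Ad U_g` of a strongly continuous unitary representation normalizing `M`. -/
def VNAction.ofUnitary {M : VonNeumannAlgebra H} (U : G →* (H ≃ₗᵢ[ℂ] H))
    (hU : ∀ v, Continuous fun g => U g v)
    (hM : ∀ g, ∀ x ∈ M.toStarSubalgebra, conjCLM (U g) x ∈ M.toStarSubalgebra) : VNAction G M where
  aut g := conjEquiv (U g) (hM g) fun y hy => by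
    have := hM g⁻¹ y hy
    rwa [map_inv] at this
  aut_one x := by ext v; simp [map_one]; rfl
  aut_mul g h x := by ext v; simp; rfl
  normal g := isNormalMap_of_conj (U g) fun x => rfl
  continuous x ω hω := by
    obtain ⟨ξ, η, hξ, hη, h⟩ := hω
    simp only [h, coe_conjEquiv, inner_conjCLM]
    have hinv : ∀ g v, (U g).symm v = U g⁻¹ v := fun g v => by rw [map_inv]; rfl
    have hU' : ∀ v, Continuous fun g => (U g).symm v := fun v => by
      simp only [hinv]
      exact (hU v).comp continuous_inv
    -- The estimate `‖ξ i‖ ‖η i‖ ≤ ‖ξ i‖ ^ 2 + ‖η i‖ ^ 2` bounds the series uniformly in `g`.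
    refine continuous_tsum (u := fun i => ‖(x : H →L[ℂ] H)‖ * (‖ξ i‖ ^ 2 + ‖η i‖ ^ 2)) (fun i => ?_)
      ((hξ.add hη).mul_left _) fun i g => ?_
    · exact (hU' (ξ i)).inner ((x : H →L[ℂ] H).continuous.comp (hU' (η i)))
    · refine (norm_inner_le_norm _ _).trans ?_
      have := (x : H →L[ℂ] H).le_opNorm ((U g).symm (η i))
      rw [LinearIsometryEquiv.norm_map] at this ⊢
      nlinarith [norm_nonneg (ξ i), norm_nonneg (η i), norm_nonneg (x : H →L[ℂ] H),
        mul_le_mul_of_nonneg_left this (norm_nonneg (ξ i)),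
        mul_nonneg (norm_nonneg (x : H →L[ℂ] H)) (sq_nonneg (‖ξ i‖ - ‖η i‖)),
        mul_nonneg (norm_nonneg (x : H →L[ℂ] H)) (sq_nonneg (‖ξ i‖)),
        mul_nonneg (norm_nonneg (x : H →L[ℂ] H)) (sq_nonneg (‖η i‖))]

@[simp] theorem VNAction.coe_ofUnitary_aut {M : VonNeumannAlgebra H} (U : G →* (H ≃ₗᵢ[ℂ] H))
    (hU : ∀ v, Continuous fun g => U g v)
    (hM : ∀ g, ∀ x ∈ M.toStarSubalgebra, conjCLM (U g) x ∈ M.toStarSubalgebra) (g : G) (x : M.Elt) :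
    ((VNAction.ofUnitary U hU hM).aut g x : H →L[ℂ] H) = conjCLM (U g) x := rfl

end UnitaryAction

open VonNeumannAlgebra

/-! ### The left ideal of a weight and uniqueness of its GNS construction -/

section Weights

variable {H : Type u} [NormedAddCommGroup H] [InnerProductSpace ℂ H] [CompleteSpace H]
  {M : VonNeumannAlgebra H} {φ : M.Elt → ℝ≥0∞}

theorem VonNeumannAlgebra.isPos_of_inner {x : M.Elt} (h : star x = x)
    (h' : ∀ v, 0 ≤ (⟪v, (x : H →L[ℂ] H) v⟫_ℂ).re) : M.IsPos x := by
  refine ContinuousLinearMap.isPositive_def'.2 ⟨congrArg Subtype.val h, fun v => ?_⟩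
  rw [ContinuousLinearMap.reApplyInnerSelf_apply, inner_re_symm]
  exact h' v

theorem VonNeumannAlgebra.inner_star_mul_self (a : M.Elt) (v : H) :
    ⟪v, ((star a * a : M.Elt) : H →L[ℂ] H) v⟫_ℂ = (‖(a : H →L[ℂ] H) v‖ ^ 2 : ℝ) := by
  change ⟪v, ContinuousLinearMap.adjoint (a : H →L[ℂ] H) ((a : H →L[ℂ] H) v)⟫_ℂ = _
  rw [ContinuousLinearMap.adjoint_inner_right, inner_self_eq_norm_sq_to_K]
  simp

theorem VonNeumannAlgebra.isPos_star_mul_self (a : M.Elt) : M.IsPos (star a * a) := by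
  refine isPos_of_inner (by simp) fun v => ?_
  rw [inner_star_mul_self, Complex.ofReal_re]
  positivity

theorem VonNeumannAlgebra.IsPos.of_isStarProjection {q : M.Elt} (hq : IsStarProjection q) :
    M.IsPos q := by
  have := isPos_star_mul_self q
  rwa [hq.isSelfAdjoint.star_eq, hq.isIdempotentElem.eq] at this

namespace IsNSFWeight

theorem map_zero (hφ : IsNSFWeight M φ) : φ 0 = 0 := by
  have := hφ.smul 0 0 le_rfl ContinuousLinearMap.isPositive_zero
  simpa using this

theorem mono (hφ : IsNSFWeight M φ) {x y : M.Elt} (hx : M.IsPos x) (h : M.IsPos (y - x)) :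
    φ x ≤ φ y := by
  have := hφ.add x (y - x) hx h
  rw [add_sub_cancel] at this
  rw [this]
  exact le_self_add

/-- Monotonicity of the weight applied to `(x a)⋆ (x a) ≤ ‖x‖² a⋆ a`. -/
theorem mul_mem (hφ : IsNSFWeight M φ) (x : M.Elt) {a : M.Elt} (ha : a ∈ weightIdeal φ) :
    x * a ∈ weightIdeal φ := by
  set C := ‖(x : H →L[ℂ] H)‖ ^ 2 with hC
  have h : φ (star (x * a) * (x * a)) ≤ φ ((C : ℂ) • (star a * a)) := by
    refine hφ.mono (isPos_star_mul_self _) (isPos_of_inner (by simp) fun v => ?_)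
    have e : ((((C : ℂ) • (star a * a) - star (x * a) * (x * a) : M.Elt) : H →L[ℂ] H)) v =
      (C : ℂ) • ((star a * a : M.Elt) : H →L[ℂ] H) v -
        ((star (x * a) * (x * a) : M.Elt) : H →L[ℂ] H) v := rfl
    rw [e, inner_sub_right, inner_smul_right, inner_star_mul_self, inner_star_mul_self,
      ← Complex.ofReal_mul, ← Complex.ofReal_sub, Complex.ofReal_re, sub_nonneg, hC, ← mul_pow]
    gcongr
    exact (x : H →L[ℂ] H).le_opNorm _
  refine h.trans_lt ?_
  rw [hφ.smul C _ (by positivity) (isPos_star_mul_self a)]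
  exact ENNReal.mul_lt_top ENNReal.ofReal_lt_top ha

theorem smul_mem (hφ : IsNSFWeight M φ) (r : ℂ) {a : M.Elt} (ha : a ∈ weightIdeal φ) :
    r • a ∈ weightIdeal φ := by
  have := hφ.mul_mem (r • (1 : M.Elt)) ha
  rwa [smul_mul_assoc, one_mul] at this

/-- The parallelogram identity bounds `(a + b)⋆ (a + b)` by `2 a⋆ a + 2 b⋆ b`. -/
theorem add_mem (hφ : IsNSFWeight M φ) {a b : M.Elt} (ha : a ∈ weightIdeal φ)
    (hb : b ∈ weightIdeal φ) : a + b ∈ weightIdeal φ := by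
  have e : star (a + b) * (a + b) + star (a - b) * (a - b) =
      ((2 : ℝ) : ℂ) • (star a * a) + ((2 : ℝ) : ℂ) • (star b * b) := by
    simp only [star_add, star_sub, add_mul, mul_add, sub_mul, mul_sub, Complex.ofReal_ofNat,
      two_smul]
    abel
  have h2 : ∀ c : M.Elt, M.IsPos (((2 : ℝ) : ℂ) • (star c * c)) := fun c => by
    have : ((2 : ℝ) : ℂ) • (star c * c) = star c * c + star c * c := by simp [two_smul]
    rw [this]
    exact (isPos_star_mul_self c).add (isPos_star_mul_self c)
  have h := congrArg φ e
  rw [hφ.add _ _ (isPos_star_mul_self _) (isPos_star_mul_self _), hφ.add _ _ (h2 a) (h2 b),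
    hφ.smul 2 _ (by norm_num) (isPos_star_mul_self _),
    hφ.smul 2 _ (by norm_num) (isPos_star_mul_self _)] at h
  have hlt : φ (star (a + b) * (a + b)) + φ (star (a - b) * (a - b)) < ⊤ := by
    rw [h]
    exact ENNReal.add_lt_top.2 ⟨ENNReal.mul_lt_top ENNReal.ofReal_lt_top ha,
      ENNReal.mul_lt_top ENNReal.ofReal_lt_top hb⟩
  exact (ENNReal.add_lt_top.1 hlt).1

/-- The left ideal of a weight as a subspace. -/
def ideal (hφ : IsNSFWeight M φ) : Submodule ℂ M.Elt where
  carrier := weightIdeal φ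
  zero_mem' := by
    change φ (star 0 * 0) < ⊤
    rw [mul_zero, hφ.map_zero]
    exact ENNReal.zero_lt_top
  add_mem' := hφ.add_mem
  smul_mem' r _ ha := hφ.smul_mem r ha

/-- The operator inequality `y² ≤ ‖y‖ y` for positive `y` gives the finiteness. -/
theorem pos_mem (hφ : IsNSFWeight M φ) {y : M.Elt} (hy : M.IsPos y) (h : φ y < ⊤) :
    y ∈ weightIdeal φ := by
  set Y : H →L[ℂ] H := y.1 with hY
  have hYp : Y.IsPositive := hy
  have hstar : star y = y := Subtype.ext hYp.isSelfAdjoint.star_eq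
  have hle : φ (star y * y) ≤ φ ((‖Y‖ : ℂ) • y) := by
    refine hφ.mono (isPos_star_mul_self y) (isPos_of_inner ?_ fun v => ?_)
    · rw [star_sub, star_smul, star_mul, star_star, hstar]
      simp
    have e : ((((‖Y‖ : ℂ) • y - star y * y : M.Elt) : H →L[ℂ] H)) v =
      (‖Y‖ : ℂ) • Y v - ((star y * y : M.Elt) : H →L[ℂ] H) v := rfl
    rw [e, inner_sub_right, inner_smul_right, inner_star_mul_self, Complex.sub_re,
      Complex.ofReal_re, Complex.re_ofReal_mul]
    rcases eq_or_ne ‖Y‖ 0 with h0 | h0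
    · have : Y = 0 := norm_eq_zero.1 h0
      simp [← hY, this]
    have hpos : 0 < ‖Y‖ := lt_of_le_of_ne (norm_nonneg _) h0.symm
    set t : ℂ := ((‖Y‖⁻¹ : ℝ) : ℂ) with ht
    -- Positivity of `Y` is tested on `v - ‖Y‖⁻¹ Y v`. With `⟪Y v, Y (Y v)⟫ ≤ ‖Y‖ ‖Y v‖²` the
    -- expansion yields `‖Y v‖² ≤ ‖Y‖ ⟪v, Y v⟫`, without functional calculus.
    have key := hYp.re_inner_nonneg_right (v - t • Y v)
    have h1 : ⟪v, Y (Y v)⟫_ℂ = ((‖Y v‖ ^ 2 : ℝ) : ℂ) := by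
      rw [← hYp.inner_left_eq_inner_right, inner_self_eq_norm_sq_to_K]; simp
    have h2 : ⟪Y v, Y v⟫_ℂ = ((‖Y v‖ ^ 2 : ℝ) : ℂ) := by
      rw [inner_self_eq_norm_sq_to_K]; simp
    have h3 : (⟪Y v, Y (Y v)⟫_ℂ).re ≤ ‖Y‖ * ‖Y v‖ ^ 2 := by
      refine (Complex.re_le_norm _).trans ((norm_inner_le_norm _ _).trans ?_)
      nlinarith [Y.le_opNorm (Y v), norm_nonneg (Y v)]
    rw [map_sub, map_smul, inner_sub_left, inner_sub_right, inner_sub_right, inner_smul_right,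
      inner_smul_left, inner_smul_left, inner_smul_right, h1, h2, ht, Complex.conj_ofReal] at key
    simp only [← Complex.ofReal_mul, map_sub, RCLike.re_to_complex, Complex.ofReal_re,
      Complex.re_ofReal_mul] at key
    have h4 : ‖Y‖⁻¹ * (‖Y‖⁻¹ * (⟪Y v, Y (Y v)⟫_ℂ).re) ≤ ‖Y‖⁻¹ * ‖Y v‖ ^ 2 := by
      gcongr
      rw [inv_mul_le_iff₀ hpos]
      exact h3
    have h5 : ‖Y‖⁻¹ * ‖Y v‖ ^ 2 ≤ (⟪v, Y v⟫_ℂ).re := by linarith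
    rw [inv_mul_le_iff₀ hpos] at h5
    linarith
  refine hle.trans_lt ?_
  rw [hφ.smul _ _ (norm_nonneg _) hy]
  exact ENNReal.mul_lt_top ENNReal.ofReal_lt_top h

end IsNSFWeight

section GNS

variable {K : Type v} [NormedAddCommGroup K] [InnerProductSpace ℂ K] [CompleteSpace K]
  {ρ : M.Elt →⋆ₐ[ℂ] (K →L[ℂ] K)} {Λ : M.Elt → K}
  {K' : Type w} [NormedAddCommGroup K'] [InnerProductSpace ℂ K'] [CompleteSpace K']
  {ρ' : M.Elt →⋆ₐ[ℂ] (K' →L[ℂ] K')} {Λ' : M.Elt → K'}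

namespace IsGNS

/-- The GNS map as a linear map on the left ideal. -/
def lin (h : IsGNS φ ρ Λ) (S : Submodule ℂ M.Elt) (hS : (S : Set M.Elt) = weightIdeal φ) :
    S →ₗ[ℂ] K where
  toFun a := Λ a
  map_add' a b := h.map_add a b (hS ▸ a.2) (hS ▸ b.2)
  map_smul' r a := h.map_smul r a (hS ▸ a.2)

theorem denseRange_lin (h : IsGNS φ ρ Λ) (S : Submodule ℂ M.Elt)
    (hS : (S : Set M.Elt) = weightIdeal φ) : DenseRange (h.lin S hS) := by
  refine h.dense.mono ?_
  rintro _ ⟨a, ha, rfl⟩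
  exact ⟨⟨a, by rw [← SetLike.mem_coe, hS]; exact ha⟩, rfl⟩

theorem norm_eq (h : IsGNS φ ρ Λ) (h' : IsGNS φ ρ' Λ') {a : M.Elt} (ha : a ∈ weightIdeal φ) :
    ‖Λ' a‖ = ‖Λ a‖ := by
  have := (h.norm_sq a ha).symm.trans (h'.norm_sq a ha)
  rw [ENNReal.ofReal_eq_ofReal_iff (by positivity) (by positivity),
    sq_eq_sq₀ (norm_nonneg _) (norm_nonneg _)] at this
  exact this.symm

/-- Two GNS constructions of the same weight are unitarily equivalent. -/
theorem exists_unitary (h : IsGNS φ ρ Λ) (h' : IsGNS φ ρ' Λ') (S : Submodule ℂ M.Elt)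
    (hS : (S : Set M.Elt) = weightIdeal φ) (hmul : ∀ x, ∀ a ∈ weightIdeal φ, x * a ∈ weightIdeal φ) :
    ∃ W : K ≃ₗᵢ[ℂ] K', (∀ a ∈ weightIdeal φ, W (Λ a) = Λ' a) ∧ ∀ x, conjCLM W (ρ x) = ρ' x := by
  set W := (LinearEquiv.refl ℂ S).extendOfIsometry (h.lin S hS) (h'.lin S hS)
    (h.denseRange_lin S hS) (h'.denseRange_lin S hS)
    (fun a => h.norm_eq h' (hS ▸ a.2)) with hW
  have hWa : ∀ a ∈ weightIdeal φ, W (Λ a) = Λ' a := fun a ha =>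
    (LinearEquiv.refl ℂ S).extendOfIsometry_eq (h.lin S hS) (h'.lin S hS) _ _ _
      ⟨a, by rw [← SetLike.mem_coe, hS]; exact ha⟩
  refine ⟨W, hWa, fun x => h'.dense.totalSet.clm_ext ?_⟩
  rintro _ ⟨a, ha, rfl⟩
  rw [conjCLM_apply, ← hWa a ha, W.symm_apply_apply, ← h.map_mul x a ha, hWa _ (hmul x a ha),
    hWa a ha, h'.map_mul x a ha]

/-- Both sides are polarizations of the same quadratic form, because the weight of `a⋆ a` is `‖Λ
a‖²`. -/
theorem weightForm_eq (h : IsGNS φ ρ Λ)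
    (hadd : ∀ a ∈ weightIdeal φ, ∀ b ∈ weightIdeal φ, a + b ∈ weightIdeal φ)
    (hsmul : ∀ r : ℂ, ∀ a ∈ weightIdeal φ, r • a ∈ weightIdeal φ) {a b : M.Elt}
    (ha : a ∈ weightIdeal φ) (hb : b ∈ weightIdeal φ) : weightForm φ a b = ⟪Λ a, Λ b⟫_ℂ := by
  have hk : ∀ r : ℂ, (φ (star (a + r • b) * (a + r • b))).toReal = ‖Λ a + r • Λ b‖ ^ 2 := by
    intro r
    rw [h.norm_sq _ (hadd _ ha _ (hsmul r _ hb)), ENNReal.toReal_ofReal (by positivity),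
      h.map_add _ _ ha (hsmul r _ hb), h.map_smul r _ hb]
  simp only [weightForm, hk]
  rw [inner_eq_sum_norm_sq_div_four]
  simp only [Finset.sum_range_succ, Finset.sum_range_zero, pow_zero, one_smul,
    pow_succ, one_mul, Complex.I_mul_I, neg_smul, mul_neg, neg_mul, neg_neg, zero_add,
    ← sub_eq_add_neg]
  have hcast : ∀ r : ℝ, (RCLike.ofReal r : ℂ) = (r : ℂ) := fun r => rfl
  simp only [RCLike.I_to_complex, hcast]
  push_cast
  ring

end IsGNS

end GNS

end Weights

/-! ### Strong continuity from weak continuity -/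

section WeakStrong

variable {H : Type u} [NormedAddCommGroup H] [InnerProductSpace ℂ H] [CompleteSpace H]
  {G : Type v} [TopologicalSpace G]

/-- Matrix coefficients depend on their vectors uniformly in `g`, since the `U g` are isometric, so
weak continuity spreads from total sets to all vectors. It is already strong continuity, because `‖U
g v - U g₀ v‖²` is an expression in `‖v‖` and one matrix coefficient. -/
theorem continuous_of_weak_totalSet {U : G → (H ≃ₗᵢ[ℂ] H)} {s t : Set H} (hs : TotalSet s)
    (ht : TotalSet t) (h : ∀ w ∈ s, ∀ v ∈ t, Continuous fun g => ⟪w, U g v⟫_ℂ) (v : H) :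
    Continuous fun g => U g v := by
  have h1 : ∀ v ∈ t, ∀ w, Continuous fun g => ⟪w, U g v⟫_ℂ := by
    intro v hv w
    have hsp : ∀ w ∈ Submodule.span ℂ s, Continuous fun g => ⟪w, U g v⟫_ℂ := by
      intro w hw
      induction hw using Submodule.span_induction with
      | mem x hx => exact h x hx v hv
      | zero => simpa using continuous_const
      | add x y _ _ hx hy => simp only [inner_add_left]; exact hx.add hy
      | smul a x _ hx => simp only [inner_smul_left]; exact continuous_const.mul hx
    refine continuous_of_uniform_approx_of_continuous fun u hu => ?_
    obtain ⟨ε, hε, hεu⟩ := Metric.mem_uniformity_dist.1 hu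
    obtain ⟨w', hw', hd⟩ := hs.dense_span.exists_dist_lt w (ε := ε / (‖v‖ + 1)) (by positivity)
    refine ⟨_, hsp w' hw', fun g => hεu ?_⟩
    rw [dist_eq_norm, ← inner_sub_left]
    refine (norm_inner_le_norm _ _).trans_lt ?_
    rw [LinearIsometryEquiv.norm_map]
    rw [dist_eq_norm, lt_div_iff₀ (by positivity)] at hd
    nlinarith [norm_nonneg v, norm_nonneg (w - w')]
  have h2 : ∀ v w, Continuous fun g => ⟪w, U g v⟫_ℂ := by
    intro v w
    have hsp : ∀ v ∈ Submodule.span ℂ t, Continuous fun g => ⟪w, U g v⟫_ℂ := by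
      intro v hv
      induction hv using Submodule.span_induction with
      | mem x hx => exact h1 x hx w
      | zero => simpa using continuous_const
      | add x y _ _ hx hy => simp only [map_add, inner_add_right]; exact hx.add hy
      | smul a x _ hx => simp only [map_smul, inner_smul_right]; exact continuous_const.mul hx
    refine continuous_of_uniform_approx_of_continuous fun u hu => ?_
    obtain ⟨ε, hε, hεu⟩ := Metric.mem_uniformity_dist.1 hu
    obtain ⟨v', hv', hd⟩ := ht.dense_span.exists_dist_lt v (ε := ε / (‖w‖ + 1)) (by positivity)
    refine ⟨_, hsp v' hv', fun g => hεu ?_⟩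
    rw [dist_eq_norm, ← inner_sub_right, ← map_sub]
    refine (norm_inner_le_norm _ _).trans_lt ?_
    rw [LinearIsometryEquiv.norm_map]
    rw [dist_eq_norm, lt_div_iff₀ (by positivity)] at hd
    nlinarith [norm_nonneg w, norm_nonneg (v - v')]
  refine continuous_iff_continuousAt.2 fun g₀ => tendsto_iff_norm_sub_tendsto_zero.2 ?_
  have hn : ∀ g, ‖U g v - U g₀ v‖ = √(‖v‖ ^ 2 - 2 * RCLike.re ⟪U g₀ v, U g v⟫_ℂ + ‖v‖ ^ 2) := by
    intro g
    have := norm_sub_sq (𝕜 := ℂ) (U g v) (U g₀ v)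
    rw [LinearIsometryEquiv.norm_map, LinearIsometryEquiv.norm_map, inner_re_symm] at this
    rw [← this, Real.sqrt_sq (norm_nonneg _)]
  have hc : Continuous fun g => ‖U g v - U g₀ v‖ := by
    simp only [hn]
    have := h2 v (U g₀ v)
    fun_prop
  have := hc.tendsto g₀
  rwa [sub_self, norm_zero] at this

end WeakStrong

/-! ### Right bounded vectors of a weight and implementation of actions -/

section Standard

variable {H : Type u} [NormedAddCommGroup H] [InnerProductSpace ℂ H] [CompleteSpace H]
  {M : VonNeumannAlgebra H} {φ : M.Elt → ℝ≥0∞} {Λ : M.Elt → H}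

/-- `η` is a right bounded vector of `φ` with right multiplication operator `R`. -/
def WeightRightBounded (φ : M.Elt → ℝ≥0∞) (Λ : M.Elt → H) (η : H) (R : H →L[ℂ] H) : Prop :=
  ∀ a ∈ weightIdeal φ, R (Λ a) = (a : H →L[ℂ] H) η

theorem WeightRightBounded.left_mul {η : H} {R : H →L[ℂ] H} (h : WeightRightBounded φ Λ η R)
    {T : H →L[ℂ] H} (hT : ∀ y ∈ M.toStarSubalgebra, y * T = T * y) :
    WeightRightBounded φ Λ (T η) (T * R) := fun a ha => by
  rw [mul_apply_eq_comp, h a ha, ← mul_apply_eq_comp, ← hT _ a.2, mul_apply_eq_comp]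

/-- Normality writes `φ` as a sum of vector functionals. Each summand is dominated by `φ`, so `Λ(a)
↦ a ζ` is a contraction and its vector `ζ` is right bounded. -/
theorem IsNSFWeight.exists_rightBounded (hφ : IsNSFWeight M φ)
    (hΛ : IsGNS φ M.toStarSubalgebra.subtype Λ) :
    ∃ (ι : Type) (ζ : ι → H) (R : ι → H →L[ℂ] H), (∀ i, WeightRightBounded φ Λ (ζ i) (R i)) ∧
      ∀ x, M.IsPos x → φ x = ∑' i, ENNReal.ofReal (⟪ζ i, (x : H →L[ℂ] H) (ζ i)⟫_ℂ).re := by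
  obtain ⟨ι, ζ, hζ⟩ := hφ.normal
  set e := hΛ.lin hφ.ideal rfl
  set f : ι → hφ.ideal →ₗ[ℂ] H := fun i =>
    { toFun := fun a => ((a : M.Elt) : H →L[ℂ] H) (ζ i)
      map_add' := fun a b => rfl
      map_smul' := fun r a => rfl }
  have hb : ∀ i (a : hφ.ideal), ‖f i a‖ ≤ 1 * ‖e a‖ := by
    intro i a
    have h1 := hζ _ (isPos_star_mul_self (a : M.Elt))
    rw [hΛ.norm_sq a a.2] at h1
    have h2 := ENNReal.le_tsum (f := fun i =>
      ENNReal.ofReal (⟪ζ i, ((star (a : M.Elt) * a : M.Elt) : H →L[ℂ] H) (ζ i)⟫_ℂ).re) i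
    rw [← h1, inner_star_mul_self, Complex.ofReal_re, ENNReal.ofReal_le_ofReal_iff (by positivity)]
      at h2
    rw [one_mul]
    exact (sq_le_sq₀ (norm_nonneg _) (norm_nonneg _)).1 h2
  refine ⟨ι, ζ, fun i => (f i).extendOfNorm e, fun i a ha => ?_, hζ⟩
  exact LinearMap.extendOfNorm_eq (hΛ.denseRange_lin _ rfl) ⟨1, hb i⟩ ⟨a, ha⟩

/-- For the right bounded vectors of the decomposition of `φ`, `∑ ‖R i w‖²` equals `‖w‖²` on the
vectors `Λ(a)` and has all its finite partial sums bounded by `‖w‖²` everywhere. If all `R i` kill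
`v`, this gives `‖Λ a‖ ≤ ‖Λ a - v‖`, and letting `Λ a` tend to `v` forces `v = 0`. -/
theorem IsNSFWeight.eq_zero_of_rightBounded (hφ : IsNSFWeight M φ)
    (hΛ : IsGNS φ M.toStarSubalgebra.subtype Λ) {v : H}
    (hv : ∀ η R, WeightRightBounded φ Λ η R → R v = 0) : v = 0 := by
  obtain ⟨ι, ζ, R, hR, hζ⟩ := hφ.exists_rightBounded hΛ
  have hsum : ∀ a ∈ weightIdeal φ, ENNReal.ofReal (‖Λ a‖ ^ 2) =
      ∑' i, ENNReal.ofReal (‖R i (Λ a)‖ ^ 2) := by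
    intro a ha
    rw [← hΛ.norm_sq a ha, hζ _ (isPos_star_mul_self a)]
    refine tsum_congr fun i => ?_
    rw [inner_star_mul_self, Complex.ofReal_re, hR i a ha]
  have hfin : ∀ (F : Finset ι) (w : H), ∑ i ∈ F, ‖R i w‖ ^ 2 ≤ ‖w‖ ^ 2 := by
    intro F w
    refine hΛ.dense.induction (P := fun w => ∑ i ∈ F, ‖R i w‖ ^ 2 ≤ ‖w‖ ^ 2) ?_
      (isClosed_le (by fun_prop) (by fun_prop)) w
    rintro _ ⟨a, ha, rfl⟩
    have := ENNReal.sum_le_tsum (f := fun i => ENNReal.ofReal (‖R i (Λ a)‖ ^ 2)) F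
    rw [← hsum a ha, ← ENNReal.ofReal_sum_of_nonneg fun i _ => by positivity] at this
    exact (ENNReal.ofReal_le_ofReal_iff (by positivity)).1 this
  have hle : ∀ a ∈ weightIdeal φ, ‖Λ a‖ ≤ ‖Λ a - v‖ := by
    intro a ha
    have h : ENNReal.ofReal (‖Λ a‖ ^ 2) ≤ ENNReal.ofReal (‖Λ a - v‖ ^ 2) := by
      rw [hsum a ha, ENNReal.tsum_eq_iSup_sum]
      refine iSup_le fun F => ?_
      rw [← ENNReal.ofReal_sum_of_nonneg fun i _ => by positivity]
      refine ENNReal.ofReal_le_ofReal ?_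
      convert hfin F (Λ a - v) using 4 with i
      rw [map_sub, hv _ _ (hR i), sub_zero]
    exact (sq_le_sq₀ (norm_nonneg _) (norm_nonneg _)).1
      ((ENNReal.ofReal_le_ofReal_iff (by positivity)).1 h)
  have hd := hΛ.dense.induction (P := fun w => ‖w‖ ≤ ‖w - v‖)
    (by rintro _ ⟨a, ha, rfl⟩; exact hle a ha) (isClosed_le (by fun_prop) (by fun_prop)) v
  simpa using hd

/-- The closed span of the right bounded vectors is invariant under the commutant, so its projection
`p` lies in `M`. It contains the vectors that define `φ`, so `φ` vanishes on `1 - p` and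
faithfulness gives `p = 1`. -/
theorem IsNSFWeight.totalSet_rightBounded (hφ : IsNSFWeight M φ)
    (hΛ : IsGNS φ M.toStarSubalgebra.subtype Λ) :
    TotalSet {η | ∃ R, WeightRightBounded φ Λ η R} := by
  obtain ⟨ι, ζ, R, hR, hζ⟩ := hφ.exists_rightBounded hΛ
  set W := (Submodule.span ℂ {η | ∃ R, WeightRightBounded φ Λ η R}).topologicalClosure with hW
  have hWc : IsClosed (W : Set H) := Submodule.isClosed_topologicalClosure _
  have : CompleteSpace W := hWc.completeSpace_coe
  have hsub : ∀ η R, WeightRightBounded φ Λ η R → η ∈ W := fun η R h =>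
    Submodule.le_topologicalClosure _ (Submodule.subset_span ⟨R, h⟩)
  have hp : W.starProjection ∈ M.toStarSubalgebra := by
    refine starProjection_mem fun T hT => ?_
    have hle : W ≤ W.comap (T : H →ₗ[ℂ] H) := by
      refine Submodule.topologicalClosure_minimal _ (Submodule.span_le.2 ?_)
        (hWc.preimage T.continuous)
      rintro η ⟨R, h⟩
      exact hsub _ _ (h.left_mul hT)
    exact fun w hw => hle hw
  set p : M.Elt := ⟨W.starProjection, hp⟩
  have hp0 : star (1 - p) * (1 - p) = 0 := by
    refine hφ.faithful _ (isPos_star_mul_self _) ?_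
    rw [hζ _ (isPos_star_mul_self _), ENNReal.tsum_eq_zero]
    intro i
    rw [inner_star_mul_self]
    have : ((1 - p : M.Elt) : H →L[ℂ] H) (ζ i) = ζ i - W.starProjection (ζ i) := rfl
    rw [this, Submodule.starProjection_eq_self_iff.2 (hsub _ _ (hR i))]
    simp
  intro v hv
  have hvW : v ∈ Wᗮ := by
    rw [hW, Submodule.orthogonal_closure]
    intro w hw
    induction hw using Submodule.span_induction with
    | mem x hx => exact hv x hx
    | zero => simp
    | add x y _ _ hx hy => rw [inner_add_left, hx, hy, add_zero]
    | smul a x _ hx => rw [inner_smul_left, hx, mul_zero]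
  have h := inner_star_mul_self (1 - p) v
  have e : ((1 - p : M.Elt) : H →L[ℂ] H) v = v - W.starProjection v := rfl
  rw [hp0, e, (Submodule.starProjection_apply_eq_zero_iff W).2 hvW, sub_zero] at h
  have h' : (0 : ℂ) = ((‖v‖ ^ 2 : ℝ) : ℂ) := by simpa using h
  rw [eq_comm, Complex.ofReal_eq_zero] at h'
  simpa using h'

/-- The vectors `Λ(a)` with `a` and `a⋆` in the left ideal are total. -/
theorem IsNSFWeight.totalSet_selfadjoint (hφ : IsNSFWeight M φ)
    (hΛ : IsGNS φ M.toStarSubalgebra.subtype Λ) :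
    TotalSet {v | ∃ a ∈ weightIdeal φ, star a ∈ weightIdeal φ ∧ v = Λ a} := by
  -- `Z` is the common kernel of the positive elements of finite weight. Its projection is central
  -- by semifiniteness and kills every `Λ(a)`, so `Z` is trivial.
  set Z : Submodule ℂ H := ⨅ y : {y : M.Elt // M.IsPos y ∧ φ y < ⊤},
    LinearMap.ker ((y.1.1 : H →L[ℂ] H) : H →ₗ[ℂ] H) with hZ
  have hmem : ∀ v, v ∈ Z ↔ ∀ y : M.Elt, M.IsPos y → φ y < ⊤ → (y : H →L[ℂ] H) v = 0 := by
    intro v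
    rw [hZ, Submodule.mem_iInf]
    exact ⟨fun h y h1 h2 => h ⟨y, h1, h2⟩, fun h y => h y.1 y.2.1 y.2.2⟩
  have hZc : IsClosed (Z : Set H) := by
    have : (Z : Set H) = ⋂ y : {y : M.Elt // M.IsPos y ∧ φ y < ⊤},
        {v | ((y : M.Elt) : H →L[ℂ] H) v = 0} := by
      ext v
      rw [SetLike.mem_coe, hmem, Set.mem_iInter]
      exact ⟨fun h y => h y.1 y.2.1 y.2.2, fun h y h1 h2 => h ⟨y, h1, h2⟩⟩
    rw [this]
    exact isClosed_iInter fun y => isClosed_eq (by fun_prop) continuous_const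
  have : CompleteSpace Z := hZc.completeSpace_coe
  have hp : Z.starProjection ∈ M.toStarSubalgebra := by
    refine starProjection_mem fun T hT w hw => (hmem _).2 fun y h1 h2 => ?_
    rw [← mul_apply_eq_comp, hT y y.2, mul_apply_eq_comp, (hmem w).1 hw y h1 h2, ContinuousLinearMap.map_zero]
  set p : M.Elt := ⟨Z.starProjection, hp⟩
  have hpc : ∀ x : M.Elt, x * p = p * x := by
    intro x
    have hx : (x : H →L[ℂ] H) ∈ (generated {x : H →L[ℂ] H | ∃ y : M.Elt, M.IsPos y ∧ φ y < ⊤ ∧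
        (y : H →L[ℂ] H) = x}).toStarSubalgebra := by rw [hφ.semifinite]; exact x.2
    refine Subtype.ext (mem_generated_iff.1 hx Z.starProjection ?_).symm
    rintro _ ⟨y, hy1, hy2, rfl⟩
    have hs : star (y : H →L[ℂ] H) = y := ContinuousLinearMap.IsPositive.isSelfAdjoint hy1
    have hyp : ∀ w ∈ Z, (y : H →L[ℂ] H) w ∈ Z := fun w hw => by
      rw [(hmem w).1 hw y hy1 hy2]; exact Z.zero_mem
    have := commute_starProjection hyp (by rwa [hs])
    rw [hs]
    exact ⟨this, this⟩
  have hpΛ : ∀ a ∈ weightIdeal φ, (p : H →L[ℂ] H) (Λ a) = 0 := by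
    intro a ha
    have h1 := hΛ.map_mul p a ha
    have h2 : p * a = 0 := by
      rw [← hpc]
      ext v
      change (a : H →L[ℂ] H) (Z.starProjection v) = 0
      have h3 := (hmem _).1 (Z.starProjection_apply_mem v) (star a * a) (isPos_star_mul_self a) ha
      have h4 := inner_star_mul_self a (Z.starProjection v)
      rw [h3, inner_zero_right, eq_comm, Complex.ofReal_eq_zero] at h4
      simpa using h4
    have h0 : Λ 0 = 0 := by
      have := hΛ.map_smul 0 a ha
      simpa using this
    rw [h2, h0] at h1
    exact h1.symm
  have hp0 : Z.starProjection = 0 := by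
    refine hΛ.dense.totalSet.clm_ext ?_
    rintro _ ⟨a, ha, rfl⟩
    exact hpΛ a ha
  intro v hv
  -- If `y` is positive of finite weight and `a` is in the left ideal, then both `y a` and `(y a)⋆ =
  -- a⋆ y` are in the left ideal. Hence `v` is orthogonal to every `Λ(y a) = y Λ(a)`, that is, `y v
  -- = 0`.
  have hvZ : v ∈ Z := by
    refine (hmem v).2 fun y hy1 hy2 => hΛ.dense.totalSet _ ?_
    rintro _ ⟨a, ha, rfl⟩
    have hs : star y = y :=
      Subtype.ext (ContinuousLinearMap.IsPositive.isSelfAdjoint hy1).star_eq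
    rw [← ContinuousLinearMap.IsPositive.inner_left_eq_inner_right hy1]
    have h1 := hΛ.map_mul y a ha
    change Λ (y * a) = (y : H →L[ℂ] H) (Λ a) at h1
    rw [← h1]
    refine hv _ ⟨y * a, hφ.mul_mem y ha, ?_, rfl⟩
    rw [star_mul, hs]
    exact hφ.mul_mem _ (hφ.pos_mem hy1 hy2)
  have := Submodule.starProjection_eq_self_iff.2 hvZ
  rw [hp0] at this
  exact this.symm

variable {G : Type v} [Group G] [TopologicalSpace G]

section Implement

variable (hφ : IsNSFWeight M φ) (hΛ : IsGNS φ M.toStarSubalgebra.subtype Λ)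
  (β : VNAction G M) {c : G → ℝ} (hc : ∀ g, 0 < c g)
  (hφβ : ∀ g x, M.IsPos x → φ (β.aut g x) = ENNReal.ofReal (c g) * φ x)

theorem VNAction.star_mul_aut (g : G) (a : M.Elt) :
    star (β.aut g a) * β.aut g a = β.aut g (star a * a) := by
  rw [map_mul, map_star]

theorem VNAction.aut_inv_aut (g : G) (a : M.Elt) : β.aut g⁻¹ (β.aut g a) = a := by
  rw [← β.aut_mul, inv_mul_cancel, β.aut_one]

theorem VNAction.aut_aut_inv (g : G) (a : M.Elt) : β.aut g (β.aut g⁻¹ a) = a := by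
  rw [← β.aut_mul, mul_inv_cancel, β.aut_one]

include hφβ in
theorem VNAction.aut_mem_weightIdeal (g : G) {a : M.Elt} (ha : a ∈ weightIdeal φ) :
    β.aut g a ∈ weightIdeal φ := by
  change φ _ < ⊤
  rw [β.star_mul_aut, hφβ g _ (isPos_star_mul_self a)]
  exact ENNReal.mul_lt_top ENNReal.ofReal_lt_top ha

/-- The restriction of an automorphism to the left ideal of a weight. -/
def VNAction.idealEquiv (g : G) : hφ.ideal ≃ₗ[ℂ] hφ.ideal where
  toFun a := ⟨β.aut g a, β.aut_mem_weightIdeal hφβ g a.2⟩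
  invFun a := ⟨β.aut g⁻¹ a, β.aut_mem_weightIdeal hφβ g⁻¹ a.2⟩
  map_add' _ _ := Subtype.ext (map_add (β.aut g) _ _)
  map_smul' r _ := Subtype.ext (map_smul (β.aut g) r _)
  left_inv a := Subtype.ext (β.aut_inv_aut g a)
  right_inv a := Subtype.ext (β.aut_aut_inv g a)

include hΛ hφβ hc in
theorem VNAction.norm_gns_aut (g : G) {a : M.Elt} (ha : a ∈ weightIdeal φ) :
    ‖Λ (β.aut g a)‖ = √(c g) * ‖Λ a‖ := by
  have h1 := hΛ.norm_sq _ (β.aut_mem_weightIdeal hφβ g ha)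
  rw [β.star_mul_aut, hφβ g _ (isPos_star_mul_self a), hΛ.norm_sq _ ha,
    ← ENNReal.ofReal_mul (hc g).le,
    ENNReal.ofReal_eq_ofReal_iff (mul_nonneg (hc g).le (sq_nonneg _)) (sq_nonneg _)] at h1
  rw [← Real.sqrt_sq (norm_nonneg (Λ (β.aut g a))), ← h1, Real.sqrt_mul (hc g).le,
    Real.sqrt_sq (norm_nonneg _)]

/-- The unitary implementing an automorphism that scales the weight. -/
def VNAction.implement (g : G) : H ≃ₗᵢ[ℂ] H :=
  (β.idealEquiv hφ hφβ g).extendOfIsometry (hΛ.lin hφ.ideal rfl)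
    ((((√(c g))⁻¹ : ℝ) : ℂ) • hΛ.lin hφ.ideal rfl) (hΛ.denseRange_lin _ rfl)
    (by
      have h : DenseRange ((fun v : H => (((√(c g))⁻¹ : ℝ) : ℂ) • v) ∘ hΛ.lin hφ.ideal rfl) := by
        refine DenseRange.comp (Function.Surjective.denseRange fun v =>
          ⟨((√(c g) : ℝ) : ℂ) • v, ?_⟩) (hΛ.denseRange_lin _ rfl) (continuous_const_smul _)
        have := (Real.sqrt_pos.2 (hc g)).ne'
        rw [smul_smul, ← Complex.ofReal_mul, inv_mul_cancel₀ this, Complex.ofReal_one, one_smul]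
      exact h)
    (fun a => by
      have := (Real.sqrt_pos.2 (hc g)).ne'
      change ‖(((√(c g))⁻¹ : ℝ) : ℂ) • Λ (β.aut g a)‖ = ‖Λ a‖
      rw [norm_smul, β.norm_gns_aut hΛ hc hφβ g a.2, Complex.norm_real, Real.norm_eq_abs,
        abs_of_nonneg (by positivity), inv_mul_cancel_left₀ this])

theorem VNAction.implement_gns (g : G) {a : M.Elt} (ha : a ∈ weightIdeal φ) :
    β.implement hφ hΛ hc hφβ g (Λ a) = (((√(c g))⁻¹ : ℝ) : ℂ) • Λ (β.aut g a) :=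
  (β.idealEquiv hφ hφβ g).extendOfIsometry_eq (hΛ.lin hφ.ideal rfl)
    ((((√(c g))⁻¹ : ℝ) : ℂ) • hΛ.lin hφ.ideal rfl) _ _ _ ⟨a, ha⟩

theorem VNAction.conjCLM_implement (g : G) (x : M.Elt) :
    conjCLM (β.implement hφ hΛ hc hφβ g) (x : H →L[ℂ] H) = β.aut g x := by
  set U := β.implement hφ hΛ hc hφβ g with hU
  have key : ∀ v, U ((x : H →L[ℂ] H) v) = (β.aut g x : H →L[ℂ] H) (U v) := by
    have : (U : H →L[ℂ] H) ∘L (x : H →L[ℂ] H) = (β.aut g x : H →L[ℂ] H) ∘L (U : H →L[ℂ] H) := by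
      refine hΛ.dense.totalSet.clm_ext ?_
      rintro _ ⟨a, ha, rfl⟩
      change U ((x : H →L[ℂ] H) (Λ a)) = (β.aut g x : H →L[ℂ] H) (U (Λ a))
      have h1 : Λ (x * a) = (x : H →L[ℂ] H) (Λ a) := hΛ.map_mul x a ha
      have h2 : Λ (β.aut g x * β.aut g a) = (β.aut g x : H →L[ℂ] H) (Λ (β.aut g a)) :=
        hΛ.map_mul _ _ (β.aut_mem_weightIdeal hφβ g ha)
      rw [← h1, hU, β.implement_gns hφ hΛ hc hφβ g (hφ.mul_mem x ha),
        β.implement_gns hφ hΛ hc hφβ g ha, map_smul, ← h2, map_mul]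
    exact fun v => DFunLike.congr_fun this v
  ext v
  rw [conjCLM_apply, key, U.apply_symm_apply]

/-- The unitary representation implementing an action that scales the weight. -/
def VNAction.implementHom (hcm : ∀ g h, c (g * h) = c g * c h) : G →* (H ≃ₗᵢ[ℂ] H) where
  toFun := β.implement hφ hΛ hc hφβ
  map_one' := by
    have h1 : c 1 = 1 := by
      have := hcm 1 1
      rw [mul_one] at this
      nlinarith [hc 1]
    refine LinearIsometryEquiv.ext fun v => ?_
    refine DFunLike.congr_fun (f := ((β.implement hφ hΛ hc hφβ 1 : H ≃ₗᵢ[ℂ] H) : H →L[ℂ] H))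
      (g := ContinuousLinearMap.id ℂ H) (hΛ.dense.totalSet.clm_ext ?_) v
    rintro _ ⟨a, ha, rfl⟩
    change β.implement hφ hΛ hc hφβ 1 (Λ a) = Λ a
    rw [β.implement_gns hφ hΛ hc hφβ 1 ha, β.aut_one, h1]
    simp
  map_mul' g h := by
    refine LinearIsometryEquiv.ext fun v => ?_
    refine DFunLike.congr_fun (f := ((β.implement hφ hΛ hc hφβ (g * h) : H ≃ₗᵢ[ℂ] H) : H →L[ℂ] H))
      (g := ((β.implement hφ hΛ hc hφβ g : H ≃ₗᵢ[ℂ] H) : H →L[ℂ] H) ∘L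
        ((β.implement hφ hΛ hc hφβ h : H ≃ₗᵢ[ℂ] H) : H →L[ℂ] H)) (hΛ.dense.totalSet.clm_ext ?_) v
    rintro _ ⟨a, ha, rfl⟩
    change β.implement hφ hΛ hc hφβ (g * h) (Λ a) =
      β.implement hφ hΛ hc hφβ g (β.implement hφ hΛ hc hφβ h (Λ a))
    rw [β.implement_gns hφ hΛ hc hφβ _ ha, β.implement_gns hφ hΛ hc hφβ _ ha, map_smul,
      β.implement_gns hφ hΛ hc hφβ _ (β.aut_mem_weightIdeal hφβ h ha), β.aut_mul, smul_smul, hcm,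
      Real.sqrt_mul (hc g).le]
    congr 1
    push_cast
    rw [mul_inv, mul_comm]

/-- The vectors `R⋆ u`, with `R` the right multiplication operator of a right bounded `η`, are
total. Their matrix coefficients with `Λ(a)` equal `c(g)^(-1/2) ⟪u, β_g(a) η⟫`, so strong continuity
of `g ↦ β_g(a)` suffices; no continuity of `g ↦ Λ(β_g(a))` is presupposed. -/
theorem VNAction.continuous_implement (hcc : Continuous c) (v : H) :
    Continuous fun g => β.implement hφ hΛ hc hφβ g v := by
  refine continuous_of_weak_totalSet
    (s := {w | ∃ η R u, WeightRightBounded φ Λ η R ∧ w = ContinuousLinearMap.adjoint R u})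
    (t := Λ '' weightIdeal φ) ?_ hΛ.dense.totalSet ?_ v
  · intro v hv
    refine hφ.eq_zero_of_rightBounded hΛ fun η R hR => ?_
    refine ext_inner_left ℂ fun u => ?_
    rw [← ContinuousLinearMap.adjoint_inner_left, hv _ ⟨η, R, u, hR, rfl⟩, inner_zero_right]
  · rintro _ ⟨η, R, u, hR, rfl⟩ _ ⟨a, ha, rfl⟩
    have : ∀ g, ⟪ContinuousLinearMap.adjoint R u, β.implement hφ hΛ hc hφβ g (Λ a)⟫_ℂ =
        (((√(c g))⁻¹ : ℝ) : ℂ) * ⟪u, (β.aut g a : H →L[ℂ] H) η⟫_ℂ := fun g => by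
      rw [ContinuousLinearMap.adjoint_inner_left, β.implement_gns hφ hΛ hc hφβ _ ha, map_smul,
        hR _ (β.aut_mem_weightIdeal hφβ g ha), inner_smul_right]
    simp only [this]
    have h1 := β.continuous_aut_apply a η
    have h2 : Continuous fun g => (√(c g))⁻¹ :=
      (Real.continuous_sqrt.comp hcc).inv₀ fun g => (Real.sqrt_pos.2 (hc g)).ne'
    fun_prop

end Implement

end Standard

/-! ### One-parameter unitary groups, Gaussian smearing and the smeared KMS condition -/

section Flow

open scoped ComplexConjugate

variable {K : Type u} [NormedAddCommGroup K] [InnerProductSpace ℂ K] [CompleteSpace K]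

/-- A strongly continuous one-parameter unitary group. -/
structure UnitaryFlow (K : Type u) [NormedAddCommGroup K] [InnerProductSpace ℂ K] where
  /-- The unitary at time `t`. -/
  toFun : ℝ → (K ≃ₗᵢ[ℂ] K)
  map_zero' : ∀ v, toFun 0 v = v
  map_add' : ∀ s t v, toFun (s + t) v = toFun s (toFun t v)
  continuous' : ∀ v, Continuous fun t => toFun t v

instance : CoeFun (UnitaryFlow K) (fun _ => ℝ → (K ≃ₗᵢ[ℂ] K)) := ⟨UnitaryFlow.toFun⟩

/-- The normalized Gaussian `π ^ (-1/2) exp (-z ^ 2)`. -/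
def gaussKer (z : ℂ) : ℂ := ((√Real.pi)⁻¹ : ℝ) * Complex.exp (-z ^ 2)

theorem gaussKer_neg (z : ℂ) : gaussKer (-z) = gaussKer z := by simp [gaussKer]

theorem gaussKer_conj (z : ℂ) : gaussKer (conj z) = conj (gaussKer z) := by
  simp [gaussKer, ← Complex.exp_conj]

theorem differentiable_gaussKer : Differentiable ℂ gaussKer := by
  unfold gaussKer; fun_prop

theorem continuous_gaussKer : Continuous gaussKer := differentiable_gaussKer.continuous

theorem hasDerivAt_gaussKer (z : ℂ) : HasDerivAt gaussKer (-2 * z * gaussKer z) z := by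
  have := (((hasDerivAt_id z).pow 2).neg.cexp).const_mul (((√Real.pi)⁻¹ : ℝ) : ℂ)
  refine this.congr_deriv ?_
  simp [gaussKer]; ring

theorem norm_gaussKer (s : ℝ) (z : ℂ) :
    ‖gaussKer (s - z)‖ = (√Real.pi)⁻¹ * (Real.exp (z.im ^ 2) * Real.exp (-(s - z.re) ^ 2)) := by
  rw [gaussKer, norm_mul, Complex.norm_exp, ← Real.exp_add, Complex.norm_real, Real.norm_of_nonneg (by positivity)]
  congr 2
  simp [sq]; ring

theorem integrable_gauss_shift (a : ℝ) : Integrable fun s : ℝ => Real.exp (-(s - a) ^ 2) := by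
  have := (integrable_exp_neg_mul_sq (b := 1) one_pos).comp_sub_right a
  simpa using this

theorem integral_gauss_shift (a : ℝ) : ∫ s : ℝ, Real.exp (-(s - a) ^ 2) = √Real.pi := by
  rw [integral_sub_right_eq_self (fun s : ℝ => Real.exp (-s ^ 2)) a]
  simpa using integral_gaussian 1

theorem integrable_norm_gaussKer (z : ℂ) : Integrable fun s : ℝ => ‖gaussKer (s - z)‖ := by
  simp only [norm_gaussKer]
  exact ((integrable_gauss_shift _).const_mul _).const_mul _

theorem integral_norm_gaussKer (z : ℂ) :
    ∫ s : ℝ, ‖gaussKer (s - z)‖ = Real.exp (z.im ^ 2) := by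
  simp only [norm_gaussKer]
  rw [integral_const_mul, integral_const_mul, integral_gauss_shift]
  have : √Real.pi ≠ 0 := by positivity
  field_simp

theorem gaussKer_ofReal (s : ℝ) : gaussKer s = (((√Real.pi)⁻¹ * Real.exp (-s ^ 2) : ℝ) : ℂ) := by
  simp [gaussKer]

theorem integral_gaussKer : ∫ s : ℝ, gaussKer s = 1 := by
  simp only [gaussKer_ofReal]
  rw [integral_complex_ofReal, integral_const_mul]
  have := integral_gauss_shift 0
  simp only [sub_zero] at this
  rw [this, inv_mul_cancel₀ (by positivity)]
  simp

theorem integrable_gaussKer_smul {E : Type*} [NormedAddCommGroup E] [NormedSpace ℂ E] (z : ℂ)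
    {f : ℝ → E} (hf : AEStronglyMeasurable f) {C : ℝ} (hC : ∀ s, ‖f s‖ ≤ C) :
    Integrable fun s : ℝ => gaussKer (s - z) • f s := by
  refine Integrable.mono' ((integrable_norm_gaussKer z).mul_const C) ?_ (ae_of_all _ fun s => ?_)
  · have : Continuous fun s : ℝ => gaussKer (s - z) := continuous_gaussKer.comp (by fun_prop)
    exact this.aestronglyMeasurable.smul hf
  · rw [norm_smul]
    gcongr
    exact hC s

namespace UnitaryFlow

variable (V V' : UnitaryFlow K)

theorem neg_apply_apply (t : ℝ) (v : K) : V (-t) (V t v) = v := by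
  rw [← V.map_add', neg_add_cancel, V.map_zero']

theorem inner_neg (t : ℝ) (u v : K) : ⟪V t u, v⟫_ℂ = ⟪u, V (-t) v⟫_ℂ := by
  rw [← (V (-t)).inner_map_map, neg_apply_apply]

/-- The flow `t ↦ V (δ t)`. -/
def scale (δ : ℝ) : UnitaryFlow K where
  toFun t := V (δ * t)
  map_zero' v := by simp [V.map_zero']
  map_add' s t v := by rw [mul_add, V.map_add']
  continuous' v := (V.continuous' v).comp (by fun_prop)

theorem scale_apply (δ t : ℝ) : V.scale δ t = V (δ * t) := rfl

theorem integrable_smear (z : ℂ) (v : K) : Integrable fun s : ℝ => gaussKer (s - z) • V s v :=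
  integrable_gaussKer_smul z (V.continuous' v).aestronglyMeasurable
    fun s => ((V s).norm_map v).le

/-- The operators `∫ gaussKer (s - z) V s ds`. -/
def smear (z : ℂ) : K →L[ℂ] K :=
  LinearMap.mkContinuous
    { toFun := fun v => ∫ s : ℝ, gaussKer (s - z) • V s v
      map_add' := fun v w => by
        rw [← integral_add (V.integrable_smear z v) (V.integrable_smear z w)]
        simp only [map_add, smul_add]
      map_smul' := fun r v => by
        rw [RingHom.id_apply, ← integral_smul]
        simp only [map_smul, smul_comm r] }
    (Real.exp (z.im ^ 2)) fun v => by
      refine (norm_integral_le_integral_norm _).trans_eq ?_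
      rw [← integral_norm_gaussKer, ← integral_mul_const]
      simp only [norm_smul, LinearIsometryEquiv.norm_map]

theorem smear_apply (z : ℂ) (v : K) : V.smear z v = ∫ s : ℝ, gaussKer (s - z) • V s v := rfl

theorem norm_smear_le (z : ℂ) (v : K) : ‖V.smear z v‖ ≤ Real.exp (z.im ^ 2) * ‖v‖ :=
  (V.smear z).le_of_opNorm_le (LinearMap.mkContinuous_norm_le _ (by positivity) _) v

theorem inner_smear_right (z : ℂ) (u v : K) :
    ⟪u, V.smear z v⟫_ℂ = ∫ s : ℝ, gaussKer (s - z) * ⟪u, V s v⟫_ℂ := by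
  rw [smear_apply, ← integral_inner (V.integrable_smear z v) u]
  simp only [inner_smul_right]

theorem inner_smear_left (z : ℂ) (u v : K) :
    ⟪V.smear z u, v⟫_ℂ = ∫ s : ℝ, gaussKer (s - conj z) * ⟪V s u, v⟫_ℂ := by
  rw [← inner_conj_symm, inner_smear_right, ← integral_conj]
  simp only [map_mul, inner_conj_symm, ← gaussKer_conj, map_sub, Complex.conj_ofReal]

variable {V V'}

/-- An identity of matrix coefficients that holds for all times may be averaged against a Gaussian
with complex centre. The conjugate comes from the antilinear slot of the inner product. This is the
tool for moving smeared flows across all relations below. -/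
theorem smear_transfer {a b c d : K} (h : ∀ t, ⟪V t a, b⟫_ℂ = ⟪c, V' t d⟫_ℂ) (z : ℂ) :
    ⟪V.smear (conj z) a, b⟫_ℂ = ⟪c, V'.smear z d⟫_ℂ := by
  rw [inner_smear_left, inner_smear_right]
  simp only [h, Complex.conj_conj]

variable (V V')

theorem inner_smear_adjoint (z : ℂ) (u v : K) :
    ⟪V.smear z u, v⟫_ℂ = ⟪u, V.smear (-conj z) v⟫_ℂ := by
  rw [inner_smear_left, inner_smear_right, ← integral_neg_eq_self]
  refine integral_congr_ae (ae_of_all _ fun s => ?_)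
  simp only
  rw [inner_neg, neg_neg, ← gaussKer_neg]
  congr 2
  push_cast; ring

theorem apply_smear_eq (r : ℝ) (z : ℂ) (v : K) :
    V r (V.smear z v) = ∫ s : ℝ, gaussKer (s - z) • V (r + s) v := by
  refine (((V r).toContinuousLinearEquiv : K →L[ℂ] K).integral_comp_comm
    (V.integrable_smear z v)).symm.trans (integral_congr_ae (ae_of_all _ fun s => ?_))
  simp only [V.map_add']
  exact map_smul (V r) _ _

theorem apply_smear (r : ℝ) (z : ℂ) (v : K) : V r (V.smear z v) = V.smear (z + r) v := by
  rw [apply_smear_eq, smear_apply, ← integral_sub_right_eq_self _ r]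
  refine integral_congr_ae (ae_of_all _ fun s => ?_)
  simp only [add_sub_cancel]
  congr 2
  push_cast; ring

theorem smear_apply_comm (r : ℝ) (z : ℂ) (v : K) : V.smear z (V r v) = V r (V.smear z v) := by
  rw [apply_smear_eq, smear_apply]
  refine integral_congr_ae (ae_of_all _ fun s => ?_)
  simp only [← V.map_add', add_comm r s]

theorem smear_comm (z w : ℂ) (v : K) : V.smear z (V.smear w v) = V.smear w (V.smear z v) := by
  rw [V.smear_apply w v, ← (V.smear z).integral_comp_comm (V.integrable_smear w v),
    V.smear_apply w (V.smear z v)]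
  refine integral_congr_ae (ae_of_all _ fun s => ?_)
  simp only [map_smul]
  rw [smear_apply_comm]

/-- Only the Gaussian depends on `z`, so differentiation under the integral shows that smeared
vectors are entire in the centre of the Gaussian. They serve as analytic vectors of the flow. -/
theorem differentiable_smear (v : K) : Differentiable ℂ fun z => V.smear z v := by
  intro z₀
  set x : ℝ → ℝ := fun s => |s - z₀.re|
  set b := |z₀.im|
  have hV : AEStronglyMeasurable fun s => V s v := (V.continuous' v).aestronglyMeasurable
  have hd : ∀ s : ℝ, ∀ z : ℂ, HasDerivAt (fun z => gaussKer (s - z) • V s v)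
      ((2 * (s - z) * gaussKer (s - z)) • V s v) z := fun s z => by
    have := ((hasDerivAt_gaussKer (s - z)).comp z ((hasDerivAt_id z).const_sub (s : ℂ))).smul_const (V s v)
    refine this.congr_deriv ?_
    congr 1; ring
  refine (hasDerivAt_integral_of_dominated_loc_of_deriv_le (𝕜 := ℂ) (μ := volume)
    (F := fun z (s : ℝ) => gaussKer (s - z) • V s v) (s := Metric.ball z₀ 1)
    (F' := fun z (s : ℝ) => (2 * (s - z) * gaussKer (s - z)) • V s v)
    (bound := fun s => 2 * (x s + (b + 2)) * (((√Real.pi)⁻¹ *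
      (Real.exp ((b + 1) ^ 2) * Real.exp (-(x s) ^ 2 / 2 + 1))) * ‖v‖)) (Metric.ball_mem_nhds _ one_pos)
    (Eventually.of_forall fun z => (V.integrable_smear z v).aestronglyMeasurable)
    (V.integrable_smear z₀ v) ?_ (ae_of_all _ fun s z hz => ?_) ?_
    (ae_of_all _ fun s z _ => hd s z)).2.differentiableAt
  · have : Continuous fun s : ℝ => (2 * (s - z₀) * gaussKer (s - z₀)) :=
      (by fun_prop : Continuous fun s : ℝ => (2 * ((s : ℂ) - z₀))).mul
        (continuous_gaussKer.comp (by fun_prop))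
    exact this.aestronglyMeasurable.smul hV
  · have hz' : ‖z - z₀‖ < 1 := by simpa [dist_eq_norm] using hz
    have hre : |z.re - z₀.re| ≤ 1 := (Complex.abs_re_le_norm (z - z₀)).trans hz'.le
    have him : |z.im - z₀.im| ≤ 1 := (Complex.abs_im_le_norm (z - z₀)).trans hz'.le
    have him' : |z.im| ≤ b + 1 := by
      calc |z.im| = |z₀.im + (z.im - z₀.im)| := by ring_nf
        _ ≤ _ := (abs_add_le _ _).trans (by gcongr)
    rw [norm_smul, norm_mul, norm_mul, LinearIsometryEquiv.norm_map, mul_assoc, mul_assoc, mul_assoc]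
    have h1 : ‖(s : ℂ) - z‖ ≤ x s + (b + 2) := by
      calc ‖(s : ℂ) - z‖ ≤ |((s : ℂ) - z).re| + |((s : ℂ) - z).im| :=
            Complex.norm_le_abs_re_add_abs_im _
        _ ≤ (x s + 1) + (b + 1) := by
            gcongr
            · simp only [Complex.sub_re, Complex.ofReal_re]
              calc |s - z.re| = |(s - z₀.re) - (z.re - z₀.re)| := by ring_nf
                _ ≤ _ := (abs_sub _ _).trans (by gcongr)
            · simpa using him'
        _ = _ := by ring
    have h2 : ‖gaussKer (s - z)‖ ≤ (√Real.pi)⁻¹ *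
      (Real.exp ((b + 1) ^ 2) * Real.exp (-(x s) ^ 2 / 2 + 1)) := by
      rw [norm_gaussKer]
      gcongr ?_ * (Real.exp ?_ * Real.exp ?_)
      · exact sq_le_sq' (by linarith [neg_abs_le z.im]) ((le_abs_self _).trans him')
      · rw [sq_abs]
        obtain ⟨h3, h4⟩ := abs_le.1 hre
        -- With `u = s - z₀.re` and `d = z.re - z₀.re`, `|d| ≤ 1`, this is `(u - d)² ≥ u²/2 - d² ≥
        -- u²/2 - 1`.
        nlinarith [sq_nonneg ((s - z₀.re) - 2 * (z.re - z₀.re))]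
    rw [Complex.norm_ofNat]
    gcongr
  · have h1 : Integrable fun s : ℝ => Real.exp (-(x s) ^ 2 / 2) := by
      have := (integrable_exp_neg_mul_sq (b := 1/2) (by norm_num)).comp_sub_right z₀.re
      refine this.congr (ae_of_all _ fun s => ?_)
      simp only [x, sq_abs]; congr 1; ring
    have h2 : Integrable fun s : ℝ => x s * Real.exp (-(x s) ^ 2 / 2) := by
      have := ((integrable_mul_exp_neg_mul_sq (b := 1/2) (by norm_num)).comp_sub_right z₀.re).norm
      refine this.congr (ae_of_all _ fun s => ?_)
      simp only [x, sq_abs, norm_mul, Real.norm_eq_abs, Real.abs_exp]; congr 2; ring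
    have h3 := (h2.add (h1.const_mul (b + 2))).const_mul
      (2 * ((√Real.pi)⁻¹ * (Real.exp ((b + 1) ^ 2) * Real.exp 1) * ‖v‖))
    refine h3.congr (ae_of_all _ fun s => ?_)
    simp only [Real.exp_add, Pi.add_apply]
    ring

/-- Slowing the flow down by `δ` has the same effect as concentrating the Gaussian, which yields an
approximate identity with the shape of the Gaussian kept fixed. -/
theorem tendsto_smear_scale (v : K) :
    Tendsto (fun δ => (V.scale δ).smear 0 v) (𝓝 0) (𝓝 v) := by
  have h : Tendsto (fun δ : ℝ => ∫ s : ℝ, gaussKer s • V (δ * s) v) (𝓝 0)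
      (𝓝 (∫ s : ℝ, gaussKer s • v)) := by
    refine tendsto_integral_filter_of_dominated_convergence (fun s : ℝ => ‖gaussKer s‖ * ‖v‖)
      (Eventually.of_forall fun δ => ?_) (Eventually.of_forall fun δ => ae_of_all _ fun s => ?_) ?_
      (ae_of_all _ fun s => ?_)
    · simpa [scale_apply] using ((V.scale δ).integrable_smear 0 v).aestronglyMeasurable
    · rw [norm_smul, LinearIsometryEquiv.norm_map]
    · simpa using (integrable_norm_gaussKer 0).mul_const ‖v‖
    · refine Tendsto.const_smul ?_ _
      have : Continuous fun δ : ℝ => V (δ * s) v := (V.continuous' v).comp (by fun_prop)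
      simpa [V.map_zero'] using this.tendsto 0
  rw [integral_smul_const, integral_gaussKer, one_smul] at h
  simpa [smear_apply, scale_apply] using h

/-- The smeared KMS condition at inverse temperature `κ` for a set of pairs. -/
def KMS (V : UnitaryFlow K) (κ : ℝ) (P : Set (K × K)) : Prop :=
  ∀ p ∈ P, ∀ r ∈ P, ∀ z : ℂ,
    ⟪V.smear (conj z - κ * Complex.I) p.2, r.1⟫_ℂ = ⟪r.2, V.smear z p.1⟫_ℂ

/-- The KMS condition with two smearings. -/
def KMS₂ (V : UnitaryFlow K) (κ : ℝ) (P : Set (K × K)) : Prop :=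
  ∀ p ∈ P, ∀ r ∈ P, ∀ w z : ℂ,
    ⟪V.smear (conj w) (V.smear (conj z - κ * Complex.I) p.2), r.1⟫_ℂ =
      ⟪r.2, V.smear w (V.smear z p.1)⟫_ℂ

/-- Sets of pairs that are stable under exchange, scalars and the flow. -/
structure StablePairs (V : UnitaryFlow K) (P : Set (K × K)) : Prop where
  swap : ∀ p ∈ P, p.swap ∈ P
  smul : ∀ (c : ℂ), ∀ p ∈ P, (c • p.1, conj c • p.2) ∈ P
  flow : ∀ t, ∀ p ∈ P, (V t p.1, V t p.2) ∈ P

/-- The pairs adjoint to all pairs of `P`. -/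
def dualPairs (P : Set (K × K)) : Set (K × K) :=
  {x | ∀ p ∈ P, ⟪x.2, p.1⟫_ℂ = ⟪p.2, x.1⟫_ℂ}

variable {V V'}

theorem KMS.mono {κ : ℝ} {P Q : Set (K × K)} (h : V.KMS κ Q) (hPQ : P ⊆ Q) : V.KMS κ P :=
  fun p hp r hr => h p (hPQ hp) r (hPQ hr)

theorem KMS₂.mono {κ : ℝ} {P Q : Set (K × K)} (h : V.KMS₂ κ Q) (hPQ : P ⊆ Q) : V.KMS₂ κ P :=
  fun p hp r hr => h p (hPQ hp) r (hPQ hr)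

/-- The condition also holds for the pair moved by the flow, and the resulting identities are
averaged over the time. -/
theorem KMS.kms₂ {κ : ℝ} {P : Set (K × K)} (h : V.KMS κ P)
    (hflow : ∀ t, ∀ p ∈ P, (V t p.1, V t p.2) ∈ P) : V.KMS₂ κ P := by
  intro p hp r hr w z
  refine smear_transfer (fun t => ?_) w
  have := h _ (hflow t p hp) r hr z
  rwa [smear_apply_comm, smear_apply_comm] at this

theorem StablePairs.closure {P : Set (K × K)} (h : V.StablePairs P) :
    V.StablePairs (AddSubmonoid.closure P : Set (K × K)) := by
  refine ⟨fun p hp => ?_, fun c p hp => ?_, fun t p hp => ?_⟩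
  · induction hp using AddSubmonoid.closure_induction with
    | mem x hx => exact AddSubmonoid.subset_closure (h.swap x hx)
    | zero => exact zero_mem _
    | add x y _ _ hx hy => exact add_mem hx hy
  · induction hp using AddSubmonoid.closure_induction with
    | mem x hx => exact AddSubmonoid.subset_closure (h.smul c x hx)
    | zero => simp only [Prod.fst_zero, Prod.snd_zero, smul_zero]; exact zero_mem _
    | add x y _ _ hx hy =>
      rw [Prod.fst_add, Prod.snd_add, smul_add, smul_add]
      exact add_mem hx hy
  · induction hp using AddSubmonoid.closure_induction with
    | mem x hx => exact AddSubmonoid.subset_closure (h.flow t x hx)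
    | zero => simp only [Prod.fst_zero, Prod.snd_zero, map_zero]; exact zero_mem _
    | add x y _ _ hx hy =>
      rw [Prod.fst_add, Prod.snd_add, map_add, map_add]
      exact add_mem hx hy

theorem KMS₂.closure {κ : ℝ} {P : Set (K × K)} (h : V.KMS₂ κ P) :
    V.KMS₂ κ (AddSubmonoid.closure P : Set (K × K)) := by
  intro p hp r hr w z
  induction hp, hr using AddSubmonoid.closure_induction₂ with
  | mem x y hx hy => exact h x hx y hy w z
  | zero_left x hx => simp
  | zero_right x hx => simp
  | add_left x y s _ _ _ hx hy => simp only [Prod.fst_add, Prod.snd_add, map_add, inner_add_left, inner_add_right, hx, hy]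
  | add_right x y s _ _ _ hx hy => simp only [Prod.fst_add, Prod.snd_add, inner_add_left, inner_add_right, hx, hy]

theorem dualPairs_closure {P : Set (K × K)} {x : K × K} (hx : x ∈ dualPairs P) :
    x ∈ dualPairs (AddSubmonoid.closure P : Set (K × K)) := by
  intro p hp
  induction hp using AddSubmonoid.closure_induction with
  | mem p hp => exact hx p hp
  | zero => simp
  | add p r _ _ hp hr => simp only [Prod.fst_add, Prod.snd_add, inner_add_left, inner_add_right, hp, hr]

theorem inner_tendsto_of_bounded {b : ℕ → K} {b₀ : K} {C : ℝ} (hb : ∀ n, ‖b n‖ ≤ C) {s : Set K}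
    (hs : Dense s) (h : ∀ y ∈ s, Tendsto (fun n => ⟪b n, y⟫_ℂ) atTop (𝓝 ⟪b₀, y⟫_ℂ)) (x : K) :
    Tendsto (fun n => ⟪b n, x⟫_ℂ) atTop (𝓝 ⟪b₀, x⟫_ℂ) := by
  rw [Metric.tendsto_atTop]
  intro ε hε
  have hC : 0 < C + ‖b₀‖ + 1 := by
    have := (norm_nonneg _).trans (hb 0)
    positivity
  obtain ⟨y, hy, hxy⟩ := Metric.dense_iff.1 hs x (ε / 2 / (C + ‖b₀‖ + 1)) (by positivity)
  obtain ⟨N, hN⟩ := Metric.tendsto_atTop.1 (h y hxy) (ε / 2) (by positivity)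
  refine ⟨N, fun n hn => ?_⟩
  have h1 := hN n hn
  rw [dist_eq_norm] at h1 ⊢
  have h2 : ‖y - x‖ < ε / 2 / (C + ‖b₀‖ + 1) := by simpa [dist_eq_norm] using hy
  have e : ⟪b n, x⟫_ℂ - ⟪b₀, x⟫_ℂ = (⟪b n, y⟫_ℂ - ⟪b₀, y⟫_ℂ) - ⟪b n - b₀, y - x⟫_ℂ := by
    simp only [inner_sub_left, inner_sub_right]; ring
  have h3 : ‖⟪b n - b₀, y - x⟫_ℂ‖ ≤ ε / 2 := by
    refine (norm_inner_le_norm _ _).trans ?_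
    calc ‖b n - b₀‖ * ‖y - x‖ ≤ (C + ‖b₀‖ + 1) * (ε / 2 / (C + ‖b₀‖ + 1)) := by
          gcongr
          exact (norm_sub_le _ _).trans (by linarith [hb n])
      _ = ε / 2 := by field_simp
  rw [e]
  exact (norm_sub_le _ _).trans_lt (by linarith)

/-- The pairs of `P` form the graph of an antilinear involution, those of `dualPairs P` the graph of
its adjoint, whose KMS condition has the opposite sign. The second smearing makes the involution
bounded on `P` in a controlled way, so that a dual vector can be approximated by first components of
`P` while the smeared second components converge weakly. No closure or polar decomposition is
needed. -/
theorem KMS₂.dual {κ : ℝ} {P : Set (K × K)} (h : V.KMS₂ κ P) (hP : V.StablePairs P)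
    (htot : TotalSet (Prod.fst '' P)) : V.KMS₂ (-κ) (dualPairs P) := by
  -- Additive closure preserves the hypotheses and does not shrink the dual set. It turns the first
  -- components into a subspace, so totality becomes density.
  wlog hadd : ∃ A : AddSubmonoid (K × K), (A : Set (K × K)) = P generalizing P with H
  · exact (H h.closure hP.closure (htot.mono (Set.image_mono AddSubmonoid.subset_closure))
      ⟨_, rfl⟩).mono fun x hx => dualPairs_closure hx
  obtain ⟨A, rfl⟩ := hadd
  intro x hx y hy w z
  have hD : ∀ x ∈ dualPairs (A : Set (K × K)), ∀ p ∈ A, ∀ a b : ℂ,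
      ⟪V.smear (conj a) (V.smear (conj b) p.2), x.1⟫_ℂ =
        ⟪x.2, V.smear a (V.smear b p.1)⟫_ℂ := by
    intro x hx p hp a b
    refine smear_transfer (fun t => ?_) a
    rw [← smear_apply_comm, ← smear_apply_comm]
    refine smear_transfer (fun s => ?_) b
    exact (hx _ (hP.flow s _ (hP.flow t _ hp))).symm
  have hdense : Dense (Prod.fst '' (A : Set (K × K))) := by
    let S : Submodule ℂ K :=
      { carrier := Prod.fst '' (A : Set (K × K))
        add_mem' := by
          rintro _ _ ⟨p, hp, rfl⟩ ⟨r, hr, rfl⟩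
          exact ⟨p + r, A.add_mem hp hr, rfl⟩
        zero_mem' := ⟨0, A.zero_mem, rfl⟩
        smul_mem' := by
          rintro c _ ⟨p, hp, rfl⟩
          exact ⟨_, hP.smul c p hp, rfl⟩ }
    exact TotalSet.dense_of_submodule (S := S) htot
  obtain ⟨g, hg, hgy⟩ := mem_closure_iff_seq_limit.1 (hdense y.1)
  choose p hpA hpg using hg
  obtain ⟨D, hD0⟩ : ∃ D, ∀ n, ‖g n‖ ≤ D := by
    obtain ⟨D, hD⟩ := hgy.norm.bddAbove_range
    exact ⟨D, fun n => hD ⟨n, rfl⟩⟩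
  set B : K →L[ℂ] K := V.smear (-conj w) ∘L V.smear (-conj z - κ * Complex.I) with hB
  -- The KMS condition for `r` and the swapped pair `r`, moved by the flow and smeared twice more,
  -- gives `‖B r.2‖² = ⟪T₁ r.1, T₂ r.1⟫`. Hence the smeared second component is controlled by the
  -- first.
  have hbound : ∃ C, ∀ r ∈ A, ‖B r.2‖ ≤ C * ‖r.1‖ := by
    set T₁ : K →L[ℂ] K := V.smear (-w) ∘L V.smear (-z + κ * Complex.I)
    set T₂ : K →L[ℂ] K := V.smear (-w) ∘L V.smear (-z)
    refine ⟨√(‖T₁‖ * ‖T₂‖), fun r hr => ?_⟩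
    have key : ⟪B r.2, B r.2⟫_ℂ = ⟪T₁ r.1, T₂ r.1⟫_ℂ := by
      have e := fun s => h r hr _ (hP.flow s _ (hP.swap r hr)) (-w) (-z)
      have e1 : ∀ b : ℂ, ∀ s : ℝ, ⟪V s (V.smear b r.1), T₂ r.1⟫_ℂ = ⟪B r.2, V s (V.smear (conj b) r.2)⟫_ℂ := by
        intro b s
        have := smear_transfer (V := V) (V' := V) (a := V s r.1) (b := T₂ r.1) (c := B r.2) (d := V s r.2)
          (fun t => ?_) (conj b)
        · rwa [Complex.conj_conj, smear_apply_comm, smear_apply_comm] at this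
        · have := e (t + s)
          simp only [map_neg, V.map_add', Prod.fst_swap, Prod.snd_swap] at this
          exact this.symm
      have e2 := smear_transfer (e1 (-z + κ * Complex.I)) (-conj w)
      simp only [map_neg, Complex.conj_conj, map_add, map_mul, Complex.conj_ofReal, Complex.conj_I] at e2
      rw [mul_neg, ← sub_eq_add_neg] at e2
      exact e2.symm
    refine abs_le_of_sq_le_sq' ?_ (by positivity) |>.2
    rw [mul_pow, Real.sq_sqrt (by positivity)]
    calc ‖B r.2‖ ^ 2 = ‖⟪B r.2, B r.2⟫_ℂ‖ := by
          rw [inner_self_eq_norm_sq_to_K]; simp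
      _ ≤ ‖T₁ r.1‖ * ‖T₂ r.1‖ := by rw [key]; exact norm_inner_le_norm _ _
      _ ≤ (‖T₁‖ * ‖r.1‖) * (‖T₂‖ * ‖r.1‖) := by gcongr <;> exact ContinuousLinearMap.le_opNorm _ _
      _ = _ := by ring
  obtain ⟨C, hC⟩ := hbound
  set b₀ : K := V.smear (-conj w) (V.smear (-conj z) y.2) with hb₀
  -- Against the first component of any pair in `A` the limit is identified by the KMS condition
  -- together with the duality relation. The uniform bound extends the convergence from this dense
  -- set to `x.1`.
  have hlim : Tendsto (fun n => ⟪B (p n).2, x.1⟫_ℂ) atTop (𝓝 ⟪b₀, x.1⟫_ℂ) := by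
    refine inner_tendsto_of_bounded (C := max C 0 * D) (fun n => (hC _ (hpA n)).trans ?_) hdense ?_ _
    · rw [hpg]
      gcongr
      · exact le_max_left _ _
      · exact hD0 n
    · rintro _ ⟨r, hr, rfl⟩
      have e1 : ∀ n, ⟪B (p n).2, r.1⟫_ℂ = ⟪r.2, V.smear (-w) (V.smear (-z) (g n))⟫_ℂ := by
        intro n
        have := h (p n) (hpA n) r hr (-w) (-z)
        rw [map_neg, map_neg, hpg] at this
        exact this
      have e2 : ⟪b₀, r.1⟫_ℂ = ⟪r.2, V.smear (-w) (V.smear (-z) y.1)⟫_ℂ := by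
        rw [hb₀, inner_smear_adjoint, inner_smear_adjoint]
        have := hD y hy r hr z w
        simp only [map_neg, Complex.conj_conj, neg_neg]
        rw [← this, inner_smear_adjoint, inner_smear_adjoint]
        simp only [Complex.conj_conj]
      simp only [e1]
      rw [e2]
      exact tendsto_const_nhds.inner
        (((V.smear (-w)).continuous.comp (V.smear (-z)).continuous).tendsto _ |>.comp hgy)
  -- The same sequence is evaluated by moving the smearings to `x`, using the duality between `x`
  -- and the approximating pairs. Its limit is the other side of the claim.
  have e3 : ∀ n, ⟪V.smear (conj w) (V.smear (conj z - ((-κ : ℝ) : ℂ) * Complex.I) x.2), g n⟫_ℂ =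
      ⟪B (p n).2, x.1⟫_ℂ := by
    intro n
    rw [inner_smear_adjoint, inner_smear_adjoint]
    have := hD x hx (p n) (hpA n) (-z + κ * Complex.I) (-w)
    rw [hpg] at this
    simp only [map_sub, map_mul, Complex.conj_conj, Complex.conj_ofReal, Complex.conj_I]
    have e : -(z - ((-κ : ℝ) : ℂ) * -Complex.I) = -z + κ * Complex.I := by push_cast; ring
    rw [e, ← this, hB, ContinuousLinearMap.comp_apply, smear_comm]
    simp only [map_neg, map_add, map_mul, Complex.conj_ofReal, Complex.conj_I, mul_neg,
      ← sub_eq_add_neg]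
  have hlim' : Tendsto (fun n => ⟪B (p n).2, x.1⟫_ℂ) atTop
      (𝓝 ⟪V.smear (conj w) (V.smear (conj z - ((-κ : ℝ) : ℂ) * Complex.I) x.2), y.1⟫_ℂ) := by
    simp only [← e3]
    exact tendsto_const_nhds.inner hgy
  rw [tendsto_nhds_unique hlim' hlim, hb₀, inner_smear_adjoint, inner_smear_adjoint, smear_comm]
  simp

end UnitaryFlow

end Flow

/-! ### Holomorphic functions on a strip: equivalence with smeared KMS conditions and uniqueness -/

section Strip

open scoped ComplexConjugate

theorem closure_strip {a : ℝ} (ha : 0 < a) :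
    closure {z : ℂ | 0 < z.im ∧ z.im < a} = {z | 0 ≤ z.im ∧ z.im ≤ a} := by
  have := Complex.closure_preimage_im (Set.Ioo 0 a)
  rw [closure_Ioo ha.ne] at this
  exact this

theorem tendsto_exp_neg_sq (c : ℝ) :
    Tendsto (fun T : ℝ => Real.exp (-(T - c) ^ 2)) atTop (𝓝 0) := by
  refine Real.tendsto_exp_atBot.comp (tendsto_neg_atTop_atBot.comp ?_)
  exact (tendsto_pow_atTop two_ne_zero).comp (tendsto_atTop_add_const_right _ _ tendsto_id)

/-- Shifting the contour of a Gaussian average of a bounded holomorphic function on a strip. -/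
theorem integral_gaussKer_strip {a : ℝ} (ha : 0 < a) {F : ℂ → ℂ}
    (hF : DiffContOnCl ℂ F {z | 0 < z.im ∧ z.im < a}) {C : ℝ}
    (hC : ∀ z : ℂ, 0 ≤ z.im → z.im ≤ a → ‖F z‖ ≤ C) (z : ℂ) :
    ∫ s : ℝ, gaussKer (s - (z + a * Complex.I)) * F s =
      ∫ s : ℝ, gaussKer (s - z) * F (s + a * Complex.I) := by
  set w := z + a * Complex.I with hw
  set f : ℂ → ℂ := fun ζ => gaussKer (ζ - w) * F ζ with hf
  have hFc : ContinuousOn F {z | 0 ≤ z.im ∧ z.im ≤ a} := closure_strip ha ▸ hF.continuousOn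
  have hC0 : 0 ≤ C := (norm_nonneg _).trans (hC 0 (by simp) (by simpa using ha.le))
  have hf1 : Integrable fun s : ℝ => f s := by
    refine integrable_gaussKer_smul w ?_ (C := C) fun s => hC s (by simp) (by simpa using ha.le)
    refine Continuous.aestronglyMeasurable ?_
    exact hFc.comp_continuous Complex.continuous_ofReal fun s => by simpa using ha.le
  have hf2 : Integrable fun s : ℝ => f (s + a * Complex.I) := by
    have := integrable_gaussKer_smul z (f := fun s : ℝ => F (s + a * Complex.I)) ?_ (C := C)
      fun s => hC _ (by simpa using ha.le) (by simp)
    · refine this.congr (ae_of_all _ fun s => ?_)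
      simp only [hf, hw, smul_eq_mul]
      congr 2; ring
    · refine Continuous.aestronglyMeasurable ?_
      exact hFc.comp_continuous (by fun_prop) fun s => by simpa using ha.le
  set D := C * ((√Real.pi)⁻¹ * Real.exp ((|w.im| + a) ^ 2)) with hD
  have hvert : ∀ T y : ℝ, 0 ≤ y → y ≤ a →
      ‖f (T + y * Complex.I)‖ ≤ D * Real.exp (-(T - w.re) ^ 2) := by
    intro T y hy hy'
    have e : (T + y * Complex.I - w : ℂ) = (T : ℂ) - (w - y * Complex.I) := by ring
    simp only [hf, norm_mul, e, norm_gaussKer]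
    have h1 : ‖F (T + y * Complex.I)‖ ≤ C := hC _ (by simpa using hy) (by simpa using hy')
    have h2 : (w - y * Complex.I).im ^ 2 ≤ (|w.im| + a) ^ 2 := by
      rw [sq_le_sq, abs_of_nonneg (by positivity : 0 ≤ |w.im| + a)]
      simp only [Complex.sub_im, Complex.mul_im, Complex.ofReal_re, Complex.I_im, mul_one,
        Complex.ofReal_im, Complex.I_re, mul_zero, add_zero]
      exact (abs_sub _ _).trans (by gcongr; rwa [abs_of_nonneg hy])
    have h3 : (w - y * Complex.I).re = w.re := by simp
    rw [h3, hD]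
    calc _ ≤ ((√Real.pi)⁻¹ * (Real.exp ((|w.im| + a) ^ 2) * Real.exp (-(T - w.re) ^ 2))) * C := by
          gcongr
      _ = _ := by ring
  have hlim : ∀ {b : ℝ → ℝ}, Tendsto (fun T => Real.exp (-(b T - w.re) ^ 2)) atTop (𝓝 0) →
      Tendsto (fun T : ℝ => Complex.I • ∫ y in (0:ℝ)..a, f (b T + y * Complex.I)) atTop (𝓝 0) := by
    intro b hb
    have : Tendsto (fun T : ℝ => ∫ y in (0:ℝ)..a, f (b T + y * Complex.I)) atTop (𝓝 0) := by
      refine squeeze_zero_norm (a := fun T => D * Real.exp (-(b T - w.re) ^ 2) * |a - 0|)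
        (fun T => ?_) ?_
      · refine intervalIntegral.norm_integral_le_of_norm_le_const fun y hy => ?_
        rw [Set.uIoc_of_le ha.le] at hy
        exact hvert _ _ hy.1.le hy.2
      · simpa using (hb.const_mul D).mul_const |a - 0|
    simpa using this.const_smul Complex.I
  have hr := hlim (b := fun T => T) (tendsto_exp_neg_sq _)
  have hl := hlim (b := fun T => -T) (by
    have := tendsto_exp_neg_sq (-w.re)
    refine this.congr fun T => ?_
    congr 1; ring)
  have h1 := intervalIntegral_tendsto_integral hf1 tendsto_neg_atTop_atBot tendsto_id
  have h2 := intervalIntegral_tendsto_integral hf2 tendsto_neg_atTop_atBot tendsto_id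
  have hsum := ((h1.sub h2).add hr).sub hl
  -- Cauchy's theorem on the rectangle with corners `-T` and `T + a i`. The integrals over the
  -- vertical sides tend to `0` by the Gaussian factor.
  have hrect : ∀ T : ℝ, (((∫ x in (-T)..T, f x) - ∫ x in (-T)..T, f (x + a * Complex.I)) +
      Complex.I • ∫ y in (0:ℝ)..a, f (T + y * Complex.I)) -
      Complex.I • ∫ y in (0:ℝ)..a, f ((-T : ℝ) + y * Complex.I) = 0 := by
    intro T
    have := Complex.integral_boundary_rect_eq_zero_of_continuousOn_of_differentiableOn f
      ((-T : ℝ) : ℂ) (T + a * Complex.I) ?_ ?_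
    · simpa using this
    · have hg : ContinuousOn (fun ζ => gaussKer (ζ - w)) Set.univ :=
        (continuous_gaussKer.comp (by fun_prop)).continuousOn
      refine (hg.mono (Set.subset_univ _)).mul (hFc.mono fun ζ hζ => ?_)
      have := hζ.2
      simpa [Set.uIcc_of_le ha.le] using this
    · have hg : DifferentiableOn ℂ (fun ζ => gaussKer (ζ - w)) Set.univ :=
        (differentiable_gaussKer.comp (by fun_prop)).differentiableOn
      refine (hg.mono (Set.subset_univ _)).mul (hF.differentiableOn.mono fun ζ hζ => ?_)
      have := hζ.2
      simpa [ha.le] using this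
  have hz := tendsto_nhds_unique hsum ((tendsto_const_nhds (x := (0 : ℂ))).congr fun T => (hrect T).symm)
  have h3 : ∫ s : ℝ, f s = ∫ s : ℝ, f (s + a * Complex.I) := by
    simpa [sub_eq_zero] using hz
  refine h3.trans (integral_congr_ae (ae_of_all _ fun s => ?_))
  simp only [hf, hw]
  congr 2; ring

/-- The maximum principle on a strip for bounded functions. -/
theorem norm_le_of_strip {F : ℂ → ℂ} (hF : DiffContOnCl ℂ F {z | 0 < z.im ∧ z.im < 1}) {C D : ℝ}
    (hC : ∀ z : ℂ, 0 ≤ z.im → z.im ≤ 1 → ‖F z‖ ≤ C) (h0 : ∀ t : ℝ, ‖F t‖ ≤ D)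
    (h1 : ∀ t : ℝ, ‖F (t + Complex.I)‖ ≤ D) {z : ℂ} (hz : 0 ≤ z.im) (hz' : z.im ≤ 1) :
    ‖F z‖ ≤ D := by
  refine PhragmenLindelof.horizontal_strip (a := 0) (b := 1) hF ⟨0, by positivity, 0, ?_⟩ ?_ ?_ hz hz'
  · refine Asymptotics.IsBigO.of_bound C ?_
    refine eventually_inf_principal.2 (Eventually.of_forall fun z hz => ?_)
    simpa using hC z hz.1.le hz.2.le
  · intro z hz
    have : z = (z.re : ℂ) := Complex.ext (by simp) (by simpa using hz)
    rw [this]; exact h0 _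
  · intro z hz
    have : z = (z.re : ℂ) + Complex.I := Complex.ext (by simp) (by simpa using hz)
    rw [this]; exact h1 _

/-- Uniform limits of bounded holomorphic functions on a strip from uniform limits at the boundary. -/
theorem exists_strip_limit {F : ℕ → ℂ → ℂ}
    (hF : ∀ n, DiffContOnCl ℂ (F n) {z | 0 < z.im ∧ z.im < 1})
    (hC : ∀ n, ∃ C : ℝ, ∀ z : ℂ, 0 ≤ z.im → z.im ≤ 1 → ‖F n z‖ ≤ C) {f₀ f₁ : ℝ → ℂ} {D : ℝ}
    (hD₀ : ∀ n (t : ℝ), ‖F n t‖ ≤ D) (hD₁ : ∀ n (t : ℝ), ‖F n (t + Complex.I)‖ ≤ D)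
    {ε : ℕ → ℝ} (hε : Tendsto ε atTop (𝓝 0))
    (h₀ : ∀ n (t : ℝ), ‖F n t - f₀ t‖ ≤ ε n) (h₁ : ∀ n (t : ℝ), ‖F n (t + Complex.I) - f₁ t‖ ≤ ε n) :
    ∃ G : ℂ → ℂ, DiffContOnCl ℂ G {z | 0 < z.im ∧ z.im < 1} ∧
      (∃ C : ℝ, ∀ z : ℂ, 0 ≤ z.im → z.im ≤ 1 → ‖G z‖ ≤ C) ∧
      ∀ t : ℝ, G t = f₀ t ∧ G (t + Complex.I) = f₁ t := by
  set S : Set ℂ := {z | 0 ≤ z.im ∧ z.im ≤ 1} with hS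
  have hcl := closure_strip one_pos
  have hdiff : ∀ m n, ∀ z ∈ S, ‖F m z - F n z‖ ≤ ε m + ε n := by
    intro m n z hz
    obtain ⟨C', hC'⟩ := hC n
    obtain ⟨C, hC⟩ := hC m
    refine norm_le_of_strip (F := fun z => F m z - F n z) ((hF m).sub (hF n)) (C := C + C') (fun z h h' => (norm_sub_le _ _).trans
      (add_le_add (hC z h h') (hC' z h h'))) (fun t => ?_) (fun t => ?_) hz.1 hz.2
    · have := (norm_sub_le_norm_sub_add_norm_sub (F m t) (f₀ t) (F n t))
      rw [norm_sub_rev (f₀ t)] at this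
      exact this.trans (add_le_add (h₀ m t) (h₀ n t))
    · have := (norm_sub_le_norm_sub_add_norm_sub (F m (t + Complex.I)) (f₁ t) (F n (t + Complex.I)))
      rw [norm_sub_rev (f₁ t)] at this
      exact this.trans (add_le_add (h₁ m t) (h₁ n t))
  have hcauchy : UniformCauchySeqOn F atTop S := by
    rw [Metric.uniformCauchySeqOn_iff]
    intro δ hδ
    obtain ⟨N, hN⟩ := (hε.eventually (gt_mem_nhds (half_pos hδ))).exists_forall_of_atTop
    refine ⟨N, fun m hm n hn z hz => ?_⟩
    rw [dist_eq_norm]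
    exact (hdiff m n z hz).trans_lt (by linarith [hN m hm, hN n hn])
  have hlim : ∀ z ∈ S, ∃ l, Tendsto (fun n => F n z) atTop (𝓝 l) := fun z hz =>
    cauchySeq_tendsto_of_complete (hcauchy.cauchySeq hz)
  classical
  set G : ℂ → ℂ := fun z => if hz : z ∈ S then (hlim z hz).choose else 0
  have hG : ∀ z ∈ S, Tendsto (fun n => F n z) atTop (𝓝 (G z)) := fun z hz => by
    simp only [G, dif_pos hz]
    exact (hlim z hz).choose_spec
  have hU := hcauchy.tendstoUniformlyOn_of_tendsto hG
  have hop : IsOpen {z : ℂ | 0 < z.im ∧ z.im < 1} :=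
    (isOpen_lt continuous_const Complex.continuous_im).inter
      (isOpen_lt Complex.continuous_im continuous_const)
  refine ⟨G, ⟨?_, ?_⟩, ⟨D, fun z hz hz' => ?_⟩, fun t => ⟨?_, ?_⟩⟩
  · refine ((hU.mono fun z hz => ⟨hz.1.le, hz.2.le⟩).tendstoLocallyUniformlyOn).differentiableOn
      (Eventually.of_forall fun n => (hF n).differentiableOn) hop
  · rw [hcl]
    refine hU.continuousOn (Frequently.of_forall fun n => ?_)
    have := (hF n).continuousOn
    rwa [hcl] at this
  · refine le_of_tendsto (hG z ⟨hz, hz'⟩).norm (Eventually.of_forall fun n => ?_)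
    obtain ⟨C, hC⟩ := hC n
    exact norm_le_of_strip (hF n) hC (hD₀ n) (hD₁ n) hz hz'
  · refine tendsto_nhds_unique (hG t ⟨by simp, by simp⟩) ?_
    exact tendsto_iff_norm_sub_tendsto_zero.2
      (squeeze_zero (fun _ => norm_nonneg _) (fun n => h₀ n t) hε)
  · refine tendsto_nhds_unique (hG (t + Complex.I) ⟨by simp, by simp⟩) ?_
    exact tendsto_iff_norm_sub_tendsto_zero.2
      (squeeze_zero (fun _ => norm_nonneg _) (fun n => h₁ n t) hε)

variable {K : Type u} [NormedAddCommGroup K] [InnerProductSpace ℂ K] [CompleteSpace K]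

namespace UnitaryFlow

/-- The KMS condition for a set of pairs, with bounded holomorphic functions on the strip. -/
def StripKMS (V : UnitaryFlow K) (P : Set (K × K)) : Prop :=
  ∀ p ∈ P, ∀ r ∈ P, ∃ F : ℂ → ℂ, DiffContOnCl ℂ F {z | 0 < z.im ∧ z.im < 1} ∧
    (∃ C : ℝ, ∀ z : ℂ, 0 ≤ z.im → z.im ≤ 1 → ‖F z‖ ≤ C) ∧
    ∀ t : ℝ, F t = ⟪V t p.2, r.1⟫_ℂ ∧ F (t + Complex.I) = ⟪r.2, V t p.1⟫_ℂ

variable {V V' : UnitaryFlow K} {P : Set (K × K)}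

/-- The contour shift is applied to `exp(i ℓ δ w) F(δ w)` on the strip of width `δ⁻¹`; the
exponential contributes `exp(-ℓ)` on the upper edge. In crossed products `ℓ` becomes the logarithm
of a character, and the factor matches the Jacobians there. -/
theorem StripKMS.integral_eq (h : V.StripKMS P) {δ : ℝ} (hδ : 0 < δ) (ℓ : ℝ) {p r : K × K}
    (hp : p ∈ P) (hr : r ∈ P) (z : ℂ) :
    ∫ s : ℝ, gaussKer (s - (z + (δ⁻¹ : ℝ) * Complex.I)) *
      (Complex.exp (Complex.I * (ℓ * (δ * s))) * ⟪V (δ * s) p.2, r.1⟫_ℂ) =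
    Complex.exp (-ℓ) * ∫ s : ℝ, gaussKer (s - z) *
      (Complex.exp (Complex.I * (ℓ * (δ * s))) * ⟪r.2, V (δ * s) p.1⟫_ℂ) := by
  obtain ⟨F, hF, ⟨C, hC⟩, hFt⟩ := h p hp r hr
  set E : ℂ → ℂ := fun w => Complex.exp (Complex.I * (ℓ * (δ * w))) * F (δ * w) with hE
  have hmem : ∀ w : ℂ, 0 ≤ w.im → w.im ≤ δ⁻¹ → 0 ≤ ((δ : ℂ) * w).im ∧ ((δ : ℂ) * w).im ≤ 1 := by
    intro w h0 h1
    rw [Complex.im_ofReal_mul]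
    refine ⟨by positivity, ?_⟩
    calc δ * w.im ≤ δ * δ⁻¹ := by gcongr
      _ = 1 := mul_inv_cancel₀ hδ.ne'
  have hmem' : ∀ w : ℂ, 0 < w.im → w.im < δ⁻¹ → 0 < ((δ : ℂ) * w).im ∧ ((δ : ℂ) * w).im < 1 := by
    intro w h0 h1
    rw [Complex.im_ofReal_mul]
    refine ⟨by positivity, ?_⟩
    calc δ * w.im < δ * δ⁻¹ := by gcongr
      _ = 1 := mul_inv_cancel₀ hδ.ne'
  have hEd : DiffContOnCl ℂ E {z | 0 < z.im ∧ z.im < δ⁻¹} := by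
    have hexp : Differentiable ℂ fun w : ℂ => Complex.exp (Complex.I * (ℓ * (δ * w))) := by fun_prop
    refine ⟨hexp.differentiableOn.mul ?_, hexp.continuous.continuousOn.mul ?_⟩
    · exact hF.differentiableOn.comp (by fun_prop) fun w hw => hmem' w hw.1 hw.2
    · refine hF.continuousOn.comp (by fun_prop) ?_
      rw [closure_strip (by positivity), closure_strip one_pos]
      exact fun w hw => hmem w hw.1 hw.2
  have hC0 : 0 ≤ C := (norm_nonneg _).trans (hC 0 (by simp) (by simp))
  have hEb : ∀ z : ℂ, 0 ≤ z.im → z.im ≤ δ⁻¹ → ‖E z‖ ≤ Real.exp |ℓ| * C := by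
    intro w h0 h1
    obtain ⟨h2, h3⟩ := hmem w h0 h1
    rw [hE, norm_mul, Complex.norm_exp]
    refine mul_le_mul (Real.exp_le_exp.2 ?_) (hC _ h2 h3) (norm_nonneg _) (by positivity)
    have : (Complex.I * (ℓ * (δ * w))).re = -(ℓ * (δ * w : ℂ).im) := by simp
    rw [this]
    refine (neg_le_abs _).trans ?_
    rw [abs_mul, abs_of_nonneg h2]
    exact mul_le_of_le_one_right (abs_nonneg _) h3
  have key := integral_gaussKer_strip (by positivity) hEd hEb z
  have e1 : ∀ s : ℝ, E s = Complex.exp (Complex.I * (ℓ * (δ * s))) * ⟪V (δ * s) p.2, r.1⟫_ℂ := by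
    intro s
    have := (hFt (δ * s)).1
    rw [← this, hE]
    push_cast; rfl
  have e2 : ∀ s : ℝ, E (s + (δ⁻¹ : ℝ) * Complex.I) = Complex.exp (-ℓ) *
      (Complex.exp (Complex.I * (ℓ * (δ * s))) * ⟪r.2, V (δ * s) p.1⟫_ℂ) := by
    intro s
    have e : (δ : ℂ) * (s + (δ⁻¹ : ℝ) * Complex.I) = ((δ * s : ℝ) : ℂ) + Complex.I := by
      have : (δ : ℂ) ≠ 0 := by exact_mod_cast hδ.ne'
      push_cast
      field_simp
    simp only [hE, e]
    rw [(hFt (δ * s)).2, ← mul_assoc (Complex.exp (-ℓ)), ← Complex.exp_add]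
    congr 2
    push_cast
    linear_combination (ℓ : ℂ) * Complex.I_mul_I
  simp only [e1, e2] at key
  rw [key, ← integral_const_mul]
  exact integral_congr_ae (ae_of_all _ fun s => by ring)

theorem StripKMS.kms (h : V.StripKMS P) {δ : ℝ} (hδ : 0 < δ) : (V.scale δ).KMS δ⁻¹ P := by
  intro p hp r hr z
  rw [inner_smear_left, inner_smear_right]
  have := h.integral_eq hδ 0 hp hr z
  simpa [scale_apply] using this

/-- For each `δ` the doubly smeared coefficient is an entire function whose values on both edges of
the strip are smeared versions of the required ones. As `δ → 0` these converge uniformly on the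
edges, and the maximum principle passes the convergence to the strip. -/
theorem stripKMS_of_kms₂ (h : ∀ δ : ℝ, 0 < δ → (V.scale δ).KMS₂ δ⁻¹ P) : V.StripKMS P := by
  intro p hp r hr
  set δ : ℕ → ℝ := fun n => 1 / ((n : ℝ) + 1)
  have hδ : ∀ n, 0 < δ n := fun n => by positivity
  have hδ0 : Tendsto δ atTop (𝓝 0) := tendsto_one_div_add_atTop_nhds_zero_nat
  set A : ℕ → ℂ → K →L[ℂ] K := fun n => (V.scale (δ n)).smear
  set F : ℕ → ℂ → ℂ := fun n z => ⟪p.2, A n 0 (A n (-(z / δ n)) r.1)⟫_ℂ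
  have hFeq : ∀ n z, F n z = ⟪A n 0 (A n (conj (z / δ n)) p.2), r.1⟫_ℂ := by
    intro n z
    simp only [A, F]
    rw [inner_smear_adjoint, inner_smear_adjoint, smear_comm]
    simp
  have hA1 : ∀ n v, ‖A n 0 v‖ ≤ ‖v‖ := fun n v => by
    simpa using (V.scale (δ n)).norm_smear_le 0 v
  have hAt : ∀ n (t : ℝ) v, A n 0 (A n (t / δ n) v) = V t (A n 0 (A n 0 v)) := by
    intro n t v
    have e := (V.scale (δ n)).apply_smear (t / δ n) 0 v
    rw [scale_apply, mul_div_cancel₀ _ (hδ n).ne', zero_add] at e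
    have e2 := (V.scale (δ n)).smear_apply_comm (t / δ n) 0 (A n 0 v)
    rw [scale_apply, mul_div_cancel₀ _ (hδ n).ne'] at e2
    rw [← e2]
    simp only [A] at *
    rw [e]
    push_cast; rfl
  have hF0 : ∀ n (t : ℝ), F n t = ⟪V t (A n 0 (A n 0 p.2)), r.1⟫_ℂ := by
    intro n t
    rw [hFeq, ← hAt]
    simp
  have hF1 : ∀ n (t : ℝ), F n (t + Complex.I) = ⟪r.2, V t (A n 0 (A n 0 p.1))⟫_ℂ := by
    intro n t
    rw [hFeq, ← hAt]
    have := h (δ n) (hδ n) p hp r hr 0 (t / δ n)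
    rw [map_zero] at this
    rw [← this]
    simp only [A]
    congr 3
    have : (δ n : ℂ) ≠ 0 := by exact_mod_cast (hδ n).ne'
    simp only [map_div₀, map_add, Complex.conj_ofReal, Complex.conj_I]
    push_cast
    field_simp
    rfl
  have hconv : ∀ v, Tendsto (fun n => ‖A n 0 (A n 0 v) - v‖) atTop (𝓝 0) := by
    intro v
    have h1 := (V.tendsto_smear_scale v).comp hδ0
    have h2 := tendsto_iff_norm_sub_tendsto_zero.1 h1
    refine squeeze_zero (fun _ => norm_nonneg _) (fun n => ?_) (by simpa using h2.add h2)
    calc ‖A n 0 (A n 0 v) - v‖ ≤ ‖A n 0 (A n 0 v) - A n 0 v‖ + ‖A n 0 v - v‖ :=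
          norm_sub_le_norm_sub_add_norm_sub _ _ _
      _ ≤ _ := by
          gcongr
          rw [← map_sub]; exact hA1 _ _
  refine exists_strip_limit (F := F) (f₀ := fun t => ⟪V t p.2, r.1⟫_ℂ)
    (f₁ := fun t => ⟪r.2, V t p.1⟫_ℂ) (D := max (‖p.2‖ * ‖r.1‖) (‖r.2‖ * ‖p.1‖))
    (ε := fun n => ‖A n 0 (A n 0 p.2) - p.2‖ * ‖r.1‖ + ‖r.2‖ * ‖A n 0 (A n 0 p.1) - p.1‖)
    (fun n => ?_) (fun n => ?_) (fun n t => ?_) (fun n t => ?_) ?_ (fun n t => ?_) (fun n t => ?_)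
  · refine Differentiable.diffContOnCl ?_
    have h1 : Differentiable ℂ fun z : ℂ => A n (-(z / δ n)) r.1 :=
      ((V.scale (δ n)).differentiable_smear r.1).comp (by fun_prop)
    exact ((innerSL ℂ p.2 ∘L A n 0).differentiable).comp h1
  · refine ⟨‖p.2‖ * (Real.exp ((1 / δ n) ^ 2) * ‖r.1‖), fun z h0 h1 => ?_⟩
    refine (norm_inner_le_norm _ _).trans ?_
    gcongr
    refine (hA1 _ _).trans ?_
    refine ((V.scale (δ n)).norm_smear_le _ _).trans ?_
    have := hδ n
    gcongr Real.exp ?_ * _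
    rw [Complex.neg_im, neg_sq, Complex.div_ofReal_im]
    gcongr
  · rw [hF0]
    refine (norm_inner_le_norm _ _).trans (le_trans ?_ (le_max_left _ _))
    rw [LinearIsometryEquiv.norm_map]
    gcongr
    exact (hA1 _ _).trans (hA1 _ _)
  · rw [hF1]
    refine (norm_inner_le_norm _ _).trans (le_trans ?_ (le_max_right _ _))
    rw [LinearIsometryEquiv.norm_map]
    gcongr
    exact (hA1 _ _).trans (hA1 _ _)
  · simpa using ((hconv p.2).mul_const ‖r.1‖).add ((hconv p.1).const_mul ‖r.2‖)
  · rw [hF0, ← inner_sub_left, ← map_sub]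
    refine (norm_inner_le_norm _ _).trans ?_
    rw [LinearIsometryEquiv.norm_map]
    exact le_add_of_nonneg_right (by positivity)
  · rw [hF1, ← inner_sub_right, ← map_sub]
    refine (norm_inner_le_norm _ _).trans ?_
    rw [LinearIsometryEquiv.norm_map]
    exact le_add_of_nonneg_left (by positivity)

/-- Uniqueness of the flow in the KMS condition. -/
theorem StripKMS.unique (h : V.StripKMS P) (h' : V'.StripKMS P)
    (hflow : ∀ t, ∀ p ∈ P, (V t p.1, V t p.2) ∈ P)
    (hflow' : ∀ t, ∀ p ∈ P, (V' t p.1, V' t p.2) ∈ P)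
    (hswap : ∀ p ∈ P, p.swap ∈ P) (htot : TotalSet (Prod.fst '' P)) (t : ℝ) (v : K) :
    V t v = V' t v := by
  -- The KMS condition of one flow is applied to pairs moved by the other one, then smeared. Its use
  -- for both flows makes the mixed coefficient periodic below.
  have hcross : ∀ W W' : UnitaryFlow K, ∀ κ : ℝ, W'.KMS κ P →
      (∀ t, ∀ p ∈ P, (W t p.1, W t p.2) ∈ P) → ∀ p ∈ P, ∀ r ∈ P, ∀ z w : ℂ,
      ⟪W.smear (conj z) r.2, W'.smear w p.1⟫_ℂ =
        ⟪W'.smear (conj w - κ * Complex.I) p.2, W.smear z r.1⟫_ℂ := by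
    intro W W' κ hK hf p hp r hr z w
    exact smear_transfer (fun t => (hK p hp _ (hf t r hr) w).symm) z
  have hconst : ∀ δ : ℝ, 0 < δ → ∀ p ∈ P, ∀ r ∈ P, ∀ t : ℝ,
      ⟪(V.scale δ).smear t r.2, (V'.scale δ).smear t p.1⟫_ℂ =
        ⟪(V.scale δ).smear 0 r.2, (V'.scale δ).smear 0 p.1⟫_ℂ := by
    intro δ hδ p hp r hr t
    set g : ℂ → ℂ := fun z => ⟪(V.scale δ).smear (conj z) r.2, (V'.scale δ).smear z p.1⟫_ℂ with hg
    have hper : ∀ z, g (z + (δ⁻¹ : ℝ) * Complex.I) = g z := by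
      intro z
      simp only [hg]
      rw [hcross (V.scale δ) _ _ (h'.kms hδ) (fun t => hflow _) p hp r hr z z]
      have := hcross (V'.scale δ) _ _ (h.kms hδ) (fun t => hflow' _) r hr p hp (z + (δ⁻¹ : ℝ) * Complex.I) z
      simp only [map_add, map_mul, Complex.conj_ofReal, Complex.conj_I, mul_neg, ← sub_eq_add_neg]
        at this ⊢
      exact this.symm
    -- The conjugation in the first argument cancels the antilinearity of the inner product there,
    -- so the difference quotients converge in the complex sense.
    have hd : Differentiable ℂ g := by
      have e : ∀ z, g z = ⟪(V'.scale δ).smear (-conj z) ((V.scale δ).smear (conj z) r.2), p.1⟫_ℂ := by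
        intro z
        rw [inner_smear_adjoint]; simp [hg]
      intro z₀
      set a : ℂ → K := fun z => (V'.scale δ).smear z p.1 with ha
      set b : ℂ → K := fun z => (V.scale δ).smear z r.2 with hb
      have hda := ((V'.scale δ).differentiable_smear p.1 z₀).hasDerivAt
      have hdb := ((V.scale δ).differentiable_smear r.2 (conj z₀)).hasDerivAt
      refine HasDerivAt.differentiableAt
        (f' := ⟪deriv b (conj z₀), a z₀⟫_ℂ + ⟪b (conj z₀), deriv a z₀⟫_ℂ) ?_
      rw [hasDerivAt_iff_tendsto_slope] at hda hdb ⊢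
      have hcj : Tendsto (fun z : ℂ => conj z) (𝓝[≠] z₀) (𝓝[≠] (conj z₀)) := by
        refine tendsto_nhdsWithin_of_tendsto_nhds_of_eventually_within _
          (Complex.continuous_conj.continuousAt.mono_left nhdsWithin_le_nhds) ?_
        filter_upwards [self_mem_nhdsWithin] with z hz h
        exact hz (by simpa using congrArg conj h)
      have hac : Tendsto a (𝓝[≠] z₀) (𝓝 (a z₀)) :=
        ((V'.scale δ).differentiable_smear p.1).continuous.continuousAt.mono_left nhdsWithin_le_nhds
      have hlim := ((hdb.comp hcj).inner hac (𝕜 := ℂ)).add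
        ((tendsto_const_nhds (x := b (conj z₀))).inner hda (𝕜 := ℂ))
      refine hlim.congr' ?_
      filter_upwards [self_mem_nhdsWithin] with z hz
      simp only [slope_def_module, Function.comp, hg]
      rw [inner_smul_left, inner_smul_right, inner_sub_left, inner_sub_right]
      simp only [map_inv₀, map_sub, Complex.conj_conj, smul_eq_mul, ha, hb]
      ring
    -- By periodicity the imaginary part may be taken in `[0, δ⁻¹]`, where the smearing operators
    -- have bounded norm. Liouville's theorem then makes `g` constant.
    have hbound : Bornology.IsBounded (Set.range g) := by
      have hnat : ∀ (n : ℤ) z, g (z + n * ((δ⁻¹ : ℝ) * Complex.I)) = g z := by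
        intro n z
        exact (Function.Periodic.int_mul hper n) z
      rw [isBounded_iff_forall_norm_le]
      refine ⟨(Real.exp (δ⁻¹ ^ 2) * ‖r.2‖) * (Real.exp (δ⁻¹ ^ 2) * ‖p.1‖), ?_⟩
      rintro _ ⟨z, rfl⟩
      set n : ℤ := ⌊z.im * δ⌋
      rw [← hnat (-n) z]
      set z' := z + ((-n : ℤ) : ℂ) * ((δ⁻¹ : ℝ) * Complex.I)
      have him : z'.im = Int.fract (z.im * δ) * δ⁻¹ := by
        have : z'.im = z.im - n * δ⁻¹ := by simp [z', sub_eq_add_neg]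
        rw [this, ← Int.self_sub_floor, sub_mul, mul_inv_cancel_right₀ hδ.ne']
      have hi0 : 0 ≤ z'.im := by rw [him]; have := Int.fract_nonneg (z.im * δ); positivity
      have hi1 : z'.im ≤ δ⁻¹ := by
        rw [him]
        exact mul_le_of_le_one_left (by positivity) (Int.fract_lt_one _).le
      refine (norm_inner_le_norm _ _).trans ?_
      gcongr
      · refine ((V.scale δ).norm_smear_le _ _).trans ?_
        gcongr Real.exp ?_ * _
        rw [Complex.conj_im, neg_sq]; gcongr
      · refine ((V'.scale δ).norm_smear_le _ _).trans ?_
        gcongr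
    have := hd.apply_eq_apply_of_bounded hbound t 0
    simpa [hg] using this
  -- Removing the smearing by `δ → 0` shows that `⟪V_t r.2, V'_t p.1⟫` does not depend on `t`. By
  -- totality `V_{-t} V'_t` fixes all first components.
  have hinner : ∀ p ∈ P, ∀ r ∈ P, ∀ t : ℝ, ⟪V t r.2, V' t p.1⟫_ℂ = ⟪r.2, p.1⟫_ℂ := by
    intro p hp r hr t
    have h0 : Tendsto (fun n : ℕ => 1 / ((n : ℝ) + 1)) atTop (𝓝 0) :=
      tendsto_one_div_add_atTop_nhds_zero_nat
    have hr' := (V.tendsto_smear_scale r.2).comp h0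
    have hp' := (V'.tendsto_smear_scale p.1).comp h0
    have l1 := hr'.inner hp' (𝕜 := ℂ)
    have l2 := (((V t).continuous.tendsto _).comp hr').inner (((V' t).continuous.tendsto _).comp hp') (𝕜 := ℂ)
    refine tendsto_nhds_unique l2 (l1.congr fun n => ?_)
    have hδ : (0 : ℝ) < 1 / ((n : ℝ) + 1) := by positivity
    have := hconst _ hδ p hp r hr (t / (1 / ((n : ℝ) + 1)))
    have e := (V.scale (1 / ((n : ℝ) + 1))).apply_smear (t / (1 / ((n : ℝ) + 1))) 0 r.2
    have e' := (V'.scale (1 / ((n : ℝ) + 1))).apply_smear (t / (1 / ((n : ℝ) + 1))) 0 p.1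
    rw [scale_apply, mul_div_cancel₀ _ hδ.ne', zero_add] at e e'
    simp only [Function.comp]
    rw [e, e']
    exact this.symm
  have hv : ∀ p ∈ P, V' t p.1 = V t p.1 := by
    intro p hp
    have : V (-t) (V' t p.1) = p.1 := by
      refine sub_eq_zero.1 (htot _ ?_)
      rintro _ ⟨r, hr, rfl⟩
      have := hinner p hp _ (hswap r hr) t
      rw [Prod.snd_swap] at this
      rw [inner_sub_right, ← this, V.inner_neg, sub_self]
    rw [← this, ← V.map_add', add_neg_cancel, V.map_zero', this]
  have := htot.clm_ext (S := ((V t).toContinuousLinearEquiv : K →L[ℂ] K))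
    (T := ((V' t).toContinuousLinearEquiv : K →L[ℂ] K)) (by
      rintro _ ⟨p, hp, rfl⟩
      exact (hv p hp).symm)
  exact congrArg (fun T : K →L[ℂ] K => T v) this

end UnitaryFlow

end Strip

/-! ### Modular functions and separation of functions and vectors on a locally compact group -/

section GroupAnalysis

open scoped CompactlySupported ComplexConjugate

variable {G : Type v} [Group G] [TopologicalSpace G] [IsTopologicalGroup G] [LocallyCompactSpace G]
  [T2Space G] [SecondCountableTopology G] [MeasurableSpace G] [BorelSpace G]
  (μ : Measure G) [μ.IsHaarMeasure]

/-- `Δ` is the modular function of the left Haar measure `μ`. -/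
structure IsModularFunction (Δ : G → ℝ) : Prop where
  pos : ∀ g, 0 < Δ g
  mul : ∀ g h, Δ (g * h) = Δ g * Δ h
  continuous : Continuous Δ
  map_inv : (μ.withDensity fun s => ENNReal.ofReal (Δ s)⁻¹).map (·⁻¹) = μ

/-- The character is constant on the cosets of an open subgroup. -/
theorem continuous_of_map_one_on_open {c : G → ℝ} (hm : ∀ g h, c (g * h) = c g * c h)
    {K : Subgroup G} (hK : IsOpen (K : Set G)) (h1 : ∀ g ∈ K, c g = 1) : Continuous c := by
  refine continuous_iff_continuousAt.2 fun g => ?_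
  refine (continuousAt_const (y := c g)).congr ?_
  have hn : (fun x => g⁻¹ * x) ⁻¹' (K : Set G) ∈ 𝓝 g :=
    (hK.preimage (continuous_const_mul g⁻¹)).mem_nhds (by simp [K.one_mem])
  filter_upwards [hn] with x hx
  have : c x = c g * c (g⁻¹ * x) := by rw [← hm, mul_inv_cancel_left]
  rw [this, h1 _ hx, mul_one]

/-- Left translation turns into right translation under inversion, so the inverted measure with
density `Δ⁻¹` is again left invariant and is a multiple of `μ`. The multiple is read off on `K`,
where the density is `1` and which is stable under inversion. -/
theorem exists_isModularFunction {K : Subgroup G} (hKo : IsOpen (K : Set G))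
    (hKc : IsCompact (K : Set G)) :
    ∃ Δ : G → ℝ, IsModularFunction μ Δ ∧ ∀ g ∈ K, Δ g = 1 := by
  set D : G → NNReal := Measure.modularCharacterFun with hD
  have hpos : ∀ g, 0 < D g := Measure.modularCharacterFun_pos
  have hmul : ∀ g h, D (g * h) = D g * D h := Measure.modularCharacterFun_map_mul
  have hmap : ∀ g, Measure.map (fun x => x * g) μ = D g • μ :=
    Measure.map_right_mul_eq_modularCharacterFun_smul μ
  have hK0 : μ (K : Set G) ≠ 0 := hKo.measure_ne_zero μ ⟨1, K.one_mem⟩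
  have hKt : μ (K : Set G) ≠ ⊤ := hKc.measure_ne_top
  have hone : ∀ g ∈ K, D g = 1 := by
    intro g hg
    have h := congrArg (fun ν : Measure G => ν K) (hmap g)
    simp only [Measure.smul_apply] at h
    rw [Measure.map_apply (measurable_mul_const g) hKo.measurableSet] at h
    have e : (fun x => x * g) ⁻¹' (K : Set G) = K := by
      ext x
      exact K.mul_mem_cancel_right hg
    rw [e, ENNReal.smul_def, smul_eq_mul] at h
    have := (ENNReal.mul_eq_right hK0 hKt).1 h.symm
    exact_mod_cast this
  have hcont : Continuous fun g => ((D g : ℝ)) :=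
    continuous_of_map_one_on_open (fun g h => by rw [hmul]; push_cast; rfl) hKo
      fun g hg => by rw [hone g hg]; rfl
  have hinv : ∀ g, D g⁻¹ = (D g)⁻¹ := fun g => by
    refine eq_inv_of_mul_eq_one_left ?_
    rw [← hmul, inv_mul_cancel]
    exact hone 1 K.one_mem
  -- `D` is the factor of the image of `μ` under right translation by `g`, the inverse of the factor
  -- by which right translation multiplies volumes of sets.
  refine ⟨fun g => ((D g : ℝ))⁻¹, ⟨fun g => inv_pos.2 (hpos g), fun g h => ?_,
    hcont.inv₀ fun g => NNReal.coe_ne_zero.2 (hpos g).ne', ?_⟩, fun g hg => by simp [hone g hg]⟩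
  · rw [hmul]; push_cast; rw [mul_inv]
  have hDm : Measurable fun s => (D s : ℝ≥0∞) := by
    have := hcont.measurable.ennreal_ofReal
    simpa using this
  simp only [inv_inv, ENNReal.ofReal_coe_nnreal]
  set ν := (μ.withDensity fun s => (D s : ℝ≥0∞)).map (·⁻¹) with hν
  have hνint : ∀ F : G → ℝ≥0∞, Measurable F → ∫⁻ s, F s ∂ν = ∫⁻ s, D s * F s⁻¹ ∂μ := by
    intro F hF
    rw [hν, lintegral_map hF measurable_inv]
    exact lintegral_withDensity_eq_lintegral_mul _ hDm (hF.comp measurable_inv)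
  have hleft : ν.IsMulLeftInvariant := by
    refine ⟨fun g => ?_⟩
    refine Measure.ext_of_lintegral _ fun F hF => ?_
    rw [lintegral_map hF (measurable_const_mul g), hνint _ hF]
    refine (hνint _ (hF.comp (measurable_const_mul g))).trans ?_
    have e : ∀ s, (D s : ℝ≥0∞) * F (g * s⁻¹) = D g * (D (s * g⁻¹) * F (s * g⁻¹)⁻¹) := by
      intro s
      rw [mul_inv_rev, inv_inv, ← mul_assoc, ← ENNReal.coe_mul, ← hmul]
      congr 2
      rw [hmul, hmul, hinv, mul_comm, inv_mul_cancel_right₀ (hpos g).ne']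
    simp only [Function.comp, e]
    have hm1 : Measurable fun s => (D s : ℝ≥0∞) * F s⁻¹ := hDm.mul (hF.comp measurable_inv)
    refine (lintegral_const_mul _ (hm1.comp (measurable_mul_const g⁻¹))).trans ?_
    simp only [Function.comp]
    rw [← lintegral_map hm1 (measurable_mul_const g⁻¹), hmap, lintegral_smul_measure, hinv,
      ENNReal.smul_def, smul_eq_mul, ← mul_assoc, ENNReal.coe_inv (hpos g).ne',
      ENNReal.mul_inv_cancel (by simpa using (hpos g).ne') (by simp), one_mul]
  have hfin : IsFiniteMeasureOnCompacts ν := by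
    refine ⟨fun C hC => ?_⟩
    rw [hν, Measure.map_apply measurable_inv hC.measurableSet, withDensity_apply _ (measurable_inv hC.measurableSet)]
    have hC' : IsCompact ((·⁻¹) ⁻¹' C : Set G) := hC.inv
    obtain ⟨b, hb⟩ := hC'.bddAbove_image hcont.continuousOn
    refine (setLIntegral_mono (g := fun _ => ENNReal.ofReal b) measurable_const fun s hs => ?_).trans_lt ?_
    · rw [← ENNReal.ofReal_coe_nnreal]
      exact ENNReal.ofReal_le_ofReal (hb ⟨s, hs, rfl⟩)
    · rw [setLIntegral_const]
      exact ENNReal.mul_lt_top ENNReal.ofReal_lt_top hC'.measure_lt_top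
  have hsm := Measure.isMulLeftInvariant_eq_smul ν μ
  have hνK : ν K = μ K := by
    rw [hν, Measure.map_apply measurable_inv hKo.measurableSet, withDensity_apply _ (measurable_inv hKo.measurableSet)]
    have e : ((·⁻¹) ⁻¹' (K : Set G)) = (K : Set G) := by ext x; simp
    rw [e, setLIntegral_congr_fun hKo.measurableSet (g := fun _ => 1) fun s hs => by simp [hone s hs]]
    simp
  have h1 := congrArg (fun ν : Measure G => ν K) hsm
  simp only [Measure.smul_apply, ENNReal.smul_def, smul_eq_mul] at h1
  rw [hνK] at h1
  have h2 := (ENNReal.mul_eq_right hK0 hKt).1 h1.symm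
  rw [hsm]
  have h3 : ν.haarScalarFactor μ = 1 := by exact_mod_cast h2
  rw [h3, one_smul]

namespace IsModularFunction

variable {μ} {Δ : G → ℝ} (hΔ : IsModularFunction μ Δ)

include hΔ

theorem map_one : Δ 1 = 1 := by
  have := hΔ.mul 1 1
  rw [mul_one] at this
  nlinarith [hΔ.pos 1]

theorem map_inv' (g : G) : Δ g⁻¹ = (Δ g)⁻¹ := by
  refine eq_inv_of_mul_eq_one_left ?_
  rw [← hΔ.mul, inv_mul_cancel, hΔ.map_one]

theorem measurable_density : Measurable fun s => ENNReal.ofReal (Δ s)⁻¹ :=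
  hΔ.continuous.measurable.inv.ennreal_ofReal

theorem quasiMeasurePreserving_inv : Measure.QuasiMeasurePreserving (·⁻¹ : G → G) μ μ := by
  refine ⟨measurable_inv, ?_⟩
  conv_rhs => rw [← hΔ.map_inv]
  refine Measure.AbsolutelyContinuous.map ?_ measurable_inv
  refine withDensity_absolutelyContinuous' hΔ.measurable_density.aemeasurable
    (ae_of_all _ fun s => ?_)
  simpa using hΔ.pos s

theorem integral_inv {E : Type*} [NormedAddCommGroup E] [NormedSpace ℝ E] (F : G → E) :
    ∫ s, (Δ s)⁻¹ • F s⁻¹ ∂μ = ∫ s, F s ∂μ := by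
  conv_rhs => rw [← hΔ.map_inv]
  refine Eq.trans ?_ ((MeasurableEquiv.inv G).measurableEmbedding.integral_map _).symm
  rw [integral_withDensity_eq_integral_toReal_smul hΔ.measurable_density (by simp)]
  refine integral_congr_ae (ae_of_all _ fun s => ?_)
  simp only
  rw [ENNReal.toReal_ofReal (inv_pos.2 (hΔ.pos s)).le]
  rfl

end IsModularFunction

/-- A square integrable function orthogonal to all compactly supported continuous functions
vanishes. -/
theorem ae_eq_zero_of_memLp {g : G → ℂ} (hg : MemLp g 2 μ)
    (h : ∀ k : C_c(G, ℂ), ∫ t, k t * g t ∂μ = 0) : g =ᵐ[μ] 0 := by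
  set f := hg.toLp g with hf
  have hsmall : ∀ ε : ℝ, 0 < ε → ‖f‖ ≤ ε := by
    intro ε hε
    obtain ⟨k, hks, hle, hkc, hkL⟩ := hg.exists_hasCompactSupport_eLpNorm_sub_le (by simp)
      (ε := ENNReal.ofReal ε) (by simpa using hε)
    set f' := hkL.toLp k
    have h1 : ‖f - f'‖ ≤ ε := by
      rw [hf, ← MemLp.toLp_sub, Lp.norm_toLp]
      exact ENNReal.toReal_le_of_le_ofReal hε.le hle
    have h2 : ⟪f', f⟫_ℂ = 0 := by
      let k' : C_c(G, ℂ) := ⟨⟨fun t => conj (k t), Complex.continuous_conj.comp hkc⟩,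
        hks.comp_left (g := fun z : ℂ => conj z) (by simp)⟩
      rw [← h k', L2.inner_def]
      refine integral_congr_ae ?_
      filter_upwards [hg.coeFn_toLp, hkL.coeFn_toLp] with t h1 h2
      rw [hf, h1, h2]
      simp [k', mul_comm]
    have h3 : ‖f‖ * ‖f‖ ≤ ε * ‖f‖ := by
      calc ‖f‖ * ‖f‖ = ‖⟪f, f⟫_ℂ‖ := by rw [inner_self_eq_norm_sq_to_K]; simp [sq]
        _ = ‖⟪f - f', f⟫_ℂ‖ := by rw [inner_sub_left, h2, sub_zero]
        _ ≤ ‖f - f'‖ * ‖f‖ := norm_inner_le_norm _ _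
        _ ≤ _ := by gcongr
    rcases (norm_nonneg f).eq_or_lt with h0 | h0
    · rw [← h0]; exact hε.le
    · exact le_of_mul_le_mul_right h3 h0
  have h0 : f = 0 := norm_le_zero_iff.1 (le_of_forall_pos_le_add fun ε hε => by simpa using hsmall ε hε)
  filter_upwards [hg.coeFn_toLp, Lp.coeFn_zero ℂ 2 μ] with t h1 h2
  rw [← h1, ← hf, h0, h2]

/-- The second function is only continuous and need not be square integrable. Multiplication by
compactly supported functions localizes the question, and countably many compact sets cover the
group. -/
theorem ae_eq_of_integral_eq {g₁ g₂ : G → ℂ} (h₁ : MemLp g₁ 2 μ) (h₂ : Continuous g₂)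
    (h : ∀ k : C_c(G, ℂ), ∫ t, k t * g₁ t ∂μ = ∫ t, k t * g₂ t ∂μ) : g₁ =ᵐ[μ] g₂ := by
  have hloc : ∀ k₀ : C_c(G, ℂ), ∀ᵐ t ∂μ, k₀ t * g₁ t = k₀ t * g₂ t := by
    intro k₀
    have m1 : ∀ k : C_c(G, ℂ), MemLp (fun t => k t * g₁ t) 2 μ := fun k => by
      obtain ⟨C, hC⟩ := k.continuous.bounded_above_of_compact_support k.hasCompactSupport
      refine h₁.of_le_mul (c := C) (k.continuous.aestronglyMeasurable.mul h₁.1)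
        (ae_of_all _ fun t => ?_)
      rw [norm_mul]
      gcongr
      exact hC t
    have m2 : ∀ k : C_c(G, ℂ), MemLp (fun t => k t * g₂ t) 2 μ := fun k =>
      (k.continuous.mul h₂).memLp_of_hasCompactSupport k.hasCompactSupport.mul_right
    have i2 : ∀ k : C_c(G, ℂ), Integrable (fun t => k t * g₂ t) μ := fun k =>
      (k.continuous.mul h₂).integrable_of_hasCompactSupport k.hasCompactSupport.mul_right
    have i1 : ∀ k : C_c(G, ℂ), Integrable (fun t => k t * g₁ t) μ := fun k =>
      (k.continuous.memLp_of_hasCompactSupport (p := 2) k.hasCompactSupport).integrable_mul h₁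
    have := ae_eq_zero_of_memLp μ ((m1 k₀).sub (m2 k₀)) fun k => by
      have e : ∀ t, k t * ((fun t => k₀ t * g₁ t) - fun t => k₀ t * g₂ t) t =
          (k * k₀) t * g₁ t - (k * k₀) t * g₂ t := fun t => by simp; ring
      simp only [e]
      rw [integral_sub (i1 _) (i2 _), h, sub_self]
    filter_upwards [this] with t ht
    simpa [sub_eq_zero] using ht
  have hcov : ∀ n : ℕ, ∃ k : C_c(G, ℂ), ∀ t ∈ compactCovering G n, k t = 1 := by
    intro n
    obtain ⟨f, h1, -, h3, -⟩ := exists_continuous_one_zero_of_isCompact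
      (isCompact_compactCovering G n) isClosed_empty (Set.disjoint_empty _)
    refine ⟨⟨⟨fun t => (f t : ℂ), by fun_prop⟩, h3.comp_left (g := fun r : ℝ => (r : ℂ)) (by simp)⟩,
      fun t ht => ?_⟩
    have := h1 ht
    simpa using this
  choose k hk using hcov
  filter_upwards [ae_all_iff.2 fun n => hloc (k n)] with t ht
  obtain ⟨n, hn⟩ := Set.mem_iUnion.1 ((iUnion_compactCovering G).symm ▸ Set.mem_univ t)
  simpa [hk n t hn] using ht n

theorem eq_zero_of_integral_eq_zero {g : G → ℂ} (hg : Continuous g)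
    (h : ∀ k : C_c(G, ℂ), ∫ t, k t * g t ∂μ = 0) (t : G) : g t = 0 := by
  have := ae_eq_of_integral_eq μ (g₁ := 0) MemLp.zero hg fun k => by simpa using (h k).symm
  have := (Continuous.ae_eq_iff_eq μ continuous_zero hg).1 this
  exact (congrFun this t).symm

section VectorValued

variable {H : Type u} [NormedAddCommGroup H] [InnerProductSpace ℂ H] [CompleteSpace H]

theorem coeFn_elemL2 (k : C_c(G, ℂ)) (ζ : H) : elemL2 μ k ζ =ᵐ[μ] fun t => k t • ζ :=
  MemLp.coeFn_toLp _

theorem coeFn_lamOp (g : G) (f : Lp H 2 μ) : lamOp μ H g f =ᵐ[μ] fun t => f (g⁻¹ * t) :=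
  Lp.coeFn_compMeasurePreserving _ _

theorem inner_elemL2 (k : C_c(G, ℂ)) (ζ : H) (f : Lp H 2 μ) :
    ⟪elemL2 μ k ζ, f⟫_ℂ = ∫ t, conj (k t) * ⟪ζ, f t⟫_ℂ ∂μ := by
  rw [L2.inner_def]
  refine integral_congr_ae ?_
  filter_upwards [coeFn_elemL2 μ k ζ] with t ht
  rw [ht, inner_smul_left]

theorem inner_elemL2_right (k : C_c(G, ℂ)) (ζ : H) (f : Lp H 2 μ) :
    ⟪f, elemL2 μ k ζ⟫_ℂ = ∫ t, k t * ⟪f t, ζ⟫_ℂ ∂μ := by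
  rw [L2.inner_def]
  refine integral_congr_ae ?_
  filter_upwards [coeFn_elemL2 μ k ζ] with t ht
  rw [ht, inner_smul_right]

theorem memLp_inner_const (f : Lp H 2 μ) (ζ : H) : MemLp (fun t => ⟪f t, ζ⟫_ℂ) 2 μ := by
  refine (Lp.memLp f).of_le_mul (c := ‖ζ‖) ((Lp.aestronglyMeasurable f).inner aestronglyMeasurable_const)
    (ae_of_all _ fun t => ?_)
  rw [mul_comm]
  exact norm_inner_le_norm _ _

variable [SecondCountableTopology H]

/-- Vectors of `L²(G, H)` are determined by their scalar components. -/
theorem Lp_ext_of_inner {s : Set H} (hs : TotalSet s) {f₁ f₂ : Lp H 2 μ}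
    (h : ∀ ζ ∈ s, ∀ᵐ t ∂μ, ⟪f₁ t, ζ⟫_ℂ = ⟪f₂ t, ζ⟫_ℂ) : f₁ = f₂ := by
  have hspan : ∀ ζ ∈ Submodule.span ℂ s, ∀ᵐ t ∂μ, ⟪f₁ t, ζ⟫_ℂ = ⟪f₂ t, ζ⟫_ℂ := by
    intro ζ hζ
    induction hζ using Submodule.span_induction with
    | mem x hx => exact h x hx
    | zero => simp
    | add x y _ _ hx hy =>
      filter_upwards [hx, hy] with t h1 h2
      rw [inner_add_right, inner_add_right, h1, h2]
    | smul c x _ hx =>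
      filter_upwards [hx] with t h1
      rw [inner_smul_right, inner_smul_right, h1]
  -- A countable dense set of test vectors produces a single exceptional null set.
  obtain ⟨d, hds, hdc, hdd⟩ := hs.dense_span.exists_countable_dense_subset
  refine Lp.ext ?_
  filter_upwards [(ae_ball_iff hdc).2 fun ζ hζ => hspan ζ (hds hζ)] with t ht
  refine sub_eq_zero.1 (hdd.totalSet _ fun ζ hζ => ?_)
  have := congrArg conj (ht ζ hζ)
  rw [inner_conj_symm, inner_conj_symm] at this
  rw [inner_sub_right, this, sub_self]

theorem totalSet_elemL2 {s : Set H} (hs : TotalSet s) :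
    TotalSet {f : Lp H 2 μ | ∃ (k : C_c(G, ℂ)) (ζ : H), ζ ∈ s ∧ f = elemL2 μ k ζ} := by
  intro f hf
  refine Lp_ext_of_inner μ hs fun ζ hζ => ?_
  have := ae_eq_zero_of_memLp μ (memLp_inner_const μ f ζ) fun k => by
    rw [← inner_elemL2_right, ← inner_conj_symm, hf _ ⟨k, ζ, hζ, rfl⟩, map_zero]
  filter_upwards [this, Lp.coeFn_zero H 2 μ] with t h1 h2
  rw [h1, h2]; simp

end VectorValued

end GroupAnalysis

/-! ### Decomposable operators, translations, convolution and inversion on `L²(G, H)` -/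

section Operators

open VonNeumannAlgebra
open scoped CompactlySupported ComplexConjugate

variable {H : Type u} [NormedAddCommGroup H] [InnerProductSpace ℂ H] [CompleteSpace H]
  [SecondCountableTopology H]
  {G : Type v} [Group G] [TopologicalSpace G] [IsTopologicalGroup G]
  [MeasurableSpace G] [BorelSpace G]

/-- A bounded strongly continuous field of operators. -/
structure OpField (G : Type v) [TopologicalSpace G] (H : Type u) [NormedAddCommGroup H]
    [InnerProductSpace ℂ H] where
  /-- The operator at a point. -/
  toFun : G → H →L[ℂ] H
  continuous' : ∀ v, Continuous fun s => toFun s v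
  bound' : ∃ C : ℝ, ∀ s, ‖toFun s‖ ≤ C

namespace OpField

instance : CoeFun (OpField G H) (fun _ => G → H →L[ℂ] H) := ⟨OpField.toFun⟩

variable (μ : Measure G) (u w : OpField G H)

theorem memLp (f : Lp H 2 μ) : MemLp (fun s => u s (f s)) 2 μ := by
  borelize H
  obtain ⟨C, hC⟩ := u.bound'
  refine (Lp.memLp f).of_le_mul (c := C) ?_ (ae_of_all _ fun s => (u s).le_of_opNorm_le (hC s) _)
  have hu : StronglyMeasurable (Function.uncurry fun (ζ : H) (s : G) => u s ζ) :=
    stronglyMeasurable_uncurry_of_continuous_of_stronglyMeasurable (fun s => (u s).continuous)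
      fun ζ => (u.continuous' ζ).stronglyMeasurable
  exact (hu.comp_measurable
    ((Lp.stronglyMeasurable f).measurable.prodMk measurable_id)).aestronglyMeasurable

/-- The decomposable operator on `L²(G, H)` defined by a field of operators. -/
def op : Lp H 2 μ →L[ℂ] Lp H 2 μ :=
  LinearMap.mkContinuous
    { toFun := fun f => (u.memLp μ f).toLp _
      map_add' := fun f₁ f₂ => by
        rw [← MemLp.toLp_add, MemLp.toLp_eq_toLp_iff]
        filter_upwards [Lp.coeFn_add f₁ f₂] with g hg
        rw [hg]
        simp
      map_smul' := fun r f => by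
        rw [RingHom.id_apply, ← MemLp.toLp_const_smul, MemLp.toLp_eq_toLp_iff]
        filter_upwards [Lp.coeFn_smul r f] with g hg
        simp [hg] }
    u.bound'.choose fun f => by
      refine Lp.norm_le_mul_norm_of_ae_le_mul ?_
      filter_upwards [(u.memLp μ f).coeFn_toLp] with g hg
      simp only [LinearMap.coe_mk, AddHom.coe_mk, hg]
      exact (u g).le_of_opNorm_le (u.bound'.choose_spec g) _

theorem coeFn_op (f : Lp H 2 μ) : u.op μ f =ᵐ[μ] fun s => u s (f s) :=
  (u.memLp μ f).coeFn_toLp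

variable {u w}

theorem op_mul {y : OpField G H} (h : ∀ s, y s = u s * w s) : y.op μ = u.op μ * w.op μ := by
  ext1 f
  refine Lp.ext ?_
  filter_upwards [coeFn_op μ y f, coeFn_op μ u (w.op μ f), coeFn_op μ w f] with s h1 h2 h3
  rw [h1, mul_apply_eq_comp, h2, h3, h s]
  rfl

theorem op_one (h : ∀ s, u s = 1) : u.op μ = 1 := by
  ext1 f
  refine Lp.ext ?_
  filter_upwards [coeFn_op μ u f] with s h1
  rw [h1, h s]
  rfl

theorem inner_op (h : ∀ s v v', ⟪u s v, v'⟫_ℂ = ⟪v, w s v'⟫_ℂ) (f f' : Lp H 2 μ) :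
    ⟪u.op μ f, f'⟫_ℂ = ⟪f, w.op μ f'⟫_ℂ := by
  rw [L2.inner_def, L2.inner_def]
  refine integral_congr_ae ?_
  filter_upwards [coeFn_op μ u f, coeFn_op μ w f'] with s h1 h2
  rw [h1, h2, h]

theorem star_op (h : ∀ s, w s = star (u s)) : star (u.op μ) = w.op μ := by
  refine (ContinuousLinearMap.eq_adjoint_iff _ _).2 (fun f f' => ?_) |>.symm
  refine inner_op μ (fun s v v' => ?_) f f'
  rw [h s]
  exact ContinuousLinearMap.adjoint_inner_left _ _ _

/-- The field attached to a strongly continuous family of unitaries. -/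
def ofUnitary (u : G → (H ≃ₗᵢ[ℂ] H)) (hu : ∀ v, Continuous fun s => u s v) : OpField G H where
  toFun s := ((u s).toContinuousLinearEquiv : H →L[ℂ] H)
  continuous' := hu
  bound' := ⟨1, fun s => ContinuousLinearMap.opNorm_le_bound _ zero_le_one fun v => by simp⟩

/-- The constant field. -/
def const (G : Type v) [TopologicalSpace G] (T : H →L[ℂ] H) : OpField G H where
  toFun _ := T
  continuous' _ := continuous_const
  bound' := ⟨‖T‖, fun _ => le_rfl⟩

end OpField

/-- The decomposable unitary on `L²(G, H)` defined by a field of unitaries. -/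
def pwUnitary (μ : Measure G) (u : G → (H ≃ₗᵢ[ℂ] H)) (hu : ∀ v, Continuous fun s => u s v)
    (hu' : ∀ v, Continuous fun s => (u s).symm v) : Lp H 2 μ ≃ₗᵢ[ℂ] Lp H 2 μ where
  toLinearEquiv := LinearEquiv.ofLinearMap
    ((OpField.ofUnitary u hu).op μ : Lp H 2 μ →ₗ[ℂ] Lp H 2 μ)
    ((OpField.ofUnitary (fun s => (u s).symm) hu').op μ : Lp H 2 μ →ₗ[ℂ] Lp H 2 μ)
    (by
      have : (1 : Lp H 2 μ →L[ℂ] Lp H 2 μ) = _ :=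
        (OpField.op_one μ (u := OpField.const G 1) fun _ => rfl).symm.trans
          (OpField.op_mul μ (u := OpField.ofUnitary u hu)
          (w := OpField.ofUnitary (fun s => (u s).symm) hu') fun s => by
            ext v; exact ((u s).apply_symm_apply v).symm)
      ext1 f
      exact (congrArg (fun T : Lp H 2 μ →L[ℂ] Lp H 2 μ => T f) this).symm)
    (by
      have : (1 : Lp H 2 μ →L[ℂ] Lp H 2 μ) = _ :=
        (OpField.op_one μ (u := OpField.const G 1) fun _ => rfl).symm.trans
          (OpField.op_mul μ (u := OpField.ofUnitary (fun s => (u s).symm) hu')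
          (w := OpField.ofUnitary u hu) fun s => by
            ext v; exact ((u s).symm_apply_apply v).symm)
      ext1 f
      exact (congrArg (fun T : Lp H 2 μ →L[ℂ] Lp H 2 μ => T f) this).symm)
  norm_map' f := by
    have h : ∀ᵐ s ∂μ, ‖(OpField.ofUnitary u hu).op μ f s‖ = ‖f s‖ := by
      filter_upwards [OpField.coeFn_op μ (OpField.ofUnitary u hu) f] with s hs
      rw [hs]
      exact (u s).norm_map _
    exact le_antisymm (Lp.norm_le_norm_of_ae_le (h.mono fun _ h => h.le))
      (Lp.norm_le_norm_of_ae_le (h.mono fun _ h => h.ge))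

theorem coeFn_pwUnitary (μ : Measure G) (u : G → (H ≃ₗᵢ[ℂ] H)) (hu : ∀ v, Continuous fun s => u s v)
    (hu' : ∀ v, Continuous fun s => (u s).symm v) (f : Lp H 2 μ) :
    pwUnitary μ u hu hu' f =ᵐ[μ] fun s => u s (f s) :=
  OpField.coeFn_op μ (OpField.ofUnitary u hu) f

theorem pwUnitary_symm (μ : Measure G) (u : G → (H ≃ₗᵢ[ℂ] H)) (hu : ∀ v, Continuous fun s => u s v)
    (hu' : ∀ v, Continuous fun s => (u s).symm v) (f : Lp H 2 μ) :
    (pwUnitary μ u hu hu').symm f = pwUnitary μ (fun s => (u s).symm) hu' hu f := rfl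

section Pi

variable {M : VonNeumannAlgebra H} (α : VNAction G M)

namespace VNAction

/-- The field `s ↦ α_{s⁻¹}(x)`. -/
def field (x : M.Elt) : OpField G H where
  toFun s := α.aut s⁻¹ x
  continuous' v := (α.continuous_aut_apply x v).comp continuous_inv
  bound' := ⟨‖(x : H →L[ℂ] H)‖, fun s => α.norm_aut_le s⁻¹ x⟩

variable (μ : Measure G)

theorem coeFn_piOp (x : M.Elt) (f : Lp H 2 μ) :
    α.piOp μ x f =ᵐ[μ] fun s => (α.aut s⁻¹ x : H →L[ℂ] H) (f s) :=
  OpField.coeFn_op μ (α.field x) f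

theorem piOp_mul (x y : M.Elt) : α.piOp μ (x * y) = α.piOp μ x * α.piOp μ y :=
  OpField.op_mul μ (y := α.field (x * y)) (u := α.field x) (w := α.field y) fun s =>
    congrArg Subtype.val (map_mul (α.aut s⁻¹) x y)

theorem star_piOp (x : M.Elt) : star (α.piOp μ x) = α.piOp μ (star x) :=
  OpField.star_op μ (u := α.field x) (w := α.field (star x)) fun s =>
    congrArg Subtype.val (map_star (α.aut s⁻¹) x)

theorem piOp_one : α.piOp μ 1 = 1 :=
  OpField.op_one μ (u := α.field 1) fun s => congrArg Subtype.val (map_one (α.aut s⁻¹))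

end VNAction

end Pi

section Conv

variable [LocallyCompactSpace G] [T2Space G] [SecondCountableTopology G]
  (μ : Measure G) [μ.IsHaarMeasure]

theorem ae_mul_left {p : G → Prop} (h : ∀ᵐ t ∂μ, p t) (g : G) : ∀ᵐ t ∂μ, p (g * t) :=
  (measurePreserving_mul_left μ g).quasiMeasurePreserving.ae h

theorem lamOp_mul (g h : G) : lamOp μ H (g * h) = lamOp μ H g * lamOp μ H h := by
  ext1 f
  refine Lp.ext ?_
  filter_upwards [coeFn_lamOp μ (g * h) f, coeFn_lamOp μ g (lamOp μ H h f),
    ae_mul_left μ (coeFn_lamOp μ h f) g⁻¹] with t h1 h2 h3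
  rw [mul_apply_eq_comp, h1, h2, h3, mul_inv_rev, mul_assoc]

theorem lamOp_one : lamOp μ H (1 : G) = 1 := by
  ext1 f
  refine Lp.ext ?_
  filter_upwards [coeFn_lamOp μ (1 : G) f] with t h1
  rw [h1]; simp

theorem inner_lamOp (g : G) (f f' : Lp H 2 μ) : ⟪lamOp μ H g f, f'⟫_ℂ = ⟪f, lamOp μ H g⁻¹ f'⟫_ℂ := by
  have h1 : ∀ x y : Lp H 2 μ, ⟪lamOp μ H g x, lamOp μ H g y⟫_ℂ = ⟪x, y⟫_ℂ := fun x y =>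
    LinearIsometry.inner_map_map _ x y
  rw [← h1 f, ← mul_apply_eq_comp, ← lamOp_mul, mul_inv_cancel, lamOp_one]
  rfl

theorem star_lamOp (g : G) : star (lamOp μ H g) = lamOp μ H g⁻¹ :=
  ((ContinuousLinearMap.eq_adjoint_iff _ _).2 fun f f' => by
    rw [inner_lamOp, inv_inv]).symm

/-- The covariance relation of the crossed product: translating the field `s ↦ α_{s⁻¹}(x)` by `g`
gives the field of `α_g(x)`. -/
theorem lamOp_piOp {M : VonNeumannAlgebra H} (α : VNAction G M) (g : G) (x : M.Elt) :
    lamOp μ H g * α.piOp μ x = α.piOp μ (α.aut g x) * lamOp μ H g := by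
  ext1 f
  refine Lp.ext ?_
  filter_upwards [coeFn_lamOp μ g (α.piOp μ x f), ae_mul_left μ (α.coeFn_piOp μ x f) g⁻¹,
    α.coeFn_piOp μ (α.aut g x) (lamOp μ H g f), coeFn_lamOp μ g f] with t h1 h2 h3 h4
  rw [mul_apply_eq_comp, mul_apply_eq_comp, h1, h2, h3, h4, ← α.aut_mul,
    mul_inv_rev, inv_inv]

variable {k : G → ℂ} (hk : Integrable k μ)

theorem convOp_apply (f : Lp H 2 μ) : convOp μ H hk f = ∫ t, k t • lamOp μ H t f ∂μ := rfl

theorem inner_convOp (u f : Lp H 2 μ) :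
    ⟪u, convOp μ H hk f⟫_ℂ = ∫ t, k t * ⟪u, lamOp μ H t f⟫_ℂ ∂μ := by
  rw [convOp_apply, ← integral_inner (integrable_conv μ hk f) u]
  simp only [inner_smul_right]

theorem inner_convOp_left (u f : Lp H 2 μ) :
    ⟪convOp μ H hk f, u⟫_ℂ = ∫ t, conj (k t) * ⟪lamOp μ H t f, u⟫_ℂ ∂μ := by
  rw [← inner_conj_symm, inner_convOp, ← integral_conj]
  simp only [map_mul, inner_conj_symm]

theorem lamOp_convOp {k' : G → ℂ} (hk' : Integrable k' μ) (g : G) (h : ∀ t, k' t = k (g⁻¹ * t))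
    (f : Lp H 2 μ) : lamOp μ H g (convOp μ H hk f) = convOp μ H hk' f := by
  rw [convOp_apply, convOp_apply, ← ContinuousLinearMap.integral_comp_comm _ (integrable_conv μ hk f),
    ← integral_mul_left_eq_self (fun t => k' t • lamOp μ H t f) g]
  refine integral_congr_ae (ae_of_all _ fun t => ?_)
  simp only [map_smul, h, inv_mul_cancel_left, lamOp_mul, mul_apply_eq_comp]

variable {M : VonNeumannAlgebra H} (α : VNAction G M)

theorem piOp_mem (x : M.Elt) : α.piOp μ x ∈ (crossedProduct μ α).toStarSubalgebra :=
  subset_generated _ (Or.inl ⟨x, rfl⟩)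

theorem lamOp_mem (g : G) : lamOp μ H g ∈ (crossedProduct μ α).toStarSubalgebra :=
  subset_generated _ (Or.inr ⟨g, rfl⟩)

/-- An operator commuting with all translations passes through the vector integral that defines the
convolution. -/
theorem convOp_mem : convOp μ H hk ∈ (crossedProduct μ α).toStarSubalgebra := by
  refine mem_generated_iff.2 fun T hT => ?_
  ext1 f
  have h : ∀ t x, T (lamOp μ H t x) = lamOp μ H t (T x) := fun t x =>
    (congrArg (fun S : Lp H 2 μ →L[ℂ] Lp H 2 μ => S x) (hT _ (Or.inr ⟨t, rfl⟩)).1).symm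
  simp only [mul_apply_eq_comp]
  rw [convOp_apply, convOp_apply, ← ContinuousLinearMap.integral_comp_comm _ (integrable_conv μ hk f)]
  simp only [map_smul, h]

/-- Operators commuting with the generators of the crossed product commute with it. -/
theorem commute_crossedProduct {T : Lp H 2 μ →L[ℂ] Lp H 2 μ}
    (h1 : ∀ x, α.piOp μ x * T = T * α.piOp μ x) (h2 : ∀ g, lamOp μ H g * T = T * lamOp μ H g)
    {y : Lp H 2 μ →L[ℂ] Lp H 2 μ} (hy : y ∈ (crossedProduct μ α).toStarSubalgebra) :
    T * y = y * T := by
  refine mem_generated_iff.1 hy T ?_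
  rintro _ (⟨x, rfl⟩ | ⟨g, rfl⟩)
  · exact ⟨h1 x, by rw [α.star_piOp]; exact h1 _⟩
  · exact ⟨h2 g, by rw [star_lamOp]; exact h2 _⟩

end Conv

section Flip

variable [LocallyCompactSpace G] [T2Space G] [SecondCountableTopology G]
  {μ : Measure G} [μ.IsHaarMeasure] {Δ : G → ℝ} (hΔ : IsModularFunction μ Δ)

namespace IsModularFunction

include hΔ

theorem integrable_inv {E : Type*} [NormedAddCommGroup E] [NormedSpace ℝ E] {F : G → E}
    (hF : Integrable F μ) : Integrable (fun s => (Δ s)⁻¹ • F s⁻¹) μ := by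
  have h1 : Integrable F ((μ.withDensity fun s => ENNReal.ofReal (Δ s)⁻¹).map (·⁻¹)) := by
    rwa [hΔ.map_inv]
  have h2 := ((MeasurableEquiv.inv G).measurableEmbedding.integrable_map_iff).1 h1
  rw [integrable_withDensity_iff_integrable_smul' hΔ.measurable_density (by simp)] at h2
  refine h2.congr (ae_of_all _ fun s => ?_)
  simp only [Function.comp]
  rw [ENNReal.toReal_ofReal (inv_pos.2 (hΔ.pos s)).le]
  rfl

theorem memLp_flip (f : Lp H 2 μ) :
    MemLp (fun s => (((√(Δ s))⁻¹ : ℝ) : ℂ) • f s⁻¹) 2 μ := by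
  have hm : AEStronglyMeasurable (fun s => (((√(Δ s))⁻¹ : ℝ) : ℂ) • f s⁻¹) μ := by
    refine AEStronglyMeasurable.smul (Continuous.aestronglyMeasurable ?_)
      ((Lp.aestronglyMeasurable f).comp_quasiMeasurePreserving hΔ.quasiMeasurePreserving_inv)
    exact Complex.continuous_ofReal.comp ((hΔ.continuous.sqrt).inv₀ fun s => (Real.sqrt_pos.2 (hΔ.pos s)).ne')
  refine (memLp_two_iff_integrable_sq_norm hm).2 ?_
  have := hΔ.integrable_inv ((memLp_two_iff_integrable_sq_norm (Lp.aestronglyMeasurable f)).1 (Lp.memLp f))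
  refine this.congr (ae_of_all _ fun s => ?_)
  simp only [norm_smul, mul_pow, smul_eq_mul]
  rw [Complex.norm_real, Real.norm_of_nonneg (by positivity), inv_pow, Real.sq_sqrt (hΔ.pos s).le]

end IsModularFunction

/-- The unitary `(J f)(s) = Δ(s)^{-1/2} f(s⁻¹)` on `L²(G, H)`. -/
def flipOp (H : Type u) [NormedAddCommGroup H] [InnerProductSpace ℂ H] [CompleteSpace H]
    [SecondCountableTopology H] (hΔ : IsModularFunction μ Δ) : Lp H 2 μ →ₗ[ℂ] Lp H 2 μ where
  toFun f := (hΔ.memLp_flip f).toLp _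
  map_add' f₁ f₂ := by
    rw [← MemLp.toLp_add, MemLp.toLp_eq_toLp_iff]
    filter_upwards [hΔ.quasiMeasurePreserving_inv.ae (Lp.coeFn_add f₁ f₂)] with s hs
    rw [hs, Pi.add_apply, smul_add]
    rfl
  map_smul' r f := by
    rw [RingHom.id_apply, ← MemLp.toLp_const_smul, MemLp.toLp_eq_toLp_iff]
    filter_upwards [hΔ.quasiMeasurePreserving_inv.ae (Lp.coeFn_smul r f)] with s hs
    rw [hs, Pi.smul_apply, smul_comm]
    rfl

theorem coeFn_flipOp (f : Lp H 2 μ) :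
    flipOp H hΔ f =ᵐ[μ] fun s => (((√(Δ s))⁻¹ : ℝ) : ℂ) • f s⁻¹ :=
  (hΔ.memLp_flip f).coeFn_toLp

theorem inner_flipOp_flipOp (f f' : Lp H 2 μ) : ⟪flipOp H hΔ f, flipOp H hΔ f'⟫_ℂ = ⟪f, f'⟫_ℂ := by
  rw [L2.inner_def, L2.inner_def, ← hΔ.integral_inv fun s => ⟪f s, f' s⟫_ℂ]
  refine integral_congr_ae ?_
  filter_upwards [coeFn_flipOp hΔ f, coeFn_flipOp hΔ f'] with s h1 h2
  rw [h1, h2, inner_smul_left, inner_smul_right, ← mul_assoc, Complex.conj_ofReal,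
    ← Complex.ofReal_mul, ← mul_inv, Real.mul_self_sqrt (hΔ.pos s).le, Complex.real_smul]

theorem flipOp_flipOp (f : Lp H 2 μ) : flipOp H hΔ (flipOp H hΔ f) = f := by
  refine Lp.ext ?_
  filter_upwards [coeFn_flipOp hΔ (flipOp H hΔ f),
    hΔ.quasiMeasurePreserving_inv.ae (coeFn_flipOp hΔ f)] with s h1 h2
  rw [h1, h2, inv_inv, smul_smul, ← Complex.ofReal_mul, hΔ.map_inv', Real.sqrt_inv, inv_inv,
    inv_mul_cancel₀ (Real.sqrt_pos.2 (hΔ.pos s)).ne', Complex.ofReal_one, one_smul]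

theorem norm_flipOp (f : Lp H 2 μ) : ‖flipOp H hΔ f‖ = ‖f‖ := by
  rw [← sq_eq_sq₀ (norm_nonneg _) (norm_nonneg _), ← inner_self_eq_norm_sq (𝕜 := ℂ),
    ← inner_self_eq_norm_sq (𝕜 := ℂ), inner_flipOp_flipOp]

/-- `flipOp` as a bounded operator. -/
def flipCLM (H : Type u) [NormedAddCommGroup H] [InnerProductSpace ℂ H] [CompleteSpace H]
    [SecondCountableTopology H] (hΔ : IsModularFunction μ Δ) : Lp H 2 μ →L[ℂ] Lp H 2 μ :=
  (flipOp H hΔ).mkContinuous 1 fun f => by rw [norm_flipOp, one_mul]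

theorem inner_flipCLM (f f' : Lp H 2 μ) : ⟪f, flipCLM H hΔ f'⟫_ℂ = ⟪flipCLM H hΔ f, f'⟫_ℂ := by
  change ⟪f, flipOp H hΔ f'⟫_ℂ = ⟪flipOp H hΔ f, f'⟫_ℂ
  rw [← inner_flipOp_flipOp hΔ f, flipOp_flipOp]

end Flip

end Operators

/-! ### Left and right bounded vectors of the dual weight -/

section RightBounded

open VonNeumannAlgebra
open scoped CompactlySupported ComplexConjugate

namespace CompactlySupportedContinuousMap

variable {G : Type v} [Group G] [TopologicalSpace G] [IsTopologicalGroup G]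

/-- The function `t ↦ k (g⁻¹ t)`. -/
def translate (g : G) (k : C_c(G, ℂ)) : C_c(G, ℂ) :=
  ⟨⟨fun t => k (g⁻¹ * t), k.continuous.comp (by fun_prop)⟩,
    k.hasCompactSupport.comp_homeomorph (Homeomorph.mulLeft g⁻¹)⟩

/-- The function `t ↦ k t⁻¹`. -/
def compInv (k : C_c(G, ℂ)) : C_c(G, ℂ) :=
  ⟨⟨fun t => k t⁻¹, k.continuous.comp (by fun_prop)⟩,
    k.hasCompactSupport.comp_homeomorph (Homeomorph.inv G)⟩

/-- The product of `k` with a continuous function. -/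
def mulLeft (f : G → ℂ) (hf : Continuous f) (k : C_c(G, ℂ)) : C_c(G, ℂ) :=
  ⟨⟨fun t => f t * k t, hf.mul k.continuous⟩, k.hasCompactSupport.mul_left⟩

theorem translate_apply (g : G) (k : C_c(G, ℂ)) (t : G) : translate g k t = k (g⁻¹ * t) := rfl

theorem compInv_apply (k : C_c(G, ℂ)) (t : G) : compInv k t = k t⁻¹ := rfl

theorem mulLeft_apply (f : G → ℂ) (hf : Continuous f) (k : C_c(G, ℂ)) (t : G) :
    mulLeft f hf k t = f t * k t := rfl

theorem integrable' [MeasurableSpace G] [BorelSpace G] (k : C_c(G, ℂ)) (μ : Measure G)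
    [IsFiniteMeasureOnCompacts μ] : Integrable k μ :=
  k.continuous.integrable_of_hasCompactSupport k.hasCompactSupport

end CompactlySupportedContinuousMap

variable {H : Type u} [NormedAddCommGroup H] [InnerProductSpace ℂ H] [CompleteSpace H]
  {M : VonNeumannAlgebra H}
  {G : Type v} [Group G] [TopologicalSpace G]

/-- An action that scales a weight by a continuous character. -/
structure ScalesWeight (φ : M.Elt → ℝ≥0∞) (Λ : M.Elt → H) (β : VNAction G M) (c : G → ℝ) : Prop where
  nsf : IsNSFWeight M φ
  gns : IsGNS φ M.toStarSubalgebra.subtype Λ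
  pos : ∀ g, 0 < c g
  scale : ∀ g x, M.IsPos x → φ (β.aut g x) = ENNReal.ofReal (c g) * φ x
  mul : ∀ g h, c (g * h) = c g * c h
  cont : Continuous c

variable {φ : M.Elt → ℝ≥0∞} {Λ : M.Elt → H} {β : VNAction G M} {c : G → ℝ}

namespace ScalesWeight

variable (h : ScalesWeight φ Λ β c)

/-- The unitary implementation of the action. -/
def rep : G →* (H ≃ₗᵢ[ℂ] H) := β.implementHom h.nsf h.gns h.pos h.scale h.mul

theorem rep_gns (g : G) {a : M.Elt} (ha : a ∈ weightIdeal φ) :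
    h.rep g (Λ a) = (((√(c g))⁻¹ : ℝ) : ℂ) • Λ (β.aut g a) :=
  β.implement_gns h.nsf h.gns h.pos h.scale g ha

theorem conjCLM_rep (g : G) (x : M.Elt) : conjCLM (h.rep g) (x : H →L[ℂ] H) = β.aut g x :=
  β.conjCLM_implement h.nsf h.gns h.pos h.scale g x

theorem rep_apply (g : G) (x : M.Elt) (v : H) :
    h.rep g ((x : H →L[ℂ] H) v) = (β.aut g x : H →L[ℂ] H) (h.rep g v) := by
  rw [← h.conjCLM_rep, conjCLM_apply, LinearIsometryEquiv.symm_apply_apply]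

theorem continuous_rep (v : H) : Continuous fun g => h.rep g v :=
  β.continuous_implement h.nsf h.gns h.pos h.scale h.cont v

theorem rep_mul (g g' : G) (v : H) : h.rep (g * g') v = h.rep g (h.rep g' v) := by
  rw [map_mul]; rfl

theorem rep_symm (g : G) (v : H) : (h.rep g).symm v = h.rep g⁻¹ v := by
  rw [LinearIsometryEquiv.symm_apply_eq, ← h.rep_mul, mul_inv_cancel, map_one]; rfl

include h in
theorem map_inv (g : G) : c g⁻¹ = (c g)⁻¹ := by
  have h1 : c 1 = 1 := by
    have := h.mul 1 1
    rw [mul_one] at this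
    nlinarith [h.pos 1]
  refine eq_inv_of_mul_eq_one_left ?_
  rw [← h.mul, inv_mul_cancel, h1]

include h in
theorem aut_mem (g : G) {a : M.Elt} (ha : a ∈ weightIdeal φ) : β.aut g a ∈ weightIdeal φ :=
  β.aut_mem_weightIdeal h.scale g ha

include h in
theorem gns_mul (x : M.Elt) {a : M.Elt} (ha : a ∈ weightIdeal φ) :
    Λ (x * a) = (x : H →L[ℂ] H) (Λ a) := h.gns.map_mul x a ha

end ScalesWeight

variable [IsTopologicalGroup G] [MeasurableSpace G] [BorelSpace G] [LocallyCompactSpace G]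
  [T2Space G] [SecondCountableTopology G] [SecondCountableTopology H]
  {μ : Measure G} [μ.IsHaarMeasure]

theorem lamOp_elemL2 (g : G) (k : C_c(G, ℂ)) (ζ : H) :
    lamOp μ H g (elemL2 μ k ζ) = elemL2 μ (k.translate g) ζ := by
  refine Lp.ext ?_
  filter_upwards [coeFn_lamOp μ g (elemL2 μ k ζ), ae_mul_left μ (coeFn_elemL2 μ k ζ) g⁻¹,
    coeFn_elemL2 μ (k.translate g) ζ] with t h1 h2 h3
  rw [h1, h2, h3]; rfl

/-- The convolution operator by a compactly supported continuous function. -/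
abbrev convCc (μ : Measure G) [μ.IsHaarMeasure] (H : Type u) [NormedAddCommGroup H]
    [InnerProductSpace ℂ H] [CompleteSpace H] (k : C_c(G, ℂ)) : Lp H 2 μ →L[ℂ] Lp H 2 μ :=
  convOp μ H (k.continuous.integrable_of_hasCompactSupport k.hasCompactSupport)

/-- Pointwise description of the adjoint of a right multiplication operator. -/
theorem IsRightBounded.ae_inner {f : Lp H 2 μ} {R : Lp H 2 μ →L[ℂ] Lp H 2 μ}
    (hR : IsRightBounded μ β φ Λ f R) (w : Lp H 2 μ) :
    ∀ᵐ t ∂μ, ∀ b ∈ weightIdeal φ,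
      ⟪ContinuousLinearMap.adjoint R w t, Λ b⟫_ℂ = ⟪w, lamOp μ H t (β.piOp μ b f)⟫_ℂ := by
  have hone : ∀ b ∈ weightIdeal φ, ∀ᵐ t ∂μ,
      ⟪ContinuousLinearMap.adjoint R w t, Λ b⟫_ℂ = ⟪w, lamOp μ H t (β.piOp μ b f)⟫_ℂ := by
    intro b hb
    refine ae_eq_of_integral_eq μ (memLp_inner_const μ _ _)
      (continuous_const.inner (continuous_lamOp μ _)) fun k => ?_
    rw [← inner_elemL2_right, ContinuousLinearMap.adjoint_inner_left, hR k b hb, inner_convOp]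
    rfl
  have : Fact ((2 : ℝ≥0∞) ≠ ∞) := ⟨by simp⟩
  -- The null set has to be independent of `b`. Both sides depend continuously on the pair `(Λ b,
  -- π(b) f)`, which ranges over a separable space, so countably many `b` suffice.
  set F : weightIdeal φ → H × Lp H 2 μ := fun b => (Λ b, β.piOp μ b f)
  obtain ⟨d, hdc, hdd⟩ := TopologicalSpace.exists_countable_dense (Set.range F)
  have hd : ∀ᵐ t ∂μ, ∀ p ∈ d,
      ⟪ContinuousLinearMap.adjoint R w t, p.1.1⟫_ℂ = ⟪w, lamOp μ H t p.1.2⟫_ℂ := by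
    refine (ae_ball_iff hdc).2 fun p _ => ?_
    obtain ⟨b, hb⟩ := p.2
    rw [← hb]
    exact hone b b.2
  filter_upwards [hd] with t ht b hb
  have hcl : IsClosed {p : Set.range F |
      ⟪ContinuousLinearMap.adjoint R w t, p.1.1⟫_ℂ = ⟪w, lamOp μ H t p.1.2⟫_ℂ} :=
    isClosed_eq (by fun_prop) (by fun_prop)
  have := hcl.closure_subset_iff.2 ht (hdd ⟨F ⟨b, hb⟩, ⟨b, hb⟩, rfl⟩)
  exact this

variable (h : ScalesWeight φ Λ β c)

include h in
-- The components of `R⋆ w` with respect to `Λ(b)` are coefficients of `λ_t π(b) f`. Multiplying `b`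
-- from the left by `β_{t⁻¹}(x)` is, by covariance, the same as moving `π(x)` to the other side of
-- the coefficient.
theorem IsRightBounded.commute_piOp {f : Lp H 2 μ} {R : Lp H 2 μ →L[ℂ] Lp H 2 μ}
    (hR : IsRightBounded μ β φ Λ f R) (x : M.Elt) : β.piOp μ x * R = R * β.piOp μ x := by
  have key : ∀ w, β.piOp μ (star x) (ContinuousLinearMap.adjoint R w) =
      ContinuousLinearMap.adjoint R (β.piOp μ (star x) w) := by
    intro w
    refine Lp_ext_of_inner μ h.gns.dense.totalSet ?_
    rintro _ ⟨a, ha, rfl⟩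
    filter_upwards [hR.ae_inner w, hR.ae_inner (β.piOp μ (star x) w),
      β.coeFn_piOp μ (star x) (ContinuousLinearMap.adjoint R w)] with t h1 h2 h3
    rw [h2 a ha, h3, map_star]
    have e1 : ⟪((star (β.aut t⁻¹ x) : M.Elt) : H →L[ℂ] H) (ContinuousLinearMap.adjoint R w t), Λ a⟫_ℂ =
        ⟪ContinuousLinearMap.adjoint R w t, Λ (β.aut t⁻¹ x * a)⟫_ℂ := by
      rw [h.gns_mul _ ha]
      exact ContinuousLinearMap.adjoint_inner_left _ _ _
    rw [e1, h1 _ (h.nsf.mul_mem _ ha), ← β.star_piOp, ContinuousLinearMap.star_eq_adjoint,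
      ContinuousLinearMap.adjoint_inner_left, ← mul_apply_eq_comp, ← mul_apply_eq_comp, ← mul_apply_eq_comp,
      lamOp_piOp, map_mul, β.aut_aut_inv, β.piOp_mul, mul_assoc, ← lamOp_piOp, ← mul_assoc]
  have h1 : β.piOp μ (star x) * star R = star R * β.piOp μ (star x) := by
    ext1 w; exact key w
  have h2 := congrArg star h1
  rw [star_mul, star_mul, star_star, β.star_piOp, star_star] at h2
  exact h2.symm

include h in
theorem IsRightBounded.commute_lamOp {f : Lp H 2 μ} {R : Lp H 2 μ →L[ℂ] Lp H 2 μ}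
    (hR : IsRightBounded μ β φ Λ f R) (g : G) : lamOp μ H g * R = R * lamOp μ H g := by
  refine (totalSet_elemL2 μ h.gns.dense.totalSet).clm_ext ?_
  rintro _ ⟨k, _, ⟨a, ha, rfl⟩, rfl⟩
  rw [mul_apply_eq_comp, mul_apply_eq_comp, lamOp_elemL2, hR k a ha, hR _ a ha]
  exact lamOp_convOp μ _ _ g (fun t => rfl) _

include h in
-- Right multiplications lie in the commutant of the crossed product: it is enough to commute with
-- the generators.
theorem IsRightBounded.commute {f : Lp H 2 μ} {R : Lp H 2 μ →L[ℂ] Lp H 2 μ}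
    (hR : IsRightBounded μ β φ Λ f R) (y : (crossedProduct μ β).Elt) :
    R * (y : Lp H 2 μ →L[ℂ] Lp H 2 μ) = (y : Lp H 2 μ →L[ℂ] Lp H 2 μ) * R :=
  commute_crossedProduct μ β (hR.commute_piOp h) (hR.commute_lamOp h) y.2

/-- The element `λ(k) π(a)` of the crossed product. -/
def convPi (μ : Measure G) [μ.IsHaarMeasure] (β : VNAction G M) (k : C_c(G, ℂ)) (a : M.Elt) :
    (crossedProduct μ β).Elt :=
  ⟨convCc μ H k * β.piOp μ a, mul_mem (convOp_mem μ _ β) (piOp_mem μ β a)⟩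

theorem isLeftMul_convPi (k : C_c(G, ℂ)) {a : M.Elt} (ha : a ∈ weightIdeal φ) :
    IsLeftMul μ β φ Λ (convPi μ β k a) (elemL2 μ k (Λ a)) := fun _ _ hR => (hR k a ha).symm

section Adjoint

variable {Δ : G → ℝ} (hΔ : IsModularFunction μ Δ)

include h hΔ in
theorem continuous_adjVec (k : C_c(G, ℂ)) {b : M.Elt} (hb : b ∈ weightIdeal φ) :
    Continuous fun s => (((Δ s)⁻¹ : ℝ) : ℂ) • conj (k s⁻¹) • Λ (β.aut s⁻¹ b) := by
  have e : ∀ s, Λ (β.aut s⁻¹ b) = ((√(c s⁻¹) : ℝ) : ℂ) • h.rep s⁻¹ (Λ b) := fun s => by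
    rw [h.rep_gns _ hb, smul_smul, ← Complex.ofReal_mul,
      mul_inv_cancel₀ (Real.sqrt_pos.2 (h.pos _)).ne', Complex.ofReal_one, one_smul]
  simp only [e]
  have h1 : Continuous fun s => h.rep s⁻¹ (Λ b) := (h.continuous_rep (Λ b)).comp continuous_inv
  have h2 : Continuous fun s => (Δ s)⁻¹ := hΔ.continuous.inv₀ fun s => (hΔ.pos s).ne'
  have h3 : Continuous fun s : G => k s⁻¹ := k.continuous.comp continuous_inv
  have h4 : Continuous fun s : G => √(c s⁻¹) := (h.cont.comp continuous_inv).sqrt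
  fun_prop

include h hΔ in
theorem memLp_adjVec (k : C_c(G, ℂ)) {b : M.Elt} (hb : b ∈ weightIdeal φ) :
    MemLp (fun s => (((Δ s)⁻¹ : ℝ) : ℂ) • conj (k s⁻¹) • Λ (β.aut s⁻¹ b)) 2 μ := by
  refine (continuous_adjVec h hΔ k hb).memLp_of_hasCompactSupport ?_
  refine k.compInv.hasCompactSupport.mono fun s hs hk => hs ?_
  have hk' : k s⁻¹ = 0 := hk
  simp [hk']

/-- The vector of the adjoint of `λ(k) π(a)`, where `b = a⋆`. -/
def adjVec (k : C_c(G, ℂ)) {b : M.Elt} (hb : b ∈ weightIdeal φ) : Lp H 2 μ :=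
  (memLp_adjVec h hΔ k hb).toLp _

theorem coeFn_adjVec (k : C_c(G, ℂ)) {b : M.Elt} (hb : b ∈ weightIdeal φ) :
    adjVec h hΔ k hb =ᵐ[μ] fun s => (((Δ s)⁻¹ : ℝ) : ℂ) • conj (k s⁻¹) • Λ (β.aut s⁻¹ b) :=
  (memLp_adjVec h hΔ k hb).coeFn_toLp

/-- The substitution `t ↦ t⁻¹` in the convolution, whose Jacobian is `Δ⁻¹`, and covariance turn
`π(a⋆) λ(k)⋆` into an integral over the vector `s ↦ Δ(s)⁻¹ conj k(s⁻¹) Λ(β_{s⁻¹}(a⋆))`. The left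
bounded vectors thus contain enough pairs for an involution. -/
theorem isLeftMul_star_convPi (k : C_c(G, ℂ)) {a : M.Elt} (ha : star a ∈ weightIdeal φ) :
    IsLeftMul μ β φ Λ (star (convPi μ β k a)) (adjVec h hΔ k ha) := by
  intro f R hR
  refine ext_inner_left ℂ fun w => ?_
  have e1 : ⟪w, ((star (convPi μ β k a) : (crossedProduct μ β).Elt) : Lp H 2 μ →L[ℂ] Lp H 2 μ) f⟫_ℂ =
      ⟪convCc μ H k (β.piOp μ a w), f⟫_ℂ := ContinuousLinearMap.adjoint_inner_right _ _ _
  rw [e1, inner_convOp_left, ← hΔ.integral_inv, ← ContinuousLinearMap.adjoint_inner_left R,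
    L2.inner_def]
  refine integral_congr_ae ?_
  filter_upwards [hR.ae_inner w, coeFn_adjVec h hΔ k ha] with t h1 h2
  have e2 : lamOp μ H t (β.piOp μ (β.aut t⁻¹ (star a)) f) = β.piOp μ (star a) (lamOp μ H t f) := by
    rw [← mul_apply_eq_comp, lamOp_piOp, β.aut_aut_inv]
    rfl
  rw [h2, inner_smul_right, inner_smul_right, h1 _ (h.aut_mem _ ha), e2, ← β.star_piOp,
    ContinuousLinearMap.star_eq_adjoint, ContinuousLinearMap.adjoint_inner_right, inner_lamOp,
    inv_inv, Complex.real_smul]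
  rfl

end Adjoint

end RightBounded

/-! ### An explicit total family of right bounded vectors -/

section ExplicitRightBounded

open VonNeumannAlgebra
open scoped CompactlySupported ComplexConjugate

variable {H : Type u} [NormedAddCommGroup H] [InnerProductSpace ℂ H] [CompleteSpace H]
  [SecondCountableTopology H] {M : VonNeumannAlgebra H}
  {G : Type v} [Group G] [TopologicalSpace G]
  {φ : M.Elt → ℝ≥0∞} {Λ : M.Elt → H} {β : VNAction G M} {c : G → ℝ}
  [IsTopologicalGroup G] [MeasurableSpace G] [BorelSpace G] [LocallyCompactSpace G]
  [T2Space G] [SecondCountableTopology G]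
  {μ : Measure G} [μ.IsHaarMeasure] (h : ScalesWeight φ Λ β c)
  {Δ : G → ℝ} (hΔ : IsModularFunction μ Δ)

/-- The unitary `(W f)(s) = U_s f(s)`. -/
def ScalesWeight.diag (μ : Measure G) : Lp H 2 μ ≃ₗᵢ[ℂ] Lp H 2 μ :=
  pwUnitary μ (fun s => h.rep s) h.continuous_rep fun v => by
    simp only [h.rep_symm]
    exact (h.continuous_rep v).comp continuous_inv

theorem ScalesWeight.coeFn_diag (f : Lp H 2 μ) : h.diag μ f =ᵐ[μ] fun s => h.rep s (f s) :=
  coeFn_pwUnitary _ _ _ _ _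

theorem const_op_elemL2 (T : H →L[ℂ] H) (k : C_c(G, ℂ)) (ζ : H) :
    (OpField.const G T).op μ (elemL2 μ k ζ) = elemL2 μ k (T ζ) := by
  refine Lp.ext ?_
  filter_upwards [OpField.coeFn_op μ (OpField.const G T) (elemL2 μ k ζ), coeFn_elemL2 μ k ζ,
    coeFn_elemL2 μ k (T ζ)] with s h1 h2 h3
  rw [h1, h2, h3]
  exact map_smul T _ _

theorem inner_const_op (T : H →L[ℂ] H) (f f' : Lp H 2 μ) :
    ⟪f, (OpField.const G T).op μ f'⟫_ℂ =
      ⟪(OpField.const G (ContinuousLinearMap.adjoint T)).op μ f, f'⟫_ℂ :=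
  (OpField.inner_op μ (fun _ _ _ => ContinuousLinearMap.adjoint_inner_left _ _ _) f f').symm

/-- The right multiplication operators `(1 ⊗ T) W⋆ J λ(k) J W`. -/
def rightOp (T : H →L[ℂ] H) (k : C_c(G, ℂ)) : Lp H 2 μ →L[ℂ] Lp H 2 μ :=
  (OpField.const G T).op μ ∘L ((h.diag μ).symm.toContinuousLinearEquiv : Lp H 2 μ →L[ℂ] Lp H 2 μ) ∘L
    flipCLM H hΔ ∘L convCc μ H k ∘L flipCLM H hΔ ∘L
      ((h.diag μ).toContinuousLinearEquiv : Lp H 2 μ →L[ℂ] Lp H 2 μ)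

theorem inner_rightOp (T : H →L[ℂ] H) (k : C_c(G, ℂ)) (f f' : Lp H 2 μ) :
    ⟪f, rightOp h hΔ T k f'⟫_ℂ = ∫ r, k r *
      ⟪flipOp H hΔ (h.diag μ ((OpField.const G (ContinuousLinearMap.adjoint T)).op μ f)),
        lamOp μ H r (flipOp H hΔ (h.diag μ f'))⟫_ℂ ∂μ := by
  have e : ⟪f, rightOp h hΔ T k f'⟫_ℂ = ⟪f, (OpField.const G T).op μ ((h.diag μ).symm
    (flipCLM H hΔ (convCc μ H k (flipOp H hΔ (h.diag μ f')))))⟫_ℂ := rfl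
  rw [e, inner_const_op, ← (h.diag μ).inner_map_map, LinearIsometryEquiv.apply_symm_apply,
    inner_flipCLM, inner_convOp]
  rfl

theorem coeFn_flip_diag_elemL2 (k : C_c(G, ℂ)) (ζ : H) :
    flipOp H hΔ (h.diag μ (elemL2 μ k ζ)) =ᵐ[μ]
      fun s => (((√(Δ s))⁻¹ : ℝ) : ℂ) • k s⁻¹ • h.rep s⁻¹ ζ := by
  filter_upwards [coeFn_flipOp hΔ (h.diag μ (elemL2 μ k ζ)),
    hΔ.quasiMeasurePreserving_inv.ae (h.coeFn_diag (elemL2 μ k ζ)),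
    hΔ.quasiMeasurePreserving_inv.ae (coeFn_elemL2 μ k ζ)] with s h1 h2 h3
  rw [h1, h2, h3, map_smul]

theorem inner_flip_diag_elemL2 (k k' : C_c(G, ℂ)) (ζ ζ' : H) (r : G) :
    ⟪flipOp H hΔ (h.diag μ (elemL2 μ k' ζ')), lamOp μ H r (flipOp H hΔ (h.diag μ (elemL2 μ k ζ)))⟫_ℂ =
      ((√(Δ r) : ℝ) : ℂ) * ⟪ζ', h.rep r ζ⟫_ℂ * ∫ s, conj (k' s) * k (s * r) ∂μ := by
  rw [L2.inner_def, ← integral_const_mul, ← hΔ.integral_inv fun s =>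
    ((√(Δ r) : ℝ) : ℂ) * ⟪ζ', h.rep r ζ⟫_ℂ * (conj (k' s) * k (s * r))]
  refine integral_congr_ae ?_
  filter_upwards [coeFn_flip_diag_elemL2 h hΔ k' ζ',
    coeFn_lamOp μ r (flipOp H hΔ (h.diag μ (elemL2 μ k ζ))),
    ae_mul_left μ (coeFn_flip_diag_elemL2 h hΔ k ζ) r⁻¹] with s h1 h2 h3
  rw [h1, h2, h3]
  simp only [inner_smul_left, inner_smul_right, Complex.conj_ofReal, mul_inv_rev, inv_inv,
    Complex.real_smul]
  rw [h.rep_mul, LinearIsometryEquiv.inner_map_map, hΔ.mul, hΔ.map_inv', Real.sqrt_mul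
    (inv_pos.2 (hΔ.pos r)).le, Real.sqrt_inv, mul_inv, inv_inv]
  have e : (((Δ s)⁻¹ : ℝ) : ℂ) = (((√(Δ s))⁻¹ : ℝ) : ℂ) * (((√(Δ s))⁻¹ : ℝ) : ℂ) := by
    rw [← Complex.ofReal_mul, ← mul_inv, Real.mul_self_sqrt (hΔ.pos s).le]
  rw [e]
  push_cast
  ring

/-- The function `r ↦ Δ(r)^{-1/2} c(r)^{1/2} l(r⁻¹)`. -/
def rightKer (l : C_c(G, ℂ)) : C_c(G, ℂ) :=
  l.compInv.mulLeft (fun r => (((√(Δ r))⁻¹ * √(c r) : ℝ) : ℂ))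
    (Complex.continuous_ofReal.comp
      (((hΔ.continuous.sqrt).inv₀ fun s => (Real.sqrt_pos.2 (hΔ.pos s)).ne').mul h.cont.sqrt))

/-- Tested against elementary vectors, both sides are double integrals of the same function: one
runs over `(s, r)`, the other over `(s, t)` with `t = s r`. The factors in `rightKer` cancel
`Δ(r)^(1/2)` from the inversion and `c(r)^(-1/2)` from the implementation. -/
theorem isRightBounded_rightOp {η : H} {T : H →L[ℂ] H} (hT : WeightRightBounded φ Λ η T)
    (l : C_c(G, ℂ)) :
    IsRightBounded μ β φ Λ (elemL2 μ l η) (rightOp h hΔ T (rightKer h hΔ l)) := by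
  intro k a ha
  refine sub_eq_zero.1 (totalSet_elemL2 μ (Dense.totalSet (s := (Set.univ : Set H)) dense_univ) _ ?_)
  rintro _ ⟨k', ζ, -, rfl⟩
  rw [inner_sub_right, sub_eq_zero, inner_rightOp, inner_convOp]
  simp only [const_op_elemL2, inner_flip_diag_elemL2]
  set b : G → ℂ := fun r => ⟪ζ, (β.aut r a : H →L[ℂ] H) η⟫_ℂ with hb
  have hbc : Continuous b := continuous_const.inner (β.continuous_aut_apply a η)
  have e1 : ∀ t, ⟪elemL2 μ k' ζ, lamOp μ H t (β.piOp μ a (elemL2 μ l η))⟫_ℂ =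
      ∫ s, conj (k' s) * (l (t⁻¹ * s) * b (s⁻¹ * t)) ∂μ := by
    intro t
    rw [inner_elemL2]
    refine integral_congr_ae ?_
    filter_upwards [coeFn_lamOp μ t (β.piOp μ a (elemL2 μ l η)),
      ae_mul_left μ (β.coeFn_piOp μ a (elemL2 μ l η)) t⁻¹,
      ae_mul_left μ (coeFn_elemL2 μ l η) t⁻¹] with s h1 h2 h3
    rw [h1, h2, h3, map_smul, inner_smul_right, mul_inv_rev, inv_inv]
  have e2 : ∀ r, rightKer h hΔ l r * (((√(Δ r) : ℝ) : ℂ) *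
      ⟪ContinuousLinearMap.adjoint T ζ, h.rep r (Λ a)⟫_ℂ * ∫ s, conj (k' s) * k (s * r) ∂μ) =
      ∫ s, conj (k' s) * (k (s * r) * (l r⁻¹ * b r)) ∂μ := by
    intro r
    rw [ContinuousLinearMap.adjoint_inner_left, h.rep_gns r ha, map_smul, hT _ (h.aut_mem r ha),
      inner_smul_right, ← integral_const_mul, ← integral_const_mul]
    refine integral_congr_ae (ae_of_all _ fun s => ?_)
    have h1 : ((√(Δ r) : ℝ) : ℂ) ≠ 0 := by
      exact_mod_cast (Real.sqrt_pos.2 (hΔ.pos r)).ne'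
    have h2 : ((√(c r) : ℝ) : ℂ) ≠ 0 := by
      exact_mod_cast (Real.sqrt_pos.2 (h.pos r)).ne'
    simp only [rightKer, CompactlySupportedContinuousMap.mulLeft_apply,
      CompactlySupportedContinuousMap.compInv_apply, hb]
    push_cast
    field_simp
  simp only [e1, e2]
  have hk'c : Continuous fun s => conj (k' s) := Complex.continuous_conj.comp k'.continuous
  have s1 : ∫ r, ∫ s, conj (k' s) * (k (s * r) * (l r⁻¹ * b r)) ∂μ ∂μ =
      ∫ s, ∫ r, conj (k' s) * (k (s * r) * (l r⁻¹ * b r)) ∂μ ∂μ := by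
    refine integral_integral_swap_of_hasCompactSupport ?_ ?_
    · have h1 : Continuous fun p : G × G => conj (k' p.2) := hk'c.comp continuous_snd
      have h2 : Continuous fun p : G × G => k (p.2 * p.1) := k.continuous.comp (by fun_prop)
      have h3 : Continuous fun p : G × G => l p.1⁻¹ := l.continuous.comp (by fun_prop)
      exact h1.mul (h2.mul (h3.mul (hbc.comp continuous_fst)))
    · refine HasCompactSupport.of_support_subset_isCompact
        (l.compInv.hasCompactSupport.isCompact.prod k'.hasCompactSupport.isCompact) ?_
      rintro ⟨r, s⟩ hp
      refine ⟨subset_tsupport _ fun h0 => hp ?_, subset_tsupport _ fun h0 => hp ?_⟩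
      · have h0' : l r⁻¹ = 0 := h0
        simp [Function.uncurry, h0']
      · have h0' : k' s = 0 := h0
        simp [Function.uncurry, h0']
  have s2 : ∫ t, k t * ∫ s, conj (k' s) * (l (t⁻¹ * s) * b (s⁻¹ * t)) ∂μ ∂μ =
      ∫ s, ∫ t, k t * (conj (k' s) * (l (t⁻¹ * s) * b (s⁻¹ * t))) ∂μ ∂μ := by
    simp only [← integral_const_mul]
    refine integral_integral_swap_of_hasCompactSupport ?_ ?_
    · have h1 : Continuous fun p : G × G => conj (k' p.2) := hk'c.comp continuous_snd
      have h2 : Continuous fun p : G × G => k p.1 := k.continuous.comp (by fun_prop)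
      have h3 : Continuous fun p : G × G => l (p.1⁻¹ * p.2) := l.continuous.comp (by fun_prop)
      have h4 : Continuous fun p : G × G => b (p.2⁻¹ * p.1) := hbc.comp (by fun_prop)
      exact h2.mul (h1.mul (h3.mul h4))
    · refine HasCompactSupport.of_support_subset_isCompact
        (k.hasCompactSupport.isCompact.prod k'.hasCompactSupport.isCompact) ?_
      rintro ⟨r, s⟩ hp
      refine ⟨subset_tsupport _ fun h0 => hp ?_, subset_tsupport _ fun h0 => hp ?_⟩
      · have h0' : k r = 0 := h0
        simp [Function.uncurry, h0']
      · have h0' : k' s = 0 := h0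
        simp [Function.uncurry, h0']
  refine s1.trans (Eq.trans ?_ s2.symm)
  refine integral_congr_ae (ae_of_all _ fun s => ?_)
  simp only
  -- The substitution `t = s r`, by left invariance, identifies the inner integrals.
  rw [← integral_mul_left_eq_self (fun t => k t * (conj (k' s) * (l (t⁻¹ * s) * b (s⁻¹ * t)))) s]
  refine integral_congr_ae (ae_of_all _ fun r => ?_)
  simp only [mul_inv_rev, inv_mul_cancel_right, inv_mul_cancel_left]
  ring

include h hΔ

theorem totalSet_isRightBounded :
    TotalSet {f : Lp H 2 μ | ∃ R, IsRightBounded μ β φ Λ f R} := by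
  refine (totalSet_elemL2 μ (h.nsf.totalSet_rightBounded h.gns)).mono ?_
  rintro _ ⟨l, η, ⟨T, hT⟩, rfl⟩
  exact ⟨_, isRightBounded_rightOp h hΔ hT l⟩

/-- The multipliers are continuous and nowhere zero, and inversion preserves compact support. Thus
arbitrary convolution kernels are available in the separation argument. -/
theorem rightKer_surjective (k : C_c(G, ℂ)) : ∃ l, rightKer h hΔ l = k := by
  refine ⟨(k.mulLeft (fun r => ((√(Δ r) * (√(c r))⁻¹ : ℝ) : ℂ)) ?_).compInv, ?_⟩
  · exact Complex.continuous_ofReal.comp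
      (hΔ.continuous.sqrt.mul (h.cont.sqrt.inv₀ fun s => (Real.sqrt_pos.2 (h.pos s)).ne'))
  · ext r
    have h1 : ((√(Δ r) : ℝ) : ℂ) ≠ 0 := by
      exact_mod_cast (Real.sqrt_pos.2 (hΔ.pos r)).ne'
    have h2 : ((√(c r) : ℝ) : ℂ) ≠ 0 := by
      exact_mod_cast (Real.sqrt_pos.2 (h.pos r)).ne'
    simp only [rightKer, CompactlySupportedContinuousMap.mulLeft_apply,
      CompactlySupportedContinuousMap.compInv_apply, inv_inv]
    push_cast
    field_simp

/-- The operators `rightOp` for all kernels annihilate `ζ`, so a continuous coefficient of the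
translations of `J W ζ` integrates to `0` against every kernel and vanishes identically. This is
what makes the vector of a left multiplication operator unique. -/
theorem eq_zero_of_isRightBounded {ζ : Lp H 2 μ}
    (hζ : ∀ f R, IsRightBounded μ β φ Λ f R → R ζ = 0) : ζ = 0 := by
  have hs : TotalSet {v | ∃ η T w, WeightRightBounded φ Λ η T ∧ v = ContinuousLinearMap.adjoint T w} := by
    intro v hv
    refine h.nsf.eq_zero_of_rightBounded h.gns fun η T hT => ?_
    refine ext_inner_left ℂ fun w => ?_
    rw [← ContinuousLinearMap.adjoint_inner_left, hv _ ⟨η, T, w, hT, rfl⟩, inner_zero_right]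
  refine totalSet_elemL2 μ hs _ ?_
  rintro _ ⟨k', _, ⟨η, T, w, hT, rfl⟩, rfl⟩
  have hker : ∀ k : C_c(G, ℂ), rightOp h hΔ T k ζ = 0 := by
    intro k
    obtain ⟨l, rfl⟩ := rightKer_surjective h hΔ k
    exact hζ _ _ (isRightBounded_rightOp h hΔ hT l)
  -- At the unit of the group the unitaries cancel, leaving the inner product of `k' ⊗ T⋆ w` with
  -- `ζ`.
  have := eq_zero_of_integral_eq_zero μ (g := fun r => ⟪flipOp H hΔ (h.diag μ
      ((OpField.const G (ContinuousLinearMap.adjoint T)).op μ (elemL2 μ k' w))),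
      lamOp μ H r (flipOp H hΔ (h.diag μ ζ))⟫_ℂ) (continuous_const.inner (continuous_lamOp μ _))
    (fun k => by rw [← inner_rightOp, hker, inner_zero_right]) 1
  rwa [lamOp_one, one_apply_eq_self, inner_flipOp_flipOp, LinearIsometryEquiv.inner_map_map,
    const_op_elemL2] at this

end ExplicitRightBounded

/-! ### The dual weight, its GNS construction and the projection of a compact open subgroup -/

section DualWeight

open VonNeumannAlgebra
open scoped CompactlySupported ComplexConjugate

variable {H : Type u} [NormedAddCommGroup H] [InnerProductSpace ℂ H] [CompleteSpace H]
  [SecondCountableTopology H] {M : VonNeumannAlgebra H}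
  {G : Type v} [Group G] [TopologicalSpace G]
  {φ : M.Elt → ℝ≥0∞} {Λ : M.Elt → H} {β : VNAction G M} {c : G → ℝ}
  [IsTopologicalGroup G] [MeasurableSpace G] [BorelSpace G] [LocallyCompactSpace G]
  [T2Space G] [SecondCountableTopology G]
  {μ : Measure G} [μ.IsHaarMeasure]

namespace IsLeftMul

variable {x y : (crossedProduct μ β).Elt} {ζ ζ' : Lp H 2 μ}

theorem add (hx : IsLeftMul μ β φ Λ x ζ) (hy : IsLeftMul μ β φ Λ y ζ') :
    IsLeftMul μ β φ Λ (x + y) (ζ + ζ') := fun f R hR => by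
  rw [map_add, ← hx f R hR, ← hy f R hR]; rfl

theorem smul (hx : IsLeftMul μ β φ Λ x ζ) (r : ℂ) : IsLeftMul μ β φ Λ (r • x) (r • ζ) :=
  fun f R hR => by rw [map_smul, ← hx f R hR]; rfl

theorem left_mul (h : ScalesWeight φ Λ β c) (hx : IsLeftMul μ β φ Λ x ζ)
    (y : (crossedProduct μ β).Elt) :
    IsLeftMul μ β φ Λ (y * x) ((y : Lp H 2 μ →L[ℂ] Lp H 2 μ) ζ) := fun f R hR => by
  rw [← mul_apply_eq_comp, hR.commute h, mul_apply_eq_comp, ← hx f R hR]; rfl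

theorem unique (h : ScalesWeight φ Λ β c) {Δ : G → ℝ} (hΔ : IsModularFunction μ Δ)
    (hx : IsLeftMul μ β φ Λ x ζ) (hx' : IsLeftMul μ β φ Λ x ζ') : ζ = ζ' :=
  sub_eq_zero.1 (eq_zero_of_isRightBounded h hΔ fun f R hR => by
    rw [map_sub, ← hx f R hR, ← hx' f R hR, sub_self])

end IsLeftMul

variable (h : ScalesWeight φ Λ β c) {Δ : G → ℝ} (hΔ : IsModularFunction μ Δ)

include h hΔ

/-- Any competitor `y'` with `y'⋆ y' = y⋆ y` satisfies `y = w y'` for a contraction `w` in the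
crossed product. By uniqueness of vectors `ζ = w ζ'`, so no competitor has a smaller norm, and the
infimum is attained at `ζ`. -/
theorem dualWeight_eq {y : (crossedProduct μ β).Elt} {ζ : Lp H 2 μ}
    (hy : IsLeftMul μ β φ Λ y ζ) :
    dualWeight μ β φ Λ (star y * y) = ENNReal.ofReal (‖ζ‖ ^ 2) := by
  refine le_antisymm (iInf₂_le_of_le y ζ (iInf_le_of_le ⟨rfl, hy⟩ le_rfl)) ?_
  refine le_iInf fun y' => le_iInf fun ζ' => le_iInf fun hy' => ?_
  obtain ⟨w, hw, hwy⟩ := exists_contraction hy'.1.symm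
  have := (hy'.2.left_mul h w).unique h hΔ (hwy ▸ hy)
  rw [← this]
  exact ENNReal.ofReal_le_ofReal (by gcongr; exact hw _)

/-- Finiteness only provides a left bounded `y'` with the same modulus; writing `y = w y'` makes `y`
left bounded with vector `w ζ'`. -/
theorem mem_weightIdeal_dual {y : (crossedProduct μ β).Elt} :
    y ∈ weightIdeal (dualWeight μ β φ Λ) ↔ ∃ ζ, IsLeftMul μ β φ Λ y ζ := by
  constructor
  · intro hy
    simp only [weightIdeal, Set.mem_ofPred_eq, dualWeight, iInf_lt_iff] at hy
    obtain ⟨y', ζ', ⟨hy1, hy2⟩, -⟩ := hy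
    obtain ⟨w, -, hwy⟩ := exists_contraction hy1.symm
    exact ⟨_, hwy ▸ hy2.left_mul h w⟩
  · rintro ⟨ζ, hζ⟩
    change dualWeight μ β φ Λ _ < ⊤
    rw [dualWeight_eq h hΔ hζ]
    exact ENNReal.ofReal_lt_top

omit h hΔ in
/-- The GNS map of the dual weight. -/
def dualGNS (μ : Measure G) [μ.IsHaarMeasure] (β : VNAction G M) (φ : M.Elt → ℝ≥0∞) (Λ : M.Elt → H)
    (y : (crossedProduct μ β).Elt) : Lp H 2 μ := by
  classical exact if hy : ∃ ζ, IsLeftMul μ β φ Λ y ζ then hy.choose else 0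

omit h hΔ in
theorem isLeftMul_dualGNS {y : (crossedProduct μ β).Elt} (hy : ∃ ζ, IsLeftMul μ β φ Λ y ζ) :
    IsLeftMul μ β φ Λ y (dualGNS μ β φ Λ y) := by
  rw [dualGNS, dif_pos hy]; exact hy.choose_spec

theorem dualGNS_eq {y : (crossedProduct μ β).Elt} {ζ : Lp H 2 μ} (hy : IsLeftMul μ β φ Λ y ζ) :
    dualGNS μ β φ Λ y = ζ :=
  (isLeftMul_dualGNS ⟨ζ, hy⟩).unique h hΔ hy

/-- The left ideal of the dual weight. -/
def dualIdeal : Submodule ℂ (crossedProduct μ β).Elt where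
  carrier := weightIdeal (dualWeight μ β φ Λ)
  add_mem' ha hb := by
    rw [mem_weightIdeal_dual h hΔ] at ha hb ⊢
    exact ⟨_, ha.choose_spec.add hb.choose_spec⟩
  zero_mem' := (mem_weightIdeal_dual h hΔ).2 ⟨0, fun f R _ => (map_zero R).symm⟩
  smul_mem' r a ha := by
    rw [mem_weightIdeal_dual h hΔ] at ha ⊢
    exact ⟨_, ha.choose_spec.smul r⟩

/-- Linearity and multiplicativity follow from uniqueness of the vector; density holds because the
vectors `k ⊗ Λ(a)` occur. -/
theorem isGNS_dualGNS : IsGNS (dualWeight μ β φ Λ) (crossedProduct μ β).toStarSubalgebra.subtype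
    (dualGNS μ β φ Λ) := by
  have hmem := fun y => mem_weightIdeal_dual (y := y) h hΔ
  refine ⟨fun a b ha hb => ?_, fun r a ha => ?_, fun a ha => ?_, ?_, fun x a ha => ?_⟩
  · exact dualGNS_eq h hΔ ((isLeftMul_dualGNS ((hmem a).1 ha)).add (isLeftMul_dualGNS ((hmem b).1 hb)))
  · exact dualGNS_eq h hΔ ((isLeftMul_dualGNS ((hmem a).1 ha)).smul r)
  · exact dualWeight_eq h hΔ (isLeftMul_dualGNS ((hmem a).1 ha))
  · let S : Submodule ℂ (Lp H 2 μ) :=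
      { carrier := dualGNS μ β φ Λ '' weightIdeal (dualWeight μ β φ Λ)
        add_mem' := by
          rintro _ _ ⟨a, ha, rfl⟩ ⟨b, hb, rfl⟩
          exact ⟨a + b, (dualIdeal h hΔ).add_mem ha hb, dualGNS_eq h hΔ
            ((isLeftMul_dualGNS ((hmem a).1 ha)).add (isLeftMul_dualGNS ((hmem b).1 hb)))⟩
        zero_mem' := ⟨0, (dualIdeal h hΔ).zero_mem, dualGNS_eq h hΔ fun f R _ => (map_zero R).symm⟩
        smul_mem' := by
          rintro r _ ⟨a, ha, rfl⟩
          exact ⟨r • a, (dualIdeal h hΔ).smul_mem r ha, dualGNS_eq h hΔ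
            ((isLeftMul_dualGNS ((hmem a).1 ha)).smul r)⟩ }
    refine TotalSet.dense_of_submodule (S := S) ?_
    refine (totalSet_elemL2 μ h.gns.dense.totalSet).mono ?_
    rintro _ ⟨k, _, ⟨a, ha, rfl⟩, rfl⟩
    exact ⟨convPi μ β k a, (hmem _).2 ⟨_, isLeftMul_convPi k ha⟩,
      dualGNS_eq h hΔ (isLeftMul_convPi k ha)⟩
  · exact dualGNS_eq h hΔ ((isLeftMul_dualGNS ((hmem a).1 ha)).left_mul h x)

theorem dualWeightForm_eq {a b : (crossedProduct μ β).Elt}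
    (ha : a ∈ weightIdeal (dualWeight μ β φ Λ)) (hb : b ∈ weightIdeal (dualWeight μ β φ Λ)) :
    weightForm (dualWeight μ β φ Λ) a b = ⟪dualGNS μ β φ Λ a, dualGNS μ β φ Λ b⟫_ℂ :=
  (isGNS_dualGNS h hΔ).weightForm_eq (fun _ ha _ hb => (dualIdeal h hΔ).add_mem ha hb)
    (fun r _ ha => (dualIdeal h hΔ).smul_mem r ha) ha hb

omit h hΔ

section Projection

variable {K : Subgroup G} (hKo : IsOpen (K : Set G)) (hKc : IsCompact (K : Set G))

/-- The indicator function of a compact open subgroup. -/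
def indCc : C_c(G, ℂ) :=
  ⟨⟨(K : Set G).indicator 1, continuous_one.indicator (by
    have hcl : IsClopen (K : Set G) := ⟨K.isClosed_of_isOpen hKo, hKo⟩
    simp [hcl.frontier_eq])⟩,
    HasCompactSupport.of_support_subset_isCompact hKc Set.support_indicator_subset⟩

theorem indCc_apply_mem {t : G} (ht : t ∈ K) : indCc hKo hKc t = 1 :=
  Set.indicator_of_mem (s := (K : Set G)) ht 1

theorem indCc_apply_notMem {t : G} (ht : t ∉ K) : indCc hKo hKc t = 0 :=
  Set.indicator_of_notMem (s := (K : Set G)) ht 1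

theorem integral_indCc {E : Type*} [NormedAddCommGroup E] [NormedSpace ℂ E]
    (F : G → E) : ∫ t, indCc hKo hKc t • F t ∂μ = ∫ t in (K : Set G), F t ∂μ := by
  rw [← integral_indicator hKo.measurableSet]
  refine integral_congr_ae (ae_of_all _ fun t => ?_)
  by_cases ht : t ∈ K
  · simp only [indCc_apply_mem hKo hKc ht, one_smul]
    rw [Set.indicator_of_mem (s := (K : Set G)) ht]
  · simp only [indCc_apply_notMem hKo hKc ht, zero_smul]
    rw [Set.indicator_of_notMem (s := (K : Set G)) ht]

theorem convCc_indCc (f : Lp H 2 μ) :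
    convCc μ H (indCc hKo hKc) f = ∫ t in (K : Set G), lamOp μ H t f ∂μ :=
  integral_indCc hKo hKc fun t => lamOp μ H t f

variable (hμ : μ (K : Set G) = 1)

include hKo hμ in
theorem setIntegral_eq_of_const {E : Type*} [NormedAddCommGroup E] [NormedSpace ℝ E] [CompleteSpace E]
    {F : G → E} {x : E} (hF : ∀ t ∈ K, F t = x) : ∫ t in (K : Set G), F t ∂μ = x := by
  rw [setIntegral_congr_fun hKo.measurableSet (g := fun _ => x) hF, setIntegral_const, measureReal_def, hμ]
  simp

include hμ in
theorem convCc_indCc_of_fixed {f : Lp H 2 μ} (hf : ∀ t ∈ K, lamOp μ H t f = f) :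
    convCc μ H (indCc hKo hKc) f = f := by
  rw [convCc_indCc, setIntegral_eq_of_const hKo hμ hf]

theorem lamOp_convCc_indCc {g : G} (hg : g ∈ K) (f : Lp H 2 μ) :
    lamOp μ H g (convCc μ H (indCc hKo hKc) f) = convCc μ H (indCc hKo hKc) f := by
  refine lamOp_convOp μ _ _ g (fun t => ?_) f
  change (K : Set G).indicator (1 : G → ℂ) t = (K : Set G).indicator (1 : G → ℂ) (g⁻¹ * t)
  have : g⁻¹ * t ∈ K ↔ t ∈ K := K.mul_mem_cancel_left (K.inv_mem hg)
  by_cases ht : t ∈ K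
  · rw [Set.indicator_of_mem (s := (K : Set G)) ht, Set.indicator_of_mem (s := (K : Set G)) (this.2 ht)]
    rfl
  · rw [Set.indicator_of_notMem (s := (K : Set G)) ht,
      Set.indicator_of_notMem (s := (K : Set G)) (fun h => ht (this.1 h))]

/-- The adjoint of `λ(k)` is convolution by `t ↦ Δ(t)⁻¹ conj k(t⁻¹)`, which is the indicator
function itself since `K` is stable under inversion and `Δ` is `1` on it. -/
theorem inner_convCc_indCc (hΔ : IsModularFunction μ Δ) (hΔK : ∀ g ∈ K, Δ g = 1) (f f' : Lp H 2 μ) :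
    ⟪convCc μ H (indCc hKo hKc) f, f'⟫_ℂ = ⟪f, convCc μ H (indCc hKo hKc) f'⟫_ℂ := by
  rw [inner_convOp_left, inner_convOp, ← hΔ.integral_inv]
  refine integral_congr_ae (ae_of_all _ fun t => ?_)
  change (Δ t)⁻¹ • (conj (indCc hKo hKc t⁻¹) * ⟪lamOp μ H t⁻¹ f, f'⟫_ℂ) =
    indCc hKo hKc t * ⟪f, lamOp μ H t f'⟫_ℂ
  rw [inner_lamOp, inv_inv]
  by_cases ht : t ∈ K
  · rw [indCc_apply_mem hKo hKc ht, indCc_apply_mem hKo hKc (K.inv_mem ht), hΔK t ht]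
    simp
  · rw [indCc_apply_notMem hKo hKc ht, indCc_apply_notMem hKo hKc (fun h => ht (inv_mem_iff.1 h))]
    simp

variable {q : M.Elt} (hqK : ∀ g ∈ K, β.aut g q = q)

include hqK in
-- Every `λ_t` with `t ∈ K` commutes with `π(q)` by covariance, because `q` is fixed by `K`.
theorem convCc_indCc_piOp : convCc μ H (indCc hKo hKc) * β.piOp μ q =
    β.piOp μ q * convCc μ H (indCc hKo hKc) := by
  ext1 f
  rw [mul_apply_eq_comp, mul_apply_eq_comp, convCc_indCc, convCc_indCc,
    ← ContinuousLinearMap.integral_comp_comm]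
  · refine setIntegral_congr_fun hKo.measurableSet fun t ht => ?_
    rw [← mul_apply_eq_comp, lamOp_piOp, hqK t ht]
    rfl
  · exact (continuous_lamOp μ f).continuousOn.integrableOn_compact hKc

include hqK in
theorem crossedProj_eq : crossedProj μ β hKo hKc q = convPi μ β (indCc hKo hKc) q :=
  (convCc_indCc_piOp hKo hKc hqK).symm

include hqK hμ in
theorem isStarProjection_convPi (hΔ : IsModularFunction μ Δ) (hΔK : ∀ g ∈ K, Δ g = 1)
    (hq : IsStarProjection q) : IsStarProjection (convPi μ β (indCc hKo hKc) q) := by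
  set P := convCc μ H (indCc hKo hKc) with hP
  have hPs : star P = P := (ContinuousLinearMap.eq_adjoint_iff _ _).2
    (fun f f' => inner_convCc_indCc hKo hKc hΔ hΔK f f') |>.symm
  have hPP : P * P = P := by
    ext1 f
    exact convCc_indCc_of_fixed hKo hKc hμ fun t ht => lamOp_convCc_indCc hKo hKc ht f
  have hcomm : P * β.piOp μ q = β.piOp μ q * P := convCc_indCc_piOp hKo hKc hqK
  constructor
  · refine Subtype.ext ?_
    change (P * β.piOp μ q) * (P * β.piOp μ q) = P * β.piOp μ q
    calc (P * β.piOp μ q) * (P * β.piOp μ q) = (P * P) * (β.piOp μ q * β.piOp μ q) := by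
          rw [mul_assoc, ← mul_assoc (β.piOp μ q) P, ← hcomm]; simp only [mul_assoc]
      _ = P * β.piOp μ q := by rw [hPP, ← β.piOp_mul, hq.isIdempotentElem.eq]
  · refine Subtype.ext ?_
    change star (P * β.piOp μ q) = P * β.piOp μ q
    rw [star_mul, hPs, β.star_piOp, hq.isSelfAdjoint.star_eq, hcomm]

include hμ in
theorem norm_elemL2_indCc (ζ : H) : ‖elemL2 μ (indCc hKo hKc) ζ‖ = ‖ζ‖ := by
  have e : ⟪elemL2 μ (indCc hKo hKc) ζ, elemL2 μ (indCc hKo hKc) ζ⟫_ℂ = ⟪ζ, ζ⟫_ℂ := by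
    rw [L2.inner_def, ← setIntegral_eq_of_const hKo hμ (F := fun _ => ⟪ζ, ζ⟫_ℂ) fun _ _ => rfl,
      ← integral_indCc hKo hKc]
    refine integral_congr_ae ?_
    filter_upwards [coeFn_elemL2 μ (indCc hKo hKc) ζ] with t ht
    rw [ht]
    by_cases h : t ∈ K
    · simp [indCc_apply_mem hKo hKc h]
    · simp [indCc_apply_notMem hKo hKc h]
  rw [inner_self_eq_norm_sq_to_K, inner_self_eq_norm_sq_to_K] at e
  have e' : ‖elemL2 μ (indCc hKo hKc) ζ‖ ^ 2 = ‖ζ‖ ^ 2 := by exact_mod_cast e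
  exact (sq_eq_sq₀ (norm_nonneg _) (norm_nonneg _)).1 e'

include h hqK hμ in
-- The vector of the projection is `1_K ⊗ Λ(q)`, of norm `1` because `μ(K) = 1` and `φ(q) = 1`.
theorem dualWeight_convPi (hΔ : IsModularFunction μ Δ) (hΔK : ∀ g ∈ K, Δ g = 1)
    (hq : IsStarProjection q) (hq1 : φ q = 1) :
    dualWeight μ β φ Λ (convPi μ β (indCc hKo hKc) q) = 1 := by
  have hproj := isStarProjection_convPi (β := β) hKo hKc hμ hqK hΔ hΔK hq
  have e : star (convPi μ β (indCc hKo hKc) q) * convPi μ β (indCc hKo hKc) q =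
      convPi μ β (indCc hKo hKc) q := by
    rw [hproj.isSelfAdjoint.star_eq, hproj.isIdempotentElem.eq]
  have hqs : star q * q = q := by rw [hq.isSelfAdjoint.star_eq, hq.isIdempotentElem.eq]
  have hqm : q ∈ weightIdeal φ := by
    change φ _ < ⊤
    rw [hqs, hq1]; exact ENNReal.one_lt_top
  have := dualWeight_eq h hΔ (isLeftMul_convPi (indCc hKo hKc) hqm)
  rw [e, norm_elemL2_indCc hKo hKc hμ, ← h.gns.norm_sq q hqm, hqs, hq1] at this
  exact this

end Projection

end DualWeight

/-! ### The modular flow on the GNS space -/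

section ModularFlow

open VonNeumannAlgebra
open scoped CompactlySupported ComplexConjugate

variable {H : Type u} [NormedAddCommGroup H] [InnerProductSpace ℂ H] [CompleteSpace H]
  {M : VonNeumannAlgebra H} {φ : M.Elt → ℝ≥0∞} {Λ : M.Elt → H}

/-- The pairs `(Λ a, Λ a⋆)`. -/
def gnsPairs (φ : M.Elt → ℝ≥0∞) (Λ : M.Elt → H) : Set (H × H) :=
  {p | ∃ a ∈ weightIdeal φ, star a ∈ weightIdeal φ ∧ p = (Λ a, Λ (star a))}

theorem gnsPairs_swap {p : H × H} (hp : p ∈ gnsPairs φ Λ) : p.swap ∈ gnsPairs φ Λ := by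
  obtain ⟨a, ha, ha', rfl⟩ := hp
  exact ⟨star a, ha', by rwa [star_star], by simp⟩

/-- The normalizing factor `c(g)^(-1/2)` is real and therefore compatible with the involution. -/
theorem gnsPairs_rep {G : Type v} [Group G] [TopologicalSpace G] {β : VNAction G M} {c : G → ℝ}
    (h : ScalesWeight φ Λ β c) (g : G) {p : H × H} (hp : p ∈ gnsPairs φ Λ) :
    (h.rep g p.1, h.rep g p.2) ∈ gnsPairs φ Λ := by
  obtain ⟨a, ha, ha', rfl⟩ := hp
  have hs : star ((((√(c g))⁻¹ : ℝ) : ℂ) • β.aut g a) =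
      (((√(c g))⁻¹ : ℝ) : ℂ) • β.aut g (star a) := by
    rw [star_smul, map_star, RCLike.star_def, Complex.conj_ofReal]
  refine ⟨(((√(c g))⁻¹ : ℝ) : ℂ) • β.aut g a, h.nsf.smul_mem _ (h.aut_mem g ha), ?_, ?_⟩
  · rw [hs]
    exact h.nsf.smul_mem _ (h.aut_mem g ha')
  · rw [hs, h.gns.map_smul _ _ (h.aut_mem g ha), h.gns.map_smul _ _ (h.aut_mem g ha'),
      h.rep_gns g ha, h.rep_gns g ha']

theorem IsNSFWeight.totalSet_gnsPairs (hφ : IsNSFWeight M φ)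
    (hΛ : IsGNS φ M.toStarSubalgebra.subtype Λ) : TotalSet (Prod.fst '' gnsPairs φ Λ) := by
  refine (hφ.totalSet_selfadjoint hΛ).mono ?_
  rintro _ ⟨a, ha, ha', rfl⟩
  exact ⟨_, ⟨a, ha, ha', rfl⟩, rfl⟩

variable {σ : VNAction (Multiplicative ℝ) M}

theorem IsModularGroup.scalesWeight (hσ : IsModularGroup φ σ) (hφ : IsNSFWeight M φ)
    (hΛ : IsGNS φ M.toStarSubalgebra.subtype Λ) : ScalesWeight φ Λ σ fun _ => 1 where
  nsf := hφ
  gns := hΛ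
  pos _ := one_pos
  scale t x hx := by rw [hσ.1 t x hx]; simp
  mul _ _ := by simp
  cont := continuous_const

/-- The flow of unitaries implementing a flow of automorphisms. -/
def ScalesWeight.flow {c : Multiplicative ℝ → ℝ} (hs : ScalesWeight φ Λ σ c) : UnitaryFlow H where
  toFun t := hs.rep (Multiplicative.ofAdd t)
  map_zero' v := by rw [ofAdd_zero, map_one]; rfl
  map_add' s t v := by rw [ofAdd_add, map_mul]; rfl
  continuous' v := (hs.continuous_rep v).comp continuous_ofAdd

theorem ScalesWeight.flow_gns (hs : ScalesWeight φ Λ σ fun _ => 1)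
    (t : ℝ) {a : M.Elt} (ha : a ∈ weightIdeal φ) :
    hs.flow t (Λ a) = Λ (σ.aut (Multiplicative.ofAdd t) a) := by
  have := hs.rep_gns (Multiplicative.ofAdd t) ha
  rw [Real.sqrt_one, inv_one, Complex.ofReal_one, one_smul] at this
  exact this

theorem IsModularGroup.stripKMS (hσ : IsModularGroup φ σ)
    (hs : ScalesWeight φ Λ σ fun _ => 1) : hs.flow.StripKMS (gnsPairs φ Λ) := by
  rintro _ ⟨x, hx, hx', rfl⟩ _ ⟨y, hy, hy', rfl⟩
  obtain ⟨F, hF, hC, hFt⟩ := hσ.2 x y hx hx' hy hy'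
  refine ⟨F, hF, hC, fun t => ⟨?_, ?_⟩⟩
  · rw [(hFt t).1, hs.flow_gns t hx', ← map_star]
    exact hs.gns.weightForm_eq (fun _ ha _ hb => hs.nsf.add_mem ha hb) (fun r _ ha => hs.nsf.smul_mem r ha)
      (hs.aut_mem _ hx') hy
  · rw [(hFt t).2, hs.flow_gns t hx]
    exact hs.gns.weightForm_eq (fun _ ha _ hb => hs.nsf.add_mem ha hb) (fun r _ ha => hs.nsf.smul_mem r ha)
      hy' (hs.aut_mem _ hx)

variable {G : Type v} [Group G] [TopologicalSpace G] {β : VNAction G M} {c : G → ℝ}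

/-- The modular flow commutes with the unitary implementation of an action scaling the weight. -/
theorem IsModularGroup.flow_rep (hσ : IsModularGroup φ σ)
    (hs : ScalesWeight φ Λ σ fun _ => 1) (h : ScalesWeight φ Λ β c) (g : G) (t : ℝ) (v : H) :
    hs.flow t (h.rep g v) = h.rep g (hs.flow t v) := by
  -- The flow conjugated by the implementing unitary satisfies the KMS condition for the same pairs,
  -- since the unitary maps these pairs to such pairs. Uniqueness identifies both flows.
  let V' : UnitaryFlow H :=
    { toFun := fun t => ((h.rep g).trans (hs.flow t)).trans (h.rep g).symm
      map_zero' := fun v => by simp [hs.flow.map_zero']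
      map_add' := fun s t v => by simp [hs.flow.map_add']
      continuous' := fun v => (h.rep g).symm.continuous.comp (hs.flow.continuous' _) }
  have hV' : V'.StripKMS (gnsPairs φ Λ) := by
    intro p hp r hr
    obtain ⟨F, hF, hC, hFt⟩ := hσ.stripKMS hs _ (gnsPairs_rep h g hp) _ (gnsPairs_rep h g hr)
    refine ⟨F, hF, hC, fun t => ⟨?_, ?_⟩⟩
    · rw [(hFt t).1]
      change _ = ⟪(h.rep g).symm _, _⟫_ℂ
      rw [← (h.rep g).inner_map_map ((h.rep g).symm _), LinearIsometryEquiv.apply_symm_apply]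
      rfl
    · rw [(hFt t).2]
      change _ = ⟪_, (h.rep g).symm _⟫_ℂ
      rw [← (h.rep g).inner_map_map _ ((h.rep g).symm _), LinearIsometryEquiv.apply_symm_apply]
      rfl
  have := (hσ.stripKMS hs).unique hV' (fun t p hp => gnsPairs_rep hs _ hp) (fun t p hp => ?_)
    (fun p hp => gnsPairs_swap hp) (hs.nsf.totalSet_gnsPairs hs.gns) t v
  · rw [this]
    exact ((h.rep g).apply_symm_apply _).symm
  · have := gnsPairs_rep h g⁻¹ (gnsPairs_rep hs (Multiplicative.ofAdd t) (gnsPairs_rep h g hp))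
    simp only [← h.rep_symm] at this
    exact this

/-- Both actions are implemented by unitaries, and these commute. -/
theorem IsModularGroup.aut_comm (hσ : IsModularGroup φ σ)
    (hs : ScalesWeight φ Λ σ fun _ => 1) (h : ScalesWeight φ Λ β c) (g : G) (t : ℝ) (x : M.Elt) :
    σ.aut (Multiplicative.ofAdd t) (β.aut g x) = β.aut g (σ.aut (Multiplicative.ofAdd t) x) := by
  refine Subtype.ext ?_
  ext1 v
  obtain ⟨v, rfl⟩ := (hs.rep (Multiplicative.ofAdd t)).surjective v
  obtain ⟨v, rfl⟩ := (h.rep g).surjective v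
  have hc := hσ.flow_rep hs h g t
  change ∀ v, hs.rep (Multiplicative.ofAdd t) _ = h.rep g (hs.rep (Multiplicative.ofAdd t) _) at hc
  rw [← hs.rep_apply, ← h.rep_apply, hc, hc, ← h.rep_apply, ← hs.rep_apply]

end ModularFlow

/-! ### Flows on `L²(G, H)` twisted by phases -/

section TwistFlow

open VonNeumannAlgebra
open scoped CompactlySupported ComplexConjugate

variable {H : Type u} [NormedAddCommGroup H] [InnerProductSpace ℂ H] [CompleteSpace H]

/-- Multiplication by `exp (i θ)`. -/
def phase (H : Type u) [NormedAddCommGroup H] [InnerProductSpace ℂ H] (θ : ℝ) : H ≃ₗᵢ[ℂ] H where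
  toLinearEquiv := LinearEquiv.smulOfNeZero ℂ H (Complex.exp (Complex.I * θ)) (Complex.exp_ne_zero _)
  norm_map' v := by
    change ‖Complex.exp (Complex.I * θ) • v‖ = ‖v‖
    rw [norm_smul, mul_comm Complex.I, Complex.norm_exp_ofReal_mul_I, one_mul]

theorem phase_apply (θ : ℝ) (v : H) : phase H θ v = Complex.exp (Complex.I * θ) • v := rfl

theorem phase_symm_apply (θ : ℝ) (v : H) : (phase H θ).symm v = phase H (-θ) v := by
  rw [LinearIsometryEquiv.symm_apply_eq, phase_apply, phase_apply, smul_smul, ← Complex.exp_add]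
  simp

variable [SecondCountableTopology H]
  {G : Type v} [Group G] [TopologicalSpace G]
  [IsTopologicalGroup G] [MeasurableSpace G] [BorelSpace G] [LocallyCompactSpace G]
  [T2Space G] [SecondCountableTopology G]
  (μ : Measure G) [μ.IsHaarMeasure] (V : UnitaryFlow H) {ℓ : G → ℝ} (hℓ : Continuous ℓ)

/-- The decomposable unitary `(f s) ↦ exp (i t ℓ(s)) V_t f(s)`. -/
def twistUnitary (t : ℝ) : Lp H 2 μ ≃ₗᵢ[ℂ] Lp H 2 μ :=
  pwUnitary μ (fun s => (V t).trans (phase H (t * ℓ s)))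
    (fun v => by
      change Continuous fun s => Complex.exp (Complex.I * (t * ℓ s : ℝ)) • V t v
      fun_prop)
    (fun v => by
      change Continuous fun s => (V t).symm ((phase H (t * ℓ s)).symm v)
      simp only [phase_symm_apply, phase_apply]
      exact (V t).symm.continuous.comp (by fun_prop))

theorem coeFn_twistUnitary (t : ℝ) (f : Lp H 2 μ) :
    twistUnitary μ V hℓ t f =ᵐ[μ] fun s => Complex.exp (Complex.I * (t * ℓ s : ℝ)) • V t (f s) :=
  coeFn_pwUnitary μ _ _ _ f

theorem twistUnitary_elemL2 (t : ℝ) (k : C_c(G, ℂ)) (ζ : H) :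
    twistUnitary μ V hℓ t (elemL2 μ k ζ) =
      elemL2 μ (k.mulLeft (fun s => Complex.exp (Complex.I * (t * ℓ s : ℝ))) (by fun_prop)) (V t ζ) := by
  refine Lp.ext ?_
  filter_upwards [coeFn_twistUnitary μ V hℓ t (elemL2 μ k ζ), coeFn_elemL2 μ k ζ,
    coeFn_elemL2 μ (k.mulLeft (fun s => Complex.exp (Complex.I * (t * ℓ s : ℝ))) (by fun_prop)) (V t ζ)]
    with s h1 h2 h3
  rw [h1, h2, h3, map_smul, smul_smul]
  rfl

theorem inner_twistUnitary (t : ℝ) (a b : Lp H 2 μ) : ⟪a, twistUnitary μ V hℓ t b⟫_ℂ =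
    ∫ g, Complex.exp (Complex.I * (ℓ g * t)) * ⟪a g, V t (b g)⟫_ℂ ∂μ := by
  rw [L2.inner_def]
  refine integral_congr_ae ?_
  filter_upwards [coeFn_twistUnitary μ V hℓ t b] with s hs
  rw [hs, inner_smul_right]
  congr 3
  push_cast
  ring

theorem integrable_norm_mul_norm (a b : Lp H 2 μ) : Integrable (fun g => ‖a g‖ * ‖b g‖) μ :=
  (Lp.memLp a).norm.integrable_mul (Lp.memLp b).norm

theorem norm_twist_le (ℓ t : ℝ) (a b : H) :
    ‖Complex.exp (Complex.I * (ℓ * t)) * ⟪a, V t b⟫_ℂ‖ ≤ ‖a‖ * ‖b‖ := by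
  have : ‖Complex.exp (Complex.I * (ℓ * t))‖ = 1 := by
    rw [mul_comm]
    exact_mod_cast Complex.norm_exp_ofReal_mul_I (ℓ * t)
  rw [norm_mul, this, one_mul]
  refine (norm_inner_le_norm _ _).trans_eq ?_
  rw [LinearIsometryEquiv.norm_map]

/-- The flow `(f s) ↦ exp (i t ℓ(s)) V_t f(s)`. -/
def twistFlow : UnitaryFlow (Lp H 2 μ) where
  toFun := twistUnitary μ V hℓ
  map_zero' f := by
    refine Lp.ext ?_
    filter_upwards [coeFn_twistUnitary μ V hℓ 0 f] with s hs
    rw [hs, V.map_zero']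
    simp
  map_add' t t' f := by
    refine Lp.ext ?_
    filter_upwards [coeFn_twistUnitary μ V hℓ (t + t') f, coeFn_twistUnitary μ V hℓ t' f,
      coeFn_twistUnitary μ V hℓ t (twistUnitary μ V hℓ t' f)] with s h1 h2 h3
    rw [h1, h3, h2, map_smul, smul_smul, ← Complex.exp_add, V.map_add']
    congr 2
    push_cast
    ring
  continuous' := by
    -- Weak continuity follows by dominated convergence with the bound `‖a g‖ ‖b g‖`.
    refine continuous_of_weak_totalSet (s := Set.univ) (t := Set.univ)
      (fun v hv => inner_self_eq_zero.1 (hv v trivial))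
      (fun v hv => inner_self_eq_zero.1 (hv v trivial)) fun a _ b _ => ?_
    simp only [inner_twistUnitary]
    refine continuous_of_dominated (fun t => ?_) (fun t => ae_of_all _ fun g => norm_twist_le V _ _ _ _)
      (integrable_norm_mul_norm μ a b) (ae_of_all _ fun g => ?_)
    · have : Continuous fun g => Complex.exp (Complex.I * (ℓ g * t)) := by fun_prop
      exact this.aestronglyMeasurable.mul ((Lp.aestronglyMeasurable a).inner
        ((V t).continuous.comp_aestronglyMeasurable (Lp.aestronglyMeasurable b)))
    · have := V.continuous' (b g)
      fun_prop

theorem twistFlow_apply (t : ℝ) : twistFlow μ V hℓ t = twistUnitary μ V hℓ t := rfl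

theorem stronglyMeasurable_flow (δ : ℝ) (b : Lp H 2 μ) :
    StronglyMeasurable fun p : ℝ × G => V (δ * p.1) (b p.2) := by
  borelize H
  have hu : StronglyMeasurable (Function.uncurry fun (ζ : H) (t : ℝ) => V (δ * t) ζ) :=
    stronglyMeasurable_uncurry_of_continuous_of_stronglyMeasurable
      (fun t => (V (δ * t)).continuous)
      fun ζ => ((V.continuous' ζ).comp (by fun_prop)).stronglyMeasurable
  exact hu.comp_measurable
    (((Lp.stronglyMeasurable b).measurable.comp measurable_snd).prodMk measurable_fst)

/-- Fubini reduces smeared coefficients to the fibres, where the twist is an exponential `exp(i ℓ(g)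
t)` as in `StripKMS.integral_eq`. -/
theorem inner_smear_twistFlow (δ : ℝ) (z : ℂ) (a b : Lp H 2 μ) :
    ⟪a, ((twistFlow μ V hℓ).scale δ).smear z b⟫_ℂ =
      ∫ g, (∫ s : ℝ, gaussKer (s - z) *
        (Complex.exp (Complex.I * (ℓ g * (δ * s))) * ⟪a g, V (δ * s) (b g)⟫_ℂ)) ∂μ := by
  rw [UnitaryFlow.inner_smear_right, ← integral_integral_swap]
  · refine integral_congr_ae (ae_of_all _ fun s => ?_)
    simp only [UnitaryFlow.scale_apply]
    rw [twistFlow_apply, inner_twistUnitary, ← integral_const_mul]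
    push_cast
    rfl
  · have hn := integrable_norm_mul_norm μ a b
    refine ((integrable_norm_gaussKer z).mul_prod hn).mono' ?_ (ae_of_all _ fun p => ?_)
    · have h1 := stronglyMeasurable_flow μ V δ b
      have h2 : StronglyMeasurable fun p : ℝ × G => a p.2 :=
        (Lp.stronglyMeasurable a).comp_measurable measurable_snd
      have h3 : Continuous fun p : ℝ × G => gaussKer (p.1 - z) := by
        have := continuous_gaussKer
        fun_prop
      have h4 : Continuous fun p : ℝ × G => Complex.exp (Complex.I * (ℓ p.2 * (δ * p.1))) := by
        fun_prop
      exact (h3.stronglyMeasurable.mul (h4.stronglyMeasurable.mul (h2.inner h1))).aestronglyMeasurable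
    · simp only [Function.uncurry]
      rw [norm_mul]
      gcongr
      exact_mod_cast norm_twist_le V (ℓ p.2) (δ * p.1) (a p.2) (b p.2)

theorem inner_smear_twistFlow_left (δ : ℝ) (z : ℂ) (a b : Lp H 2 μ) :
    ⟪((twistFlow μ V hℓ).scale δ).smear z a, b⟫_ℂ =
      ∫ g, (∫ s : ℝ, gaussKer (s - conj z) *
        (Complex.exp (Complex.I * ((-ℓ g : ℝ) * (δ * s))) * ⟪V (δ * s) (a g), b g⟫_ℂ)) ∂μ := by
  rw [← inner_conj_symm, inner_smear_twistFlow, ← integral_conj]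
  refine integral_congr_ae (ae_of_all _ fun g => ?_)
  simp only
  rw [← integral_conj]
  refine integral_congr_ae (ae_of_all _ fun s => ?_)
  simp only [map_mul, ← gaussKer_conj, inner_conj_symm, ← Complex.exp_conj, map_sub, Complex.conj_ofReal,
    Complex.conj_I]
  congr 3
  push_cast
  ring

end TwistFlow

/-! ### The candidate for the modular group of the dual weight -/

section DualModular

open VonNeumannAlgebra
open scoped CompactlySupported ComplexConjugate

variable {H : Type u} [NormedAddCommGroup H] [InnerProductSpace ℂ H] [CompleteSpace H]
  [SecondCountableTopology H] {M : VonNeumannAlgebra H}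
  {G : Type v} [Group G] [TopologicalSpace G]
  {φ : M.Elt → ℝ≥0∞} {Λ : M.Elt → H} {β : VNAction G M} {c : G → ℝ}
  [IsTopologicalGroup G] [MeasurableSpace G] [BorelSpace G] [LocallyCompactSpace G]
  [T2Space G] [SecondCountableTopology G]
  {μ : Measure G} [μ.IsHaarMeasure] {Δ : G → ℝ} {σ : VNAction (Multiplicative ℝ) M}

theorem VNAction.aut_star {K : Type*} [NormedAddCommGroup K] [InnerProductSpace ℂ K] [CompleteSpace K]
    {N : VonNeumannAlgebra K} {Γ : Type*} [Group Γ] [TopologicalSpace Γ] (α : VNAction Γ N) (g : Γ)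
    (x : N.Elt) : α.aut g (star x) = star (α.aut g x) := map_star (α.aut g) x

/-- The logarithm of the function `c Δ`. -/
def modLog (c Δ : G → ℝ) (s : G) : ℝ := Real.log (c s * Δ s)

section ModLog

variable (h : ScalesWeight φ Λ β c) (hΔ : IsModularFunction μ Δ)

include h hΔ

theorem continuous_modLog : Continuous (modLog c Δ) :=
  (h.cont.mul hΔ.continuous).log fun s => (mul_pos (h.pos s) (hΔ.pos s)).ne'

theorem modLog_mul (g s : G) : modLog c Δ (g * s) = modLog c Δ g + modLog c Δ s := by
  simp only [modLog]
  rw [h.mul, hΔ.mul, mul_mul_mul_comm, Real.log_mul]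
  · exact (mul_pos (h.pos g) (hΔ.pos g)).ne'
  · exact (mul_pos (h.pos s) (hΔ.pos s)).ne'

theorem modLog_inv (s : G) : modLog c Δ s⁻¹ = -modLog c Δ s := by
  simp only [modLog]
  rw [h.map_inv, hΔ.map_inv', ← mul_inv, Real.log_inv]

theorem exp_modLog (s : G) : Real.exp (modLog c Δ s) = c s * Δ s :=
  Real.exp_log (mul_pos (h.pos s) (hΔ.pos s))

end ModLog

variable (h : ScalesWeight φ Λ β c) (hΔ : IsModularFunction μ Δ)

/-- The flow implementing the modular group of the dual weight. -/
def dualFlow (hs : ScalesWeight φ Λ σ fun _ => 1) : UnitaryFlow (Lp H 2 μ) :=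
  twistFlow μ hs.flow (continuous_modLog h hΔ)

variable (hσ : IsModularGroup φ σ) (hs : ScalesWeight φ Λ σ fun _ => 1)

theorem coeFn_dualFlow (t : ℝ) (f : Lp H 2 μ) : dualFlow h hΔ hs t f =ᵐ[μ]
    fun s => Complex.exp (Complex.I * (t * modLog c Δ s : ℝ)) • hs.flow t (f s) :=
  coeFn_twistUnitary μ _ (continuous_modLog h hΔ) t f

include hσ in
-- The phases are scalars in each fibre, and the modular group of `φ` commutes with the
-- automorphisms `β_{s⁻¹}`.
theorem dualFlow_piOp (t : ℝ) (x : M.Elt) (f : Lp H 2 μ) :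
    dualFlow h hΔ hs t (β.piOp μ x f) =
      β.piOp μ (σ.aut (Multiplicative.ofAdd t) x) (dualFlow h hΔ hs t f) := by
  refine Lp.ext ?_
  filter_upwards [coeFn_dualFlow h hΔ hs t (β.piOp μ x f), coeFn_dualFlow h hΔ hs t f,
    β.coeFn_piOp μ x f, β.coeFn_piOp μ (σ.aut (Multiplicative.ofAdd t) x) (dualFlow h hΔ hs t f)]
    with s h1 h2 h3 h4
  rw [h1, h3, h4, h2, map_smul, ← hσ.aut_comm hs h]
  exact congrArg _ (hs.rep_apply _ _ _)

/-- Since `c Δ` is a character, shifting the phase by `g` leaves the constant `(c Δ)(g)^(it)`. This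
constant is `1` on a subgroup where `c` and `Δ` are trivial. -/
theorem dualFlow_lamOp (t : ℝ) (g : G) (f : Lp H 2 μ) :
    dualFlow h hΔ hs t (lamOp μ H g f) =
      Complex.exp (Complex.I * (t * modLog c Δ g : ℝ)) • lamOp μ H g (dualFlow h hΔ hs t f) := by
  refine Lp.ext ?_
  filter_upwards [coeFn_dualFlow h hΔ hs t (lamOp μ H g f), coeFn_lamOp μ g f,
    coeFn_lamOp μ g (dualFlow h hΔ hs t f), ae_mul_left μ (coeFn_dualFlow h hΔ hs t f) g⁻¹,
    Lp.coeFn_smul (Complex.exp (Complex.I * (t * modLog c Δ g : ℝ)))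
      (lamOp μ H g (dualFlow h hΔ hs t f))] with s h1 h2 h3 h4 h5
  rw [h1, h2, h5, Pi.smul_apply, h3, h4, smul_smul, ← Complex.exp_add, modLog_mul h hΔ, modLog_inv h hΔ]
  congr 2
  push_cast
  ring

theorem dualFlow_convCc (t : ℝ) (k : C_c(G, ℂ)) (f : Lp H 2 μ) :
    dualFlow h hΔ hs t (convCc μ H (k.mulLeft
      (fun s => Complex.exp (Complex.I * ((-t) * modLog c Δ s : ℝ)))
        (by have := continuous_modLog h hΔ; fun_prop)) f) =
      convCc μ H k (dualFlow h hΔ hs t f) := by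
  rw [convOp_apply, convOp_apply]
  refine ((dualFlow h hΔ hs t).toContinuousLinearEquiv : Lp H 2 μ →L[ℂ] Lp H 2 μ).integral_comp_comm
    (integrable_conv μ (CompactlySupportedContinuousMap.integrable' _ _) f) |>.symm.trans ?_
  refine integral_congr_ae (ae_of_all _ fun g => ?_)
  change dualFlow h hΔ hs t ((Complex.exp (Complex.I * ((-t) * modLog c Δ g : ℝ)) * k g) •
    lamOp μ H g f) = k g • lamOp μ H g (dualFlow h hΔ hs t f)
  rw [map_smul, dualFlow_lamOp, smul_smul]
  congr 1
  rw [mul_comm (Complex.exp _), mul_assoc, ← Complex.exp_add]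
  simp

include hσ in
-- Under the flow `λ_g` picks up the phase `(c Δ)(g)^(it)`, and this cancels the phase that the
-- inverse flow puts on `k` in `k ⊗ Λ(a)`; the remaining factor `π(a)` is moved along the modular
-- group of `φ` and back.
theorem IsRightBounded.dualFlow {f : Lp H 2 μ} {R : Lp H 2 μ →L[ℂ] Lp H 2 μ}
    (hR : IsRightBounded μ β φ Λ f R) (t : ℝ) :
    IsRightBounded μ β φ Λ (dualFlow h hΔ hs t f) (conjCLM (dualFlow h hΔ hs t) R) := by
  intro k a ha
  have e1 : (_root_.dualFlow h hΔ hs t).symm (elemL2 μ k (Λ a)) = elemL2 μ (k.mulLeft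
      (fun s => Complex.exp (Complex.I * ((-t) * modLog c Δ s : ℝ)))
        (by have := continuous_modLog h hΔ; fun_prop)) (Λ (σ.aut (Multiplicative.ofAdd (-t)) a)) := by
    have : (_root_.dualFlow h hΔ hs t).symm (elemL2 μ k (Λ a)) =
        _root_.dualFlow h hΔ hs (-t) (elemL2 μ k (Λ a)) := by
      rw [LinearIsometryEquiv.symm_apply_eq, ← UnitaryFlow.map_add', add_neg_cancel,
        UnitaryFlow.map_zero']
    rw [this, ← hs.flow_gns _ ha]
    exact twistUnitary_elemL2 μ _ (continuous_modLog h hΔ) _ _ _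
  rw [conjCLM_apply, e1, hR _ _ (hs.aut_mem _ ha), dualFlow_convCc h hΔ hs, dualFlow_piOp h hΔ hσ hs]
  congr 3
  rw [← σ.aut_mul, ← ofAdd_add, add_neg_cancel, ofAdd_zero, σ.aut_one]

/-- The modular group of the dual weight. -/
def dualModular : VNAction (Multiplicative ℝ) (crossedProduct μ β) :=
  VNAction.ofUnitary
    { toFun := fun t => dualFlow h hΔ hs t.toAdd
      map_one' := by ext1 v; exact (dualFlow h hΔ hs).map_zero' v
      map_mul' := fun s t => by ext1 v; exact (dualFlow h hΔ hs).map_add' _ _ v }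
    (fun v => ((dualFlow h hΔ hs).continuous' v).comp continuous_toAdd)
    (fun t x hx => by
      refine conjCLM_mem_of_generated (dualFlow h hΔ hs t.toAdd) ?_ hx
      rintro _ (⟨x, rfl⟩ | ⟨g, rfl⟩)
      · have : conjCLM (dualFlow h hΔ hs t.toAdd) (β.piOp μ x) = β.piOp μ (σ.aut t x) := by
          ext1 f
          rw [conjCLM_apply, dualFlow_piOp h hΔ hσ hs, LinearIsometryEquiv.apply_symm_apply]
          rfl
        change conjCLM (dualFlow h hΔ hs t.toAdd) (β.piOp μ x) ∈ _
        rw [this]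
        exact piOp_mem μ β _
      · have : conjCLM (dualFlow h hΔ hs t.toAdd) (lamOp μ H g) =
            Complex.exp (Complex.I * (t.toAdd * modLog c Δ g : ℝ)) • lamOp μ H g := by
          ext1 f
          rw [conjCLM_apply, dualFlow_lamOp, LinearIsometryEquiv.apply_symm_apply]
          rfl
        change conjCLM (dualFlow h hΔ hs t.toAdd) (lamOp μ H g) ∈ _
        rw [this]
        exact SMulMemClass.smul_mem _ (lamOp_mem μ β g))

theorem coe_dualModular (t : Multiplicative ℝ) (y : (crossedProduct μ β).Elt) :
    ((dualModular h hΔ hσ hs).aut t y : Lp H 2 μ →L[ℂ] Lp H 2 μ) =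
      conjCLM (dualFlow h hΔ hs t.toAdd) y := rfl

theorem IsLeftMul.dualModular {y : (crossedProduct μ β).Elt} {ζ : Lp H 2 μ}
    (hy : IsLeftMul μ β φ Λ y ζ) (t : Multiplicative ℝ) :
    IsLeftMul μ β φ Λ ((dualModular h hΔ hσ hs).aut t y) (dualFlow h hΔ hs t.toAdd ζ) := by
  intro f R hR
  have e : ∀ f, (dualFlow h hΔ hs t.toAdd).symm f = dualFlow h hΔ hs (-t.toAdd) f := fun f => by
    rw [LinearIsometryEquiv.symm_apply_eq, ← UnitaryFlow.map_add', add_neg_cancel,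
      UnitaryFlow.map_zero']
  have := hy _ _ (hR.dualFlow h hΔ hσ hs (-t.toAdd))
  rw [conjCLM_apply, ← e, ← e, LinearIsometryEquiv.eq_symm_apply] at this
  rw [coe_dualModular, conjCLM_apply, this]
  congr 1
  rw [LinearIsometryEquiv.symm_apply_eq, ← e, LinearIsometryEquiv.symm_apply_apply]

/-- Conjugation carries left bounded vectors to left bounded vectors of the same norm, which gives
one inequality; the inverse time gives the other. -/
theorem dualWeight_dualModular (t : Multiplicative ℝ) (x : (crossedProduct μ β).Elt) :
    dualWeight μ β φ Λ ((dualModular h hΔ hσ hs).aut t x) = dualWeight μ β φ Λ x := by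
  have hle : ∀ t x, dualWeight μ β φ Λ ((dualModular h hΔ hσ hs).aut t x) ≤ dualWeight μ β φ Λ x := by
    intro t x
    refine le_iInf fun y => le_iInf fun ζ => le_iInf fun hy => ?_
    refine iInf₂_le_of_le ((dualModular h hΔ hσ hs).aut t y) _
      (iInf_le_of_le ⟨?_, hy.2.dualModular h hΔ hσ hs t⟩ ?_)
    · rw [VNAction.star_mul_aut, hy.1]
    · rw [LinearIsometryEquiv.norm_map]
  refine le_antisymm (hle t x) ?_
  have := hle t⁻¹ ((dualModular h hΔ hσ hs).aut t x)
  rwa [← VNAction.aut_mul, inv_mul_cancel, VNAction.aut_one] at this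

/-- The pairs of vectors of `y` and `y⋆`, for the left Hilbert algebra of the dual weight. -/
def leftPairs (μ : Measure G) [μ.IsHaarMeasure] (β : VNAction G M) (φ : M.Elt → ℝ≥0∞)
    (Λ : M.Elt → H) : Set (Lp H 2 μ × Lp H 2 μ) :=
  {p | ∃ y, IsLeftMul μ β φ Λ y p.1 ∧ IsLeftMul μ β φ Λ (star y) p.2}

/-- The pairs `(R_g⋆ f, R_f⋆ g)` for right bounded vectors `f` and `g`. -/
def rightPairs (μ : Measure G) [μ.IsHaarMeasure] (β : VNAction G M) (φ : M.Elt → ℝ≥0∞)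
    (Λ : M.Elt → H) : Set (Lp H 2 μ × Lp H 2 μ) :=
  {p | ∃ f R g S, IsRightBounded μ β φ Λ f R ∧ IsRightBounded μ β φ Λ g S ∧
    p = (ContinuousLinearMap.adjoint S f, ContinuousLinearMap.adjoint R g)}

/-- The pairs with `h(s) = Λ(x_s)` and `h'(s⁻¹) = Δ(s) Λ(β_s(x_s⋆))`. -/
def fieldPairs (μ : Measure G) (β : VNAction G M) (φ : M.Elt → ℝ≥0∞)
    (Λ : M.Elt → H) (Δ : G → ℝ) : Set (Lp H 2 μ × Lp H 2 μ) :=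
  {p | ∀ᵐ s ∂μ, ∃ x ∈ weightIdeal φ, star x ∈ weightIdeal φ ∧ p.1 s = Λ x ∧
    p.2 s⁻¹ = ((Δ s : ℝ) : ℂ) • Λ (β.aut s (star x))}

include hσ in
theorem stablePairs_leftPairs : (dualFlow h hΔ hs).StablePairs (leftPairs μ β φ Λ) where
  swap := by
    rintro p ⟨y, h1, h2⟩
    exact ⟨star y, h2, by rwa [star_star]⟩
  smul := by
    rintro r p ⟨y, h1, h2⟩
    exact ⟨r • y, h1.smul r, by rw [star_smul]; exact h2.smul _⟩
  flow := by
    rintro t p ⟨y, h1, h2⟩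
    exact ⟨_, h1.dualModular h hΔ hσ hs (Multiplicative.ofAdd t), by
      rw [← VNAction.aut_star]
      exact h2.dualModular h hΔ hσ hs (Multiplicative.ofAdd t)⟩

theorem adjoint_conjCLM {K : Type*} [NormedAddCommGroup K] [InnerProductSpace ℂ K] [CompleteSpace K]
    (W : K ≃ₗᵢ[ℂ] K) (R : K →L[ℂ] K) (v : K) :
    ContinuousLinearMap.adjoint (conjCLM W R) (W v) = W (ContinuousLinearMap.adjoint R v) := by
  rw [← ContinuousLinearMap.star_eq_adjoint, ← conjCLM_star, conjCLM_apply,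
    LinearIsometryEquiv.symm_apply_apply]
  rfl

include hσ in
theorem stablePairs_rightPairs : (dualFlow h hΔ hs).StablePairs (rightPairs μ β φ Λ) where
  swap := by
    rintro _ ⟨f, R, g, S, hf, hg, rfl⟩
    exact ⟨g, S, f, R, hg, hf, rfl⟩
  smul := by
    rintro r _ ⟨f, R, g, S, hf, hg, rfl⟩
    refine ⟨r • f, r • R, g, S, fun k a ha => ?_, hg, ?_⟩
    · rw [map_smul, map_smul, ← hf k a ha]; rfl
    · rw [LinearIsometryEquiv.map_smulₛₗ ContinuousLinearMap.adjoint r R, map_smul]; rfl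
  flow := by
    rintro t _ ⟨f, R, g, S, hf, hg, rfl⟩
    refine ⟨_, _, _, _, hf.dualFlow h hΔ hσ hs t, hg.dualFlow h hΔ hσ hs t, ?_⟩
    rw [adjoint_conjCLM, adjoint_conjCLM]

include h hΔ in
-- A vector `v` orthogonal to all `S⋆ f` has `S v` orthogonal to the total set of right bounded
-- vectors, so all right multiplications kill `v`.
theorem totalSet_rightPairs : TotalSet (Prod.fst '' rightPairs μ β φ Λ) := by
  intro v hv
  refine eq_zero_of_isRightBounded h hΔ fun g S hg => ?_
  refine totalSet_isRightBounded h hΔ _ ?_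
  rintro f ⟨R, hf⟩
  rw [← ContinuousLinearMap.adjoint_inner_left]
  exact hv _ ⟨_, ⟨f, R, g, S, hf, hg, rfl⟩, rfl⟩

/-- Both sides equal `⟪g, y f⟫`: the right multiplication applied to the vector of `y` is `y`
applied to the right bounded vector. -/
theorem inner_leftPairs_rightPairs {p x : Lp H 2 μ × Lp H 2 μ} (hp : p ∈ leftPairs μ β φ Λ)
    (hx : x ∈ rightPairs μ β φ Λ) : ⟪x.2, p.1⟫_ℂ = ⟪p.2, x.1⟫_ℂ := by
  obtain ⟨f, R, g, S, hf, hg, rfl⟩ := hx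
  obtain ⟨y, h1, h2⟩ := hp
  rw [ContinuousLinearMap.adjoint_inner_left, ContinuousLinearMap.adjoint_inner_right, ← h1 f R hf,
    ← h2 g S hg]
  exact (ContinuousLinearMap.adjoint_inner_left _ _ _).symm

theorem rightPairs_subset_dualPairs :
    rightPairs μ β φ Λ ⊆ UnitaryFlow.dualPairs (leftPairs μ β φ Λ) :=
  fun _ hx _ hp => inner_leftPairs_rightPairs hp hx

theorem leftPairs_subset_dualPairs :
    leftPairs μ β φ Λ ⊆ UnitaryFlow.dualPairs (rightPairs μ β φ Λ) := fun _ hp _ hx =>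
  (inner_leftPairs_rightPairs hp hx).symm

end DualModular

/-! ### The KMS condition for the dual weight -/

section DualKMS

open VonNeumannAlgebra
open scoped CompactlySupported ComplexConjugate

namespace UnitaryFlow

variable {K : Type u} [NormedAddCommGroup K] [InnerProductSpace ℂ K] [CompleteSpace K]
  {V : UnitaryFlow K} {P Q : Set (K × K)}

theorem StablePairs.inter (hP : V.StablePairs P) (hQ : V.StablePairs Q) : V.StablePairs (P ∩ Q) where
  swap p hp := ⟨hP.swap p hp.1, hQ.swap p hp.2⟩
  smul r p hp := ⟨hP.smul r p hp.1, hQ.smul r p hp.2⟩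
  flow t p hp := ⟨hP.flow t p hp.1, hQ.flow t p hp.2⟩

theorem StablePairs.scale (hP : V.StablePairs P) (δ : ℝ) : (V.scale δ).StablePairs P where
  swap := hP.swap
  smul := hP.smul
  flow t p hp := hP.flow (δ * t) p hp

end UnitaryFlow

variable {H : Type u} [NormedAddCommGroup H] [InnerProductSpace ℂ H] [CompleteSpace H]
  [SecondCountableTopology H] {M : VonNeumannAlgebra H}
  {G : Type v} [Group G] [TopologicalSpace G]
  {φ : M.Elt → ℝ≥0∞} {Λ : M.Elt → H} {β : VNAction G M} {c : G → ℝ}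
  [IsTopologicalGroup G] [MeasurableSpace G] [BorelSpace G] [LocallyCompactSpace G]
  [T2Space G] [SecondCountableTopology G]
  {μ : Measure G} [μ.IsHaarMeasure] {Δ : G → ℝ} {σ : VNAction (Multiplicative ℝ) M}
  (h : ScalesWeight φ Λ β c) (hΔ : IsModularFunction μ Δ)
  (hσ : IsModularGroup φ σ) (hs : ScalesWeight φ Λ σ fun _ => 1)

include h hΔ in
-- The element over `s` in the exchanged pair is `Δ(s⁻¹) β_{s⁻¹}(x⋆)`, with `x` taken over `s⁻¹`.
theorem fieldPairs_swap {p : Lp H 2 μ × Lp H 2 μ} (hp : p ∈ fieldPairs μ β φ Λ Δ) :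
    p.swap ∈ fieldPairs μ β φ Λ Δ := by
  change ∀ᵐ s ∂μ, _
  filter_upwards [hΔ.quasiMeasurePreserving_inv.ae hp] with s hs
  obtain ⟨x, hx, hx', h1, h2⟩ := hs
  have e : star ((((Δ s⁻¹ : ℝ)) : ℂ) • β.aut s⁻¹ (star x)) = ((Δ s⁻¹ : ℝ) : ℂ) • β.aut s⁻¹ x := by
    rw [star_smul, β.aut_star, star_star, RCLike.star_def, Complex.conj_ofReal]
  refine ⟨((Δ s⁻¹ : ℝ) : ℂ) • β.aut s⁻¹ (star x), h.nsf.smul_mem _ (h.aut_mem _ hx'), ?_, ?_, ?_⟩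
  · rw [e]
    exact h.nsf.smul_mem _ (h.aut_mem _ hx)
  · rw [h.gns.map_smul _ _ (h.aut_mem _ hx'), ← h2, inv_inv]
    rfl
  · rw [e, map_smul, β.aut_aut_inv, h.gns.map_smul _ _ hx, smul_smul, ← Complex.ofReal_mul,
      hΔ.map_inv', mul_inv_cancel₀ (hΔ.pos s).ne', Complex.ofReal_one, one_smul]
    exact h1

include hσ in
theorem stablePairs_fieldPairs : (dualFlow h hΔ hs).StablePairs (fieldPairs μ β φ Λ Δ) where
  swap _ := fieldPairs_swap h hΔ
  smul := by
    intro r p hp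
    change ∀ᵐ s ∂μ, _
    filter_upwards [hp, Lp.coeFn_smul r p.1,
      hΔ.quasiMeasurePreserving_inv.ae (Lp.coeFn_smul (conj r) p.2)] with s hs h3 h4
    obtain ⟨x, hx, hx', h1, h2⟩ := hs
    refine ⟨r • x, h.nsf.smul_mem _ hx, ?_, ?_, ?_⟩
    · rw [star_smul]
      exact h.nsf.smul_mem _ hx'
    · rw [h3, Pi.smul_apply, h1, h.gns.map_smul _ _ hx]
    · rw [h4, Pi.smul_apply, h2, star_smul, map_smul, h.gns.map_smul _ _ (h.aut_mem _ hx'), smul_comm]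
      rfl
  flow := by
    intro t p hp
    change ∀ᵐ s ∂μ, _
    filter_upwards [hp, coeFn_dualFlow h hΔ hs t p.1,
      hΔ.quasiMeasurePreserving_inv.ae (coeFn_dualFlow h hΔ hs t p.2)] with s hs' h3 h4
    obtain ⟨x, hx, hx', h1, h2⟩ := hs'
    have e : star (Complex.exp (Complex.I * (t * modLog c Δ s : ℝ)) •
        σ.aut (Multiplicative.ofAdd t) x) = Complex.exp (Complex.I * (t * -modLog c Δ s : ℝ)) •
          σ.aut (Multiplicative.ofAdd t) (star x) := by
      rw [star_smul, σ.aut_star, RCLike.star_def, ← Complex.exp_conj]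
      congr 2
      simp
    refine ⟨Complex.exp (Complex.I * (t * modLog c Δ s : ℝ)) • σ.aut (Multiplicative.ofAdd t) x,
      h.nsf.smul_mem _ (hs.aut_mem _ hx), ?_, ?_, ?_⟩
    · rw [e]
      exact h.nsf.smul_mem _ (hs.aut_mem _ hx')
    · rw [h3, h1, h.gns.map_smul _ _ (hs.aut_mem _ hx), hs.flow_gns t hx]
    · rw [h4, h2, e, map_smul, map_smul, h.gns.map_smul _ _ (h.aut_mem _ (hs.aut_mem _ hx')),
        hs.flow_gns t (h.aut_mem _ hx'), hσ.aut_comm hs h, modLog_inv h hΔ, smul_comm]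

include h in
theorem inner_gns_aut (g : G) {a b : M.Elt} (ha : a ∈ weightIdeal φ) (hb : b ∈ weightIdeal φ) :
    ⟪Λ (β.aut g a), Λ (β.aut g b)⟫_ℂ = (c g : ℂ) * ⟪Λ a, Λ b⟫_ℂ := by
  have hc := Real.sqrt_pos.2 (h.pos g)
  have e : ∀ a ∈ weightIdeal φ, Λ (β.aut g a) = ((√(c g) : ℝ) : ℂ) • h.rep g (Λ a) := fun a ha => by
    rw [h.rep_gns _ ha, smul_smul, ← Complex.ofReal_mul, mul_inv_cancel₀ hc.ne', Complex.ofReal_one,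
      one_smul]
  rw [e a ha, e b hb, inner_smul_left, inner_smul_right, LinearIsometryEquiv.inner_map_map, ← mul_assoc,
    Complex.conj_ofReal, ← Complex.ofReal_mul, Real.mul_self_sqrt (h.pos g).le]

include hσ in
-- Fibre by fibre this is the KMS condition of `φ` for the two elements over `g`. The twist gives
-- the factor `c Δ`; on the other side the inversion gives `Δ⁻¹`, the two second components give
-- `Δ²`, and the scaling of inner products under `β_g` gives `c`. The factors agree, which is the
-- reason for the choice of the character `c Δ`.
theorem kms_fieldPairs {δ : ℝ} (hδ : 0 < δ) :
    ((dualFlow h hΔ hs).scale δ).KMS δ⁻¹ (fieldPairs μ β φ Λ Δ) := by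
  intro p hp r hr z
  rw [dualFlow, inner_smear_twistFlow_left, inner_smear_twistFlow, ← hΔ.integral_inv (fun g =>
    ∫ s : ℝ, gaussKer (s - z) * (Complex.exp (Complex.I * (modLog c Δ g * (δ * s))) *
      ⟪r.2 g, hs.flow (δ * s) (p.1 g)⟫_ℂ))]
  refine integral_congr_ae ?_
  filter_upwards [fieldPairs_swap h hΔ hp, hr] with g h1 h2
  obtain ⟨w, hw, hw', h3, h4⟩ := h1
  obtain ⟨y, hy, hy', h5, h6⟩ := h2
  simp only [Prod.fst_swap, Prod.snd_swap] at h3 h4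
  have key := (hσ.stripKMS hs).integral_eq hδ (-modLog c Δ g)
    (p := (Λ (star w), Λ w)) (r := (Λ y, Λ (star y)))
    ⟨star w, hw', by rwa [star_star], by rw [star_star]⟩ ⟨y, hy, hy', rfl⟩ z
  have ez : conj (conj z - ((δ⁻¹ : ℝ) : ℂ) * Complex.I) = z + ((δ⁻¹ : ℝ) : ℂ) * Complex.I := by simp
  simp only [ez, h3, h5, h4, h6]
  rw [key, ← integral_const_mul, ← integral_smul]
  refine integral_congr_ae (ae_of_all _ fun s => ?_)
  have e1 : Complex.exp (-((-modLog c Δ g : ℝ) : ℂ)) = (c g : ℂ) * (Δ g : ℂ) := by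
    rw [← Complex.ofReal_neg, neg_neg, ← Complex.ofReal_exp, exp_modLog h hΔ, Complex.ofReal_mul]
  have e2 : ⟪((Δ g : ℝ) : ℂ) • Λ (β.aut g (star y)),
      hs.flow (δ * s) (((Δ g : ℝ) : ℂ) • Λ (β.aut g (star w)))⟫_ℂ =
      (Δ g : ℂ) * ((Δ g : ℂ) * ((c g : ℂ) * ⟪Λ (star y), hs.flow (δ * s) (Λ (star w))⟫_ℂ)) := by
    rw [map_smul, hs.flow_gns _ (h.aut_mem _ hw'), hs.flow_gns _ hw', hσ.aut_comm hs h,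
      inner_smul_left, inner_smul_right, Complex.conj_ofReal,
      inner_gns_aut h g hy' (hs.aut_mem _ hw')]
  have hne : (Δ g : ℂ) ≠ 0 := by exact_mod_cast (hΔ.pos g).ne'
  simp only [e1, e2, modLog_inv h hΔ, Complex.real_smul]
  push_cast
  field_simp

include h hΔ in
-- The vectors of `λ(k) π(a)` with `a` and `a⋆` in the left ideal of `φ` belong to both families.
theorem totalSet_pairs :
    TotalSet (Prod.fst '' (fieldPairs μ β φ Λ Δ ∩ leftPairs μ β φ Λ)) := by
  refine (totalSet_elemL2 μ (h.nsf.totalSet_selfadjoint h.gns)).mono ?_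
  rintro _ ⟨k, _, ⟨a, ha, ha', rfl⟩, rfl⟩
  refine ⟨(elemL2 μ k (Λ a), adjVec h hΔ k ha'), ⟨?_, convPi μ β k a, isLeftMul_convPi k ha,
    isLeftMul_star_convPi h hΔ k ha'⟩, rfl⟩
  change ∀ᵐ s ∂μ, _
  filter_upwards [coeFn_elemL2 μ k (Λ a), hΔ.quasiMeasurePreserving_inv.ae (coeFn_adjVec h hΔ k ha')]
    with s h1 h2
  refine ⟨k s • a, h.nsf.smul_mem _ ha, ?_, ?_, ?_⟩
  · rw [star_smul]
    exact h.nsf.smul_mem _ ha'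
  · rw [h1, h.gns.map_smul _ _ ha]
  · rw [h2, star_smul, map_smul, h.gns.map_smul _ _ (h.aut_mem _ ha'), hΔ.map_inv', inv_inv, inv_inv]
    rfl

include hσ in
-- Fibrewise the condition is known only on a total subfamily. Its dual contains all pairs of right
-- bounded vectors, which therefore satisfy the condition with the opposite sign; the dual of these
-- in turn contains every pair belonging to `y` and `y⋆`, now with the original sign. So no density
-- of the elementary pairs in the graph of the involution has to be proved.
theorem stripKMS_leftPairs : (dualFlow h hΔ hs).StripKMS (leftPairs μ β φ Λ) := by
  refine UnitaryFlow.stripKMS_of_kms₂ fun δ hδ => ?_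
  have hC := (stablePairs_fieldPairs h hΔ hσ hs).inter (stablePairs_leftPairs h hΔ hσ hs)
  have h1 : ((dualFlow h hΔ hs).scale δ).KMS₂ δ⁻¹ (fieldPairs μ β φ Λ Δ ∩ leftPairs μ β φ Λ) :=
    ((kms_fieldPairs h hΔ hσ hs hδ).mono Set.inter_subset_left).kms₂ (hC.scale δ).flow
  have h2 := (h1.dual (hC.scale δ) (totalSet_pairs h hΔ)).mono (P := rightPairs μ β φ Λ)
    fun x hx p hp => rightPairs_subset_dualPairs hx p hp.2
  have h3 := (h2.dual ((stablePairs_rightPairs h hΔ hσ hs).scale δ) (totalSet_rightPairs h hΔ)).mono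
    leftPairs_subset_dualPairs
  rwa [neg_neg] at h3

theorem dualGNS_dualModular {y : (crossedProduct μ β).Elt}
    (hy : y ∈ weightIdeal (dualWeight μ β φ Λ)) (t : Multiplicative ℝ) :
    dualGNS μ β φ Λ ((dualModular h hΔ hσ hs).aut t y) =
      dualFlow h hΔ hs t.toAdd (dualGNS μ β φ Λ y) :=
  dualGNS_eq h hΔ ((isLeftMul_dualGNS ((mem_weightIdeal_dual h hΔ).1 hy)).dualModular h hΔ hσ hs t)

theorem dualModular_mem {y : (crossedProduct μ β).Elt}
    (hy : y ∈ weightIdeal (dualWeight μ β φ Λ)) (t : Multiplicative ℝ) :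
    (dualModular h hΔ hσ hs).aut t y ∈ weightIdeal (dualWeight μ β φ Λ) := by
  rw [mem_weightIdeal_dual h hΔ] at hy ⊢
  exact ⟨_, hy.choose_spec.dualModular h hΔ hσ hs t⟩

theorem isModularGroup_dualModular :
    IsModularGroup (dualWeight μ β φ Λ) (dualModular h hΔ hσ hs) := by
  refine ⟨fun t x _ => dualWeight_dualModular h hΔ hσ hs t x, fun x y hx hx' hy hy' => ?_⟩
  have hmem := fun {y} => mem_weightIdeal_dual (y := y) h hΔ
  obtain ⟨F, hF, hC, hFt⟩ := stripKMS_leftPairs h hΔ hσ hs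
    (dualGNS μ β φ Λ x, dualGNS μ β φ Λ (star x))
    ⟨x, isLeftMul_dualGNS (hmem.1 hx), isLeftMul_dualGNS (hmem.1 hx')⟩
    (dualGNS μ β φ Λ y, dualGNS μ β φ Λ (star y))
    ⟨y, isLeftMul_dualGNS (hmem.1 hy), isLeftMul_dualGNS (hmem.1 hy')⟩
  refine ⟨F, hF, hC, fun t => ⟨?_, ?_⟩⟩
  · rw [(hFt t).1, ← VNAction.aut_star, dualWeightForm_eq h hΔ (dualModular_mem h hΔ hσ hs hx' _) hy,
      dualGNS_dualModular h hΔ hσ hs hx']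
    rfl
  · rw [(hFt t).2, dualWeightForm_eq h hΔ hy' (dualModular_mem h hΔ hσ hs hx _),
      dualGNS_dualModular h hΔ hσ hs hx]
    rfl

include h hΔ in
/-- The projection `λ(1_K) π(q)` lies in the centralizer of the dual weight. -/
theorem convPi_mem_weightCentralizer {K : Subgroup G} (hKo : IsOpen (K : Set G))
    (hKc : IsCompact (K : Set G)) (hΔK : ∀ g ∈ K, Δ g = 1) (hcK : ∀ g ∈ K, c g = 1) {q : M.Elt}
    (hq : q ∈ weightCentralizer φ) :
    convPi μ β (indCc hKo hKc) q ∈ weightCentralizer (dualWeight μ β φ Λ) := by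
  obtain ⟨σ, hσ, hσq⟩ := hq
  have hs := hσ.scalesWeight h.nsf h.gns
  refine ⟨dualModular h hΔ hσ hs, isModularGroup_dualModular h hΔ hσ hs, fun t => ?_⟩
  refine Subtype.ext ?_
  ext1 f
  rw [coe_dualModular, conjCLM_apply]
  change dualFlow h hΔ hs t.toAdd (convCc μ H (indCc hKo hKc) (β.piOp μ q _)) =
    convCc μ H (indCc hKo hKc) (β.piOp μ q f)
  -- On `K` the character `c Δ` is `1`, so the phase does not change the indicator function.
  have hk : indCc hKo hKc = (indCc hKo hKc).mulLeft
      (fun s => Complex.exp (Complex.I * ((-t.toAdd) * modLog c Δ s : ℝ)))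
        (by have := continuous_modLog h hΔ; fun_prop) := by
    ext s
    rw [CompactlySupportedContinuousMap.mulLeft_apply]
    by_cases hsK : s ∈ K
    · simp [modLog, hcK s hsK, hΔK s hsK]
    · simp [indCc_apply_notMem hKo hKc hsK]
  conv_lhs => rw [hk]
  rw [dualFlow_convCc, dualFlow_piOp h hΔ hσ hs, LinearIsometryEquiv.apply_symm_apply, hσq]

end DualKMS

/-! ### Unitaries from equal Gram matrices -/

section Gram

variable {X : Type u} [NormedAddCommGroup X] [InnerProductSpace ℂ X] [CompleteSpace X]
  {Y : Type v} [NormedAddCommGroup Y] [InnerProductSpace ℂ Y] [CompleteSpace Y]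

theorem TotalSet.ext_inner {s : Set X} (hs : TotalSet s) {x y : X} (h : ∀ w ∈ s, ⟪w, x⟫_ℂ = ⟪w, y⟫_ℂ) :
    x = y :=
  sub_eq_zero.1 (hs _ fun w hw => by rw [inner_sub_right, h w hw, sub_self])

theorem TotalSet.denseRange_linearCombination {ι : Type*} {a : ι → X} (ha : TotalSet (Set.range a)) :
    DenseRange (Finsupp.linearCombination ℂ a) := by
  have := ha.dense_span
  rwa [← Finsupp.range_linearCombination] at this

/-- Total families with the same Gram matrix are unitarily equivalent. -/
theorem exists_unitary_of_gram {ι : Type*} {a : ι → X} {b : ι → Y} (ha : TotalSet (Set.range a))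
    (hb : TotalSet (Set.range b)) (h : ∀ i j, ⟪a i, a j⟫_ℂ = ⟪b i, b j⟫_ℂ) :
    ∃ W : X ≃ₗᵢ[ℂ] Y, ∀ i, W (a i) = b i := by
  have hn : ∀ f : ι →₀ ℂ, ‖Finsupp.linearCombination ℂ b f‖ = ‖Finsupp.linearCombination ℂ a f‖ := by
    intro f
    rw [← sq_eq_sq₀ (norm_nonneg _) (norm_nonneg _), ← inner_self_eq_norm_sq (𝕜 := ℂ),
      ← inner_self_eq_norm_sq (𝕜 := ℂ)]
    congr 1
    simp only [Finsupp.linearCombination_apply, Finsupp.sum, sum_inner, inner_sum, inner_smul_left,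
      inner_smul_right, h]
  refine ⟨(LinearEquiv.refl ℂ (ι →₀ ℂ)).extendOfIsometry (Finsupp.linearCombination ℂ a)
    (Finsupp.linearCombination ℂ b) ha.denseRange_linearCombination hb.denseRange_linearCombination hn, fun i => ?_⟩
  have := (LinearEquiv.refl ℂ (ι →₀ ℂ)).extendOfIsometry_eq (Finsupp.linearCombination ℂ a)
    (Finsupp.linearCombination ℂ b) ha.denseRange_linearCombination hb.denseRange_linearCombination hn (Finsupp.single i 1)
  simpa using this

/-- A bounded operator is determined by its matrix coefficients on a total family, so equality of
coefficients is enough to recognize a conjugate operator. -/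
theorem conjCLM_eq_of_inner {ι : Type*} {a : ι → X} {b : ι → Y} (ha : TotalSet (Set.range a))
    (W : X ≃ₗᵢ[ℂ] Y) (hW : ∀ i, W (a i) = b i) {A : X →L[ℂ] X} {B : Y →L[ℂ] Y}
    (h : ∀ i j, ⟪a i, A (a j)⟫_ℂ = ⟪b i, B (b j)⟫_ℂ) : conjCLM W A = B := by
  have hb : TotalSet (Set.range b) := by
    have := ha.image W
    rwa [← Set.range_comp, show W ∘ a = b from funext hW] at this
  refine hb.clm_ext ?_
  rintro _ ⟨j, rfl⟩
  refine hb.ext_inner ?_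
  rintro _ ⟨i, rfl⟩
  rw [inner_conjCLM, ← h, ← hW, ← hW, W.symm_apply_apply, W.symm_apply_apply]

end Gram

/-! ### Operators, unitaries and representations on infinite tensor products -/

namespace InfTensor

variable {H : ℕ → Type u} [∀ n, NormedAddCommGroup (H n)] [∀ n, InnerProductSpace ℂ (H n)]
  {ξ : ∀ n, Metric.sphere (0 : H n) 1}
  {K : ℕ → Type v} [∀ n, NormedAddCommGroup (K n)] [∀ n, InnerProductSpace ℂ (K n)]
  {η : ∀ n, Metric.sphere (0 : K n) 1}

theorem Fam.ext {v w : Fam ξ} (h : ∀ n, v.val n = w.val n) : v = w := by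
  cases v; cases w
  simp only [Fam.mk.injEq]
  exact funext h

theorem totalSet_tmul : TotalSet (Set.range (tmul (ξ := ξ))) :=
  TotalSet.of_span dense_span_tmul.totalSet

/-- The family `w` with the vector at `j` replaced by `f`. -/
def Fam.update (w : Fam ξ) (j : ℕ) (f : H j) : Fam ξ :=
  ⟨Function.update w.val j f, by
    filter_upwards [w.eventually_eq, (Set.finite_singleton j).compl_mem_cofinite] with n h1 h2
    rw [Function.update_of_ne (by simpa using h2), h1]⟩

theorem Fam.update_same (w : Fam ξ) (j : ℕ) (f : H j) : (w.update j f).val j = f :=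
  Function.update_self _ _ _

theorem Fam.update_ne (w : Fam ξ) {j n : ℕ} (hn : n ≠ j) (f : H j) : (w.update j f).val n = w.val n :=
  Function.update_of_ne hn _ _

theorem Fam.update_eq (w : Fam ξ) (j : ℕ) : w.update j (w.val j) = w :=
  Fam.ext fun n => congrFun (Function.update_eq_self j w.val) n

/-- The product of the other factors does not involve the slot `j`. This makes elementary tensors
linear and bounded in a single slot. -/
theorem exists_inner_update (w v : Fam ξ) (j : ℕ) : ∃ r : ℂ, ∀ f f' : H j,
    ⟪tmul (w.update j f), tmul (v.update j f')⟫_ℂ = ⟪f, f'⟫_ℂ * r := by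
  classical
  obtain ⟨F, hF⟩ := exists_common ({w, v} : Finset (Fam ξ))
  refine ⟨∏ n ∈ F.erase j, ⟪w.val n, v.val n⟫_ℂ, fun f f' => ?_⟩
  rw [inner_tmul]
  have hu : ∀ (w : Fam ξ) (f : H j), (∀ n ∉ F, w.val n = ξ n) →
      ∀ n ∉ insert j F, (w.update j f).val n = ξ n := by
    intro w f hw n hn
    rw [Finset.mem_insert, not_or] at hn
    rw [w.update_ne hn.1, hw n hn.2]
  refine (kernel_eq_prod _ _ (insert j F) (hu w f (hF w (by simp))) (hu v f' (hF v (by simp)))).trans ?_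
  rw [← Finset.insert_erase (Finset.mem_insert_self j F), Finset.prod_insert (Finset.notMem_erase _ _),
    Finset.erase_insert_eq_erase, Fam.update_same, Fam.update_same]
  congr 1
  refine Finset.prod_congr rfl fun n hn => ?_
  rw [w.update_ne (Finset.ne_of_mem_erase hn), v.update_ne (Finset.ne_of_mem_erase hn)]

/-- The map `f ↦ w 0 ⊗ ⋯ ⊗ w (j - 1) ⊗ f ⊗ w (j + 1) ⊗ ⋯`. -/
def insertCLM (w : Fam ξ) (j : ℕ) : H j →L[ℂ] InfTensor ξ :=
  LinearMap.mkContinuous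
    { toFun := fun f => tmul (w.update j f)
      map_add' := fun f f' => by
        refine totalSet_tmul.ext_inner ?_
        rintro _ ⟨v, rfl⟩
        obtain ⟨r, hr⟩ := exists_inner_update v w j
        rw [← v.update_eq j, inner_add_right, hr, hr, hr, inner_add_right, add_mul]
      map_smul' := fun c f => by
        refine totalSet_tmul.ext_inner ?_
        rintro _ ⟨v, rfl⟩
        obtain ⟨r, hr⟩ := exists_inner_update v w j
        rw [← v.update_eq j, RingHom.id_apply, inner_smul_right, hr, hr, inner_smul_right, mul_assoc] }
    (√‖(exists_inner_update w w j).choose‖) fun f => by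
      have h := (exists_inner_update w w j).choose_spec f f
      set r := (exists_inner_update w w j).choose
      refine abs_le_of_sq_le_sq' ?_ (by positivity) |>.2
      change ‖tmul (w.update j f)‖ ^ 2 ≤ _
      rw [mul_pow, Real.sq_sqrt (norm_nonneg _)]
      have h2 := congrArg norm h
      rw [inner_self_eq_norm_sq_to_K, inner_self_eq_norm_sq_to_K, norm_mul] at h2
      simp only [norm_pow, RCLike.norm_ofReal, abs_norm] at h2
      rw [h2, mul_comm]

theorem insertCLM_apply (w : Fam ξ) (j : ℕ) (f : H j) : insertCLM w j f = tmul (w.update j f) := rfl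

/-- Elementary tensors of vectors from total sets are total. -/
theorem totalSet_tmul_of_totalSet [∀ n, CompleteSpace (H n)] {s : ∀ n, Set (H n)}
    (hs : ∀ n, TotalSet (s n)) :
    TotalSet {x | ∃ w : Fam ξ, (∀ n, w.val n ∈ s n ∨ w.val n = ξ n) ∧ x = tmul w} := by
  classical
  intro v hv
  -- Induction on the set of slots with unrestricted vectors: freeing a slot `j` only requires that
  -- the adjoint of insertion into `j` sends `v` to a vector orthogonal to `s j`.
  have key : ∀ F : Finset ℕ, ∀ w : Fam ξ, (∀ n ∉ F, w.val n ∈ s n ∨ w.val n = ξ n) →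
      ⟪tmul w, v⟫_ℂ = 0 := by
    intro F
    induction F using Finset.induction_on with
    | empty => exact fun w hw => hv _ ⟨w, fun n => hw n (by simp), rfl⟩
    | insert j F hj ih =>
      intro w hw
      have h0 : ContinuousLinearMap.adjoint (insertCLM w j) v = 0 := by
        refine hs j _ fun f hf => ?_
        rw [ContinuousLinearMap.adjoint_inner_right, insertCLM_apply]
        refine ih _ fun n hn => ?_
        by_cases hnj : n = j
        · subst hnj
          rw [w.update_same]
          exact Or.inl hf
        · rw [w.update_ne hnj]
          exact hw n (by simp [hnj, hn])
      rw [← w.update_eq j, ← insertCLM_apply, ← ContinuousLinearMap.adjoint_inner_right, h0,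
        inner_zero_right]
  refine totalSet_tmul v ?_
  rintro _ ⟨w, rfl⟩
  obtain ⟨F, hF⟩ := exists_common ({w} : Finset (Fam ξ))
  exact key F w fun n hn => Or.inr (hF w (by simp) n hn)

section Op

theorem op_one : op (ξ := ξ) (fun _ => 1) (Eventually.of_forall fun _ => rfl) = 1 :=
  totalSet_tmul.clm_ext (by rintro _ ⟨w, rfl⟩; rw [op_tmul]; rfl)

theorem op_mul {T S Y : ∀ n, H n →L[ℂ] H n} (hT : ∀ᶠ n in cofinite, T n = 1)
    (hS : ∀ᶠ n in cofinite, S n = 1) (hY : ∀ᶠ n in cofinite, Y n = 1) (h : ∀ n, Y n = T n * S n) :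
    op (ξ := ξ) Y hY = op T hT * op S hS := by
  refine totalSet_tmul.clm_ext ?_
  rintro _ ⟨w, rfl⟩
  rw [mul_apply_eq_comp, op_tmul, op_tmul, op_tmul]
  exact congrArg tmul (Fam.ext fun n => by simp only [famMap, h]; rfl)

theorem star_op [∀ n, CompleteSpace (H n)] {T S : ∀ n, H n →L[ℂ] H n} (hT : ∀ᶠ n in cofinite, T n = 1)
    (hS : ∀ᶠ n in cofinite, S n = 1) (h : ∀ n, S n = star (T n)) :
    star (op (ξ := ξ) T hT) = op S hS := by
  refine totalSet_tmul.clm_ext ?_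
  rintro _ ⟨w, rfl⟩
  refine totalSet_tmul.ext_inner ?_
  rintro _ ⟨v, rfl⟩
  rw [ContinuousLinearMap.star_eq_adjoint, ContinuousLinearMap.adjoint_inner_right, op_tmul, op_tmul,
    inner_tmul, inner_tmul]
  refine finprod_congr fun n => ?_
  simp only [famMap, h]
  exact (ContinuousLinearMap.adjoint_inner_right _ _ _).symm

theorem eventually_update (j : ℕ) (T : H j →L[ℂ] H j) :
    ∀ᶠ n in cofinite, Function.update (fun _ => 1 : ∀ n, H n →L[ℂ] H n) j T n = 1 := by
  filter_upwards [(Set.finite_singleton j).compl_mem_cofinite] with n h2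
  rw [Function.update_of_ne (by simpa using h2)]

/-- The operator `T` on the factor `j`. -/
def single (j : ℕ) (T : H j →L[ℂ] H j) : InfTensor ξ →L[ℂ] InfTensor ξ :=
  op (Function.update (fun _ => 1) j T) (eventually_update j T)

theorem single_insertCLM (j : ℕ) (T : H j →L[ℂ] H j) (w : Fam ξ) (f : H j) :
    single j T (insertCLM w j f) = insertCLM w j (T f) := by
  rw [insertCLM_apply, insertCLM_apply, single, op_tmul]
  refine congrArg tmul (Fam.ext fun n => ?_)
  simp only [famMap]
  by_cases hn : n = j
  · subst hn
    rw [Function.update_self, Fam.update_same, Fam.update_same]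
  · rw [Function.update_of_ne hn, Fam.update_ne _ hn, Fam.update_ne _ hn]
    rfl

theorem star_single [∀ n, CompleteSpace (H n)] (j : ℕ) (T : H j →L[ℂ] H j) :
    star (single (ξ := ξ) j T) = single j (star T) := by
  refine star_op _ _ fun n => ?_
  by_cases hn : n = j
  · subst hn; simp
  · simp [hn]

theorem totalSet_insertCLM (j : ℕ) :
    TotalSet {x : InfTensor ξ | ∃ (w : Fam ξ) (f : H j), x = insertCLM w j f} := by
  refine totalSet_tmul.mono ?_
  rintro _ ⟨w, rfl⟩
  exact ⟨w, w.val j, by rw [insertCLM_apply, w.update_eq]⟩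

/-- Almost all factors are `1`, so the operator is a finite product of operators acting in one slot.
-/
theorem op_commute_of_single {T : ∀ n, H n →L[ℂ] H n} (hT : ∀ᶠ n in cofinite, T n = 1)
    {Y : InfTensor ξ →L[ℂ] InfTensor ξ} (h : ∀ j, single j (T j) * Y = Y * single j (T j)) :
    op T hT * Y = Y * op T hT := by
  classical
  have key : ∀ F : Finset ℕ, ∀ (S : ∀ n, H n →L[ℂ] H n) (hS : ∀ᶠ n in cofinite, S n = 1),
      (∀ n ∉ F, S n = 1) → (∀ n, S n = T n ∨ S n = 1) → op S hS * Y = Y * op S hS := by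
    intro F
    induction F using Finset.induction_on with
    | empty =>
      intro S hS h1 _
      have : S = fun _ => 1 := funext fun n => h1 n (by simp)
      subst this
      rw [op_one, one_mul, mul_one]
    | insert j F hj ih =>
      intro S hS h1 h2
      have hS' : ∀ᶠ n in cofinite, Function.update S j 1 n = 1 := by
        filter_upwards [hS] with n hn
        by_cases hnj : n = j
        · subst hnj; simp
        · rw [Function.update_of_ne hnj, hn]
      have hop : op (ξ := ξ) S hS = single j (S j) * op (Function.update S j 1) hS' := by
        refine op_mul _ _ _ fun n => ?_
        by_cases hnj : n = j
        · subst hnj; simp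
        · simp [hnj]
      have hj' : single (ξ := ξ) j (S j) * Y = Y * single j (S j) := by
        rcases h2 j with h3 | h3
        · rw [h3]; exact h j
        · have : single (ξ := ξ) j (S j) = 1 := by
            rw [← op_one]
            simp only [single, h3]
            congr 1
            exact Function.update_eq_self j _
          rw [this, one_mul, mul_one]
      rw [hop, mul_assoc, ih _ hS' ?_ ?_, ← mul_assoc, hj', mul_assoc]
      · intro n hn
        by_cases hnj : n = j
        · subst hnj; simp
        · rw [Function.update_of_ne hnj, h1 n (by simp [hnj, hn])]
      · intro n
        by_cases hnj : n = j
        · subst hnj; simp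
        · rw [Function.update_of_ne hnj]; exact h2 n
  exact key (mem_cofinite.1 hT).toFinset T hT (fun n hn => by
    by_contra hc
    exact hn ((Set.Finite.mem_toFinset _).2 hc)) fun n => Or.inl rfl

end Op

section Unitary

variable (u : ∀ n, H n ≃ₗᵢ[ℂ] K n) (hu : ∀ᶠ n in cofinite, u n (ξ n) = η n)

/-- The family `u n (v n)`. -/
def famUnitary (v : Fam ξ) : Fam η :=
  ⟨fun n => u n (v.val n), by
    filter_upwards [hu, v.eventually_eq] with n h1 h2
    rw [h2, h1]⟩

/-- Factorwise unitaries preserve the Gram matrix of elementary tensors; the condition on base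
vectors keeps the image families admissible, and their inverses show that all families are reached.
-/
theorem exists_mapUnitary : ∃ W : InfTensor ξ ≃ₗᵢ[ℂ] InfTensor η,
    ∀ v, W (tmul v) = tmul (famUnitary u hu v) := by
  refine exists_unitary_of_gram totalSet_tmul (totalSet_tmul.mono ?_) fun v w => ?_
  · rintro _ ⟨v, rfl⟩
    have hu' : ∀ᶠ n in cofinite, (u n).symm (η n) = ξ n := hu.mono fun n h => by
      rw [← h, LinearIsometryEquiv.symm_apply_apply]
    exact ⟨famUnitary (fun n => (u n).symm) hu' v, congrArg tmul (Fam.ext fun n =>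
      (u n).apply_symm_apply _)⟩
  · rw [inner_tmul, inner_tmul]
    exact finprod_congr fun n => ((u n).inner_map_map _ _).symm

/-- The tensor product of unitaries that preserve almost all base vectors. -/
def mapUnitary : InfTensor ξ ≃ₗᵢ[ℂ] InfTensor η := (exists_mapUnitary u hu).choose

theorem mapUnitary_tmul (v : Fam ξ) : mapUnitary u hu (tmul v) = tmul (famUnitary u hu v) :=
  (exists_mapUnitary u hu).choose_spec v

theorem conjCLM_mapUnitary {T : ∀ n, H n →L[ℂ] H n} (hT : ∀ᶠ n in cofinite, T n = 1)
    {S : ∀ n, K n →L[ℂ] K n} (hS : ∀ᶠ n in cofinite, S n = 1)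
    (h : ∀ n v, S n (u n v) = u n (T n v)) :
    conjCLM (mapUnitary u hu) (op T hT) = op S hS := by
  refine conjCLM_eq_of_inner totalSet_tmul _ (mapUnitary_tmul u hu) fun v w => ?_
  rw [op_tmul, op_tmul, inner_tmul, inner_tmul]
  refine finprod_congr fun n => ?_
  simp only [famMap, famUnitary, h, LinearIsometryEquiv.inner_map_map]

end Unitary

section Rep

variable {G : ℕ → Type w} [∀ n, Group (G n)] [∀ n, TopologicalSpace (G n)]
  {C : ∀ n, Subgroup (G n)}

/-- The restricted product carries the inductive limit topology of pieces on which almost all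
coordinates lie in `C n`. On such a piece the factors outside one fixed finite set are `1`. -/
theorem _root_.RestrictedProduct.continuous_finprod {f : ∀ n, G n → ℂ} (hf : ∀ n, Continuous (f n))
    (h1 : ∀ᶠ n in cofinite, ∀ x ∈ C n, f n x = 1) :
    Continuous fun g : Πʳ n, [G n, C n] => ∏ᶠ n, f n (g n) := by
  refine (RestrictedProduct.continuous_dom).2 fun S hS => ?_
  have hfin : (Sᶜ ∪ {n | ¬∀ x ∈ C n, f n x = 1}).Finite :=
    Set.Finite.union (mem_cofinite.1 (le_principal_iff.1 hS)) (mem_cofinite.1 h1)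
  have e : ∀ g : Πʳ n, [G n, C n]_[𝓟 S], (∏ᶠ n, f n (RestrictedProduct.inclusion _ _ hS g n)) =
      ∏ n ∈ hfin.toFinset, f n (g n) := by
    intro g
    refine finprod_eq_prod_of_mulSupport_subset _ fun n hn => ?_
    rw [Set.Finite.coe_toFinset]
    by_contra hc
    simp only [Set.mem_union, Set.mem_compl_iff, not_or, not_not, Set.mem_ofPred_eq] at hc
    exact hn (hc.2 _ (eventually_principal.1 g.2 n hc.1))
  change Continuous fun g : Πʳ n, [G n, C n]_[𝓟 S] =>
    ∏ᶠ n, f n (RestrictedProduct.inclusion _ _ hS g n)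
  simp only [e]
  exact continuous_finsetProd _ fun n _ => (hf n).comp (RestrictedProduct.continuous_eval n)

variable (U : ∀ n, G n →* (H n ≃ₗᵢ[ℂ] H n)) (hfix : ∀ n, ∀ g ∈ C n, U n g (ξ n) = ξ n)

/-- The representation of a restricted product on the infinite tensor product. -/
def restrictedRep : (Πʳ n, [G n, C n]) →* (InfTensor ξ ≃ₗᵢ[ℂ] InfTensor ξ) where
  toFun g := mapUnitary (fun n => U n (g n)) (g.2.mono fun n h => hfix n _ h)
  map_one' := by
    refine LinearIsometryEquiv.toContinuousLinearEquiv_injective ?_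
    refine ContinuousLinearEquiv.coe_injective (totalSet_tmul.clm_ext ?_)
    rintro _ ⟨v, rfl⟩
    refine (mapUnitary_tmul _ _ v).trans (congrArg tmul (Fam.ext fun n => ?_))
    simp [famUnitary]
  map_mul' g g' := by
    refine LinearIsometryEquiv.toContinuousLinearEquiv_injective ?_
    refine ContinuousLinearEquiv.coe_injective (totalSet_tmul.clm_ext ?_)
    rintro _ ⟨v, rfl⟩
    refine (mapUnitary_tmul _ _ v).trans ?_
    refine Eq.trans ?_ (congrArg _ (mapUnitary_tmul _ _ v)).symm
    refine Eq.trans ?_ (mapUnitary_tmul _ _ _).symm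
    refine congrArg tmul (Fam.ext fun n => ?_)
    simp [famUnitary]

theorem restrictedRep_apply (g : Πʳ n, [G n, C n]) : restrictedRep U hfix g =
    mapUnitary (fun n => U n (g n)) (g.2.mono fun n h => hfix n _ h) := rfl

/-- Coefficients of elementary tensors are products of coefficients of the factors, almost all of
which are `1` on `C n`. -/
theorem continuous_restrictedRep (hU : ∀ n v, Continuous fun g => U n g v) (x : InfTensor ξ) :
    Continuous fun g => restrictedRep U hfix g x := by
  refine continuous_of_weak_totalSet totalSet_tmul totalSet_tmul ?_ x
  rintro _ ⟨w, rfl⟩ _ ⟨v, rfl⟩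
  simp only [restrictedRep_apply, mapUnitary_tmul, inner_tmul]
  refine RestrictedProduct.continuous_finprod (f := fun n x => ⟪w.val n, U n x (v.val n)⟫_ℂ)
    (fun n => continuous_const.inner (hU n _)) ?_
  filter_upwards [w.eventually_eq, v.eventually_eq] with n h1 h2 x hx
  rw [h1, h2, hfix n x hx, inner_base]

end Rep

end InfTensor

/-! ### The restricted product action on an infinite tensor product -/

section RestrictedAction

open VonNeumannAlgebra

variable {H : ℕ → Type u} [∀ n, NormedAddCommGroup (H n)] [∀ n, InnerProductSpace ℂ (H n)]
  [∀ n, CompleteSpace (H n)] {M : ∀ n, VonNeumannAlgebra (H n)}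
  {φ : ∀ n, (M n).Elt → ℝ≥0∞}
  {K : ℕ → Type v} [∀ n, NormedAddCommGroup (K n)] [∀ n, InnerProductSpace ℂ (K n)]
  [∀ n, CompleteSpace (K n)] {ρ : ∀ n, (M n).Elt →⋆ₐ[ℂ] (K n →L[ℂ] K n)}
  {Λ : ∀ n, (M n).Elt → K n} {q : ∀ n, (M n).Elt}

section Generators

variable (hΛ : ∀ n, IsGNS (φ n) (ρ n) (Λ n)) (hq : ∀ n, IsStarProjection (q n))
  (h1 : ∀ n, φ n (q n) = 1)

theorem tensorOp_one : tensorOp hΛ hq h1 (fun _ => 1) (Eventually.of_forall fun _ => rfl) = 1 := by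
  refine Eq.trans ?_ InfTensor.op_one
  simp only [tensorOp, map_one]

theorem tensorOp_mul {x y z : ∀ n, (M n).Elt} (hx : ∀ᶠ n in cofinite, x n = 1)
    (hy : ∀ᶠ n in cofinite, y n = 1) (hz : ∀ᶠ n in cofinite, z n = 1) (h : ∀ n, z n = x n * y n) :
    tensorOp hΛ hq h1 z hz = tensorOp hΛ hq h1 x hx * tensorOp hΛ hq h1 y hy :=
  InfTensor.op_mul _ _ _ fun n => by rw [h, map_mul]

theorem star_tensorOp {x y : ∀ n, (M n).Elt} (hx : ∀ᶠ n in cofinite, x n = 1)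
    (hy : ∀ᶠ n in cofinite, y n = 1) (h : ∀ n, y n = star (x n)) :
    star (tensorOp hΛ hq h1 x hx) = tensorOp hΛ hq h1 y hy :=
  InfTensor.star_op _ _ fun n => by rw [h, map_star]

/-- Normal maps on an infinite tensor product are determined by elementary tensors. -/
theorem weightTensor_normalMap_ext {X : Type w} [NormedAddCommGroup X] [InnerProductSpace ℂ X]
    [CompleteSpace X] {N : VonNeumannAlgebra X} {Φ Ψ : (weightTensor hΛ hq h1).Elt → N.Elt}
    (hΦ : IsNormalMap _ N Φ) (hΨ : IsNormalMap _ N Ψ)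
    (h : ∀ x hx, Φ (tensorElt hΛ hq h1 x hx) = Ψ (tensorElt hΛ hq h1 x hx)) (x) : Φ x = Ψ x := by
  refine normalMap_ext ?_ ?_ ?_ hΦ hΨ ?_ x
  · exact ⟨_, _, (tensorOp_one hΛ hq h1).symm⟩
  · rintro _ ⟨x, hx, rfl⟩ _ ⟨y, hy, rfl⟩
    refine ⟨fun n => x n * y n, ?_, (tensorOp_mul hΛ hq h1 hx hy _ fun n => rfl).symm⟩
    filter_upwards [hx, hy] with n h1 h2
    rw [h1, h2, one_mul]
  · rintro _ ⟨x, hx, rfl⟩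
    refine ⟨fun n => star (x n), ?_, star_tensorOp hΛ hq h1 hx _ fun n => rfl⟩
    filter_upwards [hx] with n h1
    rw [h1, star_one]
  · rintro _ ⟨x, hx, rfl⟩
    exact h x hx

end Generators

theorem VNAction.ext' {X : Type v} [NormedAddCommGroup X] [InnerProductSpace ℂ X] [CompleteSpace X]
    {N : VonNeumannAlgebra X} {Γ : Type w} [Group Γ] [TopologicalSpace Γ] {α α' : VNAction Γ N}
    (h : ∀ g x, α.aut g x = α'.aut g x) : α = α' := by
  have : α.aut = α'.aut := funext fun g => StarAlgEquiv.ext (h g)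
  cases α; cases α'
  simp only at this
  subst this
  rfl

variable {G : ℕ → Type w} [∀ n, Group (G n)] [∀ n, TopologicalSpace (G n)]
  {C : ∀ n, Subgroup (G n)} {β : ∀ n, VNAction (G n) (M n)}

/-- Automorphisms of an action are normal, so agreement on elementary tensors suffices. -/
theorem IsRestrictedProductAction.unique {hΛ : ∀ n, IsGNS (φ n) (ρ n) (Λ n)}
    {hq : ∀ n, IsStarProjection (q n)} {h1 : ∀ n, φ n (q n) = 1}
    {α α' : VNAction (Πʳ n, [G n, C n]) (weightTensor hΛ hq h1)}
    (h : IsRestrictedProductAction β hΛ hq h1 α) (h' : IsRestrictedProductAction β hΛ hq h1 α') :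
    α = α' :=
  VNAction.ext' fun g => weightTensor_normalMap_ext hΛ hq h1 (α.normal g) (α'.normal g)
    fun x hx => (h g x hx).trans (h' g x hx).symm

section Existence

variable {Λ : ∀ n, (M n).Elt → H n} {c : ∀ n, G n → ℝ}
  (h : ∀ n, ScalesWeight (φ n) (Λ n) (β n) (c n)) (hq : ∀ n, IsStarProjection (q n))
  (h1 : ∀ n, φ n (q n) = 1) (hcC : ∀ n, ∀ g ∈ C n, c n g = 1)
  (hqC : ∀ n, ∀ g ∈ C n, (β n).aut g (q n) = q n)

include hq h1 in
theorem proj_mem_weightIdeal (n : ℕ) : q n ∈ weightIdeal (φ n) := by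
  change φ n _ < ⊤
  rw [(hq n).isSelfAdjoint.star_eq, (hq n).isIdempotentElem.eq, h1]
  exact ENNReal.one_lt_top

include hcC hqC in
-- On `C n` the scaling factor is `1` and the projection is fixed. This invariance is what allows
-- the implementations to be tensored over the restricted product.
theorem rep_gnsVec (n : ℕ) (g : G n) (hg : g ∈ C n) :
    (h n).rep g (gnsVec (fun n => (h n).gns) hq h1 n) = gnsVec (fun n => (h n).gns) hq h1 n := by
  change (h n).rep g (Λ n (q n)) = Λ n (q n)
  rw [(h n).rep_gns g (proj_mem_weightIdeal hq h1 n), hcC n g hg, hqC n g hg]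
  simp

/-- The implementation of the restricted product of actions. -/
def tensorRep : (Πʳ n, [G n, C n]) →* (InfTensor (gnsVec (fun n => (h n).gns) hq h1) ≃ₗᵢ[ℂ]
    InfTensor (gnsVec (fun n => (h n).gns) hq h1)) :=
  InfTensor.restrictedRep (fun n => (h n).rep) (rep_gnsVec h hq h1 hcC hqC)

theorem continuous_tensorRep (x : InfTensor (gnsVec (fun n => (h n).gns) hq h1)) :
    Continuous fun g => tensorRep h hq h1 hcC hqC g x :=
  InfTensor.continuous_restrictedRep _ _ (fun n => (h n).continuous_rep) x

theorem conjCLM_tensorRep (g : Πʳ n, [G n, C n]) (x : ∀ n, (M n).Elt)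
    (hx : ∀ᶠ n in cofinite, x n = 1) :
    conjCLM (tensorRep h hq h1 hcC hqC g) (tensorOp (fun n => (h n).gns) hq h1 x hx) =
      tensorOp (fun n => (h n).gns) hq h1 (fun n => (β n).aut (g n) (x n))
        (hx.mono fun n h => by rw [h, map_one]) :=
  InfTensor.conjCLM_mapUnitary _ _ _ _ fun n v => ((h n).rep_apply (g n) (x n) v).symm

variable [∀ n, IsTopologicalGroup (G n)] [Fact (∀ n, IsOpen (C n : Set (G n)))]

/-- The restricted product of actions on an infinite tensor product. -/
def tensorAction : VNAction (Πʳ n, [G n, C n]) (weightTensor (fun n => (h n).gns) hq h1) :=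
  VNAction.ofUnitary (tensorRep h hq h1 hcC hqC) (continuous_tensorRep h hq h1 hcC hqC)
    fun g x hx => conjCLM_mem_of_generated _ (by
      rintro _ ⟨x, hx, rfl⟩
      rw [conjCLM_tensorRep]
      exact subset_generated _ ⟨_, _, rfl⟩) hx

theorem isRestrictedProductAction_tensorAction :
    IsRestrictedProductAction β (fun n => (h n).gns) hq h1 (tensorAction h hq h1 hcC hqC) :=
  fun g x hx => Subtype.ext (conjCLM_tensorRep h hq h1 hcC hqC g x hx)

end Existence

end RestrictedAction

/-! ### Topology and product functions on a restricted product -/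

section RestrictedHaar

open scoped CompactlySupported ComplexConjugate

variable {G : ℕ → Type u} [∀ n, Group (G n)] [∀ n, TopologicalSpace (G n)]
  {C : ∀ n, Subgroup (G n)}

/-- The box lies in one piece of the inductive limit, where it is a product of compact sets and
Tychonoff's theorem applies. -/
theorem RestrictedProduct.isCompact_box {B : ∀ n, Set (G n)} (hB : ∀ n, IsCompact (B n))
    (hBC : ∀ᶠ n in cofinite, B n ⊆ C n) : IsCompact {g : Πʳ n, [G n, C n] | ∀ n, g n ∈ B n} := by
  set S : Set ℕ := {n | B n ⊆ C n}
  have hS : cofinite ≤ 𝓟 S := le_principal_iff.2 hBC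
  have h1 : IsCompact {g : Πʳ n, [G n, C n]_[𝓟 S] | ∀ n, g n ∈ B n} := by
    rw [RestrictedProduct.isEmbedding_coe_of_principal.isCompact_iff]
    convert isCompact_univ_pi hB using 1
    ext x
    constructor
    · rintro ⟨g, hg, rfl⟩ n -
      exact hg n
    · intro hx
      exact ⟨⟨x, eventually_principal.2 fun n hn => hn (hx n trivial)⟩, fun n => hx n trivial, rfl⟩
  convert h1.image (RestrictedProduct.continuous_inclusion hS) using 1
  ext g
  constructor
  · intro hg
    exact ⟨⟨g, eventually_principal.2 fun n hn => hn (hg n)⟩, hg, rfl⟩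
  · rintro ⟨g, hg, rfl⟩
    exact hg

/-- Countably many open pieces, indexed by finite sets, cover the restricted product, and each
embeds into a countable product. -/
instance RestrictedProduct.secondCountableTopology [hC : Fact (∀ n, IsOpen (C n : Set (G n)))]
    [∀ n, SecondCountableTopology (G n)] : SecondCountableTopology (Πʳ n, [G n, C n]) := by
  have hS : ∀ F : Finset ℕ, cofinite ≤ 𝓟 ((F : Set ℕ)ᶜ) := fun F =>
    le_principal_iff.2 F.finite_toSet.compl_mem_cofinite
  let U : Finset ℕ → Set (Πʳ n, [G n, C n]) := fun F =>
    Set.range (RestrictedProduct.inclusion G (fun n => (C n : Set (G n))) (hS F))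
  have hU : ∀ F, SecondCountableTopology (U F) := fun F => by
    have : SecondCountableTopology (Πʳ n, [G n, C n]_[𝓟 ((F : Set ℕ)ᶜ)]) :=
      RestrictedProduct.isEmbedding_coe_of_principal.secondCountableTopology
    exact (RestrictedProduct.isEmbedding_inclusion_principal
      (hS F)).toHomeomorph.symm.isEmbedding.secondCountableTopology
  refine TopologicalSpace.secondCountableTopology_of_countable_cover (U := U)
    (fun F => (RestrictedProduct.isOpenEmbedding_inclusion_principal hC.out (hS F)).isOpen_range) ?_
  refine Set.eq_univ_of_forall fun g => Set.mem_iUnion.2 ⟨(mem_cofinite.1 g.2).toFinset, ?_⟩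
  exact ⟨⟨g, eventually_principal.2 fun n hn => by
    by_contra hc
    exact hn ((Set.Finite.mem_toFinset _).2 hc)⟩, rfl⟩

theorem RestrictedProduct.hasFiniteMulSupport {f : ∀ n, G n → ℂ}
    (h1 : ∀ᶠ n in cofinite, ∀ x ∈ C n, f n x = 1) (g : Πʳ n, [G n, C n]) :
    (fun n => f n (g n)).HasFiniteMulSupport := by
  refine Set.Finite.subset (mem_cofinite.1 (h1.and g.2)) fun n hn => ?_
  simp only [Set.mem_compl_iff]
  exact fun h => hn (h.1 _ h.2)

theorem finprod_eq_mul_update {f : ℕ → ℂ} (hf : f.HasFiniteMulSupport) (j : ℕ) :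
    ∏ᶠ n, f n = f j * ∏ᶠ n, Function.update f j 1 n := by
  classical
  have hF : (Function.mulSupport f).Finite := hf
  have h1 : Function.mulSupport f ⊆ (insert j hF.toFinset : Finset ℕ) := by
    simp
  have h2 : Function.mulSupport (Function.update f j 1) ⊆ (insert j hF.toFinset : Finset ℕ) := by
    intro n hn
    by_cases hnj : n = j
    · simp [hnj]
    · rw [Function.mem_mulSupport, Function.update_of_ne hnj] at hn
      exact h1 hn
  rw [finprod_eq_prod_of_mulSupport_subset _ h1, finprod_eq_prod_of_mulSupport_subset _ h2,
    ← Finset.insert_erase (Finset.mem_insert_self j hF.toFinset),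
    Finset.prod_insert (Finset.notMem_erase _ _), Finset.prod_insert (Finset.notMem_erase _ _),
    Function.update_self, one_mul]
  congr 1
  exact Finset.prod_congr rfl fun n hn => by rw [Function.update_of_ne (Finset.ne_of_mem_erase hn)]

variable [hC : Fact (∀ n, IsOpen (C n : Set (G n)))] [∀ n, CompactSpace (C n)]
  [∀ n, IsTopologicalGroup (G n)]

/-- The indicator functions of the compact open subgroups. -/
def unitCc (C : ∀ n, Subgroup (G n)) [hC : Fact (∀ n, IsOpen (C n : Set (G n)))]
    [∀ n, CompactSpace (C n)] (n : ℕ) : C_c(G n, ℂ) :=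
  indCc (hC.out n) (isCompact_iff_compactSpace.2 inferInstance)

theorem unitCc_mem {n : ℕ} {x : G n} (hx : x ∈ C n) : unitCc C n x = 1 :=
  Set.indicator_of_mem (s := (C n : Set (G n))) hx 1

theorem unitCc_notMem {n : ℕ} {x : G n} (hx : x ∉ C n) : unitCc C n x = 0 :=
  Set.indicator_of_notMem (s := (C n : Set (G n))) hx 1

/-- Families of functions that are almost all equal to the indicator functions of `C n`. -/
structure CcFam (C : ∀ n, Subgroup (G n)) [hC : Fact (∀ n, IsOpen (C n : Set (G n)))]
    [∀ n, CompactSpace (C n)] where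
  /-- The functions of the family. -/
  val : ∀ n, C_c(G n, ℂ)
  eventually_eq : ∀ᶠ n in cofinite, val n = unitCc C n

namespace CcFam

theorem eventually_one (k : CcFam C) : ∀ᶠ n in cofinite, ∀ x ∈ C n, k.val n x = 1 :=
  k.eventually_eq.mono fun n hn x hx => by rw [hn, unitCc_mem hx]

theorem apply_ne_zero {k : CcFam C} {g : Πʳ n, [G n, C n]} (h : ∏ᶠ n, k.val n (g n) ≠ 0) (n : ℕ) :
    k.val n (g n) ≠ 0 := fun h0 =>
  h (finprod_eq_zero _ n h0 (RestrictedProduct.hasFiniteMulSupport k.eventually_one g))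

variable [∀ n, T2Space (G n)]

theorem isCompact_box (k : CcFam C) :
    IsCompact {g : Πʳ n, [G n, C n] | ∀ n, g n ∈ tsupport (k.val n)} := by
  refine RestrictedProduct.isCompact_box (fun n => (k.val n).hasCompactSupport) ?_
  filter_upwards [k.eventually_eq] with n hn
  rw [hn]
  refine closure_minimal (fun x hx => ?_) ((C n).isClosed_of_isOpen (hC.out n))
  by_contra hc
  exact hx (unitCc_notMem hc)

/-- The function `g ↦ ∏ k n (g n)` on the restricted product. -/
def prod (k : CcFam C) : C_c(Πʳ n, [G n, C n], ℂ) :=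
  ⟨⟨fun g => ∏ᶠ n, k.val n (g n),
    RestrictedProduct.continuous_finprod (fun n => (k.val n).continuous) k.eventually_one⟩,
    HasCompactSupport.intro k.isCompact_box fun g hg => by
      by_contra hc
      exact hg fun n => subset_tsupport _ (apply_ne_zero hc n)⟩

theorem prod_apply (k : CcFam C) (g : Πʳ n, [G n, C n]) : k.prod g = ∏ᶠ n, k.val n (g n) := rfl

/-- The family `k` with the function at `j` replaced by `m`. -/
def update (k : CcFam C) (j : ℕ) (m : C_c(G j, ℂ)) : CcFam C :=
  ⟨Function.update k.val j m, by
    filter_upwards [k.eventually_eq, (Set.finite_singleton j).compl_mem_cofinite] with n h1 h2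
    rw [Function.update_of_ne (by simpa using h2), h1]⟩

/-- The product of the functions with index different from `j`. -/
def rest (k : CcFam C) (j : ℕ) (g : Πʳ n, [G n, C n]) : ℂ :=
  ∏ᶠ n, Function.update (fun n => k.val n (g n)) j 1 n

theorem prod_update (k : CcFam C) (j : ℕ) (m : C_c(G j, ℂ)) (g : Πʳ n, [G n, C n]) :
    (k.update j m).prod g = m (g j) * k.rest j g := by
  rw [prod_apply, finprod_eq_mul_update
    (RestrictedProduct.hasFiniteMulSupport (k.update j m).eventually_one g) j, rest]
  congr 1
  · simp [update]
  · refine finprod_congr fun n => ?_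
    by_cases hnj : n = j
    · subst hnj; simp
    · simp [update, hnj]

theorem update_eq (k : CcFam C) (j : ℕ) : k.update j (k.val j) = k := by
  cases k
  simp [update]

theorem continuous_rest (k : CcFam C) (j : ℕ) : Continuous (k.rest j) := by
  have e : k.rest j = fun g => ∏ᶠ n, Function.update (fun n x => k.val n x) j 1 n (g n) := by
    funext g
    refine finprod_congr fun n => ?_
    by_cases hnj : n = j
    · subst hnj; simp
    · simp [hnj]
  rw [e]
  refine RestrictedProduct.continuous_finprod (f := Function.update (fun n x => k.val n x) j 1)
    (fun n => ?_) ?_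
  · by_cases hnj : n = j
    · subst hnj; simp only [Function.update_self]; exact continuous_one
    · simp only [Function.update_of_ne hnj]; exact (k.val n).continuous
  · filter_upwards [k.eventually_one] with n hn x hx
    by_cases hnj : n = j
    · subst hnj; simp
    · simp only [Function.update_of_ne hnj]; exact hn x hx

theorem rest_mulSingle_mul (k : CcFam C) (j : ℕ) (x : G j) (g : Πʳ n, [G n, C n]) :
    k.rest j (RestrictedProduct.mulSingle C j x * g) = k.rest j g := by
  refine finprod_congr fun n => ?_
  by_cases hnj : n = j
  · subst hnj; simp
  · simp [hnj]

/-- The function `rest` has no compact support because the coordinate `j` is free. Confining that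
coordinate to a compact set restores compactness, as needed for exchanging integrals. -/
theorem isCompact_rest (k : CcFam C) (j : ℕ) {D : Set (G j)} (hD : IsCompact D) :
    ∃ E : Set (Πʳ n, [G n, C n]), IsCompact E ∧ ∀ g, g j ∈ D → k.rest j g ≠ 0 → g ∈ E := by
  refine ⟨{g | ∀ n, g n ∈ Function.update (fun n => tsupport (k.val n)) j D n},
    RestrictedProduct.isCompact_box (fun n => ?_) ?_, fun g hgD hg n => ?_⟩
  · by_cases hnj : n = j
    · subst hnj; simpa using hD
    · simp only [Function.update_of_ne hnj]; exact (k.val n).hasCompactSupport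
  · filter_upwards [k.eventually_eq, (Set.finite_singleton j).compl_mem_cofinite] with n hn h2
    rw [Function.update_of_ne (by simpa using h2), hn]
    refine closure_minimal (fun x hx => ?_) ((C n).isClosed_of_isOpen (hC.out n))
    by_contra hc
    exact hx (unitCc_notMem hc)
  · by_cases hnj : n = j
    · subst hnj; simpa using hgD
    · rw [Function.update_of_ne hnj]
      refine subset_tsupport _ fun h0 => hg ?_
      refine finprod_eq_zero _ n (by rw [Function.update_of_ne hnj]; exact h0) ?_
      refine Set.Finite.subset ((RestrictedProduct.hasFiniteMulSupport k.eventually_one g)) ?_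
      intro i hi
      by_cases hij : i = j
      · subst hij; simp at hi
      · rw [Function.mem_mulSupport, Function.update_of_ne hij] at hi
        exact hi

end CcFam

end RestrictedHaar

/-! ### The Haar integral of product functions -/

section RestrictedHaarFormula

open scoped CompactlySupported ComplexConjugate

variable {G : ℕ → Type u} [∀ n, Group (G n)] [∀ n, TopologicalSpace (G n)]
  {C : ∀ n, Subgroup (G n)} [hC : Fact (∀ n, IsOpen (C n : Set (G n)))] [∀ n, CompactSpace (C n)]
  [∀ n, IsTopologicalGroup (G n)] [∀ n, T2Space (G n)] [∀ n, LocallyCompactSpace (G n)]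
  [∀ n, SecondCountableTopology (G n)] [∀ n, MeasurableSpace (G n)] [∀ n, BorelSpace (G n)]
  {μ : ∀ n, Measure (G n)} [∀ n, (μ n).IsHaarMeasure] (hμ : ∀ n, μ n (C n : Set (G n)) = 1)
  [MeasurableSpace (Πʳ n, [G n, C n])] [BorelSpace (Πʳ n, [G n, C n])]
  {ν : Measure (Πʳ n, [G n, C n])} [ν.IsHaarMeasure]

include hC in
-- Inversion turns the right translation into a left translation, and the modular function is `1` on
-- `C n`.
theorem integral_mul_right_of_mem {n : ℕ} (f : G n → ℂ) {x : G n} (hx : x ∈ C n) :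
    ∫ h, f (h * x) ∂μ n = ∫ h, f h ∂μ n := by
  obtain ⟨Δ, hΔ, hΔC⟩ := exists_isModularFunction (μ n) (hC.out n)
    (isCompact_iff_compactSpace.2 (inferInstanceAs (CompactSpace (C n))))
  have h1 := hΔ.integral_inv (fun h => f (h * x))
  have h2 := hΔ.integral_inv f
  rw [← h1, ← h2, ← integral_mul_left_eq_self (μ := μ n) (fun s => (Δ s)⁻¹ • f (s⁻¹ * x)) x]
  refine integral_congr_ae (.of_forall fun s => ?_)
  simp [hΔ.mul, hΔC x hx]

include hμ in
theorem integral_unitCc (n : ℕ) : ∫ h, unitCc C n h ∂μ n = 1 := by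
  have h1 := integral_indCc (hC.out n)
    (isCompact_iff_compactSpace.2 (inferInstanceAs (CompactSpace (C n)))) (μ := μ n)
    (fun _ => (1 : ℂ))
  simp only [smul_eq_mul, mul_one] at h1
  refine h1.trans ?_
  simp [Measure.real, hμ]

namespace CcFam

include hμ in
-- Splitting off one coordinate uses only left invariance, not a description of the Haar measure as
-- a product. The factor `1 = ∫ 1_{C j}(g_j⁻¹ h) dh` is inserted, the integrals are exchanged, `g`
-- is translated by `h` in the coordinate `j`, and the integrals are exchanged back; now `g_j` is
-- confined to `C j`, where right translation of `m` does not matter.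
theorem integral_prod_update (k : CcFam C) (j : ℕ) (m : C_c(G j, ℂ)) :
    ∫ g, (k.update j m).prod g ∂ν =
      (∫ h, m h ∂μ j) * ∫ g, (k.update j (unitCc C j)).prod g ∂ν := by
  set F : (Πʳ n, [G n, C n]) → G j → ℂ := fun g h =>
    m (g j) * k.rest j g * unitCc C j ((g j)⁻¹ * h) with hF
  have hFc : Continuous (Function.uncurry F) := by
    have h0 : Continuous fun g : Πʳ n, [G n, C n] => g j := RestrictedProduct.continuous_eval j
    simp only [hF, Function.uncurry_def]
    exact ((m.continuous.comp (h0.comp continuous_fst)).mul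
      ((k.continuous_rest j).comp continuous_fst)).mul ((unitCc C j).continuous.comp
        ((h0.comp continuous_fst).inv.mul continuous_snd))
  have hmc : IsCompact (tsupport m) := m.hasCompactSupport
  obtain ⟨E, hE, hE'⟩ := k.isCompact_rest j hmc
  have hCc : IsCompact (C j : Set (G j)) := isCompact_iff_compactSpace.2 inferInstance
  have hFs : HasCompactSupport (Function.uncurry F) := by
    refine HasCompactSupport.intro (hE.prod (hmc.mul hCc)) fun p hp => ?_
    by_contra h
    simp only [hF, Function.uncurry_def] at h
    have ha := left_ne_zero_of_mul (left_ne_zero_of_mul h)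
    have hb := right_ne_zero_of_mul (left_ne_zero_of_mul h)
    have hc := right_ne_zero_of_mul h
    have hm : p.1 j ∈ tsupport m := subset_tsupport _ ha
    refine hp ⟨hE' _ hm hb, Set.mem_mul.2 ⟨p.1 j, hm, (p.1 j)⁻¹ * p.2, ?_, by simp⟩⟩
    by_contra hh
    exact hc (unitCc_notMem hh)
  have e1 : ∀ g, (k.update j m).prod g = ∫ h, F g h ∂μ j := fun g => by
    rw [prod_update]
    simp only [hF]
    rw [integral_const_mul, integral_mul_left_eq_self (μ := μ j) (fun h => unitCc C j h),
      integral_unitCc hμ, mul_one]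
  set F' : G j → (Πʳ n, [G n, C n]) → ℂ := fun h g =>
    m (h * g j) * k.rest j g * unitCc C j (g j) with hF'
  have e2 : ∀ h, ∫ g, F g h ∂ν = ∫ g, F' h g ∂ν := fun h => by
    rw [← integral_mul_left_eq_self (μ := ν) _ (RestrictedProduct.mulSingle C j h)]
    refine integral_congr_ae (.of_forall fun g => ?_)
    simp only [hF, hF', rest_mulSingle_mul]
    have : (RestrictedProduct.mulSingle C j h * g) j = h * g j := by simp
    rw [this, mul_inv_rev, inv_mul_cancel_right]
    congr 1
    by_cases hg : g j ∈ C j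
    · rw [unitCc_mem hg, unitCc_mem (inv_mem hg)]
    · rw [unitCc_notMem hg, unitCc_notMem (by simpa using hg)]
  have hFc' : Continuous (Function.uncurry F') := by
    have h0 : Continuous fun g : Πʳ n, [G n, C n] => g j := RestrictedProduct.continuous_eval j
    simp only [hF', Function.uncurry_def]
    exact ((m.continuous.comp (continuous_fst.mul (h0.comp continuous_snd))).mul
      ((k.continuous_rest j).comp continuous_snd)).mul ((unitCc C j).continuous.comp
        (h0.comp continuous_snd))
  obtain ⟨E', hE1, hE2⟩ := k.isCompact_rest j hCc
  have hFs' : HasCompactSupport (Function.uncurry F') := by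
    refine HasCompactSupport.intro ((hmc.mul hCc).prod hE1) fun p hp => ?_
    by_contra h
    simp only [hF', Function.uncurry_def] at h
    have ha := left_ne_zero_of_mul (left_ne_zero_of_mul h)
    have hb := right_ne_zero_of_mul (left_ne_zero_of_mul h)
    have hc : p.2 j ∈ C j := by
      by_contra hh
      exact right_ne_zero_of_mul h (unitCc_notMem hh)
    exact hp ⟨Set.mem_mul.2 ⟨p.1 * p.2 j, subset_tsupport _ ha, (p.2 j)⁻¹, inv_mem hc, by simp⟩,
      hE2 _ hc hb⟩
  simp only [e1]
  rw [integral_integral_swap_of_hasCompactSupport hFc hFs]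
  simp only [e2]
  rw [integral_integral_swap_of_hasCompactSupport hFc' hFs', ← integral_const_mul]
  refine integral_congr_ae (.of_forall fun g => ?_)
  simp only [prod_update, hF']
  by_cases hg : g j ∈ C j
  · rw [integral_mul_const, integral_mul_const, integral_mul_right_of_mem (fun h => m h) hg]
    ring
  · simp [unitCc_notMem hg]

/-- The product of the indicator functions. -/
def unit (C : ∀ n, Subgroup (G n)) [hC : Fact (∀ n, IsOpen (C n : Set (G n)))]
    [∀ n, CompactSpace (C n)] : CcFam C := ⟨unitCc C, .of_forall fun _ => rfl⟩

theorem unit_prod_apply (g : Πʳ n, [G n, C n]) :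
    (unit C).prod g = Set.indicator {g : Πʳ n, [G n, C n] | ∀ n, g n ∈ C n} 1 g := by
  by_cases hg : ∀ n, g n ∈ C n
  · rw [Set.indicator_of_mem (by exact hg), prod_apply]
    exact finprod_eq_one_of_forall_eq_one fun n => unitCc_mem (hg n)
  · rw [Set.indicator_of_notMem (by exact hg)]
    push Not at hg
    obtain ⟨n, hn⟩ := hg
    by_contra hc
    exact apply_ne_zero hc n (unitCc_notMem hn)

/-- The measure of the compact open subgroup `∏ C n`. -/
def boxVol (ν : Measure (Πʳ n, [G n, C n])) : ℝ := ν.real {g : Πʳ n, [G n, C n] | ∀ n, g n ∈ C n}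

theorem isOpen_box : IsOpen {g : Πʳ n, [G n, C n] | ∀ n, g n ∈ C n} :=
  RestrictedProduct.isOpen_forall_mem hC.out

theorem isCompact_unit_box : IsCompact {g : Πʳ n, [G n, C n] | ∀ n, g n ∈ C n} :=
  RestrictedProduct.isCompact_box
    (fun n => isCompact_iff_compactSpace.2 (inferInstanceAs (CompactSpace (C n))))
    (.of_forall fun _ => subset_rfl)

theorem boxVol_pos : 0 < boxVol ν := by
  refine ENNReal.toReal_pos (isOpen_box.measure_pos ν ⟨1, fun n => one_mem _⟩).ne' ?_
  exact isCompact_unit_box.measure_lt_top.ne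

theorem integral_unit_prod : ∫ g, (unit C).prod g ∂ν = boxVol ν := by
  simp only [unit_prod_apply]
  rw [integral_indicator isOpen_box.measurableSet]
  simp [boxVol]

include hμ in
-- Coordinates are replaced one at a time by the indicator functions, until only the indicator of
-- the box is left.
theorem integral_prod (k : CcFam C) :
    ∫ g, k.prod g ∂ν = boxVol ν * ∏ᶠ n, ∫ h, k.val n h ∂μ n := by
  classical
  have key : ∀ F : Finset ℕ, ∀ k : CcFam C, (∀ n ∉ F, k.val n = unitCc C n) →
      ∫ g, k.prod g ∂ν = boxVol ν * ∏ n ∈ F, ∫ h, k.val n h ∂μ n := by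
    intro F
    induction F using Finset.induction_on with
    | empty =>
      intro k hk
      have : k = unit C := by
        cases k
        simp only [unit, mk.injEq]
        funext n
        exact hk n (by simp)
      rw [this, integral_unit_prod]; simp
    | insert a s ha ih =>
      intro k hk
      have h1 := integral_prod_update hμ (ν := ν) k a (k.val a)
      rw [update_eq] at h1
      rw [h1, ih, Finset.prod_insert ha]
      · have : ∏ n ∈ s, ∫ h, (k.update a (unitCc C a)).val n h ∂μ n = ∏ n ∈ s, ∫ h, k.val n h ∂μ n :=
          Finset.prod_congr rfl fun n hn => by
            rw [update]
            simp only [Function.update_of_ne (ne_of_mem_of_not_mem hn ha)]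
        rw [this]; ring
      · intro n hn
        by_cases hna : n = a
        · subst hna; simp [update]
        · simp only [update, Function.update_of_ne hna]
          exact hk n (by simp [hna, hn])
  have hk := mem_cofinite.1 k.eventually_eq
  have hk' : ∀ n ∉ hk.toFinset, k.val n = unitCc C n := fun n hn => by
    by_contra h
    exact hn ((Set.Finite.mem_toFinset _).2 h)
  rw [key hk.toFinset k hk', finprod_eq_prod_of_mulSupport_subset]
  intro n hn
  by_contra h
  exact hn (by simp only [hk' n h, integral_unitCc hμ])

end CcFam

end RestrictedHaarFormula

/-! ### Density of the product functions in `L²` -/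

section RestrictedDensity

open scoped CompactlySupported Pointwise

variable {G : ℕ → Type u} [∀ n, Group (G n)] [∀ n, TopologicalSpace (G n)]
  {C : ∀ n, Subgroup (G n)} [hC : Fact (∀ n, IsOpen (C n : Set (G n)))] [∀ n, CompactSpace (C n)]
  [∀ n, IsTopologicalGroup (G n)] [∀ n, T2Space (G n)]

theorem unitCc_translate {n : ℕ} {x : G n} (hx : x ∈ C n) :
    (unitCc C n).translate x = unitCc C n := by
  ext t
  rw [CompactlySupportedContinuousMap.translate_apply]
  by_cases ht : t ∈ C n
  · rw [unitCc_mem ht, unitCc_mem (mul_mem (inv_mem hx) ht)]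
  · rw [unitCc_notMem ht, unitCc_notMem fun h => ht ?_]
    simpa using mul_mem hx h

namespace CcFam

theorem ext' {k l : CcFam C} (h : ∀ n, k.val n = l.val n) : k = l := by
  cases k; cases l
  obtain rfl := funext h
  rfl

/-- Pointwise products. -/
def mul (k l : CcFam C) : CcFam C :=
  ⟨fun n => k.val n * l.val n, by
    filter_upwards [k.eventually_eq, l.eventually_eq] with n h1 h2
    ext x
    by_cases hx : x ∈ C n
    · simp [h1, h2, unitCc_mem hx]
    · simp [h1, h2, unitCc_notMem hx]⟩

theorem mul_prod (k l : CcFam C) (g : Πʳ n, [G n, C n]) :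
    (k.mul l).prod g = k.prod g * l.prod g := by
  rw [prod_apply, prod_apply, prod_apply, ← finprod_mul_distrib
    (RestrictedProduct.hasFiniteMulSupport k.eventually_one g)
    (RestrictedProduct.hasFiniteMulSupport l.eventually_one g)]
  rfl

/-- Pointwise conjugates. -/
def conj (k : CcFam C) : CcFam C :=
  ⟨fun n => star (k.val n), by
    filter_upwards [k.eventually_eq] with n h1
    ext x
    by_cases hx : x ∈ C n
    · simp [h1, unitCc_mem hx]
    · simp [h1, unitCc_notMem hx]⟩

theorem conj_prod (k : CcFam C) (g : Πʳ n, [G n, C n]) : k.conj.prod g = star (k.prod g) := by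
  rw [prod_apply, prod_apply]
  exact (MonoidHom.map_finprod (starRingEnd ℂ : ℂ →* ℂ)
    (RestrictedProduct.hasFiniteMulSupport k.eventually_one g)).symm

/-- Left translates. -/
def translate (x : Πʳ n, [G n, C n]) (k : CcFam C) : CcFam C :=
  ⟨fun n => (k.val n).translate (x n), by
    filter_upwards [k.eventually_eq, x.2] with n h1 h2
    rw [h1]
    exact unitCc_translate h2⟩

theorem translate_prod (x : Πʳ n, [G n, C n]) (k : CcFam C) :
    (k.translate x).prod = k.prod.translate x := rfl

variable [∀ n, LocallyCompactSpace (G n)] [∀ n, SecondCountableTopology (G n)]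
  [∀ n, MeasurableSpace (G n)] [∀ n, BorelSpace (G n)]
  [MeasurableSpace (Πʳ n, [G n, C n])] [BorelSpace (Πʳ n, [G n, C n])]
  (ν : Measure (Πʳ n, [G n, C n])) [ν.IsHaarMeasure]

/-- The product functions have dense span in the continuous functions on a translate of `∏ C n`. -/
theorem dense_span_restrict (x : Πʳ n, [G n, C n]) (Q : Set (Πʳ n, [G n, C n]))
    (hQ : Q = {g | x⁻¹ * g ∈ {g : Πʳ n, [G n, C n] | ∀ n, g n ∈ C n}}) (hQc : IsCompact Q) :
    Dense (Submodule.span ℂ {f : C(Q, ℂ) | ∃ k : CcFam C, ∀ g : Q, f g = k.prod g} : Set C(Q, ℂ)) := by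
  have : CompactSpace Q := isCompact_iff_compactSpace.1 hQc
  set S : Set C(Q, ℂ) := {f | ∃ k : CcFam C, ∀ g : Q, f g = k.prod g} with hS
  have hone : ∀ g ∈ Q, ((unit C).translate x).prod g = 1 := fun g hg => by
    rw [translate_prod, CompactlySupportedContinuousMap.translate_apply, unit_prod_apply]
    rw [hQ] at hg
    exact Set.indicator_of_mem (a := x⁻¹ * g) hg _
  have h1 : (1 : C(Q, ℂ)) ∈ S := ⟨(unit C).translate x, fun g => (hone g g.2).symm⟩
  have hmul : S * S ⊆ S := by
    rintro _ ⟨f, ⟨k, hk⟩, f', ⟨l, hl⟩, rfl⟩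
    exact ⟨k.mul l, fun g => by rw [mul_prod, ← hk, ← hl]; rfl⟩
  have hstar : ∀ f ∈ S, star f ∈ S := by
    rintro f ⟨k, hk⟩
    exact ⟨k.conj, fun g => by rw [conj_prod, ← hk]; rfl⟩
  -- Product functions are closed under products and conjugation and contain the unit, so their
  -- linear span is already the generated star algebra.
  have hadj : (StarAlgebra.adjoin ℂ S : Set C(Q, ℂ)) ⊆ Submodule.span ℂ S := by
    intro f hf
    refine StarAlgebra.adjoin_induction (p := fun f _ => f ∈ Submodule.span ℂ S)
      (fun f hf => Submodule.subset_span hf) (fun r => ?_) (fun _ _ _ _ => Submodule.add_mem _)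
      (fun f f' _ _ hf hf' => ?_) (fun f _ hf => ?_) hf
    · rw [Algebra.algebraMap_eq_smul_one]
      exact Submodule.smul_mem _ _ (Submodule.subset_span h1)
    · have := Submodule.mul_mem_mul hf hf'
      rw [Submodule.span_mul_span] at this
      exact Submodule.span_mono hmul this
    · clear * - hf hstar
      induction hf using Submodule.span_induction with
      | mem f hf => exact Submodule.subset_span (hstar f hf)
      | zero => rw [star_zero]; exact Submodule.zero_mem _
      | add f f' _ _ h h' => rw [star_add]; exact Submodule.add_mem _ h h'
      | smul a f _ h => rw [star_smul]; exact Submodule.smul_mem _ _ h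
  have hsep : (StarAlgebra.adjoin ℂ S).SeparatesPoints := by
    rintro g h hgh
    have : ∃ n, (g : Πʳ n, [G n, C n]) n ≠ (h : Πʳ n, [G n, C n]) n := by
      by_contra! hc
      exact hgh (Subtype.ext (RestrictedProduct.ext _ _ hc))
    obtain ⟨n, hn⟩ := this
    obtain ⟨f, hf1, hf0, hfc, -⟩ := exists_continuous_one_zero_of_isCompact
      (isCompact_singleton (x := (g : Πʳ n, [G n, C n]) n))
      (isClosed_singleton (x := (h : Πʳ n, [G n, C n]) n)) (by simpa using hn)
    let m : C_c(G n, ℂ) := ⟨⟨fun t => (f t : ℂ), by fun_prop⟩,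
      hfc.comp_left (g := fun r : ℝ => (r : ℂ)) (by simp)⟩
    have hm1 : m ((g : Πʳ n, [G n, C n]) n) = 1 := by
      have : f ((g : Πʳ n, [G n, C n]) n) = 1 := hf1 rfl
      change ((f _ : ℝ) : ℂ) = 1
      rw [this]; simp
    have hm0 : m ((h : Πʳ n, [G n, C n]) n) = 0 := by
      have : f ((h : Πʳ n, [G n, C n]) n) = 0 := hf0 rfl
      change ((f _ : ℝ) : ℂ) = 0
      rw [this]; simp
    -- On `Q` the translated indicator is `1`, so all coordinates other than `n` contribute `1` at
    -- `g`, and the values at `g` and `h` differ through `m`.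
    set k := ((unit C).translate x).update n m
    let F : C(Q, ℂ) := ⟨fun g => k.prod g, k.prod.continuous.comp continuous_subtype_val⟩
    refine ⟨F, ⟨F, StarAlgebra.subset_adjoin ℂ S ⟨k, fun _ => rfl⟩, rfl⟩, ?_⟩
    change k.prod g ≠ k.prod h
    rw [prod_update, prod_update, hm0, hm1, zero_mul, one_mul]
    have := hone g g.2
    rw [← update_eq ((unit C).translate x) n, prod_update] at this
    exact right_ne_zero_of_mul (this ▸ one_ne_zero)
  have htop := ContinuousMap.starSubalgebra_topologicalClosure_eq_top_of_separatesPoints _ hsep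
  have hd : Dense (StarAlgebra.adjoin ℂ S : Set C(Q, ℂ)) := by
    rw [dense_iff_closure_eq, ← StarSubalgebra.topologicalClosure_coe, htop]
    rfl
  exact hd.mono hadj

/-- A square integrable function orthogonal to all product functions vanishes. -/
theorem ae_eq_zero_of_integral_prod {m : (Πʳ n, [G n, C n]) → ℂ} (hm : MemLp m 2 ν)
    (h : ∀ k : CcFam C, ∫ g, k.prod g * m g ∂ν = 0) : m =ᵐ[ν] 0 := by
  -- The claim is local. On a translate `Q` of the compact open box, `f ↦ ∫_Q f m` is a bounded
  -- functional on `C(Q)` that vanishes on the dense span of product functions.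
  have key : ∀ x : Πʳ n, [G n, C n], ∃ Q ∈ 𝓝 x, ν (Q ∩ {g | m g ≠ 0}) = 0 := by
    intro x
    set B : Set (Πʳ n, [G n, C n]) := {g | ∀ n, g n ∈ C n} with hB
    set Q : Set (Πʳ n, [G n, C n]) := {g | x⁻¹ * g ∈ B} with hQ
    have hQo : IsOpen Q := isOpen_box.preimage (continuous_const_mul x⁻¹)
    have hQc : IsCompact Q := by
      have : Q = (fun g => x * g) '' B := by
        ext g
        exact ⟨fun hg => ⟨_, hg, by simp⟩, by rintro ⟨b, hb, rfl⟩; simpa [hQ] using hb⟩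
      rw [this]
      exact isCompact_unit_box.image (continuous_const_mul x)
    have : CompactSpace Q := isCompact_iff_compactSpace.1 hQc
    have hQm := hQo.measurableSet
    have hfin : IsFiniteMeasure (ν.restrict Q) := ⟨by simpa using hQc.measure_lt_top⟩
    have hint : Integrable m (ν.restrict Q) := (hm.restrict Q).integrable (by norm_num)
    set ν' : Measure Q := ν.comap Subtype.val
    have hint' : Integrable (fun g : Q => m g) ν' := by
      have h1 := (MeasurableEmbedding.subtype_coe hQm).integrable_map_iff (μ := ν')
        (g := m)
      rw [(MeasurableEmbedding.subtype_coe hQm).map_comap, Subtype.range_coe] at h1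
      exact h1.1 hint
    have hi : ∀ f : C(Q, ℂ), Integrable (fun g : Q => f g * m g) ν' := fun f =>
      hint'.bdd_mul f.continuous.aestronglyMeasurable (ae_of_all _ f.norm_coe_le_norm)
    let Φ : C(Q, ℂ) →ₗ[ℂ] ℂ :=
      { toFun f := ∫ g : Q, f g * m g ∂ν'
        map_add' f f' := by
          simp only [ContinuousMap.add_apply, add_mul]
          exact integral_add (hi f) (hi f')
        map_smul' a f := by
          simp only [ContinuousMap.smul_apply, smul_eq_mul, mul_assoc, RingHom.id_apply]
          exact integral_const_mul _ _ }
    have hΦ : ∀ f, ‖Φ f‖ ≤ (∫ g : Q, ‖m g‖ ∂ν') * ‖f‖ := fun f => by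
      rw [mul_comm, ← integral_const_mul]
      refine norm_integral_le_of_norm_le (hint'.norm.const_mul _) (ae_of_all _ fun g => ?_)
      rw [norm_mul]
      gcongr
      exact f.norm_coe_le_norm g
    let Ψ := Φ.mkContinuous _ hΦ
    -- The indicator of `Q` is itself a product function, so cutting a product function off to `Q`
    -- stays within the family for which the integrals vanish.
    have hQone : ∀ g, ((unit C).translate x).prod g = Q.indicator 1 g := fun g => by
      rw [translate_prod, CompactlySupportedContinuousMap.translate_apply, unit_prod_apply]
      rfl
    have hΨ : Ψ = 0 := by
      refine ContinuousLinearMap.ext_on (dense_span_restrict x Q rfl hQc) ?_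
      rintro f ⟨k, hk⟩
      change ∫ g : Q, f g * m g ∂ν' = 0
      simp only [hk]
      rw [integral_subtype_comap hQm (fun g => k.prod g * m g), ← integral_indicator hQm,
        ← h (((unit C).translate x).mul k)]
      refine integral_congr_ae (ae_of_all _ fun g => ?_)
      simp only [mul_prod, hQone]
      by_cases hg : g ∈ Q <;> simp [hg]
    have hz : Q.indicator m =ᵐ[ν] 0 := by
      refine ae_eq_zero_of_memLp ν (hm.indicator hQm) fun k => ?_
      have := congrArg (fun Θ => Θ (k.toContinuousMap.restrict Q)) hΨ
      change ∫ g : Q, k g * m g ∂ν' = 0 at this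
      rw [integral_subtype_comap hQm (fun g => k g * m g), ← integral_indicator hQm] at this
      rw [← this]
      refine integral_congr_ae (ae_of_all _ fun g => ?_)
      by_cases hg : g ∈ Q <;> simp [hg]
    refine ⟨Q, hQo.mem_nhds (by simp [hQ, hB, one_mem]), ?_⟩
    rw [← nonpos_iff_eq_zero]
    refine (measure_mono ?_).trans_eq (ae_iff.1 hz)
    rintro g ⟨hg, hg'⟩
    simpa [hg] using hg'
  refine measure_null_of_locally_null _ fun x _ => ?_
  obtain ⟨Q, hQ, h0⟩ := key x
  exact ⟨Q ∩ {g | m g ≠ 0}, Filter.inter_mem (mem_nhdsWithin_of_mem_nhds hQ) self_mem_nhdsWithin, h0⟩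

variable {H : Type v} [NormedAddCommGroup H] [InnerProductSpace ℂ H] [CompleteSpace H]
  [SecondCountableTopology H]

theorem totalSet_elemL2_prod {s : Set H} (hs : TotalSet s) :
    TotalSet {f : Lp H 2 ν | ∃ (k : CcFam C) (ζ : H), ζ ∈ s ∧ f = elemL2 ν k.prod ζ} := by
  intro f hf
  refine Lp_ext_of_inner ν hs fun ζ hζ => ?_
  have := ae_eq_zero_of_integral_prod ν (memLp_inner_const ν f ζ) fun k => by
    rw [← inner_elemL2_right, ← inner_conj_symm, hf _ ⟨k, ζ, hζ, rfl⟩, map_zero]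
  filter_upwards [this, Lp.coeFn_zero H 2 ν] with t h1 h2
  rw [h1, h2]; simp

end CcFam

end RestrictedDensity

/-! ### Elementary vectors and the commutant of the range of `π` -/

section ElementaryVectors

open scoped CompactlySupported ComplexConjugate

variable {H : Type u} [NormedAddCommGroup H] [InnerProductSpace ℂ H] [CompleteSpace H]
  [SecondCountableTopology H] {M : VonNeumannAlgebra H}
  {G : Type v} [Group G] [TopologicalSpace G] [IsTopologicalGroup G] [MeasurableSpace G]
  [BorelSpace G] [LocallyCompactSpace G] [T2Space G] [SecondCountableTopology G]
  (μ : Measure G) [μ.IsHaarMeasure]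

/-- The map `ζ ↦ k ⊗ ζ`. -/
def elemCLM (H : Type u) [NormedAddCommGroup H] [InnerProductSpace ℂ H] [CompleteSpace H]
    [SecondCountableTopology H] (k : C_c(G, ℂ)) : H →L[ℂ] Lp H 2 μ :=
  LinearMap.mkContinuous
    { toFun := elemL2 μ k
      map_add' := fun v w => by
        refine Lp.ext ?_
        filter_upwards [coeFn_elemL2 μ k (v + w), coeFn_elemL2 μ k v, coeFn_elemL2 μ k w,
          Lp.coeFn_add (elemL2 μ k v) (elemL2 μ k w)] with t h1 h2 h3 h4
        rw [h1, h4, Pi.add_apply, h2, h3, smul_add]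
      map_smul' := fun r v => by
        refine Lp.ext ?_
        filter_upwards [coeFn_elemL2 μ k (r • v), coeFn_elemL2 μ k v,
          Lp.coeFn_smul r (elemL2 μ k v)] with t h1 h2 h3
        rw [h1, RingHom.id_apply, h3, Pi.smul_apply, h2, smul_comm] }
    ‖elemL2 μ k (1 : ℂ)‖ fun v => by
      rw [mul_comm]
      refine Lp.norm_le_mul_norm_of_ae_le_mul ?_
      filter_upwards [coeFn_elemL2 μ k v, coeFn_elemL2 μ k (1 : ℂ)] with t h1 h2
      simp only [LinearMap.coe_mk, AddHom.coe_mk]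
      rw [h1, h2, norm_smul, norm_smul, norm_one, mul_one, mul_comm]

theorem inner_piOp_elemL2 (α : VNAction G M) (x : M.Elt) (k k' : C_c(G, ℂ)) (ζ ζ' : H) :
    ⟪elemL2 μ k ζ, α.piOp μ x (elemL2 μ k' ζ')⟫_ℂ =
      ∫ t, ⟪ζ, (α.aut t⁻¹ x : H →L[ℂ] H) ζ'⟫_ℂ * (conj (k t) * k' t) ∂μ := by
  rw [inner_elemL2]
  refine integral_congr_ae ?_
  filter_upwards [α.coeFn_piOp μ x (elemL2 μ k' ζ'), coeFn_elemL2 μ k' ζ'] with t h1 h2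
  rw [h1, h2, map_smul, inner_smul_right]
  ring

/-- An operator commuting with `π(s)` for all `s` in a generating set commutes with the range
of `π`, if the action is implemented by unitaries. -/
theorem commute_piOp_of_generated {S : Set (H →L[ℂ] H)} {N : VonNeumannAlgebra H}
    (hN : N = VonNeumannAlgebra.generated S) (α : VNAction G N)
    (U : G →* (H ≃ₗᵢ[ℂ] H)) (hU : ∀ v, Continuous fun g => U g v)
    (hα : ∀ g x, (α.aut g x : H →L[ℂ] H) = conjCLM (U g) x) {T : Lp H 2 μ →L[ℂ] Lp H 2 μ}
    (hT : ∀ x : N.Elt, (x : H →L[ℂ] H) ∈ S → α.piOp μ x * T = T * α.piOp μ x ∧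
      α.piOp μ (star x) * T = T * α.piOp μ (star x)) (y : N.Elt) :
    T * α.piOp μ y = α.piOp μ y * T := by
  have hinv : ∀ g v, (U g).symm v = U g⁻¹ v := fun g v => by
    rw [map_inv]; rfl
  have hU' : ∀ v, Continuous fun g => (U g).symm v := fun v => by
    simp only [hinv]
    exact (hU v).comp continuous_inv
  set D := pwUnitary μ U hU hU'
  -- The map `w ↦ (t ↦ k(t) U_t⁻¹ w)` intertwines `x` with `π(x)`, so after this twist `π` is an
  -- amplification and the commutant argument for amplifications applies.
  let j : C_c(G, ℂ) → H →L[ℂ] Lp H 2 μ := fun k =>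
    (D.symm.toContinuousLinearEquiv : Lp H 2 μ →L[ℂ] Lp H 2 μ) ∘L elemCLM μ H k
  have hj : ∀ k w, j k w = D.symm (elemL2 μ k w) := fun _ _ => rfl
  have hjc : ∀ k w, j k w =ᵐ[μ] fun t => k t • (U t).symm w := fun k w => by
    rw [hj, pwUnitary_symm]
    filter_upwards [coeFn_pwUnitary μ (fun s => (U s).symm) hU' hU (elemL2 μ k w),
      coeFn_elemL2 μ k w] with t h1 h2
    rw [h1, h2, map_smul]
  have hpi : ∀ (x : N.Elt) k w, α.piOp μ x (j k w) = j k ((x : H →L[ℂ] H) w) := fun x k w => by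
    refine Lp.ext ?_
    filter_upwards [α.coeFn_piOp μ x (j k w), hjc k w, hjc k ((x : H →L[ℂ] H) w)] with t h1 h2 h3
    rw [h1, h2, h3, hα, map_smul]
    congr 1
    rw [conjCLM_apply, hinv t⁻¹, inv_inv, (U t).apply_symm_apply, hinv]
  have htot : TotalSet {v | ∃ k w, v = j k w} := by
    have h1 := totalSet_elemL2 μ (dense_univ (X := H)).totalSet
    intro f hf
    have : D f = 0 := h1 _ fun g hg => by
      obtain ⟨k, w, -, rfl⟩ := hg
      have := hf _ ⟨k, w, rfl⟩
      rw [hj, ← D.inner_map_map, D.apply_symm_apply] at this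
      exact this
    simpa using this
  subst hN
  refine VonNeumannAlgebra.commute_of_amplification (S := S) htot (fun s hs => ?_) y.2 (hpi y) ?_
  · refine ⟨α.piOp μ ⟨s, VonNeumannAlgebra.subset_generated S hs⟩, hpi _, fun k w => ?_, ?_, ?_⟩
    · rw [VNAction.star_piOp]
      exact hpi _ k w
    · exact (hT ⟨s, _⟩ hs).1
    · rw [VNAction.star_piOp]
      exact (hT ⟨s, _⟩ hs).2
  · intro k w
    rw [VNAction.star_piOp]
    exact hpi _ k w

end ElementaryVectors

/-! ### Matrix coefficients of tensor products of crossed product generators -/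

section TensorCrossed

open scoped CompactlySupported ComplexConjugate
open InfTensor

variable {G : ℕ → Type u} [∀ n, Group (G n)] [∀ n, TopologicalSpace (G n)]
  {C : ∀ n, Subgroup (G n)} [hC : Fact (∀ n, IsOpen (C n : Set (G n)))] [∀ n, CompactSpace (C n)]
  [∀ n, IsTopologicalGroup (G n)] [∀ n, T2Space (G n)] [∀ n, LocallyCompactSpace (G n)]
  [∀ n, SecondCountableTopology (G n)] [∀ n, MeasurableSpace (G n)] [∀ n, BorelSpace (G n)]
  {μ : ∀ n, Measure (G n)} [∀ n, (μ n).IsHaarMeasure] (hμ : ∀ n, μ n (C n : Set (G n)) = 1)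
  [MeasurableSpace (Πʳ n, [G n, C n])] [BorelSpace (Πʳ n, [G n, C n])]
  (ν : Measure (Πʳ n, [G n, C n])) [ν.IsHaarMeasure]
  {H : ℕ → Type v} [∀ n, NormedAddCommGroup (H n)] [∀ n, InnerProductSpace ℂ (H n)]
  [∀ n, CompleteSpace (H n)] [∀ n, SecondCountableTopology (H n)]
  {ξ : ∀ n, Metric.sphere (0 : H n) 1} {η : ∀ n, Metric.sphere (0 : Lp (H n) 2 (μ n)) 1}
  (hη : ∀ n, (η n : Lp (H n) 2 (μ n)) = elemL2 (μ n) (unitCc C n) (ξ n : H n))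

/-- The family of vectors `k n ⊗ ζ n`. -/
def elemFam (k : CcFam C) (ζ : Fam ξ) : Fam η :=
  ⟨fun n => elemL2 (μ n) (k.val n) (ζ.val n), by
    filter_upwards [k.eventually_eq, ζ.eventually_eq] with n h1 h2
    rw [h1, h2, hη]⟩

theorem totalSet_elemFam : TotalSet (Set.range fun i : CcFam C × Fam ξ => tmul (elemFam hη i.1 i.2)) := by
  classical
  refine (totalSet_tmul_of_totalSet (ξ := η)
    fun n => totalSet_elemL2 (μ n) (dense_univ (X := H n)).totalSet).mono ?_
  rintro _ ⟨w, hw, rfl⟩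
  -- In the slots that carry the base vector the choice must be the indicator function and the base
  -- vector `ξ n`, so that the chosen families are admissible.
  have : ∀ n, ∃ (k : C_c(G n, ℂ)) (ζ : H n), w.val n = elemL2 (μ n) k ζ ∧
      (w.val n = η n → k = unitCc C n ∧ ζ = ξ n) := fun n => by
    by_cases h : w.val n = η n
    · exact ⟨unitCc C n, ξ n, h.trans (hη n), fun _ => ⟨rfl, rfl⟩⟩
    · obtain ⟨k, ζ, -, h'⟩ := (hw n).resolve_right h
      exact ⟨k, ζ, h', fun h'' => absurd h'' h⟩
  choose k ζ hkζ hk using this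
  refine ⟨(⟨k, w.eventually_eq.mono fun n hn => (hk n hn).1⟩,
    ⟨ζ, w.eventually_eq.mono fun n hn => (hk n hn).2⟩), ?_⟩
  exact congrArg tmul (Fam.ext fun n => (hkζ n).symm)

variable {M : ∀ n, VonNeumannAlgebra (H n)} {β : ∀ n, VNAction (G n) (M n)}
  {N : VonNeumannAlgebra (InfTensor ξ)} (α : VNAction (Πʳ n, [G n, C n]) N)

theorem eventually_piOp {x : ∀ n, (M n).Elt} (hx : ∀ᶠ n in cofinite, x n = 1) :
    ∀ᶠ n in cofinite, (β n).piOp (μ n) (x n) = 1 :=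
  hx.mono fun n h => by rw [h, VNAction.piOp_one]

theorem eventually_aut {x : ∀ n, (M n).Elt} (hx : ∀ᶠ n in cofinite, x n = 1)
    (g : Πʳ n, [G n, C n]) :
    ∀ᶠ n in cofinite, ((β n).aut (g n) (x n) : H n →L[ℂ] H n) = 1 :=
  hx.mono fun n h => by rw [h, map_one]; rfl

include hμ in
-- The coefficient of `π` is the integral over the restricted product of the product function with
-- factors `⟪ζ n, β_{t⁻¹}(x n) ζ' n⟫ conj k n (t) k' n (t)`, so it factors into the coefficients on
-- the spaces `L²(G n, H n)` up to the volume of the box.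
theorem inner_piOp_elemFam {x : ∀ n, (M n).Elt} (hx : ∀ᶠ n in cofinite, x n = 1) {y : N.Elt}
    (hy : ∀ g, (α.aut g y : InfTensor ξ →L[ℂ] InfTensor ξ) =
      op (fun n => ((β n).aut (g n) (x n) : H n →L[ℂ] H n)) (eventually_aut hx g))
    (k k' : CcFam C) (ζ ζ' : Fam ξ) :
    ⟪elemL2 ν k.prod (tmul ζ), α.piOp ν y (elemL2 ν k'.prod (tmul ζ'))⟫_ℂ =
      CcFam.boxVol ν * ⟪tmul (elemFam hη k ζ),
        op (fun n => (β n).piOp (μ n) (x n)) (eventually_piOp hx) (tmul (elemFam hη k' ζ'))⟫_ℂ := by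
  have hc : ∀ n, Continuous fun t : G n => ⟪ζ.val n, ((β n).aut t⁻¹ (x n) : H n →L[ℂ] H n) (ζ'.val n)⟫_ℂ :=
    fun n => continuous_const.inner (((β n).continuous_aut_apply (x n) (ζ'.val n)).comp continuous_inv)
  let m : CcFam C := ⟨fun n => (star (k.val n) * k'.val n).mulLeft _ (hc n), by
    filter_upwards [hx, k.eventually_eq, k'.eventually_eq, ζ.eventually_eq, ζ'.eventually_eq]
      with n h1 h2 h3 h4 h5
    ext t
    rw [CompactlySupportedContinuousMap.mulLeft_apply, h1, h2, h3, h4, h5, map_one]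
    change ⟪(ξ n : H n), (ξ n : H n)⟫_ℂ * (star (unitCc C n t) * unitCc C n t) = unitCc C n t
    rw [inner_base, one_mul]
    by_cases ht : t ∈ C n
    · simp [unitCc_mem ht]
    · simp [unitCc_notMem ht]⟩
  have e1 : ∀ n, ∫ t, m.val n t ∂μ n =
      ⟪(elemFam hη k ζ).val n, (β n).piOp (μ n) (x n) ((elemFam hη k' ζ').val n)⟫_ℂ := fun n =>
    (inner_piOp_elemL2 (μ n) (β n) (x n) (k.val n) (k'.val n) (ζ.val n) (ζ'.val n)).symm
  rw [op_tmul, inner_tmul, inner_piOp_elemL2]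
  refine Eq.trans (integral_congr_ae (.of_forall fun g => ?_)) ((CcFam.integral_prod hμ m).trans ?_)
  · simp only
    rw [hy, op_tmul, inner_tmul, CcFam.prod_apply, CcFam.prod_apply, CcFam.prod_apply]
    have f1 := RestrictedProduct.hasFiniteMulSupport k.conj.eventually_one g
    have f2 := RestrictedProduct.hasFiniteMulSupport k'.eventually_one g
    have e3 : conj (∏ᶠ n, k.val n (g n)) = ∏ᶠ n, k.conj.val n (g n) :=
      (CcFam.conj_prod k g).symm
    rw [e3, ← finprod_mul_distrib f1 f2, ← finprod_mul_distrib]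
    · rfl
    · refine Set.Finite.subset (mem_cofinite.1
        ((hx.and ζ.eventually_eq).and ζ'.eventually_eq)) fun n hn hn' => hn ?_
      obtain ⟨⟨a1, a2⟩, a3⟩ := hn'
      change ⟪ζ.val n, ((β n).aut (g⁻¹ n) (x n) : H n →L[ℂ] H n) (ζ'.val n)⟫_ℂ = 1
      rw [a1, a2, a3, map_one]
      exact inner_base n
    · exact f1.mul f2
  · congr 1
    exact finprod_congr e1

end TensorCrossed

/-! ### The unitary between the infinite tensor product and `L²` of the restricted product -/

section TensorCrossedUnitary

open scoped CompactlySupported ComplexConjugate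
open InfTensor

variable {G : ℕ → Type u} [∀ n, Group (G n)] [∀ n, TopologicalSpace (G n)]
  {C : ∀ n, Subgroup (G n)} [hC : Fact (∀ n, IsOpen (C n : Set (G n)))] [∀ n, CompactSpace (C n)]
  [∀ n, IsTopologicalGroup (G n)] [∀ n, T2Space (G n)] [∀ n, LocallyCompactSpace (G n)]
  [∀ n, SecondCountableTopology (G n)] [∀ n, MeasurableSpace (G n)] [∀ n, BorelSpace (G n)]
  {μ : ∀ n, Measure (G n)} [∀ n, (μ n).IsHaarMeasure] (hμ : ∀ n, μ n (C n : Set (G n)) = 1)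
  [MeasurableSpace (Πʳ n, [G n, C n])] [BorelSpace (Πʳ n, [G n, C n])]
  (ν : Measure (Πʳ n, [G n, C n])) [ν.IsHaarMeasure]
  {H : ℕ → Type v} [∀ n, NormedAddCommGroup (H n)] [∀ n, InnerProductSpace ℂ (H n)]
  [∀ n, CompleteSpace (H n)] [∀ n, SecondCountableTopology (H n)]
  {ξ : ∀ n, Metric.sphere (0 : H n) 1} {η : ∀ n, Metric.sphere (0 : Lp (H n) 2 (μ n)) 1}
  (hη : ∀ n, (η n : Lp (H n) 2 (μ n)) = elemL2 (μ n) (unitCc C n) (ξ n : H n))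
  {M : ∀ n, VonNeumannAlgebra (H n)} {β : ∀ n, VNAction (G n) (M n)}
  {N : VonNeumannAlgebra (InfTensor ξ)} (α : VNAction (Πʳ n, [G n, C n]) N)

theorem totalSet_elemL2_tmul : TotalSet {f : Lp (InfTensor ξ) 2 ν | ∃ (k : CcFam C) (ζ : Fam ξ),
    f = elemL2 ν k.prod (tmul ζ)} := by
  refine (CcFam.totalSet_elemL2_prod ν (totalSet_tmul (ξ := ξ))).mono ?_
  rintro _ ⟨k, _, ⟨ζ, rfl⟩, rfl⟩
  exact ⟨k, ζ, rfl⟩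

/-- The vectors `κ^(-1/2) (⨂ k n) ⊗ (⨂ ζ n)`, where `κ` is the measure of `∏ C n`. -/
def normElem (i : CcFam C × Fam ξ) : Lp (InfTensor ξ) 2 ν :=
  (((√(CcFam.boxVol ν))⁻¹ : ℝ) : ℂ) • elemL2 ν i.1.prod (tmul i.2)

theorem inner_normElem (i j : CcFam C × Fam ξ) (A : Lp (InfTensor ξ) 2 ν →L[ℂ] Lp (InfTensor ξ) 2 ν)
    {z : ℂ} (hz : ⟪elemL2 ν i.1.prod (tmul i.2), A (elemL2 ν j.1.prod (tmul j.2))⟫_ℂ =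
      CcFam.boxVol ν * z) : ⟪normElem ν i, A (normElem ν j)⟫_ℂ = z := by
  have hpos : 0 < CcFam.boxVol ν := CcFam.boxVol_pos
  rw [normElem, normElem, map_smul, inner_smul_left, inner_smul_right, hz, Complex.conj_ofReal,
    ← mul_assoc, ← mul_assoc, ← Complex.ofReal_mul, ← Complex.ofReal_mul]
  have : (√(CcFam.boxVol ν))⁻¹ * (√(CcFam.boxVol ν))⁻¹ * CcFam.boxVol ν = 1 := by
    rw [← mul_inv, Real.mul_self_sqrt hpos.le, inv_mul_cancel₀ hpos.ne']
  rw [this, Complex.ofReal_one, one_mul]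

theorem totalSet_normElem : TotalSet (Set.range (normElem (ξ := ξ) ν)) := by
  have hpos : 0 < CcFam.boxVol ν := CcFam.boxVol_pos
  intro f hf
  refine totalSet_elemL2_tmul ν f ?_
  rintro _ ⟨k, ζ, rfl⟩
  have := hf _ ⟨(k, ζ), rfl⟩
  rw [normElem, inner_smul_left] at this
  refine (mul_eq_zero.1 this).resolve_left ?_
  rw [Complex.conj_ofReal]
  exact_mod_cast (inv_pos.2 (Real.sqrt_pos.2 hpos)).ne'

theorem op_congr {X : ℕ → Type v} [∀ n, NormedAddCommGroup (X n)] [∀ n, InnerProductSpace ℂ (X n)]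
    {ζ : ∀ n, Metric.sphere (0 : X n) 1} {T S : ∀ n, X n →L[ℂ] X n}
    {hT : ∀ᶠ n in cofinite, T n = 1} {hS : ∀ᶠ n in cofinite, S n = 1} (h : ∀ n, T n = S n) :
    op (ξ := ζ) T hT = op S hS := by
  obtain rfl : T = S := funext h
  rfl

theorem eventually_coe {X : ℕ → Type v} [∀ n, NormedAddCommGroup (X n)]
    [∀ n, InnerProductSpace ℂ (X n)] [∀ n, CompleteSpace (X n)] {R : ∀ n, VonNeumannAlgebra (X n)}
    {x : ∀ n, (R n).Elt} (hx : ∀ᶠ n in cofinite, x n = 1) :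
    ∀ᶠ n in cofinite, (x n : X n →L[ℂ] X n) = 1 :=
  hx.mono fun n h => by rw [h]; rfl

/-- The generators of the infinite tensor product of the `R n`. -/
def tensorGens {X : ℕ → Type v} [∀ n, NormedAddCommGroup (X n)] [∀ n, InnerProductSpace ℂ (X n)]
    [∀ n, CompleteSpace (X n)] (ζ : ∀ n, Metric.sphere (0 : X n) 1)
    (R : ∀ n, VonNeumannAlgebra (X n)) : Set (InfTensor ζ →L[ℂ] InfTensor ζ) :=
  {T | ∃ (x : ∀ n, (R n).Elt) (hx : ∀ᶠ n in cofinite, x n = 1),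
    T = op (fun n => (x n : X n →L[ℂ] X n)) (eventually_coe hx)}

/-- `α` acts on elementary tensors as the product of the actions `β n`. -/
def IsProductAction (β : ∀ n, VNAction (G n) (M n)) (α : VNAction (Πʳ n, [G n, C n]) N) : Prop :=
  ∀ (x : ∀ n, (M n).Elt) (hx : ∀ᶠ n in cofinite, x n = 1) (y : N.Elt),
    (y : InfTensor ξ →L[ℂ] InfTensor ξ) = op (fun n => (x n : H n →L[ℂ] H n)) (eventually_coe hx) →
    ∀ g, (α.aut g y : InfTensor ξ →L[ℂ] InfTensor ξ) =
      op (fun n => ((β n).aut (g n) (x n) : H n →L[ℂ] H n)) (eventually_aut hx g)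

variable {α} (hα : IsProductAction β α)

include hμ hα in
-- The case `x = 1` of the coefficient formula says that both total families have the same Gram
-- matrix.
theorem exists_crossedUnitary : ∃ Ω : InfTensor η ≃ₗᵢ[ℂ] Lp (InfTensor ξ) 2 ν,
    ∀ i : CcFam C × Fam ξ, Ω (tmul (elemFam hη i.1 i.2)) = normElem ν i := by
  refine exists_unitary_of_gram (totalSet_elemFam hη) (totalSet_normElem ν) fun i j => ?_
  have h1 : ∀ᶠ n in cofinite, (1 : (M n).Elt) = 1 := .of_forall fun _ => rfl
  have := inner_piOp_elemFam hμ ν hη α h1 (hα (fun _ => 1) h1 1 op_one.symm) i.1 j.1 i.2 j.2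
  rw [VNAction.piOp_one, op_congr (hS := .of_forall fun _ => rfl)
    fun n => VNAction.piOp_one (β n) (μ n), op_one] at this
  exact (inner_normElem ν i j 1 this).symm

variable {Ω : InfTensor η ≃ₗᵢ[ℂ] Lp (InfTensor ξ) 2 ν}
  (hΩ : ∀ i : CcFam C × Fam ξ, Ω (tmul (elemFam hη i.1 i.2)) = normElem ν i)

include hμ hα hΩ in
theorem conjCLM_piOp {x : ∀ n, (M n).Elt} (hx : ∀ᶠ n in cofinite, x n = 1) (y : N.Elt)
    (hy : (y : InfTensor ξ →L[ℂ] InfTensor ξ) =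
      op (fun n => (x n : H n →L[ℂ] H n)) (eventually_coe hx)) :
    conjCLM Ω (op (fun n => (β n).piOp (μ n) (x n)) (eventually_piOp hx)) = α.piOp ν y :=
  conjCLM_eq_of_inner (totalSet_elemFam hη) Ω hΩ fun i j => (inner_normElem ν i j _
    (inner_piOp_elemFam hμ ν hη α hx (hα x hx y hy) i.1 j.1 i.2 j.2)).symm

theorem lamOp_normElem (g : Πʳ n, [G n, C n]) (i : CcFam C × Fam ξ) :
    lamOp ν (InfTensor ξ) g (normElem ν i) = normElem ν (i.1.translate g, i.2) := by
  rw [normElem, map_smul, lamOp_elemL2]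
  rfl

theorem eventually_lamOp {g : Πʳ n, [G n, C n]} (hg : ∀ᶠ n in cofinite, g n = 1) :
    ∀ᶠ n in cofinite, lamOp (μ n) (H n) (g n) = 1 :=
  hg.mono fun n h => by rw [h, lamOp_one]

include hΩ in
theorem conjCLM_lamOp {g : Πʳ n, [G n, C n]} (hg : ∀ᶠ n in cofinite, g n = 1) :
    conjCLM Ω (op (fun n => lamOp (μ n) (H n) (g n)) (eventually_lamOp hg)) =
      lamOp ν (InfTensor ξ) g := by
  refine (totalSet_normElem ν).clm_ext ?_
  rintro _ ⟨i, rfl⟩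
  rw [conjCLM_apply, ← hΩ, Ω.symm_apply_apply, op_tmul, hΩ, lamOp_normElem, ← hΩ]
  refine congrArg Ω (congrArg tmul (Fam.ext fun n => ?_))
  exact lamOp_elemL2 (g n) (i.1.val n) (i.2.val n)

/-- Only finitely supported translations have to be considered for the commutant. -/
theorem commute_lamOp_of_finite {T : Lp (InfTensor ξ) 2 ν →L[ℂ] Lp (InfTensor ξ) 2 ν}
    (hT : ∀ g : Πʳ n, [G n, C n], (∀ᶠ n in cofinite, g n = 1) →
      lamOp ν (InfTensor ξ) g * T = T * lamOp ν (InfTensor ξ) g) (g : Πʳ n, [G n, C n]) :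
    T * lamOp ν (InfTensor ξ) g = lamOp ν (InfTensor ξ) g * T := by
  classical
  -- For two given product vectors, almost all coordinates carry the indicator of `C n` while `g n ∈
  -- C n`, so replacing these `g n` by `1` changes neither translate. The element `g'` depends on
  -- the two vectors, which is enough for comparing coefficients.
  have key : ∀ i j : CcFam C × Fam ξ, ∃ g' : Πʳ n, [G n, C n], (∀ᶠ n in cofinite, g' n = 1) ∧
      lamOp ν (InfTensor ξ) g' (normElem ν i) = lamOp ν (InfTensor ξ) g (normElem ν i) ∧
      lamOp ν (InfTensor ξ) g'⁻¹ (normElem ν j) = lamOp ν (InfTensor ξ) g⁻¹ (normElem ν j) := by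
    intro i j
    have hev := (i.1.eventually_eq.and j.1.eventually_eq).and g.2
    set F := (mem_cofinite.1 hev).toFinset
    have hF : ∀ n ∉ F, (i.1.val n = unitCc C n ∧ j.1.val n = unitCc C n) ∧ g n ∈ C n :=
      fun n hn => by
        by_contra h
        exact hn ((Set.Finite.mem_toFinset _).2 h)
    have hfin : ∀ᶠ n in cofinite, (if n ∈ F then g n else 1) = 1 := by
      refine mem_cofinite.2 (F.finite_toSet.subset fun n hn => ?_)
      by_contra h
      exact hn (if_neg h)
    let g' : Πʳ n, [G n, C n] := ⟨fun n => if n ∈ F then g n else 1,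
      hfin.mono fun n h => by
        change (if n ∈ F then g n else 1) ∈ C n
        rw [h]; exact one_mem _⟩
    have htr : ∀ (k : CcFam C) (a b : Πʳ n, [G n, C n]), (∀ n ∈ F, a n = b n) →
        (∀ n ∉ F, k.val n = unitCc C n ∧ a n ∈ C n ∧ b n ∈ C n) → k.translate a = k.translate b := by
      intro k a b h1 h2
      refine CcFam.ext' fun n => ?_
      change (k.val n).translate (a n) = (k.val n).translate (b n)
      by_cases hn : n ∈ F
      · rw [h1 n hn]
      · obtain ⟨hk, ha, hb⟩ := h2 n hn
        rw [hk, unitCc_translate ha, unitCc_translate hb]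
    have hg'1 : ∀ n ∈ F, g' n = g n := fun n hn => if_pos hn
    have hg'2 : ∀ n ∉ F, g' n = 1 := fun n hn => if_neg hn
    refine ⟨g', hfin, ?_, ?_⟩
    · rw [lamOp_normElem, lamOp_normElem, htr i.1 g' g hg'1 fun n hn =>
        ⟨(hF n hn).1.1, by rw [hg'2 n hn]; exact one_mem _, (hF n hn).2⟩]
    · rw [lamOp_normElem, lamOp_normElem, htr j.1 g'⁻¹ g⁻¹
        (fun n hn => by rw [RestrictedProduct.inv_apply, RestrictedProduct.inv_apply, hg'1 n hn])
        fun n hn => ⟨(hF n hn).1.2, by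
          rw [RestrictedProduct.inv_apply, hg'2 n hn, inv_one]; exact one_mem _, by
          rw [RestrictedProduct.inv_apply]; exact inv_mem (hF n hn).2⟩]
  refine (totalSet_normElem ν).clm_ext ?_
  rintro _ ⟨i, rfl⟩
  refine (totalSet_normElem ν).ext_inner ?_
  rintro _ ⟨j, rfl⟩
  obtain ⟨g', h1, h2, h3⟩ := key i j
  have hadj : ∀ (a : Πʳ n, [G n, C n]) f f', ⟪f, lamOp ν (InfTensor ξ) a f'⟫_ℂ =
      ⟪lamOp ν (InfTensor ξ) a⁻¹ f, f'⟫_ℂ := fun a f f' => by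
    rw [inner_lamOp, inv_inv]
  rw [mul_apply_eq_comp, mul_apply_eq_comp, ← h2, hadj, ← h3, ← hadj, ← mul_apply_eq_comp,
    ← mul_apply_eq_comp, hT g' h1]

end TensorCrossedUnitary

/-! ### Comparison of the two von Neumann algebras through their commutants -/

section TensorCrossedIso

open scoped CompactlySupported ComplexConjugate
open InfTensor VonNeumannAlgebra

variable {G : ℕ → Type u} [∀ n, Group (G n)] [∀ n, TopologicalSpace (G n)]
  {C : ∀ n, Subgroup (G n)} [hC : Fact (∀ n, IsOpen (C n : Set (G n)))] [∀ n, CompactSpace (C n)]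
  [∀ n, IsTopologicalGroup (G n)] [∀ n, T2Space (G n)] [∀ n, LocallyCompactSpace (G n)]
  [∀ n, SecondCountableTopology (G n)] [∀ n, MeasurableSpace (G n)] [∀ n, BorelSpace (G n)]
  {μ : ∀ n, Measure (G n)} [∀ n, (μ n).IsHaarMeasure] (hμ : ∀ n, μ n (C n : Set (G n)) = 1)
  [MeasurableSpace (Πʳ n, [G n, C n])] [BorelSpace (Πʳ n, [G n, C n])]
  (ν : Measure (Πʳ n, [G n, C n])) [ν.IsHaarMeasure]
  {H : ℕ → Type v} [∀ n, NormedAddCommGroup (H n)] [∀ n, InnerProductSpace ℂ (H n)]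
  [∀ n, CompleteSpace (H n)] [∀ n, SecondCountableTopology (H n)]
  {ξ : ∀ n, Metric.sphere (0 : H n) 1} {η : ∀ n, Metric.sphere (0 : Lp (H n) 2 (μ n)) 1}
  (hη : ∀ n, (η n : Lp (H n) 2 (μ n)) = elemL2 (μ n) (unitCc C n) (ξ n : H n))
  {M : ∀ n, VonNeumannAlgebra (H n)} {β : ∀ n, VNAction (G n) (M n)}
  {N : VonNeumannAlgebra (InfTensor ξ)} {α : VNAction (Πʳ n, [G n, C n]) N}
  (hN : N = generated (tensorGens ξ M)) (hα : IsProductAction β α)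
  {Ω : InfTensor η ≃ₗᵢ[ℂ] Lp (InfTensor ξ) 2 ν}
  (hΩ : ∀ i : CcFam C × Fam ξ, Ω (tmul (elemFam hη i.1 i.2)) = normElem ν i)

theorem commute_conjCLM_symm {X : Type u} [NormedAddCommGroup X] [InnerProductSpace ℂ X]
    [CompleteSpace X] {Y : Type v} [NormedAddCommGroup Y] [InnerProductSpace ℂ Y] [CompleteSpace Y]
    (W : X ≃ₗᵢ[ℂ] Y) {A : X →L[ℂ] X} {T : Y →L[ℂ] Y} (h : conjCLM W A * T = T * conjCLM W A) :
    A * conjCLM W.symm T = conjCLM W.symm T * A := by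
  have := congrArg (conjCLM W.symm) h
  rwa [conjCLM_mul, conjCLM_mul, conjCLM_symm_conjCLM] at this

include hμ hα hΩ hN in
-- An operator `π(x)` in one slot is an elementary tensor of operators, and the unitary maps it to
-- `π` of an elementary tensor.
theorem single_piOp_commute {T : Lp (InfTensor ξ) 2 ν →L[ℂ] Lp (InfTensor ξ) 2 ν}
    (hT : ∀ y ∈ (crossedProduct ν α).toStarSubalgebra, y * T = T * y) (j : ℕ) (x : (M j).Elt) :
    single j ((β j).piOp (μ j) x) * conjCLM Ω.symm T = conjCLM Ω.symm T * single j ((β j).piOp (μ j) x) := by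
  classical
  have hx : ∀ᶠ n in cofinite, Function.update (fun n => (1 : (M n).Elt)) j x n = 1 := by
    refine mem_cofinite.2 ((Set.finite_singleton j).subset fun n hn => ?_)
    by_contra h
    exact hn (Function.update_of_ne h _ _)
  have e : single (ξ := η) j ((β j).piOp (μ j) x) = op (fun n => (β n).piOp (μ n)
      (Function.update (fun n => (1 : (M n).Elt)) j x n)) (eventually_piOp hx) := by
    refine op_congr fun n => ?_
    by_cases hn : n = j
    · subst hn; simp
    · rw [Function.update_of_ne hn, Function.update_of_ne hn, VNAction.piOp_one]
  rw [e]
  refine commute_conjCLM_symm Ω ?_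
  rw [conjCLM_piOp hμ ν hη hα hΩ hx ⟨_, by
    rw [hN]; exact subset_generated _ ⟨_, hx, rfl⟩⟩ rfl]
  exact hT _ (piOp_mem ν α _)

include hΩ in
theorem single_lamOp_commute {T : Lp (InfTensor ξ) 2 ν →L[ℂ] Lp (InfTensor ξ) 2 ν}
    (hT : ∀ g, lamOp ν (InfTensor ξ) g * T = T * lamOp ν (InfTensor ξ) g) (j : ℕ) (g : G j) :
    single j (lamOp (μ j) (H j) g) * conjCLM Ω.symm T =
      conjCLM Ω.symm T * single j (lamOp (μ j) (H j) g) := by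
  classical
  have hg : ∀ᶠ n in cofinite, (RestrictedProduct.mulSingle C j g) n = 1 := by
    refine mem_cofinite.2 ((Set.finite_singleton j).subset fun n hn => ?_)
    by_contra h
    exact hn (RestrictedProduct.mulSingle_eq_of_ne C g h)
  have e : single (ξ := η) j (lamOp (μ j) (H j) g) = op (fun n => lamOp (μ n) (H n)
      (RestrictedProduct.mulSingle C j g n)) (eventually_lamOp hg) := by
    refine op_congr fun n => ?_
    by_cases hn : n = j
    · subst hn; simp
    · rw [Function.update_of_ne hn, RestrictedProduct.mulSingle_eq_of_ne C g hn, lamOp_one]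
  rw [e]
  refine commute_conjCLM_symm Ω ?_
  rw [conjCLM_lamOp ν hη hΩ hg]
  exact hT _

include hμ hα hΩ hN in
/-- The unitary maps the infinite tensor product of the crossed products into the crossed product. -/
theorem conjCLM_mem_crossedProduct {x : InfTensor η →L[ℂ] InfTensor η}
    (hx : x ∈ (generated (tensorGens η fun n => crossedProduct (μ n) (β n))).toStarSubalgebra) :
    conjCLM Ω x ∈ (crossedProduct ν α).toStarSubalgebra := by
  refine conjCLM_mem_of_generated Ω ?_ hx
  rintro _ ⟨x, hx, rfl⟩
  refine mem_iff_commute.2 fun T hT => ?_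
  have hp := single_piOp_commute hμ ν hη hN hα hΩ hT
  have hl := single_lamOp_commute ν hη hΩ (T := T) fun g => hT _ (lamOp_mem ν α g)
  -- The slot `j` makes the tensor product an amplification of `L²(G j, H j)`, so commuting with the
  -- generators of the crossed product in that slot implies commuting with all its elements.
  have key : ∀ j, single j (x j : Lp (H j) 2 (μ j) →L[ℂ] Lp (H j) 2 (μ j)) * conjCLM Ω.symm T =
      conjCLM Ω.symm T * single j (x j : Lp (H j) 2 (μ j) →L[ℂ] Lp (H j) 2 (μ j)) := by
    intro j
    refine (commute_of_amplification (totalSet_insertCLM (ξ := η) j) (fun s hs => ?_) (x j).2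
      (fun w f => single_insertCLM j _ w f)
      (fun w f => by rw [star_single]; exact single_insertCLM j _ w f)).symm
    refine ⟨single j s, fun w f => single_insertCLM j _ w f,
      fun w f => by rw [star_single]; exact single_insertCLM j _ w f, ?_⟩
    rw [star_single]
    rcases hs with ⟨y, rfl⟩ | ⟨g, rfl⟩
    · rw [VNAction.star_piOp]
      exact ⟨hp j y, hp j (star y)⟩
    · rw [star_lamOp]
      exact ⟨hl j g, hl j g⁻¹⟩
  have h2 := op_commute_of_single (eventually_coe hx) key
  have h3 := congrArg (conjCLM Ω) h2
  rw [conjCLM_mul, conjCLM_mul, conjCLM_conjCLM_symm] at h3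
  exact h3.symm

variable (U : (Πʳ n, [G n, C n]) →* (InfTensor ξ ≃ₗᵢ[ℂ] InfTensor ξ))
  (hU : ∀ v, Continuous fun g => U g v)
  (hUα : ∀ g x, (α.aut g x : InfTensor ξ →L[ℂ] InfTensor ξ) = conjCLM (U g) x)

include hμ hα hΩ hN hU hUα in
theorem conjCLM_symm_mem_tensor {y : Lp (InfTensor ξ) 2 ν →L[ℂ] Lp (InfTensor ξ) 2 ν}
    (hy : y ∈ (crossedProduct ν α).toStarSubalgebra) :
    conjCLM Ω.symm y ∈
      (generated (tensorGens η fun n => crossedProduct (μ n) (β n))).toStarSubalgebra := by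
  -- In this direction the images of elementary generators only give commutation with `π` of
  -- elementary tensors and with finitely supported translations; both are extended by the preceding
  -- commutant lemmas.
  have hgen : ∀ (T : InfTensor η →L[ℂ] InfTensor η), (∀ y ∈ (generated (tensorGens η
      fun n => crossedProduct (μ n) (β n))).toStarSubalgebra, y * T = T * y) →
      (∀ y, conjCLM Ω T * α.piOp ν y = α.piOp ν y * conjCLM Ω T) ∧
      ∀ g, conjCLM Ω T * lamOp ν (InfTensor ξ) g = lamOp ν (InfTensor ξ) g * conjCLM Ω T := by
    intro T hT
    have hpi : ∀ x : N.Elt, (x : InfTensor ξ →L[ℂ] InfTensor ξ) ∈ tensorGens ξ M →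
        α.piOp ν x * conjCLM Ω T = conjCLM Ω T * α.piOp ν x := by
      rintro y ⟨x, hx, hy⟩
      rw [← conjCLM_piOp hμ ν hη hα hΩ hx y hy, ← conjCLM_mul, ← conjCLM_mul, hT]
      exact subset_generated _ ⟨fun n => ⟨(β n).piOp (μ n) (x n), piOp_mem (μ n) (β n) (x n)⟩,
        (eventually_piOp hx).mono fun n h => Subtype.ext h, rfl⟩
    constructor
    · refine commute_piOp_of_generated ν hN α U hU hUα fun x hx => ⟨hpi x hx, hpi _ ?_⟩
      obtain ⟨z, hz, hxz⟩ := hx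
      refine ⟨fun n => star (z n), hz.mono fun n h => by simp only [h, star_one], ?_⟩
      change star (x : InfTensor ξ →L[ℂ] InfTensor ξ) = _
      rw [hxz]
      exact star_op _ _ fun n => rfl
    · refine commute_lamOp_of_finite ν fun g hg => ?_
      rw [← conjCLM_lamOp ν hη hΩ hg, ← conjCLM_mul, ← conjCLM_mul, hT]
      exact subset_generated _ ⟨fun n => ⟨lamOp (μ n) (H n) (g n), lamOp_mem (μ n) (β n) (g n)⟩,
        (eventually_lamOp hg).mono fun n h => Subtype.ext h, rfl⟩
  refine conjCLM_mem_of_generated Ω.symm ?_ hy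
  rintro _ (⟨y, rfl⟩ | ⟨g, rfl⟩)
  · exact mem_iff_commute.2 fun T hT => commute_conjCLM_symm Ω ((hgen T hT).1 y)
  · exact mem_iff_commute.2 fun T hT => commute_conjCLM_symm Ω ((hgen T hT).2 g)

include hμ hη hα hN hU hUα in
/-- The crossed product of the tensor product is unitarily equivalent to the tensor product of the
crossed products. -/
theorem exists_conj_crossedProduct : ∃ W : Lp (InfTensor ξ) 2 ν ≃ₗᵢ[ℂ] InfTensor η,
    (∀ x ∈ (crossedProduct ν α).toStarSubalgebra, conjCLM W x ∈
      (generated (tensorGens η fun n => crossedProduct (μ n) (β n))).toStarSubalgebra) ∧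
    ∀ y ∈ (generated (tensorGens η fun n => crossedProduct (μ n) (β n))).toStarSubalgebra,
      conjCLM W.symm y ∈ (crossedProduct ν α).toStarSubalgebra := by
  obtain ⟨Ω, hΩ⟩ := exists_crossedUnitary hμ ν hη hα
  exact ⟨Ω.symm, fun x hx => conjCLM_symm_mem_tensor hμ ν hη hN hα hΩ U hU hUα hx,
    fun y hy => conjCLM_mem_crossedProduct hμ ν hη hN hα hΩ hy⟩

end TensorCrossedIso

/-! ### Independence of the choice of GNS constructions -/

section ChangeOfGNS

open VonNeumannAlgebra

variable {H : ℕ → Type u} [∀ n, NormedAddCommGroup (H n)] [∀ n, InnerProductSpace ℂ (H n)]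
  [∀ n, CompleteSpace (H n)] {M : ∀ n, VonNeumannAlgebra (H n)} {φ : ∀ n, (M n).Elt → ℝ≥0∞}
  {K : ℕ → Type v} [∀ n, NormedAddCommGroup (K n)] [∀ n, InnerProductSpace ℂ (K n)]
  [∀ n, CompleteSpace (K n)] {ρ : ∀ n, (M n).Elt →⋆ₐ[ℂ] (K n →L[ℂ] K n)}
  {Λ : ∀ n, (M n).Elt → K n} {K' : ℕ → Type w} [∀ n, NormedAddCommGroup (K' n)]
  [∀ n, InnerProductSpace ℂ (K' n)] [∀ n, CompleteSpace (K' n)]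
  {ρ' : ∀ n, (M n).Elt →⋆ₐ[ℂ] (K' n →L[ℂ] K' n)} {Λ' : ∀ n, (M n).Elt → K' n}
  {q : ∀ n, (M n).Elt}

/-- Infinite tensor products do not depend on the choice of the GNS constructions. -/
theorem exists_conj_weightTensor (hΛ : ∀ n, IsGNS (φ n) (ρ n) (Λ n))
    (hΛ' : ∀ n, IsGNS (φ n) (ρ' n) (Λ' n)) (hq : ∀ n, IsStarProjection (q n))
    (h1 : ∀ n, φ n (q n) = 1) (S : ∀ n, Submodule ℂ (M n).Elt)
    (hS : ∀ n, (S n : Set (M n).Elt) = weightIdeal (φ n))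
    (hmul : ∀ n x, ∀ a ∈ weightIdeal (φ n), x * a ∈ weightIdeal (φ n)) :
    ∃ W : InfTensor (gnsVec hΛ hq h1) ≃ₗᵢ[ℂ] InfTensor (gnsVec hΛ' hq h1),
      (∀ x ∈ (weightTensor hΛ hq h1).toStarSubalgebra,
        conjCLM W x ∈ (weightTensor hΛ' hq h1).toStarSubalgebra) ∧
      ∀ y ∈ (weightTensor hΛ' hq h1).toStarSubalgebra,
        conjCLM W.symm y ∈ (weightTensor hΛ hq h1).toStarSubalgebra := by
  choose u hu hu' using fun n => (hΛ n).exists_unitary (hΛ' n) (S n) (hS n) (hmul n)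
  have hfix : ∀ᶠ n in cofinite, u n (gnsVec hΛ hq h1 n) = gnsVec hΛ' hq h1 n :=
    .of_forall fun n => hu n _ (proj_mem_weightIdeal hq h1 n)
  have key : ∀ x hx, conjCLM (InfTensor.mapUnitary u hfix) (tensorOp hΛ hq h1 x hx) =
      tensorOp hΛ' hq h1 x hx := fun x hx =>
    InfTensor.conjCLM_mapUnitary u hfix _ _ fun n v => by
      rw [← hu' n, conjCLM_apply, (u n).symm_apply_apply]
  refine ⟨InfTensor.mapUnitary u hfix, fun x hx => conjCLM_mem_of_generated _ ?_ hx,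
    fun y hy => conjCLM_mem_of_generated _ ?_ hy⟩
  · rintro _ ⟨x, hx, rfl⟩
    rw [key]
    exact subset_generated _ ⟨x, hx, rfl⟩
  · rintro _ ⟨x, hx, rfl⟩
    rw [← key, conjCLM_symm_conjCLM]
    exact subset_generated _ ⟨x, hx, rfl⟩

end ChangeOfGNS

end

/-! ### Assembly of the theorem -/

theorem mainTheorem5
    -- locally compact second countable groups with compact open subgroups `K n`
    (G : ℕ → Type u) [∀ n, Group (G n)] [∀ n, TopologicalSpace (G n)]
    [∀ n, IsTopologicalGroup (G n)] [∀ n, LocallyCompactSpace (G n)] [∀ n, T2Space (G n)]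
    [∀ n, SecondCountableTopology (G n)] [∀ n, MeasurableSpace (G n)] [∀ n, BorelSpace (G n)]
    (K : ∀ n, Subgroup (G n)) [hKo : Fact (∀ n, IsOpen (K n : Set (G n)))]
    (hKc : ∀ n, IsCompact (K n : Set (G n)))
    (μ : ∀ n, Measure (G n)) [∀ n, (μ n).IsHaarMeasure] (hμ : ∀ n, μ n (K n : Set (G n)) = 1)
    -- von Neumann algebras with n.s.f. weights, acting on the GNS spaces
    (H : ℕ → Type v) [∀ n, NormedAddCommGroup (H n)] [∀ n, InnerProductSpace ℂ (H n)]
    [∀ n, CompleteSpace (H n)] [∀ n, SecondCountableTopology (H n)]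
    (M : ∀ n, VonNeumannAlgebra (H n))
    (φ : ∀ n, (M n).Elt → ℝ≥0∞) (hφ : ∀ n, IsNSFWeight (M n) (φ n))
    (Λ : ∀ n, (M n).Elt → H n) (hΛ : ∀ n, IsGNS (φ n) (M n).toStarSubalgebra.subtype (Λ n))
    -- projections in the centralizers
    (q : ∀ n, (M n).Elt) (hq : ∀ n, IsStarProjection (q n))
    (hqφ : ∀ n, q n ∈ weightCentralizer (φ n)) (hq1 : ∀ n, φ n (q n) = 1)
    -- actions scaling the weights
    (β : ∀ n, VNAction (G n) (M n)) (c : ∀ n, G n → ℝ) (hc : ∀ n g, 0 < c n g)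
    (hφβ : ∀ n g x, (M n).IsPos x → φ n ((β n).aut g x) = ENNReal.ofReal (c n g) * φ n x)
    (hcK : ∀ n, ∀ g ∈ K n, c n g = 1) (hqK : ∀ n, ∀ g ∈ K n, (β n).aut g (q n) = q n)
    -- a left Haar measure on the restricted direct product
    [MeasurableSpace (Πʳ n, [G n, K n])] [BorelSpace (Πʳ n, [G n, K n])]
    (ν : Measure (Πʳ n, [G n, K n])) [ν.IsHaarMeasure] :
    -- the operators `π n (q n) (λ(1_{K n}) ⊗ 1)` are projections `e n` in the crossed products, of
    -- dual weight `1`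
    ∃ (e : ∀ n, (crossedProduct (μ n) (β n)).Elt) (he : ∀ n, IsStarProjection (e n))
      (he1 : ∀ n, dualWeight (μ n) (β n) (φ n) (Λ n) (e n) = 1),
      (∀ n, (e n : Lp (H n) 2 (μ n) →L[ℂ] Lp (H n) 2 (μ n)) =
        crossedProj (μ n) (β n) (hKo.out n) (hKc n) (q n)) ∧
      (∀ n, e n ∈ weightCentralizer (dualWeight (μ n) (β n) (φ n) (Λ n))) ∧
      -- the dual weights have GNS constructions on `L²(G n, H n)`
      (∀ n, ∃ Λ' : (crossedProduct (μ n) (β n)).Elt → Lp (H n) 2 (μ n),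
        IsGNS (dualWeight (μ n) (β n) (φ n) (Λ n))
          (crossedProduct (μ n) (β n)).toStarSubalgebra.subtype Λ') ∧
      -- the restricted direct product action exists and is unique
      (∃! α : VNAction (Πʳ n, [G n, K n]) (weightTensor hΛ hq hq1),
        IsRestrictedProductAction β hΛ hq hq1 α) ∧
      -- its crossed product is the infinite tensor product of the crossed products
      ∀ α : VNAction (Πʳ n, [G n, K n]) (weightTensor hΛ hq hq1),
        IsRestrictedProductAction β hΛ hq hq1 α →
        ∀ (L : ℕ → Type w) [∀ n, NormedAddCommGroup (L n)] [∀ n, InnerProductSpace ℂ (L n)]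
          [∀ n, CompleteSpace (L n)]
          (ρ : ∀ n, (crossedProduct (μ n) (β n)).Elt →⋆ₐ[ℂ] (L n →L[ℂ] L n))
          (Λ' : ∀ n, (crossedProduct (μ n) (β n)).Elt → L n)
          (hΛ' : ∀ n, IsGNS (dualWeight (μ n) (β n) (φ n) (Λ n)) (ρ n) (Λ' n)),
          (crossedProduct ν α).IsIsomorphic (weightTensor hΛ' he he1) := by
  have hpos : ∀ n g, (M n).IsPos ((β n).aut g (q n)) := fun n g => by
    have e : (β n).aut g (q n) = star ((β n).aut g (q n)) * (β n).aut g (q n) := by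
      rw [VNAction.star_mul_aut, (hq n).isSelfAdjoint.star_eq, (hq n).isIdempotentElem.eq]
    rw [e]
    exact VonNeumannAlgebra.isPos_star_mul_self _
  have hφq : ∀ n g, φ n ((β n).aut g (q n)) = ENNReal.ofReal (c n g) := fun n g => by
    rw [hφβ n g _ (VonNeumannAlgebra.IsPos.of_isStarProjection (hq n)), hq1, mul_one]
  -- Since `φ(q) = 1`, the factor `c(g)` is the weight of `β_g(q)`; this makes `c` multiplicative,
  -- and then continuous because it is `1` on `K n`.
  have hmul : ∀ n g g', c n (g * g') = c n g * c n g' := fun n g g' => by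
    have h0 := hφq n (g * g')
    rw [(β n).aut_mul, hφβ n g _ (hpos n g'), hφq, ← ENNReal.ofReal_mul (hc n g).le,
      ENNReal.ofReal_eq_ofReal_iff (mul_pos (hc n g) (hc n g')).le (hc n _).le] at h0
    exact h0.symm
  have h : ∀ n, ScalesWeight (φ n) (Λ n) (β n) (c n) := fun n =>
    ⟨hφ n, hΛ n, hc n, hφβ n, hmul n, continuous_of_map_one_on_open (hmul n) (hKo.out n) (hcK n)⟩
  have hcomp : ∀ n, CompactSpace (K n) := fun n => isCompact_iff_compactSpace.1 (hKc n)
  choose Δ hΔ hΔK using fun n => exists_isModularFunction (μ n) (hKo.out n) (hKc n)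
  have he : ∀ n, IsStarProjection (convPi (μ n) (β n) (indCc (hKo.out n) (hKc n)) (q n)) := fun n =>
    isStarProjection_convPi (hKo.out n) (hKc n) (hμ n) (hqK n) (hΔ n) (hΔK n) (hq n)
  have he1 : ∀ n, dualWeight (μ n) (β n) (φ n) (Λ n)
      (convPi (μ n) (β n) (indCc (hKo.out n) (hKc n)) (q n)) = 1 := fun n =>
    dualWeight_convPi (h n) (hKo.out n) (hKc n) (hμ n) (hqK n) (hΔ n) (hΔK n) (hq n) (hq1 n)
  refine ⟨_, he, he1, fun n => (crossedProj_eq (hKo.out n) (hKc n) (hqK n)).symm,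
    fun n => convPi_mem_weightCentralizer (h n) (hΔ n) (hKo.out n) (hKc n) (hΔK n) (hcK n) (hqφ n),
    fun n => ⟨_, isGNS_dualGNS (h n) (hΔ n)⟩, ?_, ?_⟩
  · exact ⟨tensorAction h hq hq1 hcK hqK, isRestrictedProductAction_tensorAction h hq hq1 hcK hqK,
      fun α hα => hα.unique (isRestrictedProductAction_tensorAction h hq hq1 hcK hqK)⟩
  · intro α hα L _ _ _ ρ Λ' hΛ'
    obtain rfl := hα.unique (isRestrictedProductAction_tensorAction h hq hq1 hcK hqK)
    -- The GNS vector of `e n` is `1_{K n} ⊗ Λ n (q n)`, so the base vectors of the two pictures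
    -- match.
    have hη : ∀ n, (gnsVec (fun n => isGNS_dualGNS (h n) (hΔ n)) he he1 n : Lp (H n) 2 (μ n)) =
        elemL2 (μ n) (unitCc K n) (gnsVec hΛ hq hq1 n : H n) := fun n =>
      dualGNS_eq (h n) (hΔ n) (isLeftMul_convPi _ (proj_mem_weightIdeal hq hq1 n))
    obtain ⟨W, hW, hW'⟩ := exists_conj_crossedProduct hμ ν hη (β := β)
      (α := tensorAction h hq hq1 hcK hqK) rfl
      (fun x hx y hy g => by
        obtain rfl : y = tensorElt hΛ hq hq1 x hx := Subtype.ext hy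
        exact congrArg Subtype.val
          (isRestrictedProductAction_tensorAction h hq hq1 hcK hqK g x hx))
      (tensorRep h hq hq1 hcK hqK) (continuous_tensorRep h hq hq1 hcK hqK) fun g x => rfl
    -- The isomorphism is established for the GNS constructions on `L²(G n, H n)` and transported to
    -- the given ones.
    obtain ⟨V, hV, hV'⟩ := exists_conj_weightTensor (fun n => isGNS_dualGNS (h n) (hΔ n)) hΛ' he he1
      (fun n => dualIdeal (h n) (hΔ n)) (fun _ => rfl) fun n x a ha => by
        rw [mem_weightIdeal_dual (h n) (hΔ n)] at ha ⊢
        exact ⟨_, ha.choose_spec.left_mul (h n) x⟩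
    exact VonNeumannAlgebra.isIsomorphic_of_conj (W.trans V) (fun x hx => hV _ (hW x hx))
      fun y hy => hW' _ (hV' y hy)
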